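/- **Setting.** Let $D\subset\mathbb R^3$ be a bounded domain. Let $H$ and $V$ be the closures of the divergence-free fields in $C_c^\infty(D)^3$ in $L^2$ and in $H^1$ respectively, let $A$ be the Stokes operator, $\langle Av,w\rangle=\int_D\nabla v:\nabla w\,dx$ for $v,w\in V$, and let $(e_k)$ be an orthonormal basis of $H$ of eigenvectors of $A$. Let $(\sigma_k)$ be real numbers with $\sum_k\sigma_k^2<\infty$, and let $L:V\to V'$ be a bounded linear operator such that, for some constants $a,b>0$, $a\langle Av,v\rangle\le\langle Lv,v\rangle\le b\langle Av,v\rangle$ for all $v\in V$. For $\nu>0$, a *martingale solution* $(u,Z)$ of $$\partial_tu+u\cdot\nabla u+\nabla p=\nu\Delta u+Z_t,\quad \operatorname{div}u=0,\quad u|_{\partial D}=0,\quad dZ_t=-LZ_t\,dt+dW_t,\quad W_t=\sum_k\sigma_ke_k\beta_k(t)$$ consists of a filtered probability space with independent Brownian motions $(\beta_k)$ relative to its filtration and a progressively measurable $H\times H$-valued process $(u,Z)$ on $[0,\infty)$ such that, for some $\alpha>1$, almost surely the paths of $u$ and of $Z$ lie in $C([0,T];D(A^{-\alpha/2}))\cap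 L^\infty(0,T;H)\cap L^2(0,T;V)$ for every $T$; the equation for $Z$ holds weakly, tested with $V$; and for all $t\ge0$ and all divergence-free $v\in C_c^\infty(D)^3$ $$\langle u(t),v\rangle+\int_0^t\langle u\cdot\nabla u,v\rangle ds+\nu\int_0^t\langle\nabla u,\nabla v\rangle ds=\langle u(0),v\rangle+\int_0^t\langle Z_s,v\rangle ds .$$ It is *stationary* if the law of the path $(u,Z)$ is invariant under time shifts. A *pressure* for a stationary solution is a measurable $L^{3/2}(D)$-valued process $p$, jointly stationary with $(u,Z)$ and almost surely locally integrable in time, such that almost surely the last identity holds for all $t\ge 0$ and all $v\in C_c^\infty(D)^3$, divergence-free or not, with $\int_0^t\int_Dp\operatorname{div}v\,dx\,ds$ added to its right side. Below, $\mathbf E$ of quantities at one time does not depend on the time. Write $\delta_hf(x)=f(x+h)-f(x)$ and $D_h=\{x\in D:x+h\in D\}$. For $\psi\in C_c^\infty(D)$ put $$S_0(\ell)=\frac1{4\pi}\mathbf E\int_{S^2}\int_D\psi\,|\delta_{\ell\hat n}u|^2\,\delta_{\ell\hat n}u\cdot\hat n\,dx\,dS(\hat n),\qquad S_\parallel(\ell)=\frac1{4\pi}\mathbf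 E\int_{S^2}\int_D\psi\,(\delta_{\ell\hat n}u\cdot\hat n)^3\,dx\,dS(\hat n),$$ with $u$ extended by $0$ outside $D$. **Theorem.** For $\nu\in(0,1)$ let $(u^\nu,Z^\nu)$ be stationary martingale solutions with viscosity $\nu$ (each on its own probability space) and let $p^\nu$ be pressures for them. Suppose that there are constants $c_1,c_2,C$, independent of $\nu$, such that for all $\nu\in(0,1)$ $$\nu\,\mathbf E\|\nabla u^\nu\|_{L^2}^2\le c_1\nu\,\mathbf E\|u^\nu\|_{L^2}^2+c_2\big(\mathbf E\|u^\nu\|_{L^2}^2\big)^{3/2},\qquad \mathbf E\|u^\nu\|_{L^3(D)}^3\le C,\qquad \mathbf E\|p^\nu\|_{L^{3/2}(D)}^{3/2}\le C,$$ and that $$\lim_{|h|\to0}\sup_{\nu\in(0,1)}\mathbf E\|\delta_hu^\nu\|_{L^3(D_h)}^3=0,\qquad \lim_{|h|\to0}\sup_{\nu\in(0,1)}\mathbf E\|\delta_hp^\nu\|_{L^{3/2}(D_h)}^{3/2}=0 .$$ Then there are scales $\ell_\nu>0$, $\nu\in(0,1)$, with $\ell_\nu\to0$ as $\nu\to0$,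 such that for every $\psi\in C_c^\infty(D)$, with $S_0,S_\parallel,u,p,Z$ taken for the solution of index $\nu$, $$\lim_{\ell_I\to0}\limsup_{\nu\to0}\sup_{\ell\in[\ell_\nu,\ell_I]}\left|\frac1\ell S_0(\ell)+\frac23\mathbf E\int_D(|u|^2+2p)\,u\cdot\nabla\psi\,dx+\frac43\mathbf E\int_D\psi\,u\cdot Z\,dx\right|=0,$$ $$\lim_{\ell_I\to0}\limsup_{\nu\to0}\sup_{\ell\in[\ell_\nu,\ell_I]}\left|\frac1\ell S_\parallel(\ell)+\frac25\mathbf E\int_D(|u|^2+2p)\,u\cdot\nabla\psi\,dx+\frac45\mathbf E\int_D\psi\,u\cdot Z\,dx\right|=0.$$ -/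

import Mathlib

open MeasureTheory ProbabilityTheory Filter Topology Set
open scoped ENNReal NNReal RealInnerProductSpace

noncomputable section

namespace LocalLaws

/-! ### Fields on a domain of Euclidean three-space -/

/-- Physical space, with the Euclidean norm. -/
abbrev E3 : Type := EuclideanSpace ℝ (Fin 3)

/-- Matrices with the Frobenius inner product, stored by columns: the `i`-th entry of the
gradient of a vector field `v` is the vector `∂ᵢ v`. -/
abbrev Grad : Type := PiLp 2 (fun _ : Fin 3 => E3)

/-- The `i`-th standard basis vector. -/
def basisVec (i : Fin 3) : E3 := EuclideanSpace.single i 1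

/-- The classical gradient `(∂₁ v, ∂₂ v, ∂₃ v)`. -/
def gradField (v : E3 → E3) (x : E3) : Grad :=
  WithLp.toLp 2 (fun i => fderiv ℝ v x (basisVec i))

/-- The classical divergence `∂₁ v₁ + ∂₂ v₂ + ∂₃ v₃`. -/
def divField (v : E3 → E3) (x : E3) : ℝ := ∑ i, (fderiv ℝ v x (basisVec i)) i

/-- The convective term `(w · ∇) v`, evaluated from the value of `w` and the gradient of `v`. -/
def convect (w : E3) (G : Grad) : E3 := ∑ i, w i • G i

/-- Smooth vector fields with compact support in `D`. -/
structure IsTestField (D : Set E3) (v : E3 → E3) : Prop where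
  smooth : ContDiff ℝ (⊤ : ℕ∞) v
  compact : HasCompactSupport v
  support : tsupport v ⊆ D

/-- Smooth scalar functions with compact support in `D`. -/
structure IsCutoff (D : Set E3) (ψ : E3 → ℝ) : Prop where
  smooth : ContDiff ℝ (⊤ : ℕ∞) ψ
  compact : HasCompactSupport ψ
  support : tsupport ψ ⊆ D

/-- Divergence-free test fields. -/
structure IsSolenoidalTestField (D : Set E3) (v : E3 → E3) : Prop extends IsTestField D v where
  divFree : ∀ x, divField v x = 0

/-- Square-integrable vector fields on `D`. -/
abbrev L2Vec (D : Set E3) : Type := Lp E3 2 (volume.restrict D)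

/-- Square-integrable matrix fields on `D`. -/
abbrev L2Grad (D : Set E3) : Type := Lp Grad 2 (volume.restrict D)

instance fact_one_le_three_halves : Fact ((1 : ℝ≥0∞) ≤ 3 / 2) :=
  ⟨by
    rw [ENNReal.le_div_iff_mul_le (by simp) (by simp)]
    norm_num⟩

/-- Scalar functions on `D` in `L^{3/2}`. -/
abbrev L32 (D : Set E3) : Type := Lp ℝ (3 / 2) (volume.restrict D)

instance instMeasurableSpaceL2Vec (D : Set E3) : MeasurableSpace (L2Vec D) := borel _
instance instBorelSpaceL2Vec (D : Set E3) : BorelSpace (L2Vec D) := ⟨rfl⟩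
instance instMeasurableSpaceL32 (D : Set E3) : MeasurableSpace (L32 D) := borel _
instance instBorelSpaceL32 (D : Set E3) : BorelSpace (L32 D) := ⟨rfl⟩

/-- The space `H`: closure in `L²(D)` of the divergence-free test fields. -/
def solH (D : Set E3) : Submodule ℝ (L2Vec D) :=
  (Submodule.span ℝ
    {w : L2Vec D | ∃ v, IsSolenoidalTestField D v ∧ w =ᵐ[volume.restrict D] v}).topologicalClosure

/-- The space `H` as a type. -/
abbrev VelH (D : Set E3) : Type := ↥(solH D)

/-- The space `V`: closure of the divergence-free test fields for the `H¹` norm, an element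
being stored as the pair `(v, ∇v)` of the field and its weak gradient. -/
def solV (D : Set E3) : Submodule ℝ (WithLp 2 (L2Vec D × L2Grad D)) :=
  (Submodule.span ℝ
    {w | ∃ v, IsSolenoidalTestField D v ∧ w.fst =ᵐ[volume.restrict D] v ∧
      w.snd =ᵐ[volume.restrict D] gradField v}).topologicalClosure

/-- The space `V` as a type (a Hilbert space with the `H¹` inner product). -/
abbrev VelV (D : Set E3) : Type := ↥(solV D)

/-- The field underlying an element of `V`. -/
def VelV.field {D : Set E3} (v : VelV D) : L2Vec D := v.1.fst

/-- The weak gradient of an element of `V`. -/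
def VelV.grad {D : Set E3} (v : VelV D) : L2Grad D := v.1.snd

/-- The field `w` belongs to `V`. -/
def InV {D : Set E3} (w : VelH D) : Prop := ∃ v : VelV D, v.field = (w : L2Vec D)

open Classical in
/-- The element of `V` with underlying field `w` (and `0` if `w` does not belong to `V`). -/
def toV {D : Set E3} (w : VelH D) : VelV D := if h : InV w then h.choose else 0

/-- `‖∇w‖²` in `L²(D)`, with the value `∞` for `w` outside `V`. -/
def dirichlet {D : Set E3} (w : VelH D) : ℝ≥0∞ :=
  ⨅ (v : VelV D) (_ : v.field = (w : L2Vec D)), ‖v.grad‖ₑ ^ 2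

/-! ### The Stokes operator and the noise -/

/-- The quadratic form `⟨A v, w⟩ = ∫ ∇v : ∇w` of the Stokes operator `A = -PΔ` on `V`. -/
def stokesForm {D : Set E3} (v w : VelV D) : ℝ := ⟪v.grad, w.grad⟫

/-- `e` is an orthonormal basis of `H` of eigenvectors of the Stokes operator, with eigenvalues
`lam`: `e k` belongs to `V` and `⟨A (e k), w⟩ = lam k ⟨e k, w⟩` for all `w` in `V`. -/
def IsStokesEigenbasis {D : Set E3} (e : HilbertBasis ℕ ℝ (VelH D)) (lam : ℕ → ℝ) : Prop :=
  ∀ k, InV (e k) ∧ ∀ w : VelV D, stokesForm (toV (e k)) w = lam k * ⟪(e k : L2Vec D), w.field⟫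

/-- The square of the norm of `D(A^{-α/2})`, as a series in the Stokes eigenbasis. -/
def negNormSq {D : Set E3} (e : HilbertBasis ℕ ℝ (VelH D)) (lam : ℕ → ℝ) (α : ℝ)
    (w : VelH D) : ℝ≥0∞ :=
  ∑' k, ENNReal.ofReal (lam k ^ (-α) * ⟪e k, w⟫ ^ 2)

/-- A family of independent standard Brownian motions relative to the filtration `ℱ`. -/
structure IsBrownianFamily {Ω : Type*} {mΩ : MeasurableSpace Ω} (P : Measure Ω)
    (ℱ : Filtration ℝ≥0 mΩ) (β : ℕ → ℝ≥0 → Ω → ℝ) : Prop where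
  brownian : ∀ k, IsBrownianReal (β k) P
  adapted : ∀ k, StronglyAdapted ℱ (β k)
  indep : iIndepFun (fun k ω => fun t => β k t ω) P
  indepPast : ∀ s t, s ≤ t →
    Indep (MeasurableSpace.comap (fun ω => fun k => β k t ω - β k s ω) inferInstance) (ℱ s) P

/-- The `Q`-Wiener process `W_t = ∑ σ_k e_k β_k(t)`. -/
def wiener {D : Set E3} (e : HilbertBasis ℕ ℝ (VelH D)) (σ : ℕ → ℝ) {Ω : Type*}
    (β : ℕ → ℝ≥0 → Ω → ℝ) (t : ℝ≥0) (ω : Ω) : VelH D :=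
  ∑' k, (σ k * β k t ω) • e k

/-! ### Solutions -/

/-- A path `[0,∞) → H` (extended to negative real times by its value at `0`) belongs, on every `[0,T]`, to
`C([0,T]; D(A^{-α/2})) ∩ L^∞(0,T; H) ∩ L²(0,T; V)`. -/
structure IsRegularPath {D : Set E3} (e : HilbertBasis ℕ ℝ (VelH D)) (lam : ℕ → ℝ) (α : ℝ)
    (w : ℝ≥0 → VelH D) : Prop where
  continuous : ∀ t, Tendsto (fun s => negNormSq e lam α (w s - w t)) (𝓝 t) (𝓝 0)
  bounded : ∀ T : ℝ, MemLp (fun s : ℝ => w s.toNNReal) ⊤ (volume.restrict (Icc 0 T))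
  inV : ∀ᵐ s : ℝ, 0 ≤ s → InV (w s.toNNReal)
  energy : ∀ T : ℝ, MemLp (fun s : ℝ => toV (w s.toNNReal)) 2 (volume.restrict (Icc 0 T))

/-- The sum, for a path `(u, Z)` and a test field `v`, of
`∫₀ᵗ ⟨u·∇u, v⟩ ds + ν ∫₀ᵗ ⟨∇u, ∇v⟩ ds - ∫₀ᵗ ⟨Z, v⟩ ds`. -/
def momentumTerms {D : Set E3} (ν : ℝ) (u Z : ℝ≥0 → VelH D) (v : E3 → E3) (t : ℝ≥0) : ℝ :=
  (∫ s in (0 : ℝ)..t, ∫ x in D,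
      ⟪convect ((u s.toNNReal : L2Vec D) x) ((toV (u s.toNNReal)).grad x), v x⟫)
    + ν * (∫ s in (0 : ℝ)..t, ∫ x in D, ⟪(toV (u s.toNNReal)).grad x, gradField v x⟫)
    - ∫ s in (0 : ℝ)..t, ∫ x in D, ⟪(Z s.toNNReal : L2Vec D) x, v x⟫

/-- A martingale solution `(u, Z)`, with viscosity `ν`, of the Navier-Stokes equations
driven by the Ornstein-Uhlenbeck process `dZ = -LZ dt + dW` on the stochastic basis
`(Ω, ℱ, P)` with Brownian motions `β`. The operator `L : V → V'` is given by `(v, w) ↦ ⟨Lv, w⟩`; the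
equation for `Z` is tested with `V`, and the one for `u` with solenoidal test fields. -/
structure IsMartingaleSolution {D : Set E3} (e : HilbertBasis ℕ ℝ (VelH D)) (lam : ℕ → ℝ)
    (σ : ℕ → ℝ) (L : VelV D →L[ℝ] VelV D →L[ℝ] ℝ) (ν : ℝ)
    {Ω : Type*} {mΩ : MeasurableSpace Ω} (P : Measure Ω) (ℱ : Filtration ℝ≥0 mΩ)
    (β : ℕ → ℝ≥0 → Ω → ℝ) (u Z : ℝ≥0 → Ω → VelH D) : Prop where
  noise : IsBrownianFamily P ℱ β
  progressive_u : IsStronglyProgressive ℱ u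
  progressive_Z : IsStronglyProgressive ℱ Z
  regular : ∃ α : ℝ, 1 < α ∧ ∀ᵐ ω ∂P,
    IsRegularPath e lam α (fun t => u t ω) ∧ IsRegularPath e lam α (fun t => Z t ω)
  ornsteinUhlenbeck : ∀ᵐ ω ∂P, ∀ (t : ℝ≥0) (v : VelV D),
    ⟪(Z t ω : L2Vec D), v.field⟫ = ⟪(Z 0 ω : L2Vec D), v.field⟫
      - (∫ s in (0 : ℝ)..t, L (toV (Z s.toNNReal ω)) v) + ⟪(wiener e σ β t ω : L2Vec D), v.field⟫
  momentum : ∀ᵐ ω ∂P, ∀ (t : ℝ≥0) (v : E3 → E3), IsSolenoidalTestField D v →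
    (∫ x in D, ⟪(u t ω : L2Vec D) x, v x⟫)
        + momentumTerms ν (fun s => u s ω) (fun s => Z s ω) v t
      = ∫ x in D, ⟪(u 0 ω : L2Vec D) x, v x⟫

/-- A stationary martingale solution: the law of the path `(u, Z)` is invariant under time
shifts. -/
structure IsStationaryMartingaleSolution {D : Set E3} (e : HilbertBasis ℕ ℝ (VelH D))
    (lam : ℕ → ℝ) (σ : ℕ → ℝ) (L : VelV D →L[ℝ] VelV D →L[ℝ] ℝ) (ν : ℝ)
    {Ω : Type*} {mΩ : MeasurableSpace Ω} (P : Measure Ω) (ℱ : Filtration ℝ≥0 mΩ)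
    (β : ℕ → ℝ≥0 → Ω → ℝ) (u Z : ℝ≥0 → Ω → VelH D) : Prop
    extends IsMartingaleSolution e lam σ L ν P ℱ β u Z where
  stationary : ∀ τ : ℝ≥0,
    IdentDistrib (fun ω => fun t => (u (t + τ) ω, Z (t + τ) ω))
      (fun ω => fun t => (u t ω, Z t ω)) P P

/-- A pressure field corresponding to a stationary solution `(u, Z)`: a measurable process with
values in `L^{3/2}(D)`, jointly stationary with `(u, Z)`, for which the momentum equation holds
with all test fields, solenoidal or not. -/
structure IsStationaryPressure {D : Set E3} (ν : ℝ)
    {Ω : Type*} {mΩ : MeasurableSpace Ω} (P : Measure Ω)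
    (u Z : ℝ≥0 → Ω → VelH D) (p : ℝ≥0 → Ω → L32 D) : Prop where
  measurable : Measurable (fun q : ℝ≥0 × Ω => p q.1 q.2)
  stationary : ∀ τ : ℝ≥0,
    IdentDistrib (fun ω => fun t => (u (t + τ) ω, Z (t + τ) ω, p (t + τ) ω))
      (fun ω => fun t => (u t ω, Z t ω, p t ω)) P P
  locallyIntegrable : ∀ᵐ ω ∂P, ∀ T : ℝ,
    IntegrableOn (fun s : ℝ => p s.toNNReal ω) (Icc 0 T)
  momentum : ∀ᵐ ω ∂P, ∀ (t : ℝ≥0) (v : E3 → E3), IsTestField D v →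
    (∫ x in D, ⟪(u t ω : L2Vec D) x, v x⟫)
        + momentumTerms ν (fun s => u s ω) (fun s => Z s ω) v t
        - (∫ s in (0 : ℝ)..t, ∫ x in D, p s.toNNReal ω x * divField v x)
      = ∫ x in D, ⟪(u 0 ω : L2Vec D) x, v x⟫

/-! ### Increments, assumptions and structure functions

All expectations are of quantities at a fixed time of a stationary process, which is taken to be
the initial time. A family of solutions is indexed by the viscosity, each member living on its
own probability space. -/

/-- The increment `f(x + h) - f(x)` of a field on `D`, extended by zero outside `D`. -/
def increment {F : Type*} [AddCommGroup F] (D : Set E3) (f : E3 → F) (h x : E3) : F :=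
  D.indicator f (x + h) - D.indicator f x

/-- The points `x` of `D` with `x + h` in `D`, where the increments of fields on `D` live. -/
def shiftDomain (D : Set E3) (h : E3) : Set E3 := {x | x ∈ D ∧ x + h ∈ D}

section Family

variable {D : Set E3} {Ω : ℝ → Type*} [∀ ν, MeasurableSpace (Ω ν)]

/-- Precompactness on average of the velocities in `L³`: uniform bound and uniformly vanishing
increments. -/
def VelocityPrecompact (P : ∀ ν, Measure (Ω ν)) (u : ∀ ν, ℝ≥0 → Ω ν → VelH D) : Prop :=
  (∃ C : ℝ≥0, ∀ ν ∈ Ioo (0 : ℝ) 1, ∫⁻ ω, (∫⁻ x in D, ‖(u ν 0 ω : L2Vec D) x‖ₑ ^ 3) ∂(P ν) ≤ C) ∧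
  Tendsto (fun h : E3 => ⨆ ν ∈ Ioo (0 : ℝ) 1,
      ∫⁻ ω, (∫⁻ x in shiftDomain D h, ‖increment D (u ν 0 ω : L2Vec D) h x‖ₑ ^ 3) ∂(P ν))
    (𝓝 0) (𝓝 0)

/-- Uniform bound on average in `L^{3/2}`, and uniformly vanishing increments, of the
pressures. -/
def PressurePrecompact (P : ∀ ν, Measure (Ω ν)) (p : ∀ ν, ℝ≥0 → Ω ν → L32 D) : Prop :=
  (∃ C : ℝ≥0, ∀ ν ∈ Ioo (0 : ℝ) 1, ∫⁻ ω, (∫⁻ x in D, ‖p ν 0 ω x‖ₑ ^ (3 / 2 : ℝ)) ∂(P ν) ≤ C) ∧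
  Tendsto (fun h : E3 => ⨆ ν ∈ Ioo (0 : ℝ) 1,
      ∫⁻ ω, (∫⁻ x in shiftDomain D h, ‖increment D (p ν 0 ω) h x‖ₑ ^ (3 / 2 : ℝ)) ∂(P ν))
    (𝓝 0) (𝓝 0)

/-- The a priori estimate
`ν E‖∇u‖² ≤ c₁ ν E‖u‖² + c₂ (E‖u‖²)^{3/2}`, with constants that do not depend on `ν`. -/
def EnergyEstimate (P : ∀ ν, Measure (Ω ν)) (u : ∀ ν, ℝ≥0 → Ω ν → VelH D) : Prop :=
  ∃ c₁ c₂ : ℝ≥0, ∀ ν ∈ Ioo (0 : ℝ) 1,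
    ENNReal.ofReal ν * ∫⁻ ω, dirichlet (u ν 0 ω) ∂(P ν) ≤
      c₁ * ENNReal.ofReal ν * (∫⁻ ω, ‖u ν 0 ω‖ₑ ^ 2 ∂(P ν))
        + c₂ * (∫⁻ ω, ‖u ν 0 ω‖ₑ ^ 2 ∂(P ν)) ^ (3 / 2 : ℝ)

end Family

/-- Surface measure on the unit sphere. -/
def sphereMeasure : Measure (Metric.sphere (0 : E3) 1) := (volume : Measure E3).toSphere

section OneSolution

variable {D : Set E3} {Ω : Type*} [MeasurableSpace Ω]

/-- The local structure function
`S₀(ℓ) = (4π)⁻¹ E ∫_{S²} ∫ ψ |δ_{ℓn} u|² (δ_{ℓn} u · n) dx dS(n)`. -/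
def structureZero (P : Measure Ω) (u : Ω → VelH D) (ψ : E3 → ℝ) (l : ℝ) : ℝ :=
  (1 / (4 * Real.pi)) * ∫ ω, (∫ n : Metric.sphere (0 : E3) 1, (∫ x in D,
    ψ x * ‖increment D (u ω : L2Vec D) (l • (n : E3)) x‖ ^ 2
      * ⟪increment D (u ω : L2Vec D) (l • (n : E3)) x, (n : E3)⟫) ∂sphereMeasure) ∂P

/-- The local longitudinal structure function
`S_∥(ℓ) = (4π)⁻¹ E ∫_{S²} ∫ ψ (δ_{ℓn} u · n)³ dx dS(n)`. -/
def structureLong (P : Measure Ω) (u : Ω → VelH D) (ψ : E3 → ℝ) (l : ℝ) : ℝ :=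
  (1 / (4 * Real.pi)) * ∫ ω, (∫ n : Metric.sphere (0 : E3) 1, (∫ x in D,
    ψ x * ⟪increment D (u ω : L2Vec D) (l • (n : E3)) x, (n : E3)⟫ ^ 3) ∂sphereMeasure) ∂P

/-- The nonlinear flux `E ∫ (|u|² + 2p) u · ∇ψ dx`. -/
def nonlinearFlux (P : Measure Ω) (u : Ω → VelH D) (p : Ω → L32 D) (ψ : E3 → ℝ) : ℝ :=
  ∫ ω, (∫ x in D, (‖(u ω : L2Vec D) x‖ ^ 2 + 2 * p ω x)
    * ⟪(u ω : L2Vec D) x, gradient ψ x⟫) ∂P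

/-- The local energy input `E ∫ ψ u · Z dx`. -/
def energyInput (P : Measure Ω) (u Z : Ω → VelH D) (ψ : E3 → ℝ) : ℝ :=
  ∫ ω, (∫ x in D, ψ x * ⟪(u ω : L2Vec D) x, (Z ω : L2Vec D) x⟫) ∂P

end OneSolution

/-- `lim_{ℓ_I → 0} limsup_{ν → 0} sup_{ℓ ∈ [ℓ_ν, ℓ_I]} |R(ν, ℓ)| = 0`, as an iterated limit of
extended nonnegative numbers. -/
def VanishesInInertialRange (scale : ℝ → ℝ) (R : ℝ → ℝ → ℝ) : Prop :=
  Tendsto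
    (fun lI : ℝ => limsup (fun ν : ℝ => ⨆ l ∈ Icc (scale ν) lI, ‖R ν l‖ₑ) (𝓝[>] 0))
    (𝓝[>] 0) (𝓝 0)

end LocalLaws

end

noncomputable section

namespace LocalLaws

open ENNReal (ofReal ofReal_mul ofReal_le_ofReal ofReal_add ofReal_ne_top toReal_mono mul_ne_top
  toReal toReal_one tendsto_nhds_zero rpow_natCast rpow_mul toReal_mul toReal_ofReal ofReal_pow
  continuous_ofReal div_ne_top mul_iSup)
open Metric (closedBall cthickening sphere isClosed_closedBall)
open Real (norm_eq_abs sqrt_nonneg norm_of_nonneg coe_toNNReal rpow_pos_of_pos toNNReal_le_toNNReal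
  sq_sqrt volume_Ioc dist_eq sqrt_sq smoothTransition)
open EuclideanSpace (proj inner_single_left volume_ball_fin_three)
open Function (uncurry comp_def)
open WithLp (toLp)
open Finset (sum_congr sum_le_sum sum_add_distrib mul_sum single_le_sum sum_nonneg measurable_sum
  sum_const card_univ)
open ContinuousLinearMap (le_opNorm comp_id norm_id_le inr le_opENorm)
local notation "vol₂" => (volume.prod volume : Measure (E3 × E3))

/-! ### Smooth functions with compact support -/

/-- Smooth functions with compact support in `D`, with values in a normed space. -/
structure SmoothIn {F : Type*} [NormedAddCommGroup F] [NormedSpace ℝ F] (D : Set E3)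
    (g : E3 → F) : Prop where
  smooth : ContDiff ℝ (⊤ : ℕ∞) g
  compact : HasCompactSupport g
  support : tsupport g ⊆ D

lemma IsTestField.smoothIn {D : Set E3} {v : E3 → E3} (h : IsTestField D v) : SmoothIn D v :=
  ⟨h.smooth, h.compact, h.support⟩

lemma SmoothIn.isTestField {D : Set E3} {v : E3 → E3} (h : SmoothIn D v) : IsTestField D v :=
  ⟨h.smooth, h.compact, h.support⟩

lemma IsCutoff.smoothIn {D : Set E3} {v : E3 → ℝ} (h : IsCutoff D v) : SmoothIn D v :=
  ⟨h.smooth, h.compact, h.support⟩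

namespace SmoothIn

variable {F : Type*} [NormedAddCommGroup F] [NormedSpace ℝ F] {D : Set E3} {g : E3 → F}

lemma continuous (h : SmoothIn D g) : Continuous g := h.smooth.continuous

lemma differentiable (h : SmoothIn D g) : Differentiable ℝ g := h.smooth.differentiable (by simp)

lemma eq_zero_of_notMem (h : SmoothIn D g) {x : E3} (hx : x ∉ D) : g x = 0 :=
  image_eq_zero_of_notMem_tsupport fun hx' => hx (h.support hx')

lemma of_support {g' : E3 → F} {F' : Type*} [NormedAddCommGroup F'] [NormedSpace ℝ F']
    {f : E3 → F'} (hf : SmoothIn D f) (hg : ContDiff ℝ (⊤ : ℕ∞) g')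
    (hs : ∀ x, f x = 0 → g' x = 0) : SmoothIn D g' := by
  have : Function.support g' ⊆ Function.support f := fun x hx hx' => hx (hs x hx')
  have h2 : tsupport g' ⊆ tsupport f := closure_mono this
  exact ⟨hg, hf.compact.mono' (this.trans subset_closure), h2.trans hf.support⟩

lemma fderiv (h : SmoothIn D g) : SmoothIn D (fderiv ℝ g) :=
  ⟨h.smooth.fderiv_right (by simp), h.compact.fderiv ℝ, (tsupport_fderiv_subset ℝ).trans h.support⟩

lemma clm_comp {F' : Type*} [NormedAddCommGroup F'] [NormedSpace ℝ F'] (h : SmoothIn D g)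
    (L : F →L[ℝ] F') : SmoothIn D (fun x => L (g x)) :=
  h.of_support (L.contDiff.comp h.smooth) fun x hx => by simp [hx]

lemma fderiv_apply (h : SmoothIn D g) (a : E3) : SmoothIn D (fun x => _root_.fderiv ℝ g x a) :=
  h.fderiv.clm_comp (ContinuousLinearMap.apply ℝ F a)

lemma add {g' : E3 → F} (h : SmoothIn D g) (h' : SmoothIn D g') :
    SmoothIn D (fun x => g x + g' x) :=
  ⟨h.smooth.add h'.smooth, h.compact.add h'.compact,
    (tsupport_add g g').trans (union_subset h.support h'.support)⟩

lemma sum {ι : Type*} (s : Finset ι) {f : ι → E3 → F} (h : ∀ i ∈ s, SmoothIn D (f i)) :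
    SmoothIn D (fun x => ∑ i ∈ s, f i x) := by
  classical
  induction s using Finset.induction_on with
  | empty => exact ⟨by simpa using contDiff_const, by simp only [Finset.sum_empty]; exact HasCompactSupport.zero,
      by simp [tsupport]⟩
  | insert a s ha ih =>
    simp only [Finset.sum_insert ha]
    exact (h a (by simp)).add (ih fun i hi => h i (by simp [hi]))

lemma smul_left {f : E3 → ℝ} (hf : ContDiff ℝ (⊤ : ℕ∞) f) (h : SmoothIn D g) :
    SmoothIn D (fun x => f x • g x) :=
  h.of_support (hf.smul h.smooth) fun x hx => by simp [hx]

lemma smul_right {f : E3 → ℝ} (hf : SmoothIn D f) (h : ContDiff ℝ (⊤ : ℕ∞) g) :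
    SmoothIn D (fun x => f x • g x) :=
  hf.of_support (hf.smooth.smul h) fun x hx => by simp [hx]

lemma exists_bound (h : SmoothIn D g) : ∃ C : ℝ, 0 ≤ C ∧ ∀ x, ‖g x‖ ≤ C := by
  obtain ⟨C, hC⟩ := h.compact.exists_bound_of_continuous h.continuous
  exact ⟨C, (norm_nonneg _).trans (hC 0), hC⟩

lemma integrable (h : SmoothIn D g) : Integrable g :=
  h.continuous.integrable_of_hasCompactSupport h.compact

lemma memLp (h : SmoothIn D g) (p : ℝ≥0∞) (μ : Measure E3) [IsFiniteMeasureOnCompacts μ] :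
    MemLp g p μ :=
  h.continuous.memLp_of_hasCompactSupport h.compact

lemma setIntegral_eq (h : ∀ x, x ∉ D → g x = 0) : ∫ x in D, g x = ∫ x, g x :=
  setIntegral_eq_integral_of_forall_compl_eq_zero h

end SmoothIn

variable {F : Type*} [NormedAddCommGroup F] [NormedSpace ℝ F] {D : Set E3}

lemma integral_fderiv_apply_eq_zero {g : E3 → F} (h : SmoothIn D g) (a : E3) :
    ∫ x, fderiv ℝ g x a = 0 := by
  have := integral_smul_fderiv_eq_neg_fderiv_smul_of_integrable (μ := (volume : Measure E3))
    (f := fun _ => (1 : ℝ)) (g := g) (v := a) (by simp)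
    (by simpa using (h.fderiv_apply a).integrable) (by simpa using h.integrable)
    (fun x _ => differentiableAt_const _) (fun x _ => h.differentiable x)
  simpa using this

lemma integral_inner_fderiv {F : Type*} [NormedAddCommGroup F] [InnerProductSpace ℝ F]
    {f g : E3 → F} {D' : Set E3} (hf : SmoothIn D f)
    (hg : SmoothIn D' g) (a : E3) :
    ∫ x, ⟪f x, fderiv ℝ g x a⟫ = - ∫ x, ⟪fderiv ℝ f x a, g x⟫ := by
  have int : ∀ {f' g' : E3 → F}, SmoothIn D f' → SmoothIn D' g' →
      Integrable (fun x => ⟪f' x, g' x⟫) := fun hf hg =>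
    (hf.continuous.inner hg.continuous).integrable_of_hasCompactSupport
      (hf.compact.mono fun x hx hx' => hx (by simp [hx']))
  exact integral_bilinear_fderiv_right_eq_neg_left_of_integrable (μ := (volume : Measure E3))
    (B := innerSL ℝ) (int (hf.fderiv_apply a) hg) (int hf (hg.fderiv_apply a)) (int hf hg)
    (fun x _ => hf.differentiable x) (fun x _ => hg.differentiable x)

lemma fderiv_apply_eq_sum (L : E3 →L[ℝ] F) (a : E3) : L a = ∑ i, a i • L (basisVec i) := by
  conv_lhs => rw [← (EuclideanSpace.basisFun (Fin 3) ℝ).sum_repr a]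
  simp [basisVec]

lemma convect_gradField (v : E3 → E3) (w x : E3) :
    convect w (gradField v x) = fderiv ℝ v x w := by
  rw [fderiv_apply_eq_sum (fderiv ℝ v x) w]
  simp [convect, gradField]

lemma integral_fderiv_divFree {g : E3 → ℝ} {v : E3 → E3} (hg : SmoothIn D g)
    (hv : IsSolenoidalTestField D v) : ∫ x, fderiv ℝ g x (v x) = 0 := by
  have hv' : SmoothIn D v := hv.toIsTestField.smoothIn
  have hc : ∀ i : Fin 3, SmoothIn D (fun x => v x i) := fun i =>
    hv'.clm_comp (proj i)
  have h1 : ∀ i : Fin 3, ∫ x, v x i * fderiv ℝ g x (basisVec i)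
      = - ∫ x, (fderiv ℝ v x (basisVec i)) i * g x := fun i => by
    have := integral_inner_fderiv (hc i) hg (basisVec i)
    have h2 : ∀ x, fderiv ℝ (fun x => v x i) x (basisVec i) = (fderiv ℝ v x (basisVec i)) i :=
      fun x => by
        have := ((proj (𝕜 := ℝ) i : E3 →L[ℝ] ℝ).hasFDerivAt.comp x
          (hv'.differentiable x).hasFDerivAt).fderiv
        exact DFunLike.congr_fun this (basisVec i)
    simp only [h2] at this
    simpa [mul_comm] using this
  have int1 : ∀ i : Fin 3, Integrable (fun x => v x i * fderiv ℝ g x (basisVec i)) := fun i =>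
    (SmoothIn.smul_right (hc i) (hg.fderiv_apply (basisVec i)).smooth).integrable
  have int2 : ∀ i : Fin 3, Integrable (fun x => (fderiv ℝ v x (basisVec i)) i * g x) := fun i =>
    (SmoothIn.smul_right ((hv'.fderiv_apply (basisVec i)).clm_comp
      (proj (𝕜 := ℝ) i : E3 →L[ℝ] ℝ)) hg.smooth).integrable
  calc ∫ x, fderiv ℝ g x (v x) = ∫ x, ∑ i, v x i * fderiv ℝ g x (basisVec i) := by
        congr 1; ext x; rw [fderiv_apply_eq_sum (fderiv ℝ g x)]; simp
    _ = - ∑ i, ∫ x, (fderiv ℝ v x (basisVec i)) i * g x := by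
        rw [integral_finsetSum _ fun i _ => int1 i, ← Finset.sum_neg_distrib]
        exact sum_congr rfl fun i _ => h1 i
    _ = - ∫ x, divField v x * g x := by
        rw [← integral_finsetSum _ fun i _ => int2 i]
        simp [divField, Finset.sum_mul]
    _ = 0 := by simp [hv.divFree]

/-! ### The spaces `H` and `V` -/

lemma fderiv_apply_eq_inner (g : E3 → ℝ) (x w : E3) : fderiv ℝ g x w = ⟪gradient g x, w⟫ := by
  simp [gradient]

lemma gradient_eq_sum (g : E3 → ℝ) (x : E3) :
    gradient g x = ∑ i, fderiv ℝ g x (basisVec i) • basisVec i := by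
  refine ext_inner_right ℝ fun w => ?_
  rw [← fderiv_apply_eq_inner, fderiv_apply_eq_sum (fderiv ℝ g x), sum_inner]
  simp [basisVec, inner_smul_left, mul_comm, inner_single_left]

lemma SmoothIn.gradient {g : E3 → ℝ} (hg : SmoothIn D g) : SmoothIn D (gradient g) := by
  simp only [funext (gradient_eq_sum g)]
  exact SmoothIn.sum _ fun i _ => (hg.fderiv_apply (basisVec i)).smul_right contDiff_const

lemma setIntegral_fderiv_solH {g : E3 → ℝ} (hg : SmoothIn D g) {w : L2Vec D} (hw : w ∈ solH D) :
    ∫ x in D, fderiv ℝ g x (w x) = 0 := by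
  have hG := hg.gradient.memLp 2 (volume.restrict D)
  have key : ∀ w : L2Vec D, ⟪hG.toLp, w⟫ = ∫ x in D, fderiv ℝ g x (w x) := fun w => by
    rw [L2.inner_def]
    refine integral_congr_ae ?_
    filter_upwards [hG.coeFn_toLp] with x hx
    rw [hx, fderiv_apply_eq_inner]
  suffices h : solH D ≤ (ℝ ∙ hG.toLp)ᗮ by
    rw [← key]; exact Submodule.mem_orthogonal_singleton_iff_inner_right.1 (h hw)
  refine Submodule.topologicalClosure_minimal _ (Submodule.span_le.2 ?_)
    (Submodule.isClosed_orthogonal _)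
  rintro w ⟨v, hv, hwv⟩
  refine Submodule.mem_orthogonal_singleton_iff_inner_right.2 ?_
  rw [key, ← integral_fderiv_divFree hg hv, ← SmoothIn.setIntegral_eq (D := D)
    (fun x hx => by simp [(hv.toIsTestField.smoothIn).eq_zero_of_notMem hx])]
  refine integral_congr_ae ?_
  filter_upwards [hwv] with x hx
  rw [hx]

lemma solV_induction {Ψ : E3 → E3} {Θ : E3 → Grad} (hΨ : MemLp Ψ 2 (volume.restrict D))
    (hΘ : MemLp Θ 2 (volume.restrict D))
    (h : ∀ v, IsSolenoidalTestField D v → ∫ x in D, (⟪Ψ x, v x⟫ + ⟪Θ x, gradField v x⟫) = 0)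
    (v : VelV D) : ∫ x in D, (⟪Ψ x, v.field x⟫ + ⟪Θ x, v.grad x⟫) = 0 := by
  have key : ∀ w : WithLp 2 (L2Vec D × L2Grad D), ⟪toLp 2 (hΨ.toLp, hΘ.toLp), w⟫ =
      ∫ x in D, (⟪Ψ x, w.fst x⟫ + ⟪Θ x, w.snd x⟫) := fun w => by
    rw [WithLp.prod_inner_apply, L2.inner_def, L2.inner_def,
      ← integral_add (L2.integrable_inner _ _) (L2.integrable_inner _ _)]
    refine integral_congr_ae ?_
    filter_upwards [hΨ.coeFn_toLp, hΘ.coeFn_toLp] with x hx hx'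
    rw [hx, hx']; rfl
  suffices h : solV D ≤ (ℝ ∙ toLp 2 (hΨ.toLp, hΘ.toLp))ᗮ by
    have := Submodule.mem_orthogonal_singleton_iff_inner_right.1 (h v.2)
    rwa [key] at this
  refine Submodule.topologicalClosure_minimal _ (Submodule.span_le.2 ?_)
    (Submodule.isClosed_orthogonal _)
  rintro w ⟨v, hv, hwv, hwv'⟩
  refine Submodule.mem_orthogonal_singleton_iff_inner_right.2 ?_
  rw [key, ← h v hv]
  refine integral_congr_ae ?_
  filter_upwards [hwv, hwv'] with x hx hx'
  rw [hx, hx']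

/-- The Laplacian of a vector field. -/
def lapField (v : E3 → E3) (x : E3) : E3 :=
  ∑ i, fderiv ℝ (fun y => fderiv ℝ v y (basisVec i)) x (basisVec i)

lemma SmoothIn.gradField {v : E3 → E3} (hv : SmoothIn D v) : SmoothIn D (gradField v) := by
  refine hv.fderiv.of_support ?_ fun x hx => ?_
  · refine (contDiff_piLp 2).2 fun i => ?_
    exact (hv.fderiv_apply (basisVec i)).smooth
  · ext i j; simp [LocalLaws.gradField, hx]

lemma SmoothIn.lapField {v : E3 → E3} (hv : SmoothIn D v) : SmoothIn D (lapField v) :=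
  SmoothIn.sum _ fun i _ => (hv.fderiv_apply (basisVec i)).fderiv_apply (basisVec i)

lemma inner_grad (A B : Grad) : ⟪A, B⟫ = ∑ i, ⟪A i, B i⟫ := PiLp.inner_apply A B

lemma setIntegral_grad_apply {φ : E3 → E3} (hφ : SmoothIn D φ) (i : Fin 3) (v : VelV D) :
    ∫ x in D, (⟪fderiv ℝ φ x (basisVec i), v.field x⟫ + ⟪φ x, v.grad x i⟫) = 0 := by
  have hΘ : SmoothIn D (fun x => (toLp 2 (Pi.single i (φ x)) : Grad)) := by
    refine hφ.of_support ((contDiff_piLp 2).2 fun j => ?_) fun x hx => by simp [hx]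
    by_cases hj : j = i
    · subst hj; simpa using hφ.smooth
    · simpa [hj] using contDiff_const
  have hin : ∀ x (B : Grad), ⟪(toLp 2 (Pi.single i (φ x)) : Grad), B⟫ = ⟪φ x, B i⟫ := by
    intro x B
    rw [inner_grad, Finset.sum_eq_single i]
    · simp
    · intro j _ hj; simp [hj]
    · simp
  have := solV_induction ((hφ.fderiv_apply (basisVec i)).memLp 2 _) (hΘ.memLp 2 _) ?_ v
  · simpa only [hin] using this
  · intro u hu
    have hu' := hu.toIsTestField.smoothIn
    simp only [hin]
    rw [SmoothIn.setIntegral_eq (fun x hx => by simp [(hφ.eq_zero_of_notMem hx),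
      hu'.eq_zero_of_notMem hx])]
    have int : ∀ {f' g' : E3 → E3}, SmoothIn D f' → SmoothIn D g' →
        Integrable (fun x => ⟪f' x, g' x⟫) := fun hf hg =>
      (hf.continuous.inner hg.continuous).integrable_of_hasCompactSupport
        (hf.compact.mono fun x hx hx' => hx (by simp [hx']))
    rw [integral_add (int (hφ.fderiv_apply _) hu')]
    · have := integral_inner_fderiv hφ hu' (basisVec i)
      simp only [gradField]
      rw [this]; simp
    · exact int hφ (hu'.fderiv_apply (basisVec i))

lemma integrable_inner_memLp {F : Type*} [NormedAddCommGroup F] [InnerProductSpace ℝ F]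
    {α : Type*} {mα : MeasurableSpace α} {μ : Measure α} {f g : α → F} (hf : MemLp f 2 μ)
    (hg : MemLp g 2 μ) : Integrable (fun x => ⟪f x, g x⟫) μ :=
  (L2.integrable_inner (𝕜 := ℝ) hf.toLp hg.toLp).congr <| by
    filter_upwards [hf.coeFn_toLp, hg.coeFn_toLp] with x hx hx'
    rw [hx, hx']

lemma VelV.memLp_field (v : VelV D) : MemLp v.field 2 (volume.restrict D) := Lp.memLp _
lemma VelV.memLp_grad (v : VelV D) : MemLp v.grad 2 (volume.restrict D) := Lp.memLp _
lemma VelV.memLp_grad_apply (v : VelV D) (i : Fin 3) :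
    MemLp (fun x => v.grad x i) 2 (volume.restrict D) :=
  (PiLp.proj 2 (fun _ : Fin 3 => E3) (𝕜 := ℝ) i).comp_memLp' v.memLp_grad

lemma setIntegral_inner_grad {φ : E3 → E3} (hφ : SmoothIn D φ) (v : VelV D) :
    ∫ x in D, ⟪v.grad x, gradField φ x⟫ = - ∫ x in D, ⟪v.field x, lapField φ x⟫ := by
  have h : ∀ i, ∫ x in D, ⟪v.grad x i, fderiv ℝ φ x (basisVec i)⟫ =
      - ∫ x in D, ⟪v.field x, fderiv ℝ (fun y => fderiv ℝ φ y (basisVec i)) x (basisVec i)⟫ := by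
    intro i
    have := setIntegral_grad_apply (hφ.fderiv_apply (basisVec i)) i v
    rw [integral_add (integrable_inner_memLp
      (((hφ.fderiv_apply (basisVec i)).fderiv_apply (basisVec i)).memLp 2 _) v.memLp_field)
      (integrable_inner_memLp ((hφ.fderiv_apply (basisVec i)).memLp 2 _) (v.memLp_grad_apply i))]
      at this
    simp only [real_inner_comm] at this ⊢
    linarith
  simp only [inner_grad, lapField, inner_sum]
  rw [integral_finsetSum, integral_finsetSum, ← Finset.sum_neg_distrib]
  · exact sum_congr rfl fun i _ => h i
  · exact fun i _ => integrable_inner_memLp v.memLp_field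
      (((hφ.fderiv_apply (basisVec i)).fderiv_apply (basisVec i)).memLp 2 _)
  · exact fun i _ => integrable_inner_memLp (v.memLp_grad_apply i)
      ((hφ.fderiv_apply (basisVec i)).memLp 2 _)

lemma L2Vec.memLp (w : L2Vec D) : MemLp w 2 (volume.restrict D) := Lp.memLp _

lemma setIntegral_convect {φ : E3 → E3} (hφ : SmoothIn D φ) {w : L2Vec D} (hw : w ∈ solH D)
    (v : VelV D) : ∫ x in D, ⟪convect (w x) (v.grad x), φ x⟫
      = - ∫ x in D, ⟪v.field x, fderiv ℝ φ x (w x)⟫ := by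
  obtain ⟨C, hC0, hC⟩ := hφ.exists_bound
  obtain ⟨C', hC0', hC'⟩ := hφ.fderiv.exists_bound
  have hw2 := L2Vec.memLp w
  have hΨ : MemLp (fun x => fderiv ℝ φ x (w x)) 2 (volume.restrict D) := by
    refine hw2.of_le_mul (c := C') ?_ (ae_of_all _ fun x => ?_)
    · exact (ContinuousLinearMap.apply ℝ E3).aestronglyMeasurable_comp₂ hw2.1
        hφ.fderiv.continuous.aestronglyMeasurable
    · exact (le_opNorm _ _).trans (by gcongr; exact hC' x)
  have hΘ : MemLp (fun x => (toLp 2 (fun i => w x i • φ x) : Grad)) 2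
      (volume.restrict D) := by
    refine MemLp.of_eval_piLp fun i => ?_
    refine hw2.of_le_mul (c := C) ?_ (ae_of_all _ fun x => ?_)
    · exact ((proj (𝕜 := ℝ) i : E3 →L[ℝ] ℝ).continuous.comp_aestronglyMeasurable
        hw2.1).smul hφ.continuous.aestronglyMeasurable
    · simp only [norm_smul]
      rw [mul_comm]
      gcongr
      · exact hC x
      · exact PiLp.norm_apply_le _ _
  have hin : ∀ x (B : Grad), ⟪(toLp 2 (fun i => w x i • φ x) : Grad), B⟫
      = ⟪convect (w x) B, φ x⟫ := fun x B => by
    rw [inner_grad, convect, sum_inner]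
    refine sum_congr rfl fun i _ => ?_
    simp [inner_smul_left, real_inner_comm]
  have := solV_induction hΨ hΘ ?_ v
  · rw [integral_add (integrable_inner_memLp hΨ v.memLp_field)
      (integrable_inner_memLp hΘ v.memLp_grad)] at this
    simp only [hin, real_inner_comm (v.field _)] at this ⊢
    linarith
  · intro u hu
    have hu' := hu.toIsTestField.smoothIn
    have hg : SmoothIn D (fun x => ⟪u x, φ x⟫) :=
      hφ.of_support (hu'.smooth.inner ℝ hφ.smooth) fun x hx => by simp [hx]
    rw [← setIntegral_fderiv_solH hg hw]
    refine integral_congr_ae (ae_of_all _ fun x => ?_)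
    simp only [hin, convect_gradField]
    rw [fderiv_inner_apply ℝ (hu'.differentiable x) (hφ.differentiable x), real_inner_comm]

lemma norm_clm_le_grad (L : E3 →L[ℝ] E3) :
    ‖L‖ ≤ 3 * ‖(toLp 2 (fun i => L (basisVec i)) : Grad)‖ := by
  refine L.opNorm_le_bound (by positivity) fun a => ?_
  rw [fderiv_apply_eq_sum L a]
  refine (norm_sum_le _ _).trans ?_
  have : ∀ i ∈ Finset.univ, ‖a i • L (basisVec i)‖ ≤
      ‖(toLp 2 (fun i => L (basisVec i)) : Grad)‖ * ‖a‖ := fun i _ => by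
    rw [norm_smul, mul_comm]
    exact mul_le_mul (PiLp.norm_apply_le (toLp 2 (fun i => L (basisVec i)) : Grad) i)
      (PiLp.norm_apply_le a i) (norm_nonneg _) (norm_nonneg _)
  refine (sum_le_sum this).trans ?_
  simp [mul_assoc]

/-- The Poincaré inequality on `V`. -/
lemma exists_poincare (hD : Bornology.IsBounded D) :
    ∃ C : ℝ≥0, ∀ v : VelV D, ‖v.field‖ ≤ C * ‖v.grad‖ := by
  set C : ℝ≥0 := eLpNormLESNormFDerivOfLeConst E3 (volume : Measure E3) D 2 2
  refine ⟨C * 3, fun v => ?_⟩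
  have hcl : IsClosed {w : WithLp 2 (L2Vec D × L2Grad D) | ‖w.fst‖ ≤ (C * 3 : ℝ≥0) * ‖w.snd‖} :=
    isClosed_le (WithLp.fstL 2 ℝ (L2Vec D) (L2Grad D)).continuous.norm
      (continuous_const.mul (WithLp.sndL 2 ℝ (L2Vec D) (L2Grad D)).continuous.norm)
  refine closure_minimal (fun w hw => ?_) hcl v.2
  obtain ⟨u, hu, h1, h2⟩ : ∃ u, IsSolenoidalTestField D u ∧ w.fst =ᵐ[volume.restrict D] u ∧
      w.snd =ᵐ[volume.restrict D] gradField u := by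
    induction hw using Submodule.span_induction with
    | mem x h => exact h
    | zero =>
      refine ⟨fun _ => 0, ⟨⟨contDiff_const, HasCompactSupport.zero, by simp [tsupport]⟩, by simp [divField]⟩,
        Lp.coeFn_zero _ _ _, ?_⟩
      refine (Lp.coeFn_zero _ _ _).trans (ae_of_all _ fun x => ?_)
      ext i j; simp [gradField]
    | add x y _ _ hx hy =>
      obtain ⟨u, hu, h1, h2⟩ := hx
      obtain ⟨u', hu', h1', h2'⟩ := hy
      have hs := hu.toIsTestField.smoothIn
      have hs' := hu'.toIsTestField.smoothIn
      have hf : ∀ x, fderiv ℝ (fun x => u x + u' x) x = fderiv ℝ u x + fderiv ℝ u' x := fun x =>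
        fderiv_fun_add (hs.differentiable x) (hs'.differentiable x)
      refine ⟨fun x => u x + u' x, ⟨(hs.add hs').isTestField, fun x => ?_⟩, ?_, ?_⟩
      · have a1 := hu.divFree x
        have a2 := hu'.divFree x
        simp only [divField] at a1 a2 ⊢
        simp [hf, sum_add_distrib, a1, a2]
      · refine (Lp.coeFn_add x.fst y.fst).trans ?_
        filter_upwards [h1, h1'] with z hz hz'
        simp [hz, hz']
      · refine (Lp.coeFn_add x.snd y.snd).trans ?_
        filter_upwards [h2, h2'] with z hz hz'
        ext i j
        simp [hz, hz', gradField, hf]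
    | smul a x _ hx =>
      obtain ⟨u, hu, h1, h2⟩ := hx
      have hs := hu.toIsTestField.smoothIn
      have hf : ∀ x, fderiv ℝ (fun x => a • u x) x = a • fderiv ℝ u x := fun x =>
        fderiv_fun_const_smul (hs.differentiable x) a
      refine ⟨fun x => a • u x, ⟨(hs.smul_left contDiff_const).isTestField, fun x => ?_⟩, ?_, ?_⟩
      · have a1 := hu.divFree x
        simp only [divField] at a1 ⊢
        simp [hf, ← mul_sum, a1]
      · refine (Lp.coeFn_smul a x.fst).trans ?_
        filter_upwards [h1] with z hz
        simp [hz]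
      · refine (Lp.coeFn_smul a x.snd).trans ?_
        filter_upwards [h2] with z hz
        ext i j
        simp [hz, gradField, hf]
  have hs := hu.toIsTestField.smoothIn
  have hsob := eLpNorm_le_eLpNorm_fderiv_of_le (volume : Measure E3) (u := u) (s := D)
    (hs.smooth.of_le (by simp)) ((subset_tsupport u).trans hs.support) (p := 2) (q := 2)
    (by norm_num) (by simp; norm_num) (by simp) hD
  have e1 : eLpNorm w.fst 2 (volume.restrict D) = eLpNorm u 2 volume := by
    rw [eLpNorm_congr_ae h1, eLpNorm_restrict_eq_of_support_subset
      ((subset_tsupport u).trans hs.support)]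
  have e2 : eLpNorm (fderiv ℝ u) 2 volume ≤ 3 * eLpNorm w.snd 2 (volume.restrict D) := by
    rw [eLpNorm_congr_ae h2, eLpNorm_restrict_eq_of_support_subset
      ((subset_tsupport _).trans hs.gradField.support)]
    have := eLpNorm_le_mul_eLpNorm_of_ae_le_mul (μ := (volume : Measure E3)) (p := 2)
      (f := fderiv ℝ u) (g := gradField u) (c := 3)
      (ae_of_all _ fun x => norm_clm_le_grad (fderiv ℝ u x))
    simpa using this
  have e3 : eLpNorm w.fst 2 (volume.restrict D) ≤ (C * 3 : ℝ≥0) *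
      eLpNorm w.snd 2 (volume.restrict D) := by
    rw [e1]
    refine hsob.trans ?_
    push_cast
    rw [mul_assoc]
    exact mul_le_mul_right e2 _
  simp only [mem_ofPred_eq, Lp.norm_def]
  rw [← ENNReal.coe_toReal, ← toReal_mul]
  exact toReal_mono (mul_ne_top ENNReal.coe_ne_top (Lp.eLpNorm_ne_top _)) e3

/-! ### Jointly measurable representatives -/

lemma Lp.integrable_restrict {F : Type*} [NormedAddCommGroup F] {D : Set E3} {p : ℝ≥0∞}
    [hp : Fact (1 ≤ p)] [IsFiniteMeasure (volume.restrict D)]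
    (w : Lp F p (volume.restrict D : Measure E3)) : Integrable w (volume.restrict D) :=
  (Lp.memLp w).integrable hp.out

section Fld

variable {F : Type*} [NormedAddCommGroup F] [NormedSpace ℝ F] {D : Set E3} {p : ℝ≥0∞}

/-- A representative, jointly measurable in the class and in the point, of the extension by zero
of a class of functions on `D`: the limit of its ball averages. -/
def fld (w : Lp F p (volume.restrict D : Measure E3)) (x : E3) : F :=
  D.indicator (fun x => @limUnder _ _ _ ⟨0⟩ atTop fun n : ℕ =>
    ⨍ y in closedBall x (1 / ((n : ℝ) + 1)), D.indicator w y) x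

lemma fld_of_notMem (w : Lp F p (volume.restrict D : Measure E3)) {x : E3} (hx : x ∉ D) :
    fld w x = 0 := indicator_of_notMem hx _

lemma fld_ae_eq [CompleteSpace F] [hp : Fact (1 ≤ p)]
    [IsFiniteMeasure (volume.restrict D)] (hD : MeasurableSet D)
    (w : Lp F p (volume.restrict D : Measure E3)) : fld w =ᵐ[volume] D.indicator w := by
  have hint : Integrable (D.indicator w) (volume : Measure E3) :=
    (integrable_indicator_iff hD).2 (Lp.integrable_restrict w)
  filter_upwards [IsUnifLocDoublingMeasure.ae_tendsto_average (volume : Measure E3)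
    hint.locallyIntegrable 1] with x hx
  by_cases hxD : x ∈ D
  · rw [fld, indicator_of_mem hxD]
    refine (hx (fun _ => x) (fun n : ℕ => 1 / ((n : ℝ) + 1)) ?_ ?_).limUnder_eq
    · refine tendsto_nhdsWithin_iff.2 ⟨tendsto_one_div_add_atTop_nhds_zero_nat, ?_⟩
      exact Eventually.of_forall fun n => by simp only [mem_Ioi]; positivity
    · exact Eventually.of_forall fun n => Metric.mem_closedBall_self (by positivity)
  · rw [fld_of_notMem w hxD, indicator_of_notMem hxD]

lemma fld_ae_eq_restrict [CompleteSpace F] [hp : Fact (1 ≤ p)]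
    [IsFiniteMeasure (volume.restrict D)] (hD : MeasurableSet D)
    (w : Lp F p (volume.restrict D : Measure E3)) : fld w =ᵐ[volume.restrict D] w :=
  by
  filter_upwards [ae_restrict_of_ae (fld_ae_eq hD w), indicator_ae_eq_restrict (f := w) hD]
    with x hx hx'
  rw [hx, hx']

lemma continuous_setIntegral_Lp [hp : Fact (1 ≤ p)]
    [IsFiniteMeasure (volume.restrict D)] (s : Set E3) :
    Continuous fun w : Lp F p (volume.restrict D : Measure E3) =>
      ∫ y in s, w y ∂(volume.restrict D) := by
  set μ := (volume.restrict D : Measure E3)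
  let L : Lp F p μ →ₗ[ℝ] F :=
    { toFun := fun w => ∫ y in s, w y ∂μ
      map_add' := fun f g => by
        rw [← integral_add (Lp.integrable_restrict f).integrableOn
          (Lp.integrable_restrict g).integrableOn]
        exact integral_congr_ae (ae_restrict_of_ae (Lp.coeFn_add f g))
      map_smul' := fun c f => by
        rw [RingHom.id_apply, ← integral_smul]
        exact integral_congr_ae (ae_restrict_of_ae (Lp.coeFn_smul c f)) }
  refine (L.mkContinuous ((μ univ) ^ (1 / toReal 1 - 1 / p.toReal)).toReal
    fun w => ?_).continuous
  have h1 : ‖∫ y in s, w y ∂μ‖ₑ ≤ eLpNorm w p μ * (μ univ) ^ (1 / toReal 1 - 1 / p.toReal) :=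
    calc ‖∫ y in s, w y ∂μ‖ₑ ≤ ∫⁻ y in s, ‖w y‖ₑ ∂μ := enorm_integral_le_lintegral_enorm _
      _ ≤ ∫⁻ y, ‖w y‖ₑ ∂μ := setLIntegral_le_lintegral _ _
      _ = eLpNorm w 1 μ := eLpNorm_one_eq_lintegral_enorm.symm
      _ ≤ _ := eLpNorm_le_eLpNorm_mul_rpow_measure_univ hp.out (Lp.aestronglyMeasurable w)
  have hexp : 0 ≤ 1 / toReal 1 - 1 / p.toReal := by
    rcases eq_or_ne p ⊤ with h | h
    · simp [h]
    · have : 1 ≤ p.toReal := by rw [← toReal_one]; exact toReal_mono h hp.out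
      simp only [toReal_one]
      have := one_div_le_one_div_of_le one_pos this
      linarith
  change ‖∫ y in s, w y ∂μ‖ ≤ _ * ‖w‖
  rw [Lp.norm_def, mul_comm, ← toReal_mul, ← toReal_enorm]
  exact toReal_mono (mul_ne_top (Lp.eLpNorm_ne_top _)
    (ENNReal.rpow_ne_top_of_nonneg hexp (measure_ne_top _ _))) h1

lemma stronglyMeasurable_fld [CompleteSpace F] [hp : Fact (1 ≤ p)]
    [IsFiniteMeasure (volume.restrict D)] (hD : MeasurableSet D)
    [MeasurableSpace (Lp F p (volume.restrict D : Measure E3))]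
    [OpensMeasurableSpace (Lp F p (volume.restrict D : Measure E3))]
    [SecondCountableTopology (Lp F p (volume.restrict D : Measure E3))] :
    StronglyMeasurable fun q : Lp F p (volume.restrict D : Measure E3) × E3 => fld q.1 q.2 := by
  refine StronglyMeasurable.indicator (f := fun q : Lp F p (volume.restrict D : Measure E3) × E3 =>
    @limUnder _ _ _ ⟨0⟩ atTop fun n : ℕ =>
    ⨍ y in closedBall q.2 (1 / ((n : ℝ) + 1)), D.indicator q.1 y) (s := Prod.snd ⁻¹' D)
    (@StronglyMeasurable.limUnder _ _ _ _ _ _ _ _ _ ⟨0⟩ _ fun n => ?_) (measurable_snd hD)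
  refine stronglyMeasurable_uncurry_of_continuous_of_stronglyMeasurable
    (u := fun (w : Lp F p (volume.restrict D : Measure E3)) (x : E3) =>
      ⨍ y in closedBall x (1 / ((n : ℝ) + 1)), D.indicator w y) (fun x => ?_) fun w => ?_
  · simp only [setAverage_eq]
    refine continuous_const.smul ?_
    have : ∀ w : Lp F p (volume.restrict D : Measure E3),
        ∫ y in closedBall x (1 / ((n : ℝ) + 1)), D.indicator w y =
        ∫ y in closedBall x (1 / ((n : ℝ) + 1)), w y ∂(volume.restrict D) := fun w => by
      rw [setIntegral_indicator hD, Measure.restrict_restrict isClosed_closedBall.measurableSet]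
    simp only [this]
    exact continuous_setIntegral_Lp _
  · simp only [setAverage_eq]
    have hvol : ∀ x : E3, volume.real (closedBall x (1 / ((n : ℝ) + 1))) =
        volume.real (closedBall (0 : E3) (1 / ((n : ℝ) + 1))) := fun x => by
      simp only [measureReal_def, Measure.addHaar_closedBall_center]
    simp only [hvol]
    refine StronglyMeasurable.const_smul ?_ _
    have hm : MeasurableSet {q : E3 × E3 | q.2 ∈ closedBall q.1 (1 / ((n : ℝ) + 1))} :=
      (isClosed_le (continuous_snd.dist continuous_fst) continuous_const).measurableSet
    have h1 : StronglyMeasurable fun q : E3 × E3 =>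
        {q : E3 × E3 | q.2 ∈ closedBall q.1 (1 / ((n : ℝ) + 1))}.indicator
          (fun q => D.indicator w q.2) q :=
      StronglyMeasurable.indicator (((Lp.stronglyMeasurable w).indicator hD).comp_measurable
        measurable_snd) hm
    have h2 := h1.integral_prod_right' (ν := (volume : Measure E3))
    convert h2 using 2 with x
    rw [← integral_indicator isClosed_closedBall.measurableSet]
    rfl

end Fld

attribute [irreducible] fld

variable {D : Set E3}

instance instSecondCountableL2Vec : SecondCountableTopology (L2Vec D) := by
  have : Fact ((2 : ℝ≥0∞) ≠ ⊤) := ⟨by simp⟩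
  infer_instance

instance instSecondCountableL32 : SecondCountableTopology (L32 D) := by
  have : Fact ((3 / 2 : ℝ≥0∞) ≠ ⊤) := ⟨div_ne_top (by simp) (by simp)⟩
  infer_instance

instance instBorelSpaceVelH : BorelSpace (VelH D) := inferInstance
instance instSecondCountableVelH : SecondCountableTopology (VelH D) := inferInstance

lemma measurable_fld_L2Vec [IsFiniteMeasure (volume.restrict D)]
    (hD : MeasurableSet D) : Measurable fun q : L2Vec D × E3 => fld q.1 q.2 :=
  (stronglyMeasurable_fld hD).measurable

lemma measurable_fld_L32 [IsFiniteMeasure (volume.restrict D)]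
    (hD : MeasurableSet D) : Measurable fun q : L32 D × E3 => fld q.1 q.2 :=
  (stronglyMeasurable_fld hD).measurable

lemma measurable_fld_right [IsFiniteMeasure (volume.restrict D)]
    (hD : MeasurableSet D) (w : L2Vec D) : Measurable (fld w) :=
  (measurable_fld_L2Vec hD).comp (measurable_prodMk_left (x := w))

lemma measurable_fld_L32_right [IsFiniteMeasure (volume.restrict D)]
    (hD : MeasurableSet D) (w : L32 D) : Measurable (fld w) :=
  (measurable_fld_L32 hD).comp (measurable_prodMk_left (x := w))

/-- A space integral of a measurable function of the point and of the value of a field is a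
measurable functional of the field. -/
lemma measurable_setIntegral_fld [IsFiniteMeasure (volume.restrict D)]
    (hD : MeasurableSet D) {f : E3 → E3 → ℝ} (hf : Measurable (uncurry f)) :
    Measurable fun w : L2Vec D => ∫ x in D, f x (w x) := by
  have h1 : Measurable fun q : L2Vec D × E3 => f q.2 (fld q.1 q.2) :=
    hf.comp (measurable_snd.prodMk (measurable_fld_L2Vec hD))
  have h2 := h1.stronglyMeasurable.integral_prod_right' (ν := volume.restrict D)
  convert h2.measurable using 2 with w
  refine integral_congr_ae ?_
  filter_upwards [fld_ae_eq_restrict hD w] with x hx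
  rw [hx]

lemma measurable_setIntegral_fld_L32 [IsFiniteMeasure (volume.restrict D)]
    (hD : MeasurableSet D) {f : E3 → ℝ → ℝ} (hf : Measurable (uncurry f)) :
    Measurable fun w : L32 D => ∫ x in D, f x (w x) := by
  have h1 : Measurable fun q : L32 D × E3 => f q.2 (fld q.1 q.2) :=
    hf.comp (measurable_snd.prodMk (measurable_fld_L32 hD))
  have h2 := h1.stronglyMeasurable.integral_prod_right' (ν := volume.restrict D)
  convert h2.measurable using 2 with w
  refine integral_congr_ae ?_
  filter_upwards [fld_ae_eq_restrict hD w] with x hx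
  rw [hx]

/-! ### Regularisation by matrix kernels -/

/-- The convolution `∫ Φ(x - y) w(y) dy` of a matrix kernel and a field. -/
def conv (Φ : E3 → E3 →L[ℝ] E3) (w : E3 → E3) (x : E3) : E3 := ∫ y, Φ (x - y) (w y)

/-- The derivative of a function in a fixed direction. -/
def dirDeriv {F : Type*} [NormedAddCommGroup F] [NormedSpace ℝ F] (a : E3) (g : E3 → F) (x : E3) :
    F := fderiv ℝ g x a

lemma conv_eq_convolution (Φ : E3 → E3 →L[ℝ] E3) (w : E3 → E3) :
    conv Φ w = convolution w Φ (ContinuousLinearMap.apply ℝ E3) volume := rfl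

variable {Φ : E3 → E3 →L[ℝ] E3} {w : E3 → E3} {ρ : ℝ} {D S : Set E3}

lemma SmoothIn.dirDeriv {F : Type*} [NormedAddCommGroup F] [NormedSpace ℝ F] {g : E3 → F}
    (h : SmoothIn D g) (a : E3) : SmoothIn D (dirDeriv a g) := h.fderiv_apply a

lemma fderiv_conv_apply (hΦ : SmoothIn S Φ) (hw : Integrable w) (x a : E3) :
    fderiv ℝ (conv Φ w) x a = conv (dirDeriv a Φ) w x := by
  rw [conv_eq_convolution, (hΦ.compact.hasFDerivAt_convolution_right _ hw.locallyIntegrable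
    (hΦ.smooth.of_le (by simp)) x).fderiv, convolution_precompR_apply _ hw.locallyIntegrable
    hΦ.fderiv.compact hΦ.fderiv.continuous]
  rfl

lemma contDiff_conv (hΦ : SmoothIn S Φ) (hw : Integrable w) : ContDiff ℝ (⊤ : ℕ∞) (conv Φ w) := by
  rw [conv_eq_convolution]
  exact hΦ.compact.contDiff_convolution_right (ContinuousLinearMap.apply ℝ E3) hw.locallyIntegrable
    hΦ.smooth

lemma differentiable_conv (hΦ : SmoothIn S Φ) (hw : Integrable w) :
    Differentiable ℝ (conv Φ w) := (contDiff_conv hΦ hw).differentiable (by simp)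

lemma integrable_clm_apply {F : Type*} [NormedAddCommGroup F] [NormedSpace ℝ F]
    {Ψ : E3 → E3 →L[ℝ] F} (hΨ : SmoothIn S Ψ)
    (hw : Integrable w) (x : E3) : Integrable (fun y => Ψ (x - y) (w y)) := by
  obtain ⟨C, hC0, hC⟩ := hΨ.exists_bound
  refine (hw.norm.const_mul C).mono' ?_ (ae_of_all _ fun y => ?_)
  · exact (ContinuousLinearMap.apply ℝ F).aestronglyMeasurable_comp₂ hw.1
      (hΨ.continuous.comp (continuous_const.sub continuous_id)).aestronglyMeasurable
  · exact (le_opNorm _ _).trans (by gcongr; exact hC _)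

lemma norm_conv_le {C : ℝ} (hΦ : ∀ h, ‖Φ h‖ ≤ C) (hw : Integrable w) (x : E3) :
    ‖conv Φ w x‖ ≤ C * ∫ y, ‖w y‖ := by
  rw [← integral_const_mul]
  refine norm_integral_le_of_norm_le (hw.norm.const_mul C) (ae_of_all _ fun y => ?_)
  exact (le_opNorm _ _).trans (by gcongr; exact hΦ _)

lemma conv_add {w' : E3 → E3} (hΦ : SmoothIn S Φ) (hw : Integrable w) (hw' : Integrable w')
    (x : E3) : conv Φ (fun y => w y + w' y) x = conv Φ w x + conv Φ w' x := by
  simp only [conv, map_add]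
  exact integral_add (integrable_clm_apply hΦ hw x) (integrable_clm_apply hΦ hw' x)

lemma conv_smul (c : ℝ) (x : E3) : conv Φ (fun y => c • w y) x = c • conv Φ w x := by
  simp only [conv, map_smul]
  exact integral_smul _ _

lemma conv_congr_ae {w' : E3 → E3} (h : w =ᵐ[volume] w') : conv Φ w = conv Φ w' := by
  ext1 x
  refine integral_congr_ae ?_
  filter_upwards [h] with y hy
  rw [hy]

lemma smoothIn_conv {K : Set E3} (hΦ : SmoothIn (closedBall 0 ρ) Φ) (hw : Integrable w)
    (hK : Bornology.IsBounded K) (hKD : cthickening ρ K ⊆ D) (hwK : ∀ y, y ∉ K → w y = 0) :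
    SmoothIn D (conv Φ w) := by
  have h1 : Function.support (conv Φ w) ⊆ cthickening ρ K := by
    intro x hx
    by_contra hx'
    refine hx ?_
    refine integral_eq_zero_of_ae (ae_of_all _ fun y => ?_)
    by_cases hy : y ∈ K
    · have : Φ (x - y) = 0 := hΦ.eq_zero_of_notMem fun h => hx' <|
        Metric.mem_cthickening_of_dist_le x y ρ K hy (by simpa [dist_eq_norm] using h)
      simp [this]
    · simp [hwK y hy]
  have h2 : tsupport (conv Φ w) ⊆ cthickening ρ K :=
    closure_minimal h1 Metric.isClosed_cthickening
  refine ⟨contDiff_conv hΦ hw, ?_, h2.trans hKD⟩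
  exact HasCompactSupport.of_support_subset_isCompact
    (Metric.isCompact_of_isClosed_isBounded Metric.isClosed_cthickening hK.cthickening) h1

/-- The regularised field `ψ · (Φ ∗ w)`. -/
def vloc (ψ : E3 → ℝ) (Φ : E3 → E3 →L[ℝ] E3) (w : E3 → E3) (x : E3) : E3 := ψ x • conv Φ w x

/-- The regularised field `Φ ∗ (ψ w)`. -/
def vstar (ψ : E3 → ℝ) (Φ : E3 → E3 →L[ℝ] E3) (w : E3 → E3) : E3 → E3 := conv Φ fun y => ψ y • w y

variable {ψ : E3 → ℝ}

lemma SmoothIn.integrable_smul (hψ : SmoothIn D ψ) (hw : Integrable w) :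
    Integrable fun y => ψ y • w y := by
  obtain ⟨C, hC0, hC⟩ := hψ.exists_bound
  refine (hw.norm.const_mul C).mono' (hψ.continuous.aestronglyMeasurable.smul hw.1)
    (ae_of_all _ fun y => ?_)
  rw [norm_smul]; gcongr; exact hC y

lemma smoothIn_vloc (hψ : SmoothIn D ψ) (hΦ : SmoothIn S Φ) (hw : Integrable w) :
    SmoothIn D (vloc ψ Φ w) := hψ.smul_right (contDiff_conv hΦ hw)

lemma smoothIn_vstar (hψ : SmoothIn D ψ) (hΦ : SmoothIn (closedBall 0 ρ) Φ)
    (hρ : cthickening ρ (tsupport ψ) ⊆ D) (hw : Integrable w) :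
    SmoothIn D (vstar ψ Φ w) :=
  smoothIn_conv hΦ (hψ.integrable_smul hw) hψ.compact.isBounded hρ fun y hy => by
    simp [image_eq_zero_of_notMem_tsupport hy]

lemma fderiv_vloc (hψ : SmoothIn D ψ) (hΦ : SmoothIn S Φ) (hw : Integrable w) (x a : E3) :
    fderiv ℝ (vloc ψ Φ w) x a = vloc (dirDeriv a ψ) Φ w x + vloc ψ (dirDeriv a Φ) w x := by
  have := ((hψ.differentiable x).hasFDerivAt.smul (differentiable_conv hΦ hw x).hasFDerivAt).fderiv
  change fderiv ℝ (ψ • conv Φ w) x a = _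
  rw [this]
  simp [fderiv_conv_apply hΦ hw, vloc, dirDeriv, add_comm]

lemma fderiv_vstar (hψ : SmoothIn D ψ) (hΦ : SmoothIn S Φ) (hw : Integrable w) (x a : E3) :
    fderiv ℝ (vstar ψ Φ w) x a = vstar ψ (dirDeriv a Φ) w x :=
  fderiv_conv_apply hΦ (hψ.integrable_smul hw) x a

lemma lapField_vloc (hψ : SmoothIn D ψ) (hΦ : SmoothIn S Φ) (hw : Integrable w) (x : E3) :
    lapField (vloc ψ Φ w) x = ∑ i, (vloc (dirDeriv (basisVec i) (dirDeriv (basisVec i) ψ)) Φ w x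
      + 2 • vloc (dirDeriv (basisVec i) ψ) (dirDeriv (basisVec i) Φ) w x
      + vloc ψ (dirDeriv (basisVec i) (dirDeriv (basisVec i) Φ)) w x) := by
  refine sum_congr rfl fun i _ => ?_
  set a := basisVec i
  have h1 : (fun y => fderiv ℝ (vloc ψ Φ w) y a) =
      fun y => vloc (dirDeriv a ψ) Φ w y + vloc ψ (dirDeriv a Φ) w y :=
    funext fun y => fderiv_vloc hψ hΦ hw y a
  rw [h1, fderiv_fun_add ((smoothIn_vloc (hψ.dirDeriv a) hΦ hw).differentiable x)
    ((smoothIn_vloc hψ (hΦ.dirDeriv a) hw).differentiable x), add_apply,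
    fderiv_vloc (hψ.dirDeriv a) hΦ hw, fderiv_vloc hψ (hΦ.dirDeriv a) hw]
  abel

lemma lapField_vstar (hψ : SmoothIn D ψ) (hΦ : SmoothIn S Φ) (hw : Integrable w) (x : E3) :
    lapField (vstar ψ Φ w) x =
      ∑ i, vstar ψ (dirDeriv (basisVec i) (dirDeriv (basisVec i) Φ)) w x := by
  refine sum_congr rfl fun i _ => ?_
  rw [funext fun y => fderiv_vstar hψ hΦ hw y (basisVec i), fderiv_vstar hψ (hΦ.dirDeriv _) hw]

/-- Even symmetric matrix kernels supported in the ball of radius `ρ`, whose divergence is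
the gradient of an even scalar function supported in the same ball. -/
structure IsKernel (ρ : ℝ) (Φ : E3 → E3 →L[ℝ] E3) (G : E3 → ℝ) : Prop where
  smooth : SmoothIn (closedBall 0 ρ) Φ
  smoothG : SmoothIn (closedBall 0 ρ) G
  even : ∀ h, Φ (-h) = Φ h
  evenG : ∀ h, G (-h) = G h
  symm : ∀ h a b, ⟪Φ h a, b⟫ = ⟪a, Φ h b⟫
  div : ∀ h b, ∑ i, (fderiv ℝ Φ h (basisVec i) b) i = fderiv ℝ G h b

variable {G : E3 → ℝ}

lemma sum_conv_dirDeriv (hK : IsKernel ρ Φ G) (hw : Integrable w) (x : E3) :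
    ∑ i, (conv (dirDeriv (basisVec i) Φ) w x) i = ∫ y, fderiv ℝ G (x - y) (w y) := by
  have h1 : ∀ i : Fin 3, (conv (dirDeriv (basisVec i) Φ) w x) i =
      ∫ y, (dirDeriv (basisVec i) Φ (x - y) (w y)) i := fun i =>
    ((proj (𝕜 := ℝ) i : E3 →L[ℝ] ℝ).integral_comp_comm
      (integrable_clm_apply (hK.smooth.dirDeriv _) hw x)).symm
  simp only [h1]
  rw [← integral_finsetSum]
  · simp only [← hK.div]; rfl
  · exact fun i _ => (proj (𝕜 := ℝ) i : E3 →L[ℝ] ℝ).integrable_comp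
      (integrable_clm_apply (hK.smooth.dirDeriv _) hw x)

lemma divField_vloc (hψ : SmoothIn D ψ) (hK : IsKernel ρ Φ G) (hw : Integrable w) (x : E3) :
    divField (vloc ψ Φ w) x = fderiv ℝ ψ x (conv Φ w x) + ψ x * ∫ y, fderiv ℝ G (x - y) (w y) := by
  simp only [divField, fderiv_vloc hψ hK.smooth hw]
  rw [← sum_conv_dirDeriv hK hw, mul_sum, fderiv_apply_eq_sum (fderiv ℝ ψ x),
    ← sum_add_distrib]
  simp [vloc, dirDeriv, mul_comm]

lemma divField_vstar (hψ : SmoothIn D ψ) (hK : IsKernel ρ Φ G) (hw : Integrable w) (x : E3) :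
    divField (vstar ψ Φ w) x = ∫ y, fderiv ℝ G (x - y) (ψ y • w y) := by
  simp only [divField, fderiv_vstar hψ hK.smooth hw]
  exact sum_conv_dirDeriv hK (hψ.integrable_smul hw) x

/-! ### Joint measurability of the regularised fields -/

lemma measurable_divField_of {V : L2Vec D → E3 → E3}
    (h : ∀ a, Measurable fun q : L2Vec D × E3 => fderiv ℝ (V q.1) q.2 a) :
    Measurable fun q : L2Vec D × E3 => divField (V q.1) q.2 :=
  measurable_sum _ fun i _ =>
    (proj (𝕜 := ℝ) i : E3 →L[ℝ] ℝ).continuous.measurable.comp (h _)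

lemma measurable_fderiv_kernel (hΦ : SmoothIn S Φ) :
    Measurable fun q : (E3 × E3) × E3 × E3 => fderiv ℝ Φ (q.1.1 - q.2.1) q.1.2 q.2.2 :=
  (((hΦ.fderiv.continuous.comp ((continuous_fst.comp continuous_fst).sub
    (continuous_fst.comp continuous_snd))).clm_apply (continuous_snd.comp continuous_fst)).clm_apply
    (continuous_snd.comp continuous_snd)).measurable

section Measurability

variable [IsFiniteMeasure (volume.restrict D)]

lemma measurable_integral_fld {A F : Type*} [MeasurableSpace A] [NormedAddCommGroup F]
    [NormedSpace ℝ F] [MeasurableSpace F] [BorelSpace F] [SecondCountableTopology F]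
    (hD : MeasurableSet D) {f : A → E3 → E3 → F}
    (hf : Measurable fun q : A × E3 × E3 => f q.1 q.2.1 q.2.2) :
    Measurable fun q : L2Vec D × A => ∫ y, f q.2 y (fld q.1 y) := by
  have h1 : Measurable fun q : (L2Vec D × A) × E3 => f q.1.2 q.2 (fld q.1.1 q.2) :=
    hf.comp ((measurable_snd.comp measurable_fst).prodMk (measurable_snd.prodMk
      ((measurable_fld_L2Vec hD).comp ((measurable_fst.comp measurable_fst).prodMk
        measurable_snd))))
  exact (h1.stronglyMeasurable.integral_prod_right' (ν := volume)).measurable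

lemma integrable_fld (hD : MeasurableSet D) (w : L2Vec D) : Integrable (fld w) :=
  ((integrable_indicator_iff hD).2 (Lp.integrable_restrict w)).congr (fld_ae_eq hD w).symm

lemma measurable_conv_fld (hD : MeasurableSet D) (hΦ : Continuous Φ) :
    Measurable fun q : L2Vec D × E3 => conv Φ (fld q.1) q.2 :=
  measurable_integral_fld hD (f := fun x y b => Φ (x - y) b) (by
    have : Continuous fun q : E3 × E3 × E3 => Φ (q.1 - q.2.1) q.2.2 := by fun_prop
    exact this.measurable)

lemma measurable_vloc_fld (hD : MeasurableSet D) (hΦ : Continuous Φ) (hψ : Continuous ψ) :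
    Measurable fun q : L2Vec D × E3 => vloc ψ Φ (fld q.1) q.2 :=
  (hψ.measurable.comp measurable_snd).smul (measurable_conv_fld hD hΦ)

lemma measurable_vstar_fld (hD : MeasurableSet D) (hΦ : Continuous Φ) (hψ : Continuous ψ) :
    Measurable fun q : L2Vec D × E3 => vstar ψ Φ (fld q.1) q.2 :=
  measurable_integral_fld hD (f := fun x y b => Φ (x - y) (ψ y • b)) (by
    have : Continuous fun q : E3 × E3 × E3 => Φ (q.1 - q.2.1) (ψ q.2.1 • q.2.2) := by fun_prop
    exact this.measurable)

lemma measurable_fderiv_vloc_fld (hD : MeasurableSet D) (hΦ : SmoothIn S Φ) (hψ : SmoothIn D ψ) :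
    Measurable fun q : L2Vec D × E3 => fderiv ℝ (vloc ψ Φ (fld q.1)) q.2 (fld q.1 q.2) := by
  have h : ∀ q : L2Vec D × E3, fderiv ℝ (vloc ψ Φ (fld q.1)) q.2 (fld q.1 q.2) =
      fderiv ℝ ψ q.2 (fld q.1 q.2) • conv Φ (fld q.1) q.2 +
        ψ q.2 • ∫ y, fderiv ℝ Φ (q.2 - y) (fld q.1 q.2) (fld q.1 y) := fun q => by
    rw [fderiv_vloc hψ hΦ (integrable_fld hD q.1)]; rfl
  simp only [h]
  have hm := measurable_fld_L2Vec (D := D) hD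
  have h1 : Measurable fun q : L2Vec D × E3 => fderiv ℝ ψ q.2 (fld q.1 q.2) := by
    have : Continuous fun q : E3 × E3 => fderiv ℝ ψ q.1 q.2 :=
      (hψ.fderiv.continuous.comp continuous_fst).clm_apply continuous_snd
    exact this.measurable.comp (measurable_snd.prodMk hm)
  have h2 : Measurable fun q : L2Vec D × (E3 × E3) =>
      ∫ y, fderiv ℝ Φ (q.2.1 - y) q.2.2 (fld q.1 y) :=
    measurable_integral_fld (A := E3 × E3) (F := E3) hD
      (f := fun p y b => fderiv ℝ Φ (p.1 - y) p.2 b) (measurable_fderiv_kernel hΦ)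
  have h3 : Measurable fun q : L2Vec D × E3 =>
      ∫ y, fderiv ℝ Φ (q.2 - y) (fld q.1 q.2) (fld q.1 y) :=
    h2.comp (g := fun q : L2Vec D × (E3 × E3) => ∫ y, fderiv ℝ Φ (q.2.1 - y) q.2.2 (fld q.1 y))
      (f := fun q : L2Vec D × E3 => (q.1, q.2, fld q.1 q.2))
      (measurable_fst.prodMk (measurable_snd.prodMk hm))
  have h4 : Measurable fun q : L2Vec D × E3 => ψ q.2 := hψ.continuous.measurable.comp measurable_snd
  refine Measurable.add ?_ ?_
  · exact Measurable.smul h1 (measurable_conv_fld hD hΦ.continuous)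
  · exact Measurable.smul h4 h3

lemma measurable_fderiv_vstar_fld (hD : MeasurableSet D) (hΦ : SmoothIn S Φ) (hψ : SmoothIn D ψ) :
    Measurable fun q : L2Vec D × E3 => fderiv ℝ (vstar ψ Φ (fld q.1)) q.2 (fld q.1 q.2) := by
  have h : ∀ q : L2Vec D × E3, fderiv ℝ (vstar ψ Φ (fld q.1)) q.2 (fld q.1 q.2) =
      ∫ y, fderiv ℝ Φ (q.2 - y) (fld q.1 q.2) (ψ y • fld q.1 y) := fun q => by
    rw [fderiv_vstar hψ hΦ (integrable_fld hD q.1)]; rfl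
  simp only [h]
  have hm := measurable_fld_L2Vec (D := D) hD
  have h2 : Measurable fun q : L2Vec D × (E3 × E3) =>
      ∫ y, fderiv ℝ Φ (q.2.1 - y) q.2.2 (ψ y • fld q.1 y) :=
    measurable_integral_fld (A := E3 × E3) (F := E3) hD
      (f := fun p y b => fderiv ℝ Φ (p.1 - y) p.2 (ψ y • b)) <|
      (measurable_fderiv_kernel hΦ).comp
        (f := fun q : (E3 × E3) × E3 × E3 => (q.1, q.2.1, ψ q.2.1 • q.2.2))
        (measurable_fst.prodMk ((measurable_fst.comp measurable_snd).prodMk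
          ((hψ.continuous.measurable.comp (measurable_fst.comp measurable_snd)).smul
            (measurable_snd.comp measurable_snd))))
  exact h2.comp
    (g := fun q : L2Vec D × (E3 × E3) => ∫ y, fderiv ℝ Φ (q.2.1 - y) q.2.2 (ψ y • fld q.1 y))
    (f := fun q : L2Vec D × E3 => (q.1, q.2, fld q.1 q.2))
    (measurable_fst.prodMk (measurable_snd.prodMk hm))

lemma measurable_divField_vloc_fld (hD : MeasurableSet D) (hΦ : SmoothIn S Φ)
    (hψ : SmoothIn D ψ) :
    Measurable fun q : L2Vec D × E3 => divField (vloc ψ Φ (fld q.1)) q.2 := by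
  refine measurable_divField_of (V := fun w => vloc ψ Φ (fld w)) fun a => ?_
  have h : ∀ q : L2Vec D × E3, fderiv ℝ (vloc ψ Φ (fld q.1)) q.2 a =
      vloc (dirDeriv a ψ) Φ (fld q.1) q.2 + vloc ψ (dirDeriv a Φ) (fld q.1) q.2 := fun q =>
    fderiv_vloc hψ hΦ (integrable_fld hD q.1) q.2 a
  rw [funext h]
  exact Measurable.add (measurable_vloc_fld hD hΦ.continuous (hψ.dirDeriv a).continuous)
    (measurable_vloc_fld hD (hΦ.dirDeriv a).continuous hψ.continuous)

lemma measurable_divField_vstar_fld (hD : MeasurableSet D) (hΦ : SmoothIn S Φ)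
    (hψ : SmoothIn D ψ) :
    Measurable fun q : L2Vec D × E3 => divField (vstar ψ Φ (fld q.1)) q.2 := by
  refine measurable_divField_of (V := fun w => vstar ψ Φ (fld w)) fun a => ?_
  have h : ∀ q : L2Vec D × E3, fderiv ℝ (vstar ψ Φ (fld q.1)) q.2 a =
      vstar ψ (dirDeriv a Φ) (fld q.1) q.2 := fun q =>
    fderiv_vstar hψ hΦ (integrable_fld hD q.1) q.2 a
  rw [funext h]
  exact measurable_vstar_fld hD (hΦ.dirDeriv a).continuous hψ.continuous

lemma measurable_lapField_vloc_fld (hD : MeasurableSet D) (hΦ : SmoothIn S Φ)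
    (hψ : SmoothIn D ψ) :
    Measurable fun q : L2Vec D × E3 => lapField (vloc ψ Φ (fld q.1)) q.2 := by
  rw [funext fun q : L2Vec D × E3 => lapField_vloc hψ hΦ (integrable_fld hD q.1) q.2]
  refine measurable_sum _ fun i _ => Measurable.add (Measurable.add ?_ ?_) ?_
  · exact measurable_vloc_fld hD hΦ.continuous ((hψ.dirDeriv _).dirDeriv _).continuous
  · exact (measurable_vloc_fld hD (hΦ.dirDeriv _).continuous
      (hψ.dirDeriv _).continuous).const_smul 2
  · exact measurable_vloc_fld hD ((hΦ.dirDeriv _).dirDeriv _).continuous hψ.continuous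

lemma measurable_lapField_vstar_fld (hD : MeasurableSet D) (hΦ : SmoothIn S Φ)
    (hψ : SmoothIn D ψ) :
    Measurable fun q : L2Vec D × E3 => lapField (vstar ψ Φ (fld q.1)) q.2 := by
  rw [funext fun q : L2Vec D × E3 => lapField_vstar hψ hΦ (integrable_fld hD q.1) q.2]
  exact measurable_sum _ fun i _ =>
    measurable_vstar_fld hD ((hΦ.dirDeriv _).dirDeriv _).continuous hψ.continuous

end Measurability

/-! ### The weak form of the right-hand side -/

variable {D S : Set E3}

/-- The right-hand side of the momentum equation tested with `v`, after integration by parts. -/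
def forcing (ν : ℝ) (w z : L2Vec D) (q : L32 D) (v : E3 → E3) : ℝ :=
  (∫ x in D, ⟪w x, fderiv ℝ v x (w x)⟫) + ν * (∫ x in D, ⟪w x, lapField v x⟫)
    + (∫ x in D, ⟪z x, v x⟫) + ∫ x in D, q x * divField v x

/-- A common bound for a field, its first partial derivatives and its Laplacian. -/
structure FieldBound (v : E3 → E3) (A : ℝ) : Prop where
  value : ∀ x, ‖v x‖ ≤ A
  deriv : ∀ x i, ‖fderiv ℝ v x (basisVec i)‖ ≤ A
  lap : ∀ x, ‖lapField v x‖ ≤ A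

lemma norm_clm_le {F : Type*} [NormedAddCommGroup F] [NormedSpace ℝ F] {A : ℝ} (hA : 0 ≤ A)
    (L : E3 →L[ℝ] F) (h : ∀ i, ‖L (basisVec i)‖ ≤ A) : ‖L‖ ≤ 3 * A := by
  refine L.opNorm_le_bound (by positivity) fun a => ?_
  rw [fderiv_apply_eq_sum L a]
  refine (norm_sum_le _ _).trans ?_
  have : ∀ i ∈ Finset.univ, ‖a i • L (basisVec i)‖ ≤ A * ‖a‖ := fun i _ => by
    rw [norm_smul, mul_comm]
    exact mul_le_mul (h i) (PiLp.norm_apply_le a i) (norm_nonneg _) hA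
  refine (sum_le_sum this).trans ?_
  simp [mul_assoc]

lemma FieldBound.nonneg {v : E3 → E3} {A : ℝ} (h : FieldBound v A) : 0 ≤ A :=
  (norm_nonneg _).trans (h.value 0)

lemma FieldBound.norm_fderiv_le {v : E3 → E3} {A : ℝ} (h : FieldBound v A) (x : E3) :
    ‖fderiv ℝ v x‖ ≤ 3 * A := norm_clm_le h.nonneg _ fun i => h.deriv x i

lemma FieldBound.abs_div_le {v : E3 → E3} {A : ℝ} (h : FieldBound v A) (x : E3) :
    |divField v x| ≤ 3 * A := by
  refine (Finset.abs_sum_le_sum_abs _ _).trans ?_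
  refine (sum_le_sum fun i _ =>
    (PiLp.norm_apply_le (fderiv ℝ v x (basisVec i)) i).trans (h.deriv x i)).trans ?_
  simp

lemma exists_integral_norm_le {F : Type*} [NormedAddCommGroup F] (D : Set E3)
    [IsFiniteMeasure (volume.restrict D)] (p : ℝ≥0∞) (hp : 1 ≤ p) :
    ∃ C : ℝ, 0 ≤ C ∧ ∀ w : Lp F p (volume.restrict D : Measure E3), ∫ x in D, ‖w x‖ ≤ C * ‖w‖ := by
  set μ := (volume.restrict D : Measure E3)
  refine ⟨((μ univ) ^ (1 / toReal 1 - 1 / p.toReal)).toReal, ENNReal.toReal_nonneg,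
    fun w => ?_⟩
  have h1 : eLpNorm w 1 μ ≤ eLpNorm w p μ * (μ univ) ^ (1 / toReal 1 - 1 / p.toReal) :=
    eLpNorm_le_eLpNorm_mul_rpow_measure_univ hp (Lp.aestronglyMeasurable w)
  have hexp : 0 ≤ 1 / toReal 1 - 1 / p.toReal := by
    rcases eq_or_ne p ⊤ with h | h
    · simp [h]
    · have : 1 ≤ p.toReal := by rw [← toReal_one]; exact toReal_mono h hp
      simp only [toReal_one]
      have := one_div_le_one_div_of_le one_pos this
      linarith
  rw [integral_norm_eq_lintegral_enorm (Lp.aestronglyMeasurable w), ← eLpNorm_one_eq_lintegral_enorm,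
    Lp.norm_def, mul_comm, ← toReal_mul]
  exact toReal_mono (mul_ne_top (Lp.eLpNorm_ne_top _)
    (ENNReal.rpow_ne_top_of_nonneg hexp (measure_ne_top _ _))) h1

lemma setIntegral_norm_sq (w : L2Vec D) : ∫ x in D, ‖w x‖ ^ 2 = ‖w‖ ^ 2 := by
  rw [← real_inner_self_eq_norm_sq, L2.inner_def]
  simp

lemma integrable_norm_sq (w : L2Vec D) : Integrable (fun x => ‖w x‖ ^ 2) (volume.restrict D) :=
  (L2Vec.memLp w).integrable_norm_pow (by norm_num)

variable {v v' : E3 → E3}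

lemma integrable_convective (hv : SmoothIn D v) (w : L2Vec D) :
    Integrable (fun x => ⟪w x, fderiv ℝ v x (w x)⟫) (volume.restrict D) := by
  obtain ⟨C, hC0, hC⟩ := hv.fderiv.exists_bound
  refine ((integrable_norm_sq w).const_mul C).mono' ?_ (ae_of_all _ fun x => ?_)
  · exact (L2Vec.memLp w).1.inner ((ContinuousLinearMap.apply ℝ E3).aestronglyMeasurable_comp₂
      (L2Vec.memLp w).1 hv.fderiv.continuous.aestronglyMeasurable)
  · calc ‖⟪w x, fderiv ℝ v x (w x)⟫‖ ≤ ‖w x‖ * ‖fderiv ℝ v x (w x)‖ := norm_inner_le_norm _ _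
      _ ≤ ‖w x‖ * (C * ‖w x‖) := by
        gcongr; exact (le_opNorm _ _).trans (by gcongr; exact hC x)
      _ = _ := by ring

lemma integrable_inner_smooth (hv : SmoothIn D v) (w : L2Vec D) :
    Integrable (fun x => ⟪w x, v x⟫) (volume.restrict D) :=
  integrable_inner_memLp (L2Vec.memLp w) (hv.memLp 2 _)

lemma continuous_divField (hv : SmoothIn D v) : Continuous (divField v) :=
  continuous_finsetSum _ fun i _ => (proj (𝕜 := ℝ) i : E3 →L[ℝ] ℝ).continuous.comp
    (hv.fderiv_apply (basisVec i)).continuous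

lemma forcing_smul (hv : SmoothIn D v) (c ν : ℝ) (w z : L2Vec D) (q : L32 D) :
    forcing ν w z q (fun x => c • v x) = c * forcing ν w z q v := by
  have h1 : ∀ x, fderiv ℝ (fun x => c • v x) x = c • fderiv ℝ v x := fun x =>
    fderiv_fun_const_smul (hv.differentiable x) c
  have h2 : ∀ x, lapField (fun x => c • v x) x = c • lapField v x := fun x => by
    simp only [lapField, h1, smul_apply, Finset.smul_sum]
    refine sum_congr rfl fun i _ => ?_
    rw [fderiv_fun_const_smul ((hv.fderiv_apply _).differentiable x) c, smul_apply]
  have h3 : ∀ x, divField (fun x => c • v x) x = c * divField v x := fun x => by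
    simp [divField, h1, mul_sum]
  simp only [forcing, h1, h2, h3, smul_apply, inner_smul_right, mul_left_comm _ c,
    integral_const_mul]
  ring

section Forcing

variable [IsFiniteMeasure (volume.restrict D)]

lemma integrable_mul_div (hv : SmoothIn D v) (q : L32 D) :
    Integrable (fun x => q x * divField v x) (volume.restrict D) := by
  have hs : SmoothIn D (divField v) := SmoothIn.sum _ fun i _ =>
    (hv.fderiv_apply (basisVec i)).clm_comp (proj (𝕜 := ℝ) i : E3 →L[ℝ] ℝ)
  obtain ⟨C, hC0, hC⟩ := hs.exists_bound
  exact (Lp.integrable_restrict q).mul_bdd hs.continuous.aestronglyMeasurable (c := C) (ae_of_all _ hC)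

lemma exists_abs_forcing_le (D : Set E3) [IsFiniteMeasure (volume.restrict D)]
    (ν : ℝ) : ∃ K : ℝ, 0 ≤ K ∧ ∀ (w z : L2Vec D) (q : L32 D) (v : E3 → E3) (A : ℝ),
      SmoothIn D v → FieldBound v A →
      |forcing ν w z q v| ≤ K * (1 + ‖w‖ ^ 2 + ‖z‖ + ‖q‖) * A := by
  obtain ⟨C2, hC2, h2⟩ := exists_integral_norm_le (F := E3) D 2 (by norm_num)
  obtain ⟨C3, hC3, h3⟩ := exists_integral_norm_le (F := ℝ) D (3 / 2) fact_one_le_three_halves.out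
  refine ⟨3 + |ν| * C2 + C2 + 3 * C3, by positivity, fun w z q v A hv hA => ?_⟩
  have hA0 := hA.nonneg
  have a1 : |∫ x in D, ⟪w x, fderiv ℝ v x (w x)⟫| ≤ 3 * A * ‖w‖ ^ 2 := by
    rw [← setIntegral_norm_sq, ← integral_const_mul, ← norm_eq_abs]
    refine norm_integral_le_of_norm_le ((integrable_norm_sq w).const_mul _) (ae_of_all _ fun x => ?_)
    calc ‖⟪w x, fderiv ℝ v x (w x)⟫‖ ≤ ‖w x‖ * ‖fderiv ℝ v x (w x)‖ := norm_inner_le_norm _ _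
      _ ≤ ‖w x‖ * (3 * A * ‖w x‖) := by
        gcongr
        exact (le_opNorm _ _).trans (by gcongr; exact hA.norm_fderiv_le x)
      _ = _ := by ring
  have a2 : ∀ (w : L2Vec D) (v' : E3 → E3), (∀ x, ‖v' x‖ ≤ A) →
      |∫ x in D, ⟪w x, v' x⟫| ≤ C2 * ‖w‖ * A := fun w v' hv' => by
    rw [← norm_eq_abs]
    refine (norm_integral_le_of_norm_le ((Lp.integrable_restrict w).norm.mul_const A)
      (ae_of_all _ fun x => ?_)).trans ?_
    · exact (norm_inner_le_norm _ _).trans (by gcongr; exact hv' x)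
    · rw [integral_mul_const]; gcongr; exact h2 w
  have a3 : |∫ x in D, q x * divField v x| ≤ C3 * ‖q‖ * (3 * A) := by
    rw [← norm_eq_abs]
    refine (norm_integral_le_of_norm_le ((Lp.integrable_restrict q).norm.mul_const (3 * A))
      (ae_of_all _ fun x => ?_)).trans ?_
    · rw [norm_mul]; gcongr; exact hA.abs_div_le x
    · rw [integral_mul_const]; gcongr; exact h3 q
  have a4 : |ν * ∫ x in D, ⟪w x, lapField v x⟫| ≤ |ν| * (C2 * ‖w‖ * A) := by
    rw [abs_mul]; gcongr; exact a2 w _ hA.lap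
  have hw : ‖w‖ ≤ 1 + ‖w‖ ^ 2 := by nlinarith [sq_nonneg (‖w‖ - 1)]
  have b := a2 z v hA.value
  have hn := norm_nonneg w
  have hz := norm_nonneg z
  have hq := norm_nonneg q
  calc |forcing ν w z q v| ≤ 3 * A * ‖w‖ ^ 2 + |ν| * (C2 * ‖w‖ * A) + C2 * ‖z‖ * A
        + C3 * ‖q‖ * (3 * A) := by
        unfold forcing
        exact (abs_add_le _ _).trans (add_le_add ((abs_add_le _ _).trans (add_le_add
          ((abs_add_le _ _).trans (add_le_add a1 a4)) b)) a3)
    _ ≤ 3 * A * (1 + ‖w‖ ^ 2 + ‖z‖ + ‖q‖) + |ν| * (C2 * (1 + ‖w‖ ^ 2 + ‖z‖ + ‖q‖) * A)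
        + C2 * (1 + ‖w‖ ^ 2 + ‖z‖ + ‖q‖) * A + C3 * (1 + ‖w‖ ^ 2 + ‖z‖ + ‖q‖) * (3 * A) := by
        gcongr <;> nlinarith [sq_nonneg ‖w‖]
    _ = _ := by ring

lemma forcing_add (hv : SmoothIn D v) (hv' : SmoothIn D v') (ν : ℝ) (w z : L2Vec D) (q : L32 D) :
    forcing ν w z q (fun x => v x + v' x) = forcing ν w z q v + forcing ν w z q v' := by
  have h1 : ∀ x, fderiv ℝ (fun x => v x + v' x) x = fderiv ℝ v x + fderiv ℝ v' x := fun x =>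
    fderiv_fun_add (hv.differentiable x) (hv'.differentiable x)
  have h2 : ∀ x, lapField (fun x => v x + v' x) x = lapField v x + lapField v' x := fun x => by
    simp only [lapField, h1, add_apply, ← sum_add_distrib]
    refine sum_congr rfl fun i _ => ?_
    rw [fderiv_fun_add ((hv.fderiv_apply _).differentiable x)
      ((hv'.fderiv_apply _).differentiable x), add_apply]
  have h3 : ∀ x, divField (fun x => v x + v' x) x = divField v x + divField v' x := fun x => by
    simp [divField, h1, sum_add_distrib]
  simp only [forcing, h1, h2, h3, add_apply, inner_add_right, mul_add]
  rw [integral_add (integrable_convective hv w) (integrable_convective hv' w),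
    integral_add (integrable_inner_smooth hv.lapField w) (integrable_inner_smooth hv'.lapField w),
    integral_add (integrable_inner_smooth hv z) (integrable_inner_smooth hv' z),
    integral_add (integrable_mul_div hv q) (integrable_mul_div hv' q)]
  ring

/-- Measurability of the right-hand side tested with a field that depends on the velocity. -/
lemma measurable_forcing_self (hD : MeasurableSet D) {V : L2Vec D → E3 → E3} (ν : ℝ)
    (h0 : Measurable fun q : L2Vec D × E3 => V q.1 q.2)
    (h1 : Measurable fun q : L2Vec D × E3 => fderiv ℝ (V q.1) q.2 (fld q.1 q.2))
    (h2 : Measurable fun q : L2Vec D × E3 => lapField (V q.1) q.2)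
    (h3 : Measurable fun q : L2Vec D × E3 => divField (V q.1) q.2) :
    Measurable fun X : (L2Vec D × L2Vec D) × L32 D => forcing ν X.1.1 X.1.2 X.2 (V X.1.1) := by
  have key : ∀ X : (L2Vec D × L2Vec D) × L32 D, forcing ν X.1.1 X.1.2 X.2 (V X.1.1) =
      (∫ x in D, ⟪fld X.1.1 x, fderiv ℝ (V X.1.1) x (fld X.1.1 x)⟫)
      + ν * (∫ x in D, ⟪fld X.1.1 x, lapField (V X.1.1) x⟫)
      + (∫ x in D, ⟪fld X.1.2 x, V X.1.1 x⟫) + ∫ x in D, fld X.2 x * divField (V X.1.1) x := by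
    intro X
    have e1 := fld_ae_eq_restrict hD X.1.1
    have e2 := fld_ae_eq_restrict hD X.1.2
    have e3 := fld_ae_eq_restrict hD X.2
    unfold forcing
    congr 1
    · congr 1
      · congr 1
        · refine integral_congr_ae ?_
          filter_upwards [e1] with x hx using by rw [hx]
        · congr 1
          refine integral_congr_ae ?_
          filter_upwards [e1] with x hx using by rw [hx]
      · refine integral_congr_ae ?_
        filter_upwards [e2] with x hx using by rw [hx]
    · refine integral_congr_ae ?_
      filter_upwards [e3] with x hx using by rw [hx]
  simp only [key]
  have m1 : Measurable fun q : ((L2Vec D × L2Vec D) × L32 D) × E3 => (q.1.1.1, q.2) :=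
    (measurable_fst.comp (measurable_fst.comp measurable_fst)).prodMk measurable_snd
  have m2 : Measurable fun q : ((L2Vec D × L2Vec D) × L32 D) × E3 => (q.1.1.2, q.2) :=
    (measurable_snd.comp (measurable_fst.comp measurable_fst)).prodMk measurable_snd
  have m3 : Measurable fun q : ((L2Vec D × L2Vec D) × L32 D) × E3 => (q.1.2, q.2) :=
    (measurable_snd.comp measurable_fst).prodMk measurable_snd
  have int : ∀ {f : ((L2Vec D × L2Vec D) × L32 D) × E3 → ℝ}, Measurable f →
      Measurable fun X => ∫ x in D, f (X, x) := fun hf =>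
    (hf.stronglyMeasurable.integral_prod_right' (ν := volume.restrict D)).measurable
  have hm := measurable_fld_L2Vec (D := D) hD
  exact (((int ((hm.comp m1).inner (h1.comp m1))).add
    ((int ((hm.comp m1).inner (h2.comp m1))).const_mul ν)).add
    (int ((hm.comp m2).inner (h0.comp m1)))).add
    (int (((measurable_fld_L32 hD).comp m3).mul (h3.comp m1)))

end Forcing

/-! ### A product rule for weakly continuous paths -/

lemma product_rule {H : Type*} [NormedAddCommGroup H] [InnerProductSpace ℝ H] [CompleteSpace H]
    {u : ℝ → H} {M : ℝ} (hM : ∀ t ∈ Icc (0 : ℝ) 1, ‖u t‖ ≤ M)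
    (hcont : ∀ f, ∀ t ∈ Icc (0 : ℝ) 1, Tendsto (fun s => ⟪f, u s⟫) (𝓝[Icc 0 1] t) (𝓝 ⟪f, u t⟫))
    {B : H → H → ℝ} {JA JB : ℝ → H →L[ℝ] ℝ} {c : ℝ → ℝ}
    (hc : IntervalIntegrable c volume 0 1) (hc0 : ∀ s, 0 ≤ c s) (hA : ∀ s f, ‖JA s f‖ ≤ c s * ‖f‖)
    (hB : ∀ s f, ‖JB s f‖ ≤ c s * ‖f‖)
    (mA : ∀ f, AEStronglyMeasurable (fun s => JA s f) (volume.restrict (Ioc 0 1)))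
    (mB : ∀ f, AEStronglyMeasurable (fun s => JB s f) (volume.restrict (Ioc 0 1)))
    (incA : ∀ r t, 0 ≤ r → r ≤ t → t ≤ 1 → ∀ f, B (u t) f - B (u r) f = ∫ s in r..t, JA s f)
    (incB : ∀ r t, 0 ≤ r → r ≤ t → t ≤ 1 → ∀ f, B f (u t) - B f (u r) = ∫ s in r..t, JB s f) :
    B (u 1) (u 1) - B (u 0) (u 0) = ∫ s in (0 : ℝ)..1, (JA s (u s) + JB s (u s)) := by
  have intJ : ∀ {J : ℝ → H →L[ℝ] ℝ}, (∀ s f, ‖J s f‖ ≤ c s * ‖f‖) →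
      (∀ f, AEStronglyMeasurable (fun s => J s f) (volume.restrict (Ioc 0 1))) →
      ∀ f r t, 0 ≤ r → r ≤ t → t ≤ 1 → IntervalIntegrable (fun s => J s f) volume r t := by
    intro J hJ mJ f r t hr hrt ht
    have h01 : IntervalIntegrable (fun s => J s f) volume 0 1 := by
      refine (hc.mul_const ‖f‖).mono_fun' (by simpa using mJ f) (ae_of_all _ fun s => hJ s f)
    exact h01.mono_set (by rw [uIcc_of_le hrt, uIcc_of_le zero_le_one]; exact Icc_subset_Icc hr ht)
  set π : ℕ → ℝ → ℝ := fun n s => (⌈((n : ℝ) + 1) * s⌉ : ℝ) / ((n : ℝ) + 1) with hπ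
  set π' : ℕ → ℝ → ℝ := fun n s => ((⌈((n : ℝ) + 1) * s⌉ : ℝ) - 1) / ((n : ℝ) + 1) with hπ'
  set g : ℕ → ℝ → ℝ := fun n s => JA s (u (π n s)) + JB s (u (π' n s)) with hg
  have hpos : ∀ n : ℕ, (0 : ℝ) < n + 1 := fun n => by positivity
  -- on each cell of the partition the integrand is frozen
  have hcell : ∀ n i : ℕ, ∀ s ∈ Ioc ((i : ℝ) / (n + 1)) (((i + 1 : ℕ) : ℝ) / (n + 1)),
      g n s = JA s (u (((i + 1 : ℕ) : ℝ) / (n + 1))) + JB s (u ((i : ℝ) / (n + 1))) := by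
    intro n i s hs
    have : ⌈((n : ℝ) + 1) * s⌉ = (i : ℤ) + 1 := by
      rw [Int.ceil_eq_iff]
      have h1 := (div_lt_iff₀ (hpos n)).1 hs.1
      have h2 := (le_div_iff₀ (hpos n)).1 hs.2
      push_cast at h2 ⊢
      constructor <;> linarith
    simp only [hg, hπ, hπ', this]
    push_cast
    simp
  have hle : ∀ n i : ℕ, (i : ℝ) / (n + 1) ≤ ((i + 1 : ℕ) : ℝ) / (n + 1) := fun n i => by
    gcongr; simp
  have hcellInt : ∀ n i : ℕ, i < n + 1 →
      IntervalIntegrable (g n) volume ((i : ℝ) / (n + 1)) (((i + 1 : ℕ) : ℝ) / (n + 1)) ∧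
      ∫ s in ((i : ℝ) / (n + 1))..(((i + 1 : ℕ) : ℝ) / (n + 1)), g n s =
        B (u (((i + 1 : ℕ) : ℝ) / (n + 1))) (u (((i + 1 : ℕ) : ℝ) / (n + 1)))
          - B (u ((i : ℝ) / (n + 1))) (u ((i : ℝ) / (n + 1))) := by
    intro n i hi
    have h0 : 0 ≤ (i : ℝ) / (n + 1) := by positivity
    have h1 : ((i + 1 : ℕ) : ℝ) / (n + 1) ≤ 1 := by rw [div_le_one (hpos n)]; exact_mod_cast hi
    have iA := intJ hA mA (u (((i + 1 : ℕ) : ℝ) / (n + 1))) _ _ h0 (hle n i) h1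
    have iB := intJ hB mB (u ((i : ℝ) / (n + 1))) _ _ h0 (hle n i) h1
    constructor
    · refine (iA.add iB).congr_ae ?_
      rw [uIoc_of_le (hle n i)]
      filter_upwards [ae_restrict_mem measurableSet_Ioc] with s hs using (hcell n i s hs).symm
    · rw [intervalIntegral.integral_congr_ae (g := fun s =>
        JA s (u (((i + 1 : ℕ) : ℝ) / (n + 1))) + JB s (u ((i : ℝ) / (n + 1))))
        (ae_of_all _ fun s hs => hcell n i s (by rwa [uIoc_of_le (hle n i)] at hs)),
        intervalIntegral.integral_add iA iB, ← incA _ _ h0 (hle n i) h1, ← incB _ _ h0 (hle n i) h1]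
      ring
  have hsum : ∀ n : ℕ, IntervalIntegrable (g n) volume 0 1 ∧
      ∫ s in (0 : ℝ)..1, g n s = B (u 1) (u 1) - B (u 0) (u 0) := by
    intro n
    have e0 : ((0 : ℕ) : ℝ) / ((n : ℝ) + 1) = 0 := by simp
    have e1 : ((n + 1 : ℕ) : ℝ) / ((n : ℝ) + 1) = 1 := by push_cast; exact div_self (hpos n).ne'
    constructor
    · have := IntervalIntegrable.trans_iterate (f := g n) (μ := volume)
        (a := fun i : ℕ => (i : ℝ) / ((n : ℝ) + 1)) (n := n + 1) fun k hk => (hcellInt n k hk).1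
      simpa only [e0, e1] using this
    · have := intervalIntegral.sum_integral_adjacent_intervals (f := g n) (μ := volume)
        (a := fun i : ℕ => (i : ℝ) / ((n : ℝ) + 1)) (n := n + 1) fun k hk => (hcellInt n k hk).1
      simp only [e0, e1] at this
      rw [← this, sum_congr rfl fun i hi => (hcellInt n i (Finset.mem_range.1 hi)).2,
        Finset.sum_range_sub (fun i : ℕ => B (u ((i : ℝ) / ((n : ℝ) + 1))) (u ((i : ℝ) / ((n : ℝ) + 1))))]
      simp only [e0, e1]
  have hmem : ∀ n : ℕ, ∀ s ∈ Ioc (0 : ℝ) 1, π n s ∈ Icc (0 : ℝ) 1 ∧ π' n s ∈ Icc (0 : ℝ) 1 ∧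
      |π n s - s| ≤ 1 / (n + 1) ∧ |π' n s - s| ≤ 1 / (n + 1) := by
    intro n s hs
    have hn := hpos n
    have c1 : 1 ≤ ⌈((n : ℝ) + 1) * s⌉ := Int.one_le_ceil_iff.2 (mul_pos hn hs.1)
    have c2 : ⌈((n : ℝ) + 1) * s⌉ ≤ (n : ℤ) + 1 := Int.ceil_le.2 (by push_cast; nlinarith [hs.2])
    have c1' : (1 : ℝ) ≤ ⌈((n : ℝ) + 1) * s⌉ := by exact_mod_cast c1
    have c2' : (⌈((n : ℝ) + 1) * s⌉ : ℝ) ≤ n + 1 := by exact_mod_cast c2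
    have c3 := Int.le_ceil (((n : ℝ) + 1) * s)
    have c4 := Int.ceil_lt_add_one (((n : ℝ) + 1) * s)
    refine ⟨⟨by positivity, (div_le_one hn).2 c2'⟩,
      ⟨div_nonneg (by linarith) hn.le, (div_le_one hn).2 (by linarith)⟩, ?_, ?_⟩
    · have : π n s - s = (⌈((n : ℝ) + 1) * s⌉ - (n + 1) * s) / (n + 1) := by
        simp only [hπ]; field_simp
      rw [this, abs_div, abs_of_pos hn]
      gcongr
      rw [abs_le]; constructor <;> linarith
    · have : π' n s - s = (⌈((n : ℝ) + 1) * s⌉ - 1 - (n + 1) * s) / (n + 1) := by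
        simp only [hπ']; field_simp
      rw [this, abs_div, abs_of_pos hn]
      gcongr
      rw [abs_le]; constructor <;> linarith
  have hweak : ∀ (J : H →L[ℝ] ℝ) (θ : ℕ → ℝ) (s : ℝ), s ∈ Icc (0 : ℝ) 1 →
      (∀ n, θ n ∈ Icc (0 : ℝ) 1) → (∀ n : ℕ, |θ n - s| ≤ 1 / ((n : ℝ) + 1)) →
      Tendsto (fun n => J (u (θ n))) atTop (𝓝 (J (u s))) := by
    intro J θ s hs hθ hθs
    have h1 : Tendsto θ atTop (𝓝[Icc 0 1] s) := by
      refine tendsto_nhdsWithin_iff.2 ⟨?_, Eventually.of_forall hθ⟩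
      rw [tendsto_iff_norm_sub_tendsto_zero]
      exact squeeze_zero (fun _ => norm_nonneg _) hθs tendsto_one_div_add_atTop_nhds_zero_nat
    have h2 := (hcont ((InnerProductSpace.toDual ℝ H).symm J) s hs).comp h1
    simpa only [comp_def, InnerProductSpace.toDual_symm_apply] using h2
  have hlim : Tendsto (fun n => ∫ s in (0 : ℝ)..1, g n s) atTop
      (𝓝 (∫ s in (0 : ℝ)..1, (JA s (u s) + JB s (u s)))) := by
    refine intervalIntegral.tendsto_integral_filter_of_dominated_convergence
      (fun s => c s * M + c s * M) ?_ ?_ ?_ ?_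
    · exact Eventually.of_forall fun n => by
        rw [uIoc_of_le zero_le_one]; exact (hsum n).1.1.aestronglyMeasurable
    · refine Eventually.of_forall fun n => ae_of_all _ fun s hs => ?_
      rw [uIoc_of_le zero_le_one] at hs
      obtain ⟨h1, h2, -, -⟩ := hmem n s hs
      exact (norm_add_le _ _).trans (add_le_add
        ((hA s _).trans (mul_le_mul_of_nonneg_left (hM _ h1) (hc0 s)))
        ((hB s _).trans (mul_le_mul_of_nonneg_left (hM _ h2) (hc0 s))))
    · exact (hc.mul_const M).add (hc.mul_const M)
    · refine ae_of_all _ fun s hs => ?_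
      rw [uIoc_of_le zero_le_one] at hs
      exact (hweak (JA s) _ s (Ioc_subset_Icc_self hs) (fun n => (hmem n s hs).1)
        fun n => (hmem n s hs).2.2.1).add (hweak (JB s) _ s (Ioc_subset_Icc_self hs)
        (fun n => (hmem n s hs).2.1) fun n => (hmem n s hs).2.2.2)
  simp only [fun n => (hsum n).2] at hlim
  exact tendsto_nhds_unique tendsto_const_nhds hlim

/-! ### Paths of solutions -/

lemma tendsto_inner_of_basis {H : Type*} [NormedAddCommGroup H] [InnerProductSpace ℝ H]
    (e : HilbertBasis ℕ ℝ H) {ι : Type*} {l : Filter ι} {x : ι → H} {y : H} {M : ℝ}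
    (hM : ∀ᶠ i in l, ‖x i‖ ≤ M) (h : ∀ k, Tendsto (fun i => ⟪e k, x i⟫) l (𝓝 ⟪e k, y⟫)) (f : H) :
    Tendsto (fun i => ⟪f, x i⟫) l (𝓝 ⟪f, y⟫) := by
  have hspan : ∀ g ∈ Submodule.span ℝ (range e), Tendsto (fun i => ⟪g, x i⟫) l (𝓝 ⟪g, y⟫) := by
    intro g hg
    induction hg using Submodule.span_induction with
    | mem z hz => obtain ⟨k, rfl⟩ := hz; exact h k
    | zero => simpa using tendsto_const_nhds
    | add a b _ _ ha hb => simpa only [inner_add_left] using ha.add hb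
    | smul c a _ ha => simpa only [inner_smul_left] using ha.const_mul _
  rw [Metric.tendsto_nhds]
  intro ε hε
  have hf : f ∈ closure (Submodule.span ℝ (range e) : Set H) := by
    rw [← Submodule.topologicalClosure_coe, e.dense_span]; trivial
  set K := |M| + ‖y‖ + 1
  have hK : 0 < K := by positivity
  obtain ⟨g, hg, hfg⟩ := Metric.mem_closure_iff.1 hf (ε / (2 * K)) (by positivity)
  filter_upwards [hM, Metric.tendsto_nhds.1 (hspan g hg) (ε / 2) (by positivity)] with i hi hi'
  rw [dist_eq] at hi' ⊢
  rw [dist_eq_norm] at hfg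
  have e1 : ⟪f, x i⟫ - ⟪f, y⟫ = ⟪f - g, x i - y⟫ + (⟪g, x i⟫ - ⟪g, y⟫) := by
    simp only [inner_sub_left, inner_sub_right]; ring
  have e2 : |⟪f - g, x i - y⟫| ≤ ε / (2 * K) * K := by
    refine (abs_real_inner_le_norm _ _).trans (mul_le_mul hfg.le ?_ (norm_nonneg _) (by positivity))
    refine (norm_sub_le _ _).trans ?_
    linarith [le_abs_self M]
  have e3 : ε / (2 * K) * K = ε / 2 := by field_simp
  rw [e1]
  refine (abs_add_le _ _).trans_lt ?_
  linarith

variable {D : Set E3} {e : HilbertBasis ℕ ℝ (VelH D)} {lam : ℕ → ℝ}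

lemma toV_field {w : VelH D} (h : InV w) : (toV w).field = (w : L2Vec D) := by
  rw [toV, dif_pos h]; exact h.choose_spec

lemma IsStokesEigenbasis.lam_eq (he : IsStokesEigenbasis e lam) (k : ℕ) :
    lam k = ‖(toV (e k)).grad‖ ^ 2 := by
  have h := (he k).2 (toV (e k))
  rw [toV_field (he k).1, stokesForm, real_inner_self_eq_norm_sq, real_inner_self_eq_norm_sq] at h
  have h1 : ‖(e k : L2Vec D)‖ = 1 := e.orthonormal.1 k
  rw [h, h1]; ring

lemma IsStokesEigenbasis.lam_pos (hD : Bornology.IsBounded D) (he : IsStokesEigenbasis e lam)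
    (k : ℕ) : 0 < lam k := by
  rw [he.lam_eq]
  obtain ⟨C, hC⟩ := exists_poincare hD
  have h := hC (toV (e k))
  rw [toV_field (he k).1] at h
  have h1 : ‖(e k : L2Vec D)‖ = 1 := e.orthonormal.1 k
  rw [h1] at h
  have : ‖(toV (e k)).grad‖ ≠ 0 := fun h0 => by rw [h0, mul_zero] at h; linarith
  positivity

lemma IsRegularPath.continuous_coeff {α : ℝ} {w : ℝ≥0 → VelH D} (hlam : ∀ k, 0 < lam k)
    (hw : IsRegularPath e lam α w) (k : ℕ) : Continuous fun t => ⟪e k, w t⟫ := by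
  refine continuous_iff_continuousAt.2 fun t => ?_
  have h1 : Tendsto (fun s => ofReal (lam k ^ (-α) * ⟪e k, w s - w t⟫ ^ 2)) (𝓝 t) (𝓝 0) :=
    tendsto_of_tendsto_of_tendsto_of_le_of_le tendsto_const_nhds (hw.continuous t)
      (fun _ => zero_le) fun s => ENNReal.le_tsum (f := fun k =>
        ofReal (lam k ^ (-α) * ⟪e k, w s - w t⟫ ^ 2)) k
  have hpos : 0 < lam k ^ (-α) := rpow_pos_of_pos (hlam k) _
  have h2 := (ENNReal.tendsto_toReal ENNReal.zero_ne_top).comp h1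
  have h3 : Tendsto (fun s => lam k ^ (-α) * ⟪e k, w s - w t⟫ ^ 2) (𝓝 t) (𝓝 0) := by
    refine h2.congr fun s => ?_
    simp only [Function.comp_apply]
    exact toReal_ofReal (by positivity)
  have h4 := ((h3.const_mul (lam k ^ (-α))⁻¹).sqrt)
  simp only [mul_zero, Real.sqrt_zero, inv_mul_cancel_left₀ hpos.ne', Real.sqrt_sq_eq_abs] at h4
  rw [ContinuousAt, tendsto_iff_norm_sub_tendsto_zero]
  refine h4.congr fun s => ?_
  rw [inner_sub_right, norm_eq_abs]

lemma IsRegularPath.exists_bound {α : ℝ} {w : ℝ≥0 → VelH D} (hlam : ∀ k, 0 < lam k)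
    (hw : IsRegularPath e lam α w) {T : ℝ} (hT : 0 < T) :
    ∃ M : ℝ, ∀ t ∈ Icc (0 : ℝ) T, ‖w t.toNNReal‖ ≤ M := by
  obtain ⟨M, hM0, hM⟩ : ∃ M : ℝ, 0 ≤ M ∧ ∀ᵐ t ∂(volume.restrict (Icc 0 T)), ‖w t.toNNReal‖ ≤ M := by
    have h := (hw.bounded T).2
    rw [eLpNorm_exponent_top] at h
    refine ⟨(eLpNormEssSup (fun s : ℝ => w s.toNNReal) (volume.restrict (Icc 0 T))).toReal,
      ENNReal.toReal_nonneg, ?_⟩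
    filter_upwards [ae_le_eLpNormEssSup (f := fun s : ℝ => w s.toNNReal)
      (μ := volume.restrict (Icc 0 T))] with t ht
    rw [← toReal_enorm]
    exact toReal_mono h.ne ht
  refine ⟨M, ?_⟩
  have hcoef : ∀ n : ℕ, ∀ t ∈ Icc (0 : ℝ) T,
      ∑ k ∈ Finset.range n, ⟪w t.toNNReal, e k⟫ * ⟪e k, w t.toNNReal⟫ ≤ M ^ 2 := by
    intro n
    set f : ℝ → ℝ := fun t => ∑ k ∈ Finset.range n, ⟪w t.toNNReal, e k⟫ * ⟪e k, w t.toNNReal⟫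
    have hf : Continuous f := continuous_finsetSum _ fun k _ => by
      have := (hw.continuous_coeff hlam k).comp continuous_real_toNNReal
      simp only [comp_def] at this
      have h2 := this.mul this
      refine h2.congr fun t => ?_
      simp only [Pi.mul_apply, real_inner_comm]
    have hle : ∀ t, ‖w t.toNNReal‖ ≤ M → f t ≤ M ^ 2 := fun t ht => by
      have h1 : f t ≤ ⟪w t.toNNReal, w t.toNNReal⟫ :=
        sum_le_hasSum _ (fun k _ => by rw [real_inner_comm]; exact mul_self_nonneg _)
          (e.hasSum_inner_mul_inner (w t.toNNReal) (w t.toNNReal))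
      rw [real_inner_self_eq_norm_sq] at h1
      exact h1.trans (by gcongr)
    have hopen : IsOpen ({t | M ^ 2 < f t} ∩ Ioo 0 T) :=
      (isOpen_lt continuous_const hf).inter isOpen_Ioo
    have hnull : volume ({t | M ^ 2 < f t} ∩ Ioo 0 T) = 0 := by
      have h2 : ∀ᵐ t ∂(volume.restrict (Icc 0 T)), ¬ (M ^ 2 < f t) := by
        filter_upwards [hM] with t ht using not_lt.2 (hle t ht)
      have h3 := (ae_restrict_iff' measurableSet_Icc).1 h2
      refine measure_mono_null (fun t ht => ?_) (ae_iff.1 h3)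
      simp only [mem_ofPred_eq, not_forall, not_not]
      exact ⟨Ioo_subset_Icc_self ht.2, ht.1⟩
    have hempty := (hopen.measure_eq_zero_iff volume).1 hnull
    have hsub : Ioo 0 T ⊆ {t | f t ≤ M ^ 2} := fun t ht => by
      by_contra h
      have hmem : t ∈ {t | M ^ 2 < f t} ∩ Ioo 0 T := ⟨by simpa using h, ht⟩
      rw [hempty] at hmem
      exact hmem
    have := closure_minimal hsub (isClosed_le hf continuous_const)
    rw [closure_Ioo hT.ne] at this
    exact fun t ht => this ht
  intro t ht
  have h1 := (e.hasSum_inner_mul_inner (w t.toNNReal) (w t.toNNReal)).tendsto_sum_nat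
  have h2 := le_of_tendsto h1 (Eventually.of_forall fun n => hcoef n t ht)
  rw [real_inner_self_eq_norm_sq] at h2
  exact le_of_sq_le_sq h2 hM0

lemma IsRegularPath.tendsto_inner {α : ℝ} {w : ℝ≥0 → VelH D} (hlam : ∀ k, 0 < lam k)
    (hw : IsRegularPath e lam α w) {T : ℝ} (hT : 0 < T) (f : VelH D) (t : ℝ) :
    Tendsto (fun s : ℝ => ⟪f, w s.toNNReal⟫) (𝓝[Icc 0 T] t) (𝓝 ⟪f, w t.toNNReal⟫) := by
  obtain ⟨M, hM⟩ := hw.exists_bound hlam hT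
  refine tendsto_inner_of_basis e (M := M) ?_ (fun k => ?_) f
  · filter_upwards [self_mem_nhdsWithin] with s hs using hM s hs
  · exact (((hw.continuous_coeff hlam k).comp continuous_real_toNNReal).tendsto t).mono_left
      nhdsWithin_le_nhds

/-! ### The momentum equation along a path -/

lemma abs_setIntegral_inner_le {D : Set E3} {v' : E3 → E3} (hv : MemLp v' 2 (volume.restrict D))
    (w : L2Vec D) : |∫ x in D, ⟪w x, v' x⟫| ≤ ‖hv.toLp‖ * (1 + ‖w‖ ^ 2) := by
  have h : ∫ x in D, ⟪w x, v' x⟫ = ⟪w, hv.toLp⟫ := by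
    rw [L2.inner_def]
    refine integral_congr_ae ?_
    filter_upwards [hv.coeFn_toLp] with x hx using by rw [hx]
  rw [h]
  refine (abs_real_inner_le_norm _ _).trans ?_
  rw [mul_comm]
  gcongr
  nlinarith [sq_nonneg (‖w‖ - 1)]

lemma exists_abs_convective_le {D : Set E3} {v : E3 → E3} (hv : SmoothIn D v) :
    ∃ C, ∀ w : L2Vec D, |∫ x in D, ⟪w x, fderiv ℝ v x (w x)⟫| ≤ C * (1 + ‖w‖ ^ 2) := by
  obtain ⟨C, hC0, hC⟩ := hv.fderiv.exists_bound
  refine ⟨C, fun w => ?_⟩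
  have : |∫ x in D, ⟪w x, fderiv ℝ v x (w x)⟫| ≤ C * ‖w‖ ^ 2 := by
    rw [← setIntegral_norm_sq, ← integral_const_mul, ← norm_eq_abs]
    refine norm_integral_le_of_norm_le ((integrable_norm_sq w).const_mul _) (ae_of_all _ fun x => ?_)
    calc ‖⟪w x, fderiv ℝ v x (w x)⟫‖ ≤ ‖w x‖ * ‖fderiv ℝ v x (w x)‖ := norm_inner_le_norm _ _
      _ ≤ ‖w x‖ * (C * ‖w x‖) := by
        gcongr
        exact (le_opNorm _ _).trans (by gcongr; exact hC x)
      _ = _ := by ring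
  refine this.trans (by gcongr; simp)

lemma IsRegularPath.aemeasurable {D : Set E3}
    {e : HilbertBasis ℕ ℝ (VelH D)} {lam : ℕ → ℝ} {α : ℝ} {u : ℝ≥0 → VelH D}
    (hu : IsRegularPath e lam α u) (T : ℝ) :
    AEMeasurable (fun s : ℝ => (u s.toNNReal : L2Vec D)) (volume.restrict (Icc 0 T)) :=
  measurable_subtype_coe.comp_aemeasurable (hu.bounded T).1.aemeasurable

lemma IsRegularPath.intervalIntegrable_comp {D : Set E3}
    {e : HilbertBasis ℕ ℝ (VelH D)} {lam : ℕ → ℝ} {α : ℝ} {u : ℝ≥0 → VelH D}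
    (hlam : ∀ k, 0 < lam k)
    (hu : IsRegularPath e lam α u) {φ : L2Vec D → ℝ} (hφ : Measurable φ) {C : ℝ}
    (hC : ∀ w, |φ w| ≤ C * (1 + ‖w‖ ^ 2)) {T : ℝ} (hT : 0 < T) :
    IntervalIntegrable (fun s : ℝ => φ (u s.toNNReal)) volume 0 T := by
  obtain ⟨M, hM⟩ := hu.exists_bound hlam hT
  have hC0 : 0 ≤ C := by
    have := (abs_nonneg _).trans (hC 0)
    simpa using this
  rw [intervalIntegrable_iff_integrableOn_Icc_of_le hT.le]
  refine Integrable.of_bound (C := C * (1 + M ^ 2))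
    (hφ.comp_aemeasurable (hu.aemeasurable T)).aestronglyMeasurable ?_
  filter_upwards [ae_restrict_mem measurableSet_Icc] with s hs
  refine (hC _).trans ?_
  have h1 := hM s hs
  have h2 : ‖(u s.toNNReal : L2Vec D)‖ ≤ M := h1
  gcongr

section Path

variable {D : Set E3} [IsFiniteMeasure (volume.restrict D)]
  {e : HilbertBasis ℕ ℝ (VelH D)} {lam : ℕ → ℝ} {α ν : ℝ}
  {u Z : ℝ≥0 → VelH D} {p : ℝ≥0 → L32 D}

lemma measurable_setIntegral_inner (hD : MeasurableSet D) {v' : E3 → E3} (hv : Continuous v') :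
    Measurable fun w : L2Vec D => ∫ x in D, ⟪w x, v' x⟫ :=
  measurable_setIntegral_fld hD (f := fun x b => ⟪b, v' x⟫)
    (show Continuous fun q : E3 × E3 => ⟪q.2, v' q.1⟫ by fun_prop).measurable

lemma measurable_convective (hD : MeasurableSet D) {v : E3 → E3} (hv : SmoothIn D v) :
    Measurable fun w : L2Vec D => ∫ x in D, ⟪w x, fderiv ℝ v x (w x)⟫ :=
  measurable_setIntegral_fld hD (f := fun x b => ⟪b, fderiv ℝ v x b⟫) (by
    have := hv.fderiv.continuous
    exact (show Continuous fun q : E3 × E3 => ⟪q.2, fderiv ℝ v q.1 q.2⟫ by fun_prop).measurable)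

lemma intervalIntegrable_pressure (hD : MeasurableSet D)
    (hp : ∀ T : ℝ, IntegrableOn (fun s : ℝ => p s.toNNReal) (Icc 0 T)) {v : E3 → E3}
    (hv : SmoothIn D v) {T : ℝ} (hT : 0 < T) :
    IntervalIntegrable (fun s : ℝ => ∫ x in D, p s.toNNReal x * divField v x) volume 0 T := by
  obtain ⟨C3, hC3, h3⟩ := exists_integral_norm_le (F := ℝ) D (3 / 2) fact_one_le_three_halves.out
  have hs : SmoothIn D (divField v) := SmoothIn.sum _ fun i _ =>
    (hv.fderiv_apply (basisVec i)).clm_comp (proj (𝕜 := ℝ) i : E3 →L[ℝ] ℝ)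
  obtain ⟨C, hC0, hC⟩ := hs.exists_bound
  have hm : Measurable fun q : L32 D => ∫ x in D, q x * divField v x :=
    measurable_setIntegral_fld_L32 hD (f := fun x b => b * divField v x) (by
      have := continuous_divField hv
      exact (show Continuous fun q : E3 × ℝ => q.2 * divField v q.1 by fun_prop).measurable)
  rw [intervalIntegrable_iff_integrableOn_Icc_of_le hT.le]
  refine ((hp T).norm.const_mul (C3 * C)).mono'
    (hm.comp_aemeasurable (hp T).1.aemeasurable).aestronglyMeasurable (ae_of_all _ fun s => ?_)
  refine (norm_integral_le_of_norm_le ((Lp.integrable_restrict (p s.toNNReal)).norm.mul_const C)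
    (ae_of_all _ fun x => ?_)).trans ?_
  · rw [norm_mul]; gcongr; exact hC x
  · rw [integral_mul_const]
    nlinarith [h3 (p s.toNNReal), mul_le_mul_of_nonneg_right (h3 (p s.toNNReal)) hC0]

/-- The momentum equation along a path, in terms of `forcing`. -/
lemma momentum_increment (hD : MeasurableSet D) (hlam : ∀ k, 0 < lam k)
    (hu : IsRegularPath e lam α u) (hZ : IsRegularPath e lam α Z)
    (hp : ∀ T : ℝ, IntegrableOn (fun s : ℝ => p s.toNNReal) (Icc 0 T))
    (hmom : ∀ (t : ℝ≥0) (v : E3 → E3), IsTestField D v →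
      (∫ x in D, ⟪(u t : L2Vec D) x, v x⟫) + momentumTerms ν u Z v t
        - (∫ s in (0 : ℝ)..t, ∫ x in D, p s.toNNReal x * divField v x)
      = ∫ x in D, ⟪(u 0 : L2Vec D) x, v x⟫) {v : E3 → E3} (hv : SmoothIn D v) :
    (∀ T : ℝ, 0 < T → IntervalIntegrable
      (fun s : ℝ => forcing ν (u s.toNNReal) (Z s.toNNReal) (p s.toNNReal) v) volume 0 T) ∧
    ∀ r t : ℝ, 0 ≤ r → r ≤ t →
      (∫ x in D, ⟪(u t.toNNReal : L2Vec D) x, v x⟫) - (∫ x in D, ⟪(u r.toNNReal : L2Vec D) x, v x⟫)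
        = ∫ s in r..t, forcing ν (u s.toNNReal) (Z s.toNNReal) (p s.toNNReal) v := by
  obtain ⟨C, hC⟩ := exists_abs_convective_le hv
  have i1 : ∀ T : ℝ, 0 < T → IntervalIntegrable (fun s : ℝ => ∫ x in D,
      ⟪(u s.toNNReal : L2Vec D) x, fderiv ℝ v x ((u s.toNNReal : L2Vec D) x)⟫) volume 0 T :=
    fun T hT => hu.intervalIntegrable_comp hlam (measurable_convective hD hv) hC hT
  have i2 : ∀ T : ℝ, 0 < T → IntervalIntegrable (fun s : ℝ => ∫ x in D,
      ⟪(u s.toNNReal : L2Vec D) x, lapField v x⟫) volume 0 T := fun T hT =>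
    hu.intervalIntegrable_comp hlam (measurable_setIntegral_inner hD hv.lapField.continuous)
      (abs_setIntegral_inner_le (hv.lapField.memLp 2 _)) hT
  have i3 : ∀ T : ℝ, 0 < T → IntervalIntegrable (fun s : ℝ => ∫ x in D,
      ⟪(Z s.toNNReal : L2Vec D) x, v x⟫) volume 0 T := fun T hT =>
    hZ.intervalIntegrable_comp hlam (measurable_setIntegral_inner hD hv.continuous)
      (abs_setIntegral_inner_le (hv.memLp 2 _)) hT
  have i4 : ∀ T : ℝ, 0 < T → IntervalIntegrable (fun s : ℝ => ∫ x in D,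
      p s.toNNReal x * divField v x) volume 0 T := fun T hT => intervalIntegrable_pressure hD hp hv hT
  have itot : ∀ T : ℝ, 0 < T → IntervalIntegrable
      (fun s : ℝ => forcing ν (u s.toNNReal) (Z s.toNNReal) (p s.toNNReal) v) volume 0 T :=
    fun T hT => (((i1 T hT).add ((i2 T hT).const_mul ν)).add (i3 T hT)).add (i4 T hT)
  refine ⟨itot, ?_⟩
  have base : ∀ t : ℝ, 0 ≤ t → (∫ x in D, ⟪(u t.toNNReal : L2Vec D) x, v x⟫)
      - (∫ x in D, ⟪(u 0 : L2Vec D) x, v x⟫)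
        = ∫ s in (0 : ℝ)..t, forcing ν (u s.toNNReal) (Z s.toNNReal) (p s.toNNReal) v := by
    intro t ht
    rcases ht.eq_or_lt with rfl | ht
    · simp
    have h := hmom t.toNNReal v hv.isTestField
    have hpos : ∀ᵐ s : ℝ, s ∈ uIoc 0 t → InV (u s.toNNReal) := by
      filter_upwards [hu.inV] with s hs hst
      rw [uIoc_of_le ht.le] at hst
      exact hs hst.1.le
    have c1 : (∫ s in (0 : ℝ)..t, ∫ x in D,
        ⟪convect ((u s.toNNReal : L2Vec D) x) ((toV (u s.toNNReal)).grad x), v x⟫) =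
        ∫ s in (0 : ℝ)..t, -∫ x in D,
          ⟪(u s.toNNReal : L2Vec D) x, fderiv ℝ v x ((u s.toNNReal : L2Vec D) x)⟫ := by
      refine intervalIntegral.integral_congr_ae ?_
      filter_upwards [hpos] with s hs hst
      rw [setIntegral_convect hv (u s.toNNReal).2, toV_field (hs hst)]
    have c2 : (∫ s in (0 : ℝ)..t, ∫ x in D, ⟪(toV (u s.toNNReal)).grad x, gradField v x⟫) =
        ∫ s in (0 : ℝ)..t, -∫ x in D, ⟪(u s.toNNReal : L2Vec D) x, lapField v x⟫ := by
      refine intervalIntegral.integral_congr_ae ?_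
      filter_upwards [hpos] with s hs hst
      rw [setIntegral_inner_grad hv, toV_field (hs hst)]
    unfold momentumTerms at h
    rw [coe_toNNReal _ ht.le, c1, c2, intervalIntegral.integral_neg,
      intervalIntegral.integral_neg] at h
    simp only [forcing]
    rw [intervalIntegral.integral_add (((i1 t ht).add ((i2 t ht).const_mul ν)).add (i3 t ht)) (i4 t ht),
      intervalIntegral.integral_add ((i1 t ht).add ((i2 t ht).const_mul ν)) (i3 t ht),
      intervalIntegral.integral_add (i1 t ht) ((i2 t ht).const_mul ν),
      intervalIntegral.integral_const_mul]
    linarith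
  intro r t hr hrt
  rcases hrt.eq_or_lt with rfl | hlt
  · simp
  have ht : 0 < t := hr.trans_lt hlt
  have hI : IntervalIntegrable
      (fun s : ℝ => forcing ν (u s.toNNReal) (Z s.toNNReal) (p s.toNNReal) v) volume 0 r :=
    (itot t ht).mono_set (by rw [uIcc_of_le hr, uIcc_of_le ht.le]; exact Icc_subset_Icc_right hrt)
  rw [← intervalIntegral.integral_interval_sub_left (itot t ht) hI, ← base t ht.le, ← base r hr]
  ring

end Path

/-! ### Bounds for the regularised fields -/

/-- A common bound for a function and its first and second partial derivatives. -/
structure C2Bound {F : Type*} [NormedAddCommGroup F] [NormedSpace ℝ F] (g : E3 → F) (M : ℝ) :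
    Prop where
  value : ∀ x, ‖g x‖ ≤ M
  deriv : ∀ i x, ‖dirDeriv (basisVec i) g x‖ ≤ M
  deriv2 : ∀ i x, ‖dirDeriv (basisVec i) (dirDeriv (basisVec i) g) x‖ ≤ M

lemma C2Bound.nonneg {F : Type*} [NormedAddCommGroup F] [NormedSpace ℝ F] {g : E3 → F} {M : ℝ}
    (h : C2Bound g M) : 0 ≤ M := (norm_nonneg _).trans (h.value 0)

lemma SmoothIn.exists_C2Bound {F : Type*} [NormedAddCommGroup F] [NormedSpace ℝ F] {D : Set E3}
    {g : E3 → F} (h : SmoothIn D g) : ∃ M, C2Bound g M := by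
  obtain ⟨A, hA0, hA⟩ := h.exists_bound
  choose B hB0 hB using fun i : Fin 3 => (h.dirDeriv (basisVec i)).exists_bound
  choose C hC0 hC using fun i : Fin 3 => ((h.dirDeriv (basisVec i)).dirDeriv (basisVec i)).exists_bound
  have hs1 : ∀ i, B i ≤ ∑ j, B j := fun i => single_le_sum (fun j _ => hB0 j) (Finset.mem_univ i)
  have hs2 : ∀ i, C i ≤ ∑ j, C j := fun i => single_le_sum (fun j _ => hC0 j) (Finset.mem_univ i)
  have p1 : 0 ≤ ∑ j, B j := sum_nonneg fun j _ => hB0 j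
  have p2 : 0 ≤ ∑ j, C j := sum_nonneg fun j _ => hC0 j
  exact ⟨A + ∑ j, B j + ∑ j, C j, fun x => by linarith [hA x], fun i x => by
    linarith [hB i x, hs1 i], fun i x => by linarith [hC i x, hs2 i]⟩

section Bounds

variable {D S : Set E3} {ψ : E3 → ℝ} {Φ : E3 → E3 →L[ℝ] E3} {w : E3 → E3} {B M : ℝ}

lemma norm_vloc_le {b m : ℝ} (hb : ∀ x, ‖ψ x‖ ≤ b) (hm : ∀ h, ‖Φ h‖ ≤ m) (hb0 : 0 ≤ b)
    (hw : Integrable w) (x : E3) : ‖vloc ψ Φ w x‖ ≤ b * m * ∫ y, ‖w y‖ := by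
  rw [vloc, norm_smul, mul_assoc]
  exact mul_le_mul (hb x) (norm_conv_le hm hw x) (norm_nonneg _) hb0

lemma norm_vstar_le {m : ℝ} (hψ : SmoothIn D ψ) (hb : ∀ x, ‖ψ x‖ ≤ B) (hm : ∀ h, ‖Φ h‖ ≤ m)
    (hm0 : 0 ≤ m) (hw : Integrable w) (x : E3) : ‖vstar ψ Φ w x‖ ≤ B * m * ∫ y, ‖w y‖ := by
  refine (norm_conv_le hm (hψ.integrable_smul hw) x).trans ?_
  have : ∫ y, ‖ψ y • w y‖ ≤ B * ∫ y, ‖w y‖ := by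
    rw [← integral_const_mul]
    refine integral_mono (hψ.integrable_smul hw).norm (hw.norm.const_mul B) fun y => ?_
    simp only [norm_smul]
    gcongr; exact hb y
  calc m * ∫ y, ‖ψ y • w y‖ ≤ m * (B * ∫ y, ‖w y‖) := by gcongr
    _ = _ := by ring

lemma fieldBound_vloc (hψ : SmoothIn D ψ) (hΦ : SmoothIn S Φ) (hB : C2Bound ψ B)
    (hM : C2Bound Φ M) (hw : Integrable w) :
    FieldBound (vloc ψ Φ w) (12 * (B * M * ∫ y, ‖w y‖)) := by
  have hB0 := hB.nonneg
  have hM0 := hM.nonneg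
  have hI : 0 ≤ ∫ y, ‖w y‖ := integral_nonneg fun _ => norm_nonneg _
  have hX : 0 ≤ B * M * ∫ y, ‖w y‖ := by positivity
  refine ⟨fun x => ?_, fun x i => ?_, fun x => ?_⟩
  · linarith [norm_vloc_le hB.value hM.value hB0 hw x]
  · rw [fderiv_vloc hψ hΦ hw]
    refine (norm_add_le _ _).trans ?_
    linarith [norm_vloc_le (hB.deriv i) hM.value hB0 hw x, norm_vloc_le hB.value (hM.deriv i) hB0 hw x]
  · rw [lapField_vloc hψ hΦ hw]
    refine (norm_sum_le _ _).trans ?_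
    have : ∀ i ∈ (Finset.univ : Finset (Fin 3)),
        ‖vloc (dirDeriv (basisVec i) (dirDeriv (basisVec i) ψ)) Φ w x
      + 2 • vloc (dirDeriv (basisVec i) ψ) (dirDeriv (basisVec i) Φ) w x
      + vloc ψ (dirDeriv (basisVec i) (dirDeriv (basisVec i) Φ)) w x‖
        ≤ 4 * (B * M * ∫ y, ‖w y‖) := fun i _ => by
      refine (norm_add_le _ _).trans ((add_le_add_left (norm_add_le _ _) _).trans ?_)
      rw [two_nsmul]
      have := norm_add_le (vloc (dirDeriv (basisVec i) ψ) (dirDeriv (basisVec i) Φ) w x)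
        (vloc (dirDeriv (basisVec i) ψ) (dirDeriv (basisVec i) Φ) w x)
      linarith [norm_vloc_le (hB.deriv2 i) hM.value hB0 hw x,
        norm_vloc_le (hB.deriv i) (hM.deriv i) hB0 hw x,
        norm_vloc_le hB.value (hM.deriv2 i) hB0 hw x]
    refine (sum_le_sum this).trans ?_
    simp only [sum_const, card_univ, Fintype.card_fin, nsmul_eq_mul]
    push_cast
    linarith

lemma fieldBound_vstar (hψ : SmoothIn D ψ) (hΦ : SmoothIn S Φ) (hB : C2Bound ψ B)
    (hM : C2Bound Φ M) (hw : Integrable w) :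
    FieldBound (vstar ψ Φ w) (12 * (B * M * ∫ y, ‖w y‖)) := by
  have hB0 := hB.nonneg
  have hM0 := hM.nonneg
  have hI : 0 ≤ ∫ y, ‖w y‖ := integral_nonneg fun _ => norm_nonneg _
  have hX : 0 ≤ B * M * ∫ y, ‖w y‖ := by positivity
  refine ⟨fun x => ?_, fun x i => ?_, fun x => ?_⟩
  · linarith [norm_vstar_le hψ hB.value hM.value hM0 hw x]
  · rw [fderiv_vstar hψ hΦ hw]
    linarith [norm_vstar_le hψ hB.value (hM.deriv i) hM0 hw x]
  · rw [lapField_vstar hψ hΦ hw]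
    refine (norm_sum_le _ _).trans ?_
    refine (sum_le_sum fun i _ => norm_vstar_le hψ hB.value (hM.deriv2 i) hM0 hw x).trans ?_
    simp only [sum_const, card_univ, Fintype.card_fin, nsmul_eq_mul]
    push_cast
    linarith

end Bounds

/-! ### The stationary two-point balance -/

instance instCompleteSpaceVelH (D : Set E3) : CompleteSpace (VelH D) :=
  (Submodule.isClosed_topologicalClosure _).completeSpace_coe

lemma integrable_prod_of_le {F : Type*} [NormedAddCommGroup F] {f : E3 × E3 → F} {a b : E3 → ℝ}
    {C : ℝ} (hf : AEStronglyMeasurable f (volume.prod volume)) (ha : Integrable a)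
    (hb : Integrable b) (h : ∀ x y, ‖f (x, y)‖ ≤ C * (a x * b y)) :
    Integrable f (volume.prod volume) :=
  ((ha.mul_prod hb).const_mul C).mono' hf (ae_of_all _ fun q => h q.1 q.2)

section Balance

variable {D : Set E3} [IsFiniteMeasure (volume.restrict D)]
  {ψ : E3 → ℝ} {Φ : E3 → E3 →L[ℝ] E3} {G : E3 → ℝ} {ρ ν : ℝ}

lemma setIntegral_inner_eq (hD : MeasurableSet D) (w : L2Vec D) (v : E3 → E3) :
    ∫ x in D, ⟪w x, v x⟫ = ∫ x, ⟪fld w x, v x⟫ := by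
  rw [← SmoothIn.setIntegral_eq (D := D) fun x hx => by rw [fld_of_notMem _ hx, inner_zero_left]]
  refine integral_congr_ae ?_
  filter_upwards [fld_ae_eq_restrict hD w] with x hx using by rw [hx]

lemma integrable_pair (hD : MeasurableSet D) (hψ : SmoothIn D ψ)
    (hK : IsKernel ρ Φ G) (w w' : L2Vec D) :
    Integrable (fun q : E3 × E3 => ψ q.1 * ⟪fld w q.1, Φ (q.1 - q.2) (fld w' q.2)⟫)
      (volume.prod volume) := by
  obtain ⟨C, hC0, hC⟩ := hK.smooth.exists_bound
  obtain ⟨B, hB0, hB⟩ := hψ.exists_bound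
  refine integrable_prod_of_le (a := fun x => ‖fld w x‖) (b := fun x => ‖fld w' x‖) (C := B * C) ?_
    (integrable_fld hD w).norm (integrable_fld hD w').norm fun x y => ?_
  · have h1 : Measurable fun q : E3 × E3 => fld w q.1 := (measurable_fld_right hD w).comp measurable_fst
    have h2 : Measurable fun q : E3 × E3 => fld w' q.2 := (measurable_fld_right hD w').comp measurable_snd
    have h3 : Continuous fun r : (E3 × E3) × E3 × E3 =>
        ψ r.1.1 * ⟪r.2.1, Φ (r.1.1 - r.1.2) r.2.2⟫ := by
      have := hψ.continuous
      have := hK.smooth.continuous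
      fun_prop
    exact (h3.measurable.comp (measurable_id.prodMk (h1.prodMk h2))).aestronglyMeasurable
  · rw [norm_mul]
    calc ‖ψ x‖ * ‖⟪fld w x, Φ (x - y) (fld w' y)⟫‖ ≤ B * (‖fld w x‖ * (C * ‖fld w' y‖)) := by
          gcongr
          · exact hB x
          · refine (norm_inner_le_norm _ _).trans ?_
            gcongr
            exact (le_opNorm _ _).trans (by gcongr; exact hC _)
      _ = _ := by ring

lemma setIntegral_inner_vloc (hD : MeasurableSet D) (hψ : SmoothIn D ψ)
    (hK : IsKernel ρ Φ G) (w w' : L2Vec D) :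
    ∫ x in D, ⟪w x, vloc ψ Φ (fld w') x⟫ = ∫ x in D, ⟪w' x, vstar ψ Φ (fld w) x⟫ := by
  rw [setIntegral_inner_eq hD, setIntegral_inner_eq hD]
  have h1 : ∀ x, ⟪fld w x, vloc ψ Φ (fld w') x⟫ =
      ∫ y, ψ x * ⟪fld w x, Φ (x - y) (fld w' y)⟫ := fun x => by
    rw [vloc, inner_smul_right, integral_const_mul, conv,
      integral_inner (integrable_clm_apply hK.smooth (integrable_fld hD w') x)]
  have h2 : ∀ y, ⟪fld w' y, vstar ψ Φ (fld w) y⟫ =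
      ∫ x, ψ x * ⟪fld w x, Φ (x - y) (fld w' y)⟫ := fun y => by
    rw [vstar, conv, ← integral_inner (integrable_clm_apply hK.smooth
      (hψ.integrable_smul (integrable_fld hD w)) y)]
    refine integral_congr_ae (ae_of_all _ fun x => ?_)
    simp only [map_smul, inner_smul_right]
    rw [← hK.even, neg_sub, ← hK.symm, real_inner_comm]
  simp only [h1, h2]
  exact integral_integral_swap (integrable_pair hD hψ hK w w')

lemma fld_add_ae (hD : MeasurableSet D) (w w' : L2Vec D) :
    fld (w + w') =ᵐ[volume] fun x => fld w x + fld w' x := by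
  filter_upwards [fld_ae_eq hD w, fld_ae_eq hD w', fld_ae_eq hD (w + w'),
    (ae_restrict_iff' hD).1 (Lp.coeFn_add w w')] with x h1 h2 h3 h4
  rw [h1, h2, h3]
  by_cases hx : x ∈ D
  · simp only [indicator_of_mem hx, h4 hx, Pi.add_apply]
  · simp [hx]

lemma fld_smul_ae (hD : MeasurableSet D) (c : ℝ) (w : L2Vec D) :
    fld (c • w) =ᵐ[volume] fun x => c • fld w x := by
  filter_upwards [fld_ae_eq hD w, fld_ae_eq hD (c • w),
    (ae_restrict_iff' hD).1 (Lp.coeFn_smul c w)] with x h1 h2 h3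
  rw [h1, h2]
  by_cases hx : x ∈ D
  · simp [hx, h3 hx]
  · simp [hx]

lemma vloc_fld_add (hD : MeasurableSet D) (hΦ : SmoothIn (closedBall 0 ρ) Φ)
    (w w' : L2Vec D) : vloc ψ Φ (fld (w + w')) =
      fun x => vloc ψ Φ (fld w) x + vloc ψ Φ (fld w') x := by
  ext1 x
  rw [vloc, conv_congr_ae (fld_add_ae hD w w'), conv_add hΦ (integrable_fld hD w)
    (integrable_fld hD w'), smul_add, vloc, vloc]

lemma vloc_fld_smul (hD : MeasurableSet D) (c : ℝ)
    (w : L2Vec D) : vloc ψ Φ (fld (c • w)) = fun x => c • vloc ψ Φ (fld w) x := by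
  ext1 x
  rw [vloc, conv_congr_ae (fld_smul_ae hD c w), conv_smul, smul_comm, vloc]

lemma vstar_fld_add (hD : MeasurableSet D) (hψ : SmoothIn D ψ)
    (hΦ : SmoothIn (closedBall 0 ρ) Φ) (w w' : L2Vec D) : vstar ψ Φ (fld (w + w')) =
      fun x => vstar ψ Φ (fld w) x + vstar ψ Φ (fld w') x := by
  ext1 x
  have : (fun y => ψ y • fld (w + w') y) =ᵐ[volume] fun y => ψ y • fld w y + ψ y • fld w' y := by
    filter_upwards [fld_add_ae hD w w'] with y hy
    rw [hy, smul_add]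
  rw [vstar, conv_congr_ae this, conv_add hΦ (hψ.integrable_smul (integrable_fld hD w))
    (hψ.integrable_smul (integrable_fld hD w')), vstar, vstar]

lemma vstar_fld_smul (hD : MeasurableSet D) (c : ℝ)
    (w : L2Vec D) : vstar ψ Φ (fld (c • w)) = fun x => c • vstar ψ Φ (fld w) x := by
  ext1 x
  have : (fun y => ψ y • fld (c • w) y) =ᵐ[volume] fun y => c • (ψ y • fld w y) := by
    filter_upwards [fld_smul_ae hD c w] with y hy
    rw [hy, smul_comm]
  rw [vstar, conv_congr_ae this, conv_smul, vstar]

/-- The right-hand side tested with the two regularisations of the velocity. -/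
def balance (ν : ℝ) (ψ : E3 → ℝ) (Φ : E3 → E3 →L[ℝ] E3) (w z : L2Vec D) (q : L32 D) : ℝ :=
  forcing ν w z q (vloc ψ Φ (fld w)) + forcing ν w z q (vstar ψ Φ (fld w))

lemma exists_fieldBound (hD : MeasurableSet D) (hψ : SmoothIn D ψ)
    (hΦ : SmoothIn (closedBall 0 ρ) Φ) :
    ∃ A : ℝ, 0 ≤ A ∧ ∀ w : L2Vec D, FieldBound (vloc ψ Φ (fld w)) (A * ‖w‖) ∧
      FieldBound (vstar ψ Φ (fld w)) (A * ‖w‖) := by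
  obtain ⟨B, hB⟩ := hψ.exists_C2Bound
  obtain ⟨M, hM⟩ := hΦ.exists_C2Bound
  obtain ⟨C, hC0, hC⟩ := exists_integral_norm_le (F := E3) D 2 (by norm_num)
  have hB0 := hB.nonneg
  have hM0 := hM.nonneg
  refine ⟨12 * (B * M * C), by positivity, fun w => ?_⟩
  have hI : ∫ y, ‖fld w y‖ ≤ C * ‖w‖ := by
    refine le_of_eq_of_le ?_ (hC w)
    rw [← SmoothIn.setIntegral_eq (D := D) fun x hx => by rw [fld_of_notMem _ hx, norm_zero]]
    refine integral_congr_ae ?_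
    filter_upwards [fld_ae_eq_restrict hD w] with x hx using by rw [hx]
  have hle : 12 * (B * M * ∫ y, ‖fld w y‖) ≤ 12 * (B * M * C) * ‖w‖ := by
    calc _ ≤ 12 * (B * M * (C * ‖w‖)) := by gcongr
      _ = _ := by ring
  have mono : ∀ {v : E3 → E3}, FieldBound v (12 * (B * M * ∫ y, ‖fld w y‖)) →
      FieldBound v (12 * (B * M * C) * ‖w‖) := fun h =>
    ⟨fun x => (h.value x).trans hle, fun x i => (h.deriv x i).trans hle, fun x => (h.lap x).trans hle⟩
  exact ⟨mono (fieldBound_vloc hψ hΦ hB hM (integrable_fld hD w)),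
    mono (fieldBound_vstar hψ hΦ hB hM (integrable_fld hD w))⟩

lemma exists_forcing_clm {V : L2Vec D → E3 → E3} {A K : ℝ}
    (hadd : ∀ w w', V (w + w') = fun x => V w x + V w' x)
    (hsmul : ∀ (c : ℝ) w, V (c • w) = fun x => c • V w x) (hV : ∀ w, SmoothIn D (V w))
    (hA : ∀ w, FieldBound (V w) (A * ‖w‖))
    (hK : ∀ (w z : L2Vec D) (q : L32 D) (v : E3 → E3) (A : ℝ), SmoothIn D v → FieldBound v A →
      |forcing ν w z q v| ≤ K * (1 + ‖w‖ ^ 2 + ‖z‖ + ‖q‖) * A) (w z : L2Vec D) (q : L32 D) :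
    ∃ J : VelH D →L[ℝ] ℝ, ∀ f : VelH D, J f = forcing ν w z q (V f) := by
  let J : VelH D →ₗ[ℝ] ℝ :=
    { toFun := fun f => forcing ν w z q (V f)
      map_add' := fun f g => by rw [Submodule.coe_add, hadd, forcing_add (hV _) (hV _)]
      map_smul' := fun c f => by rw [Submodule.coe_smul, hsmul, forcing_smul (hV _)]; rfl }
  refine ⟨J.mkContinuous (K * (1 + ‖w‖ ^ 2 + ‖z‖ + ‖q‖) * A) fun f => ?_, fun f => rfl⟩
  refine (hK w z q _ _ (hV f) (hA f)).trans_eq ?_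
  rw [Submodule.coe_norm]; ring

lemma balance_of_path {e : HilbertBasis ℕ ℝ (VelH D)} {lam : ℕ → ℝ} {α : ℝ}
    {u Z : ℝ≥0 → VelH D} {p : ℝ≥0 → L32 D}
    (hD : MeasurableSet D) (hlam : ∀ k, 0 < lam k)
    (hu : IsRegularPath e lam α u) (hZ : IsRegularPath e lam α Z)
    (hp : ∀ T : ℝ, IntegrableOn (fun s : ℝ => p s.toNNReal) (Icc 0 T))
    (hmom : ∀ (t : ℝ≥0) (v : E3 → E3), IsTestField D v →
      (∫ x in D, ⟪(u t : L2Vec D) x, v x⟫) + momentumTerms ν u Z v t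
        - (∫ s in (0 : ℝ)..t, ∫ x in D, p s.toNNReal x * divField v x)
      = ∫ x in D, ⟪(u 0 : L2Vec D) x, v x⟫)
    (hψ : SmoothIn D ψ) (hK : IsKernel ρ Φ G)
    (hρ : cthickening ρ (tsupport ψ) ⊆ D) :
    (∫ x in D, ⟪(u 1 : L2Vec D) x, vloc ψ Φ (fld (u 1 : L2Vec D)) x⟫)
      - (∫ x in D, ⟪(u 0 : L2Vec D) x, vloc ψ Φ (fld (u 0 : L2Vec D)) x⟫)
      = ∫ s in (0 : ℝ)..1, balance ν ψ Φ (u s.toNNReal : L2Vec D) (Z s.toNNReal) (p s.toNNReal) := by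
  obtain ⟨A, hA0, hA⟩ := exists_fieldBound hD hψ hK.smooth
  obtain ⟨K, hK0, hforce⟩ := exists_abs_forcing_le D ν
  have sm1 : ∀ w : L2Vec D, SmoothIn D (vloc ψ Φ (fld w)) := fun w =>
    smoothIn_vloc hψ hK.smooth (integrable_fld hD w)
  have sm2 : ∀ w : L2Vec D, SmoothIn D (vstar ψ Φ (fld w)) := fun w =>
    smoothIn_vstar hψ hK.smooth hρ (integrable_fld hD w)
  choose JA hJA using fun s : ℝ => exists_forcing_clm (ν := ν) (V := fun w => vloc ψ Φ (fld w))
    (vloc_fld_add hD hK.smooth) (vloc_fld_smul hD) sm1 (fun w => (hA w).1) hforce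
    (u s.toNNReal) (Z s.toNNReal) (p s.toNNReal)
  choose JB hJB using fun s : ℝ => exists_forcing_clm (ν := ν) (V := fun w => vstar ψ Φ (fld w))
    (vstar_fld_add hD hψ hK.smooth) (vstar_fld_smul hD) sm2 (fun w => (hA w).2) hforce
    (u s.toNNReal) (Z s.toNNReal) (p s.toNNReal)
  obtain ⟨M, hM⟩ := hu.exists_bound hlam one_pos
  have hc : IntervalIntegrable (fun s : ℝ => K * (1 + ‖(u s.toNNReal : L2Vec D)‖ ^ 2 +
      ‖(Z s.toNNReal : L2Vec D)‖ + ‖p s.toNNReal‖) * A) volume 0 1 := by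
    have i1 := hu.intervalIntegrable_comp hlam (φ := fun w => ‖w‖ ^ 2) (C := 1)
      (measurable_norm.pow_const 2) (fun w => by rw [abs_of_nonneg (by positivity)]; linarith) one_pos
    have i2 := hZ.intervalIntegrable_comp hlam (φ := fun w => ‖w‖) (C := 1)
      measurable_norm (fun w => by
        rw [abs_of_nonneg (by positivity)]; nlinarith [sq_nonneg (‖w‖ - 1)]) one_pos
    have i3 : IntervalIntegrable (fun s : ℝ => ‖p s.toNNReal‖) volume 0 1 := by
      rw [intervalIntegrable_iff_integrableOn_Icc_of_le zero_le_one]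
      exact (hp 1).norm
    exact ((((intervalIntegrable_const (c := (1 : ℝ))).add i1).add i2).add i3).const_mul K |>.mul_const A
  have key := product_rule (u := fun s : ℝ => u s.toNNReal) (M := M) hM
    (fun f t _ => hu.tendsto_inner hlam one_pos f t)
    (B := fun w w' => ∫ x in D, ⟪(w : L2Vec D) x, vloc ψ Φ (fld (w' : L2Vec D)) x⟫)
    (JA := JA) (JB := JB) hc (fun s => by positivity)
    (fun s f => by
      rw [hJA, mul_assoc]
      exact hforce _ _ _ _ _ (sm1 f) (hA f).1)
    (fun s f => by
      rw [hJB, mul_assoc]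
      exact hforce _ _ _ _ _ (sm2 f) (hA f).2)
    (fun f => by
      simp only [hJA]
      exact ((momentum_increment hD hlam hu hZ hp hmom (sm1 f)).1 1 one_pos).1.1)
    (fun f => by
      simp only [hJB]
      exact ((momentum_increment hD hlam hu hZ hp hmom (sm2 f)).1 1 one_pos).1.1)
    (fun r t hr hrt _ f => by
      simp only [hJA]
      exact (momentum_increment hD hlam hu hZ hp hmom (sm1 f)).2 r t hr hrt)
    (fun r t hr hrt _ f => by
      simp only [hJB, setIntegral_inner_vloc hD hψ hK (f : L2Vec D)]
      exact (momentum_increment hD hlam hu hZ hp hmom (sm2 f)).2 r t hr hrt)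
  simp only [Real.toNNReal_one, Real.toNNReal_zero, hJA, hJB] at key
  exact key

lemma measurable_balance (hD : MeasurableSet D) (hψ : SmoothIn D ψ)
    (hΦ : SmoothIn (closedBall 0 ρ) Φ) (ν : ℝ) :
    Measurable fun X : (L2Vec D × L2Vec D) × L32 D => balance ν ψ Φ X.1.1 X.1.2 X.2 :=
  (measurable_forcing_self hD (V := fun w => vloc ψ Φ (fld w)) ν
    (measurable_vloc_fld hD hΦ.continuous hψ.continuous) (measurable_fderiv_vloc_fld hD hΦ hψ)
    (measurable_lapField_vloc_fld hD hΦ hψ) (measurable_divField_vloc_fld hD hΦ hψ)).add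
  (measurable_forcing_self hD (V := fun w => vstar ψ Φ (fld w)) ν
    (measurable_vstar_fld hD hΦ.continuous hψ.continuous) (measurable_fderiv_vstar_fld hD hΦ hψ)
    (measurable_lapField_vstar_fld hD hΦ hψ) (measurable_divField_vstar_fld hD hΦ hψ))

lemma exists_abs_balance_le (hD : MeasurableSet D) (hψ : SmoothIn D ψ)
    (hΦ : SmoothIn (closedBall 0 ρ) Φ) (hρ : cthickening ρ (tsupport ψ) ⊆ D) (ν : ℝ) :
    ∃ K : ℝ, 0 ≤ K ∧ ∀ (w z : L2Vec D) (q : L32 D),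
      |balance ν ψ Φ w z q| ≤ K * ((1 + ‖w‖ ^ 2 + ‖z‖ + ‖q‖) * ‖w‖) := by
  obtain ⟨A, hA0, hA⟩ := exists_fieldBound hD hψ hΦ
  obtain ⟨K, hK0, hforce⟩ := exists_abs_forcing_le D ν
  refine ⟨2 * K * A, by positivity, fun w z q => ?_⟩
  have h1 := hforce w z q _ _ (smoothIn_vloc hψ hΦ (integrable_fld hD w)) (hA w).1
  have h2 := hforce w z q _ _ (smoothIn_vstar hψ hΦ hρ (integrable_fld hD w)) (hA w).2
  refine (abs_add_le _ _).trans ((add_le_add h1 h2).trans_eq ?_)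
  ring

lemma integral_eq_zero_of_increment {Ω S : Type*} {mΩ : MeasurableSpace Ω} [MeasurableSpace S]
    {P : Measure Ω} [IsProbabilityMeasure P] {X : ℝ≥0 → Ω → S}
    (hX : Measurable fun q : ℝ × Ω => X (min q.1.toNNReal 1) q.2)
    (hstat : ∀ t, IdentDistrib (X t) (X 0) P P) {b Γ : S → ℝ} (hb : Measurable b)
    (hΓ : Measurable Γ) (ib : Integrable (fun ω => b (X 0 ω)) P)
    (iΓ : Integrable (fun ω => Γ (X 0 ω)) P)
    (h : ∀ᵐ ω ∂P, b (X 1 ω) - b (X 0 ω) = ∫ s in (0 : ℝ)..1, Γ (X s.toNNReal ω)) :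
    ∫ ω, Γ (X 0 ω) ∂P = 0 := by
  have hm : Measurable fun q : ℝ × Ω => Γ (X (min q.1.toNNReal 1) q.2) := hΓ.comp hX
  have eΓ : ∀ t, ∫ ω, Γ (X t ω) ∂P = ∫ ω, Γ (X 0 ω) ∂P := fun t => ((hstat t).comp hΓ).integral_eq
  have eN : ∀ t, ∫ ω, ‖Γ (X t ω)‖ ∂P = ∫ ω, ‖Γ (X 0 ω)‖ ∂P := fun t =>
    ((hstat t).comp hΓ.norm).integral_eq
  have hint : Integrable (fun q : ℝ × Ω => Γ (X (min q.1.toNNReal 1) q.2))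
      ((volume.restrict (Ioc (0 : ℝ) 1)).prod P) := by
    refine (integrable_prod_iff hm.aestronglyMeasurable).2 ⟨ae_of_all _ fun s => ?_, ?_⟩
    · have h0 : Integrable (Γ ∘ X (min s.toNNReal 1)) P := ((hstat _).comp hΓ).integrable_iff.2 iΓ
      exact h0
    · simp only [eN]
      exact integrable_const _
  have h1 : ∫ ω, (b (X 1 ω) - b (X 0 ω)) ∂P = 0 := by
    have h0 : Integrable (fun ω => b (X 1 ω)) P := ((hstat 1).comp hb).integrable_iff.2 ib
    rw [integral_sub h0 ib]
    exact sub_eq_zero.2 ((hstat 1).comp hb).integral_eq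
  rw [integral_congr_ae h] at h1
  have h2 : ∀ ω, ∫ s in (0 : ℝ)..1, Γ (X s.toNNReal ω) =
      ∫ s in Ioc (0 : ℝ) 1, Γ (X (min s.toNNReal 1) ω) := fun ω => by
    rw [intervalIntegral.integral_of_le zero_le_one]
    refine setIntegral_congr_fun measurableSet_Ioc fun s hs => ?_
    have : s.toNNReal ≤ 1 := Real.toNNReal_le_one.2 hs.2
    simp only [min_eq_left this]
  simp only [h2] at h1
  rw [← integral_integral_swap hint] at h1
  simpa only [eΓ, integral_const, measureReal_restrict_apply_univ, Real.volume_real_Ioc, sub_zero, max_eq_left, zero_le_one, one_smul] using h1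

lemma measurable_progressive {Ω E : Type*} {mΩ : MeasurableSpace Ω} [TopologicalSpace E]
    [MeasurableSpace E] [BorelSpace E] [TopologicalSpace.PseudoMetrizableSpace E]
    {ℱ : Filtration ℝ≥0 mΩ} {u : ℝ≥0 → Ω → E}
    (hu : IsStronglyProgressive ℱ u) : Measurable fun q : ℝ × Ω => u (min q.1.toNNReal 1) q.2 := by
  have h1 : Measurable[Subtype.instMeasurableSpace.prod mΩ]
      fun q : Set.Iic (1 : ℝ≥0) × Ω => u q.1 q.2 :=
    (hu 1).measurable.mono (sup_le_sup le_rfl (MeasurableSpace.comap_mono (ℱ.le 1))) le_rfl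
  exact h1.comp (f := fun q : ℝ × Ω => ((⟨min q.1.toNNReal 1, Set.mem_Iic.2 (min_le_right _ _)⟩ :
    Set.Iic (1 : ℝ≥0)), q.2)) ((Measurable.subtype_mk (by fun_prop)).prodMk measurable_snd)

/-- The stationary two-point balance. -/
lemma integral_balance_eq_zero {e : HilbertBasis ℕ ℝ (VelH D)} {lam σ : ℕ → ℝ}
    {L : VelV D →L[ℝ] VelV D →L[ℝ] ℝ} {Ω : Type*} {mΩ : MeasurableSpace Ω} {P : Measure Ω}
    [IsProbabilityMeasure P] {ℱ : Filtration ℝ≥0 mΩ} {β : ℕ → ℝ≥0 → Ω → ℝ}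
    {u Z : ℝ≥0 → Ω → VelH D} {p : ℝ≥0 → Ω → L32 D}
    (hD : MeasurableSet D) (hlam : ∀ k, 0 < lam k)
    (hsol : IsMartingaleSolution e lam σ L ν P ℱ β u Z) (hp : IsStationaryPressure ν P u Z p)
    (hu3 : Integrable (fun ω => ‖u 0 ω‖ ^ 2) P)
    (hX : Integrable (fun ω => (1 + ‖u 0 ω‖ ^ 2 + ‖Z 0 ω‖ + ‖p 0 ω‖) * ‖u 0 ω‖) P)
    (hψ : SmoothIn D ψ) (hK : IsKernel ρ Φ G)
    (hρ : cthickening ρ (tsupport ψ) ⊆ D) :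
    ∫ ω, balance ν ψ Φ (u 0 ω : L2Vec D) (Z 0 ω) (p 0 ω) ∂P = 0 := by
  have mu := measurable_progressive hsol.progressive_u
  have mZ := measurable_progressive hsol.progressive_Z
  have hm : Measurable fun q : ℝ × Ω => (((u (min q.1.toNNReal 1) q.2 : L2Vec D),
      (Z (min q.1.toNNReal 1) q.2 : L2Vec D)), p (min q.1.toNNReal 1) q.2) :=
    ((measurable_subtype_coe.comp mu).prodMk (measurable_subtype_coe.comp mZ)).prodMk
      (hp.measurable.comp (f := fun q : ℝ × Ω => (min q.1.toNNReal 1, q.2)) (by fun_prop))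
  have hm0 : Measurable fun ω : Ω => (((u 0 ω : L2Vec D), (Z 0 ω : L2Vec D)), p 0 ω) := by
    simpa [comp_def] using hm.comp (measurable_prodMk_left (x := (0 : ℝ)))
  have hbm : Measurable fun w : L2Vec D => ∫ x in D, ⟪w x, vloc ψ Φ (fld w) x⟫ := by
    simp only [setIntegral_inner_eq hD]
    have : Measurable fun q : L2Vec D × E3 => ⟪fld q.1 q.2, vloc ψ Φ (fld q.1) q.2⟫ :=
      (measurable_fld_L2Vec hD).inner (measurable_vloc_fld hD hK.smooth.continuous hψ.continuous)
    exact (this.stronglyMeasurable.integral_prod_right' (ν := volume)).measurable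
  obtain ⟨A, hA0, hA⟩ := exists_fieldBound hD hψ hK.smooth
  obtain ⟨C, hC0, hC⟩ := exists_integral_norm_le (F := E3) D 2 (by norm_num)
  obtain ⟨K, hK0, hKb⟩ := exists_abs_balance_le hD hψ hK.smooth hρ ν
  refine integral_eq_zero_of_increment
    (X := fun t ω => (((u t ω : L2Vec D), (Z t ω : L2Vec D)), p t ω)) hm (fun t => ?_)
    (b := fun X => ∫ x in D, ⟪X.1.1 x, vloc ψ Φ (fld X.1.1) x⟫)
    (Γ := fun X => balance ν ψ Φ X.1.1 X.1.2 X.2)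
    (hbm.comp (measurable_fst.comp measurable_fst)) (measurable_balance hD hψ hK.smooth ν) ?_ ?_ ?_
  · have h := (hp.stationary t).comp (u := fun f : ℝ≥0 → VelH D × VelH D × L32 D =>
      ((((f 0).1 : L2Vec D), ((f 0).2.1 : L2Vec D)), (f 0).2.2)) (by
        have h0 : Measurable fun f : ℝ≥0 → VelH D × VelH D × L32 D => f 0 := measurable_pi_apply 0
        exact ((measurable_subtype_coe.comp h0.fst).prodMk
          (measurable_subtype_coe.comp h0.snd.fst)).prodMk h0.snd.snd)
    simpa [comp_def] using h
  · refine (hu3.const_mul (A * C)).mono'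
      (hbm.comp hm0.fst.fst).aestronglyMeasurable (ae_of_all _ fun ω => ?_)
    refine (norm_integral_le_of_norm_le ((Lp.integrable_restrict (u 0 ω : L2Vec D)).norm.mul_const
      (A * ‖u 0 ω‖)) (ae_of_all _ fun x => ?_)).trans ?_
    · refine (norm_inner_le_norm _ _).trans ?_
      gcongr
      exact (hA (u 0 ω)).1.value x
    · rw [integral_mul_const]
      calc _ ≤ C * ‖(u 0 ω : L2Vec D)‖ * (A * ‖u 0 ω‖) := by gcongr; exact hC _
        _ = A * C * ‖u 0 ω‖ ^ 2 := by rw [Submodule.coe_norm]; ring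
  · refine (hX.const_mul K).mono' ((measurable_balance hD hψ hK.smooth ν).comp hm0).aestronglyMeasurable
      (ae_of_all _ fun ω => hKb _ _ _)
  · obtain ⟨α, -, hreg⟩ := hsol.regular
    filter_upwards [hreg, hp.locallyIntegrable, hp.momentum] with ω h1 h2 h3
    have h := balance_of_path (ν := ν) (u := fun s => u s ω) (Z := fun s => Z s ω)
      (p := fun s => p s ω) hD hlam h1.1 h1.2 h2 h3 hψ hK hρ
    exact h

end Balance

/-! ### The two-point form of the balance -/

/-- The common size of a velocity and of the square roots of a forcing and of a pressure. -/
def size (u z : E3 → E3) (q : E3 → ℝ) (x : E3) : ℝ := ‖u x‖ + √‖z x‖ + √|q x|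

/-- Fields on `D` extended by zero, with the integrability of the velocity in `L³`, of the forcing
and of the pressure in `L^{3/2}`, and a weakly divergence-free velocity. -/
structure IsState (D : Set E3) (u z : E3 → E3) (q : E3 → ℝ) : Prop where
  measurable_u : Measurable u
  measurable_z : Measurable z
  measurable_q : Measurable q
  integrable : Integrable fun x => size u z q x ^ 3
  divFree : ∀ g : E3 → ℝ, SmoothIn D g → ∫ x, fderiv ℝ g x (u x) = 0

/-- A state together with a cutoff and a kernel whose range is at most the distance from the
support of the cutoff to the boundary. -/
structure IsLocalized (D : Set E3) (u z : E3 → E3) (q ψ : E3 → ℝ) (Φ : E3 → E3 →L[ℝ] E3)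
    (G : E3 → ℝ) (ρ : ℝ) : Prop where
  meas : MeasurableSet D
  state : IsState D u z q
  cut : SmoothIn D ψ
  ker : IsKernel ρ Φ G
  supp : cthickening ρ (tsupport ψ) ⊆ D

lemma mem_of_cthickening {D : Set E3} {ψ : E3 → ℝ} {ρ : ℝ}
    (hρ : cthickening ρ (tsupport ψ) ⊆ D) {x y : E3}
    (hx : x ∈ tsupport ψ) (hk : x - y ∈ closedBall (0 : E3) ρ) : y ∈ D := by
  refine hρ (Metric.mem_cthickening_of_dist_le y x ρ _ hx ?_)
  rw [dist_comm, dist_eq_norm]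
  simpa using hk

lemma norm_inner_le_of_le {a b : E3} {A B : ℝ} (ha : ‖a‖ ≤ A) (hb : ‖b‖ ≤ B) : ‖⟪a, b⟫‖ ≤ A * B :=
  (norm_inner_le_norm a b).trans
    (mul_le_mul ha hb (norm_nonneg _) ((norm_nonneg _).trans ha))

lemma size_bounds (u z : E3 → E3) (q : E3 → ℝ) (x : E3) : 0 ≤ size u z q x ∧
    ‖u x‖ ≤ size u z q x ∧ ‖z x‖ ≤ size u z q x ^ 2 ∧ ‖q x‖ ≤ size u z q x ^ 2 := by
  have a := norm_nonneg (u x)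
  have b := sqrt_nonneg ‖z x‖
  have c := sqrt_nonneg |q x|
  unfold size
  refine ⟨by positivity, by linarith, ?_, ?_⟩
  · nlinarith [sq_sqrt (norm_nonneg (z x))]
  · rw [norm_eq_abs]
    nlinarith [sq_sqrt (abs_nonneg (q x))]

/-- The bilinear form of a matrix kernel. -/
def bil (Φ : E3 → E3 →L[ℝ] E3) (k a b : E3) : ℝ := ⟪a, Φ k b⟫

/-- The cubic form of the derivative of a matrix kernel. -/
def tri (Φ : E3 → E3 →L[ℝ] E3) (k a b c : E3) : ℝ := ⟪a, fderiv ℝ Φ k c b⟫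

/-- A measurable function of two points, bounded by a power of the sizes at these points. -/
def SizeLE {F : Type*} [NormedAddCommGroup F] [MeasurableSpace F] (u z : E3 → E3) (q : E3 → ℝ)
    (n : ℕ) (a : E3 × E3 → F) : Prop :=
  Measurable a ∧ ∀ p, ‖a p‖ ≤ (size u z q p.1 + size u z q p.2) ^ n

section State

variable {D : Set E3} {u z : E3 → E3}
  {q ψ : E3 → ℝ} {Φ : E3 → E3 →L[ℝ] E3} {G : E3 → ℝ} {ρ : ℝ}

lemma sizeLE_of_le {F : Type*} [NormedAddCommGroup F] [MeasurableSpace F] {f : E3 → F} {n : ℕ}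
    (hf : Measurable f) (hn : ∀ x, ‖f x‖ ≤ size u z q x ^ n) :
    SizeLE u z q n (fun p => f p.1) ∧ SizeLE u z q n fun p => f p.2 := by
  have s := fun x => (size_bounds u z q x).1
  exact ⟨⟨hf.comp measurable_fst, fun p => (hn _).trans
      (pow_le_pow_left₀ (s _) (le_add_of_nonneg_right (s _)) n)⟩,
    hf.comp measurable_snd, fun p => (hn _).trans
      (pow_le_pow_left₀ (s _) (le_add_of_nonneg_left (s _)) n)⟩

lemma IsState.sizeLE_u (h : IsState D u z q) :
    SizeLE u z q 1 (fun p => u p.1) ∧ SizeLE u z q 1 fun p => u p.2 :=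
  sizeLE_of_le h.measurable_u fun x => by simpa using (size_bounds u z q x).2.1

lemma IsState.sizeLE_z (h : IsState D u z q) :
    SizeLE u z q 2 (fun p => z p.1) ∧ SizeLE u z q 2 fun p => z p.2 :=
  sizeLE_of_le h.measurable_z fun x => (size_bounds u z q x).2.2.1

lemma IsState.sizeLE_q (h : IsState D u z q) :
    SizeLE u z q 2 (fun p => q p.1) ∧ SizeLE u z q 2 fun p => q p.2 :=
  sizeLE_of_le h.measurable_q fun x => (size_bounds u z q x).2.2.2

variable [IsFiniteMeasure (volume.restrict D)]

lemma IsLocalized.integrable_form {F₁ F₂ W : Type*} [NormedAddCommGroup F₁] [NormedSpace ℝ F₁]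
    [NormedAddCommGroup F₂] [NormedSpace ℝ F₂] [TopologicalSpace W] [SecondCountableTopology W]
    [MeasurableSpace W] [BorelSpace W] (hL : IsLocalized D u z q ψ Φ G ρ) {f : E3 → F₁}
    (hf : SmoothIn D f) (hfψ : tsupport f ⊆ tsupport ψ) {g : E3 → F₂}
    (hg : SmoothIn (closedBall 0 ρ) g) {N : F₁ → F₂ → W → ℝ}
    (hN : Continuous fun r : F₁ × F₂ × W => N r.1 r.2.1 r.2.2) {X : E3 × E3 → W}
    (hX : Measurable X)
    (hb : ∀ a b p, ‖N a b (X p)‖ ≤ ‖a‖ * ‖b‖ * (size u z q p.1 + size u z q p.2) ^ 3) :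
    Integrable (fun p => N (f p.1) (g (p.1 - p.2)) (X p)) vol₂ := by
  obtain ⟨B, hB0, hB⟩ := hf.exists_bound
  obtain ⟨M, hM0, hM⟩ := hg.exists_bound
  have h1 : Integrable (D.indicator fun _ : E3 => (1 : ℝ)) :=
    (integrable_indicator_iff hL.meas).2 (integrable_const _)
  have hm := hL.state.integrable
  have hfc := hf.continuous
  have hgc := hg.continuous
  have h3 : Continuous fun r : (E3 × E3) × W => N (f r.1.1) (g (r.1.1 - r.1.2)) r.2 :=
    hN.comp (f := fun r : (E3 × E3) × W => (f r.1.1, g (r.1.1 - r.1.2), r.2)) (by fun_prop)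
  refine ((hm.mul_prod h1).add (h1.mul_prod hm)).const_mul (B * M * 4) |>.mono'
    (h3.measurable.comp (measurable_id.prodMk hX)).aestronglyMeasurable (ae_of_all _ fun p => ?_)
  obtain ⟨x, y⟩ := p
  have e := hb (f x) (g (x - y)) (x, y)
  have a0 := (size_bounds u z q x).1
  have b0 := (size_bounds u z q y).1
  simp only [Pi.add_apply]
  by_cases h0 : f x = 0 ∨ g (x - y) = 0
  · have e0 : ‖N (f x) (g (x - y)) (X (x, y))‖ ≤ 0 := by rcases h0 with h0 | h0 <;> simpa [h0] using e
    refine e0.trans ?_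
    have i : ∀ x, 0 ≤ D.indicator (fun _ : E3 => (1 : ℝ)) x := fun x =>
      indicator_nonneg (fun _ _ => zero_le_one) x
    have := i x
    have := i y
    positivity
  · rw [not_or] at h0
    have hx := hfψ (subset_tsupport f h0.1)
    rw [indicator_of_mem (hL.cut.support hx), indicator_of_mem (mem_of_cthickening hL.supp hx
      (by_contra fun h => h0.2 (hg.eq_zero_of_notMem h))), mul_one, one_mul]
    calc _ ≤ B * M * (size u z q x + size u z q y) ^ 3 :=
          e.trans (by gcongr; exacts [hB x, hM _])
      _ ≤ B * M * (4 * (size u z q x ^ 3 + size u z q y ^ 3)) := by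
          gcongr
          nlinarith [mul_nonneg (add_nonneg a0 b0) (sq_nonneg (size u z q x - size u z q y))]
      _ = _ := by ring

variable {a b c : E3 × E3 → E3} {r : E3 × E3 → ℝ}

lemma IsLocalized.psi_tri (hL : IsLocalized D u z q ψ Φ G ρ) (ha : SizeLE u z q 1 a)
    (hb : SizeLE u z q 1 b) (hc : SizeLE u z q 1 c) :
    Integrable (fun p => ψ p.1 * tri Φ (p.1 - p.2) (a p) (b p) (c p)) vol₂ :=
  (hL.integrable_form hL.cut subset_rfl hL.ker.smooth.fderiv
    (N := fun t (T : E3 →L[ℝ] E3 →L[ℝ] E3) (w : E3 × E3 × E3) => t * ⟪w.1, T w.2.2 w.2.1⟫)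
    (by fun_prop) (ha.1.prodMk (hb.1.prodMk hc.1)) fun t T p => (norm_mul_le_of_le (le_refl ‖t‖)
      (norm_inner_le_of_le (ha.2 p) ((T (c p)).le_of_opNorm_le_of_le
      (T.le_of_opNorm_le_of_le le_rfl (hc.2 p)) (hb.2 p)))).trans_eq (by ring) :)

lemma IsLocalized.dpsi_bil (hL : IsLocalized D u z q ψ Φ G ρ) (ha : SizeLE u z q 1 a)
    (hb : SizeLE u z q 1 b) (hc : SizeLE u z q 1 c) :
    Integrable (fun p => fderiv ℝ ψ p.1 (c p) * bil Φ (p.1 - p.2) (a p) (b p)) vol₂ :=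
  hL.integrable_form hL.cut.fderiv (tsupport_fderiv_subset ℝ) hL.ker.smooth
    (N := fun t T (w : E3 × E3 × E3) => t w.2.2 * ⟪w.1, T w.2.1⟫) (by fun_prop)
    (ha.1.prodMk (hb.1.prodMk hc.1)) fun t T p => (norm_mul_le_of_le
      (t.le_of_opNorm_le_of_le le_rfl (hc.2 p)) (norm_inner_le_of_le (ha.2 p)
      (T.le_of_opNorm_le_of_le le_rfl (hb.2 p)))).trans_eq (by ring)

lemma IsLocalized.pressure_vloc (hL : IsLocalized D u z q ψ Φ G ρ) (ha : SizeLE u z q 1 a) :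
    Integrable (fun p => q p.1 * fderiv ℝ ψ p.1 (Φ (p.1 - p.2) (a p))) vol₂ :=
  hL.integrable_form hL.cut.fderiv (tsupport_fderiv_subset ℝ) hL.ker.smooth
    (N := fun t T (w : ℝ × E3) => w.1 * t (T w.2)) (by fun_prop)
    (hL.state.sizeLE_q.1.1.prodMk ha.1) fun t T p => (norm_mul_le_of_le (hL.state.sizeLE_q.1.2 p)
      (t.le_of_opNorm_le_of_le le_rfl (T.le_of_opNorm_le_of_le le_rfl (ha.2 p)))).trans_eq (by ring)

lemma IsLocalized.pressure_scalar (hL : IsLocalized D u z q ψ Φ G ρ) (hr : SizeLE u z q 2 r) :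
    Integrable (fun p => r p * (fderiv ℝ ψ p.1 (u p.1) * G (p.1 - p.2))) vol₂ :=
  hL.integrable_form hL.cut.fderiv (tsupport_fderiv_subset ℝ) hL.ker.smoothG
    (N := fun t g (w : ℝ × E3) => w.1 * (t w.2 * g)) (by fun_prop)
    (hr.1.prodMk hL.state.sizeLE_u.1.1) fun t _ p => (norm_mul_le_of_le (hr.2 p) (norm_mul_le_of_le
      (t.le_of_opNorm_le_of_le le_rfl (hL.state.sizeLE_u.1.2 p)) le_rfl)).trans_eq (by ring)

lemma IsLocalized.pressure_deriv (hL : IsLocalized D u z q ψ Φ G ρ) :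
    Integrable (fun p => q p.2 * (ψ p.1 * fderiv ℝ G (p.1 - p.2) (u p.1))) vol₂ :=
  hL.integrable_form hL.cut subset_rfl hL.ker.smoothG.fderiv
    (N := fun t T (w : ℝ × E3) => w.1 * (t * T w.2)) (by fun_prop)
    (hL.state.sizeLE_q.2.1.prodMk hL.state.sizeLE_u.1.1) fun _ T p => (norm_mul_le_of_le
      (hL.state.sizeLE_q.2.2 p) (norm_mul_le_of_le le_rfl
      (T.le_of_opNorm_le_of_le le_rfl (hL.state.sizeLE_u.1.2 p)))).trans_eq (by ring)

lemma IsLocalized.psi_bil (hL : IsLocalized D u z q ψ Φ G ρ) {ζ : E3 × E3 → E3}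
    (hζ : SizeLE u z q 2 ζ) (ha : SizeLE u z q 1 a) :
    Integrable (fun p => ψ p.1 * bil Φ (p.1 - p.2) (ζ p) (a p)) vol₂ :=
  (hL.integrable_form hL.cut subset_rfl hL.ker.smooth
    (N := fun t (T : E3 →L[ℝ] E3) (w : E3 × E3) => t * ⟪w.1, T w.2⟫) (by fun_prop) (hζ.1.prodMk ha.1)
    fun t T p => (norm_mul_le_of_le (le_refl ‖t‖) (norm_inner_le_of_le (hζ.2 p)
      (T.le_of_opNorm_le_of_le le_rfl (ha.2 p)))).trans_eq (by ring) :)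

lemma IsLocalized.forcing_vstar (hL : IsLocalized D u z q ψ Φ G ρ) :
    Integrable (fun p => ψ p.2 * bil Φ (p.1 - p.2) (z p.1) (u p.2)) vol₂ :=
  (hL.psi_bil hL.state.sizeLE_z.2 hL.state.sizeLE_u.1).swap.congr (ae_of_all _ fun p => by
    simp only [Function.comp_apply, Prod.fst_swap, Prod.snd_swap, bil]
    rw [← neg_sub, hL.ker.even])

end State

/-! ### Reduction of the balance to increments -/

lemma smoothIn_bil {Φ : E3 → E3 →L[ℝ] E3} {S : Set E3} (hΦ : SmoothIn S Φ) (a b : E3) :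
    SmoothIn S fun k => bil Φ k a b :=
  hΦ.clm_comp ((innerSL ℝ a).comp (ContinuousLinearMap.apply ℝ E3 b))

lemma fderiv_bil {Φ : E3 → E3 →L[ℝ] E3} {S : Set E3} (hΦ : SmoothIn S Φ) (k a b c : E3) :
    fderiv ℝ (fun k => bil Φ k a b) k c = tri Φ k a b c := by
  rw [HasFDerivAt.fderiv (f := fun k => bil Φ k a b) (((innerSL ℝ a).comp (ContinuousLinearMap.apply ℝ E3 b)).hasFDerivAt.comp k
    (hΦ.differentiable k).hasFDerivAt)]
  rfl

lemma fderiv_neg_arg {F : Type*} [NormedAddCommGroup F] [NormedSpace ℝ F] {f : E3 → F}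
    (h : ∀ k, f (-k) = f k) (k : E3) : fderiv ℝ f (-k) = -fderiv ℝ f k := by
  have h2 := (ContinuousLinearEquiv.neg ℝ (M := E3)).comp_right_fderiv (f := f) (x := k)
  rw [show f ∘ (ContinuousLinearEquiv.neg ℝ (M := E3)) = f from funext h] at h2
  ext1 a
  simp [h2]

section Reduction

variable {D S : Set E3} {ψ f : E3 → ℝ} {ρ : ℝ}

lemma smoothIn_reflect (hf : SmoothIn (closedBall 0 ρ) f)
    (hρ : cthickening ρ (tsupport ψ) ⊆ D) (x : E3) : SmoothIn D fun y => ψ x * f (x - y) := by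
  by_cases hx : x ∈ tsupport ψ
  · have hsub : Function.support (fun y => ψ x * f (x - y)) ⊆ closedBall x ρ := by
      intro y hy
      by_contra h
      refine hy ?_
      have : f (x - y) = 0 := hf.eq_zero_of_notMem fun h' => h (by
        simpa [dist_eq_norm, norm_sub_rev] using h')
      simp [this]
    refine ⟨contDiff_const.mul (hf.smooth.comp (contDiff_const.sub contDiff_id)),
      HasCompactSupport.of_support_subset_isCompact (isCompact_closedBall x ρ) hsub, ?_⟩
    refine (closure_minimal hsub isClosed_closedBall).trans fun y hy =>
      mem_of_cthickening hρ hx ?_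
    simpa [dist_eq_norm, norm_sub_rev] using hy
  · simp only [image_eq_zero_of_notMem_tsupport hx, zero_mul]
    exact ⟨contDiff_const, HasCompactSupport.zero, by simp [tsupport]⟩

lemma fderiv_reflect (hf : SmoothIn S f) (r : ℝ) (x y c : E3) :
    fderiv ℝ (fun y => r * f (x - y)) y c = -(r * fderiv ℝ f (x - y) c) := by
  rw [HasFDerivAt.fderiv (f := fun y => r * f (x - y)) (((hf.differentiable (x - y)).hasFDerivAt.comp y ((hasFDerivAt_const x
    y).sub (hasFDerivAt_id y))).const_mul r)]
  simp

lemma smoothIn_mul_translate (hψ : SmoothIn D ψ) (hf : SmoothIn S f) (y : E3) :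
    SmoothIn D fun x => ψ x * f (x - y) :=
  hψ.smul_right (hf.smooth.comp (contDiff_id.sub contDiff_const))

lemma fderiv_mul_translate (hψ : SmoothIn D ψ) (hf : SmoothIn S f) (x y c : E3) :
    fderiv ℝ (fun x => ψ x * f (x - y)) x c =
      fderiv ℝ ψ x c * f (x - y) + ψ x * fderiv ℝ f (x - y) c := by
  rw [HasFDerivAt.fderiv (f := fun x => ψ x * f (x - y)) ((hψ.differentiable x).hasFDerivAt.mul ((hf.differentiable
    (x - y)).hasFDerivAt.comp x ((hasFDerivAt_id x).sub (hasFDerivAt_const y x))))]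
  simp [mul_comm, add_comm]

end Reduction

section TwoPoint

variable {D : Set E3} [IsFiniteMeasure (volume.restrict D)] {u z : E3 → E3}
  {q : E3 → ℝ} {ψ : E3 → ℝ} {Φ : E3 → E3 →L[ℝ] E3} {G : E3 → ℝ} {ρ : ℝ}

/-- The two-point density in which the increments of the velocity appear. -/
def twoPoint (ψ : E3 → ℝ) (Φ : E3 → E3 →L[ℝ] E3) (G : E3 → ℝ) (u z : E3 → E3) (q : E3 → ℝ)
    (p : E3 × E3) : ℝ :=
  1 / 2 * (ψ p.1 * tri Φ (p.1 - p.2) (u p.2 - u p.1) (u p.2 - u p.1) (u p.2 - u p.1))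
    + 1 / 2 * (fderiv ℝ ψ p.1 (u p.2 - u p.1) * bil Φ (p.1 - p.2) (u p.2) (u p.2))
    + fderiv ℝ ψ p.1 (u p.1) * bil Φ (p.1 - p.2) (u p.1) (u p.2)
    + q p.1 * fderiv ℝ ψ p.1 (Φ (p.1 - p.2) (u p.2))
    + q p.2 * (fderiv ℝ ψ p.1 (u p.1) * G (p.1 - p.2))
    + ψ p.1 * bil Φ (p.1 - p.2) (z p.1) (u p.2)
    + ψ p.2 * bil Φ (p.1 - p.2) (z p.1) (u p.2)

/-- The two-point density read off from the momentum equation. -/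
def rawTwoPoint (ψ : E3 → ℝ) (Φ : E3 → E3 →L[ℝ] E3) (G : E3 → ℝ) (u z : E3 → E3) (q : E3 → ℝ)
    (p : E3 × E3) : ℝ :=
  fderiv ℝ ψ p.1 (u p.1) * bil Φ (p.1 - p.2) (u p.1) (u p.2)
    + ψ p.1 * tri Φ (p.1 - p.2) (u p.1) (u p.2) (u p.1)
    - ψ p.1 * tri Φ (p.1 - p.2) (u p.2) (u p.1) (u p.2)
    + q p.1 * fderiv ℝ ψ p.1 (Φ (p.1 - p.2) (u p.2))
    - q p.2 * (ψ p.1 * fderiv ℝ G (p.1 - p.2) (u p.1))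
    + ψ p.1 * bil Φ (p.1 - p.2) (z p.1) (u p.2)
    + ψ p.2 * bil Φ (p.1 - p.2) (z p.1) (u p.2)

lemma tri_symm (hK : IsKernel ρ Φ G) (k a b c : E3) : tri Φ k a b c = tri Φ k b a c := by
  rw [← fderiv_bil hK.smooth, ← fderiv_bil hK.smooth]
  congr 2
  ext1 k
  rw [bil, bil, ← hK.symm, real_inner_comm]

lemma tri_neg_arg (hK : IsKernel ρ Φ G) (k a b c : E3) : tri Φ (-k) a b c = -tri Φ k a b c := by
  simp [tri, fderiv_neg_arg hK.even]

/-- The two-point functions with integral zero. -/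
def Null (g : E3 × E3 → ℝ) : Prop := Integrable g vol₂ ∧ ∫ p, g p ∂vol₂ = 0

lemma null_of_left {g : E3 × E3 → ℝ} (hg : Integrable g vol₂) (h : ∀ x, ∫ y, g (x, y) = 0) :
    Null g :=
  ⟨hg, (integral_prod _ hg).trans (integral_eq_zero_of_ae (ae_of_all _ h))⟩

lemma null_of_right {g : E3 × E3 → ℝ} (hg : Integrable g vol₂) (h : ∀ y, ∫ x, g (x, y) = 0) :
    Null g :=
  ⟨hg, (integral_prod_symm _ hg).trans (integral_eq_zero_of_ae (ae_of_all _ h))⟩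

lemma integral_add_null {f g : E3 × E3 → ℝ} {r : ℝ} (c : ℝ) (hg : Null g)
    (hf : Integrable f vol₂ ∧ ∫ p, f p ∂vol₂ = r) :
    Integrable (fun p => f p + c * g p) vol₂ ∧ ∫ p, (f p + c * g p) ∂vol₂ = r := by
  refine ⟨hf.1.add (hg.1.const_mul c), ?_⟩
  rw [integral_add hf.1 (hg.1.const_mul c), integral_const_mul, hg.2, hf.2, mul_zero, add_zero]

lemma integrable_rawTwoPoint (hL : IsLocalized D u z q ψ Φ G ρ) :
    Integrable (rawTwoPoint ψ Φ G u z q) vol₂ :=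
  have ⟨m1, m2⟩ := hL.state.sizeLE_u
  ((((((hL.dpsi_bil m1 m2 m1).add (hL.psi_tri m1 m2 m1)).sub (hL.psi_tri m2 m1 m2)).add
    (hL.pressure_vloc m2)).sub hL.pressure_deriv).add
    (hL.psi_bil hL.state.sizeLE_z.1 m2)).add hL.forcing_vstar

lemma integral_twoPoint (hL : IsLocalized D u z q ψ Φ G ρ) :
    Integrable (twoPoint ψ Φ G u z q) vol₂ ∧
      ∫ p, twoPoint ψ Φ G u z q p ∂vol₂ = ∫ p, rawTwoPoint ψ Φ G u z q p ∂vol₂ := by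
  obtain ⟨m1, m2⟩ := hL.state.sizeLE_u
  have hK := hL.ker
  have hs := fun b => smoothIn_bil hK.smooth b b
  have e : ∀ k a b, tri Φ k (b - a) (b - a) (b - a) = tri Φ k b b b - tri Φ k b b a
      - 2 * tri Φ k b a b + 2 * tri Φ k a b a + tri Φ k a a b - tri Φ k a a a := by
    intro k a b
    have s1 := tri_symm hK k a b a
    have s2 := tri_symm hK k a b b
    simp only [tri] at s1 s2 ⊢
    simp only [map_sub, sub_apply, inner_sub_left, inner_sub_right]
    linarith
  have key : twoPoint ψ Φ G u z q = fun p => rawTwoPoint ψ Φ G u z q p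
      + 1 / 2 * (fderiv ℝ ψ p.1 (u p.2) * bil Φ (p.1 - p.2) (u p.2) (u p.2) +
          ψ p.1 * tri Φ (p.1 - p.2) (u p.2) (u p.2) (u p.2))
      + -(1 / 2) * (fderiv ℝ ψ p.1 (u p.1) * bil Φ (p.1 - p.2) (u p.2) (u p.2) +
          ψ p.1 * tri Φ (p.1 - p.2) (u p.2) (u p.2) (u p.1))
      + 1 / 2 * (ψ p.1 * tri Φ (p.1 - p.2) (u p.1) (u p.1) (u p.2))
      + -(1 / 2) * (ψ p.1 * tri Φ (p.1 - p.2) (u p.1) (u p.1) (u p.1))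
      + 1 * (q p.2 * (fderiv ℝ ψ p.1 (u p.1) * G (p.1 - p.2) +
          ψ p.1 * fderiv ℝ G (p.1 - p.2) (u p.1))) := by
    ext1 p
    rw [twoPoint, e, rawTwoPoint, map_sub]
    ring
  rw [key]
  refine integral_add_null 1 (null_of_right (by
      simp only [mul_add]; exact (hL.pressure_scalar hL.state.sizeLE_q.2).add hL.pressure_deriv)
      fun y => ?_) <|
    integral_add_null _ (null_of_left (hL.psi_tri m1 m1 m1) fun x => ?_) <|
    integral_add_null _ (null_of_left (hL.psi_tri m1 m1 m2) fun x => ?_) <|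
    integral_add_null _ (null_of_right ((hL.dpsi_bil m2 m2 m1).add (hL.psi_tri m2 m2 m1))
      fun y => ?_) <|
    integral_add_null _ (null_of_right ((hL.dpsi_bil m2 m2 m2).add (hL.psi_tri m2 m2 m2))
      fun y => ?_) ⟨integrable_rawTwoPoint hL, rfl⟩
  · have h1 := hL.state.divFree _ (smoothIn_mul_translate hL.cut hK.smoothG y)
    simp only [fderiv_mul_translate hL.cut hK.smoothG] at h1
    simp [integral_const_mul, h1]
  · simp only [integral_const_mul]
    rw [integral_sub_left_eq_self (fun k => tri Φ k (u x) (u x) (u x)) volume x]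
    simp only [← fderiv_bil hK.smooth]
    rw [integral_fderiv_apply_eq_zero (hs _), mul_zero]
  · have h1 := hL.state.divFree _ (smoothIn_reflect (hs (u x)) hL.supp x)
    simp only [fderiv_reflect (hs (u x)), fderiv_bil hK.smooth, integral_neg] at h1
    exact neg_eq_zero.1 h1
  · have h1 := hL.state.divFree _ (smoothIn_mul_translate hL.cut (hs (u y)) y)
    simp only [fderiv_mul_translate hL.cut (hs (u y)), fderiv_bil hK.smooth] at h1
    exact h1
  · have h1 := integral_fderiv_apply_eq_zero (smoothIn_mul_translate hL.cut (hs (u y)) y) (u y)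
    simp only [fderiv_mul_translate hL.cut (hs (u y)), fderiv_bil hK.smooth] at h1
    exact h1

end TwoPoint

/-! ### The balance as a two-point integral -/

section TwoPoint

variable {D : Set E3} [IsFiniteMeasure (volume.restrict D)] {u z : E3 → E3}
  {q : E3 → ℝ} {ψ : E3 → ℝ} {Φ : E3 → E3 →L[ℝ] E3} {G : E3 → ℝ} {ρ : ℝ}

lemma setIntegral_fld_eq {F : Type*} [NormedAddCommGroup F] [NormedSpace ℝ F] [CompleteSpace F]
    {r : ℝ≥0∞} [hr : Fact (1 ≤ r)] (hD : MeasurableSet D) (w : Lp F r (volume.restrict D : Measure E3))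
    {f : E3 → F → ℝ} (hf : ∀ x, f x 0 = 0) : ∫ x in D, f x (w x) = ∫ x, f x (fld w x) := by
  rw [← SmoothIn.setIntegral_eq (D := D) fun x hx => by rw [fld_of_notMem _ hx, hf]]
  refine integral_congr_ae ?_
  filter_upwards [fld_ae_eq_restrict hD w] with x hx using by rw [hx]

lemma integral_convective_vloc (hL : IsLocalized D u z q ψ Φ G ρ) (hu : Integrable u) :
    ∫ x, ⟪u x, fderiv ℝ (vloc ψ Φ u) x (u x)⟫ =
      ∫ p : E3 × E3, (fderiv ℝ ψ p.1 (u p.1) * bil Φ (p.1 - p.2) (u p.1) (u p.2)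
        + ψ p.1 * tri Φ (p.1 - p.2) (u p.1) (u p.2) (u p.1)) ∂vol₂ := by
  have ⟨m1, m2⟩ := hL.state.sizeLE_u
  refine Eq.trans (integral_congr_ae (ae_of_all _ fun x => ?_))
    (integral_prod _ ((hL.dpsi_bil m1 m2 m1).add
      (hL.psi_tri m1 m2 m1))).symm
  have i1 := integrable_clm_apply hL.ker.smooth hu x
  have i2 := integrable_clm_apply (hL.ker.smooth.dirDeriv (u x)) hu x
  have e1 : ⟪u x, conv Φ u x⟫ = ∫ y, bil Φ (x - y) (u x) (u y) := (integral_inner i1 (u x)).symm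
  have e2 : ⟪u x, conv (dirDeriv (u x) Φ) u x⟫ = ∫ y, tri Φ (x - y) (u x) (u y) (u x) :=
    (integral_inner i2 (u x)).symm
  have j1 : Integrable fun y => bil Φ (x - y) (u x) (u y) := i1.const_inner (u x)
  have j2 : Integrable fun y => tri Φ (x - y) (u x) (u y) (u x) := i2.const_inner (u x)
  beta_reduce
  rw [fderiv_vloc hL.cut hL.ker.smooth hu, inner_add_right, vloc, vloc, inner_smul_right, inner_smul_right,
    e1, e2, ← integral_const_mul, ← integral_const_mul,
    ← integral_add (j1.const_mul _) (j2.const_mul _)]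
  rfl

lemma integral_convective_vstar (hL : IsLocalized D u z q ψ Φ G ρ) (hu : Integrable u) :
    ∫ x, ⟪u x, fderiv ℝ (vstar ψ Φ u) x (u x)⟫ =
      -∫ p : E3 × E3, ψ p.1 * tri Φ (p.1 - p.2) (u p.2) (u p.1) (u p.2) ∂vol₂ := by
  rw [integral_prod_symm _ (hL.psi_tri hL.state.sizeLE_u.2 hL.state.sizeLE_u.1 hL.state.sizeLE_u.2), ← integral_neg]
  refine integral_congr_ae (ae_of_all _ fun x => ?_)
  beta_reduce
  rw [fderiv_vstar hL.cut hL.ker.smooth hu, vstar, conv, ← integral_neg,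
    ← integral_inner (integrable_clm_apply (hL.ker.smooth.dirDeriv _) (hL.cut.integrable_smul hu) x)]
  refine integral_congr_ae (ae_of_all _ fun y => ?_)
  simp only [map_smul, inner_smul_right]
  rw [← neg_sub x y, tri_neg_arg hL.ker]
  simp only [tri, dirDeriv, mul_neg, neg_neg]

lemma integral_pressure_vloc (hL : IsLocalized D u z q ψ Φ G ρ) (hu : Integrable u) :
    ∫ x, q x * divField (vloc ψ Φ u) x =
      ∫ p : E3 × E3, q p.1 * fderiv ℝ ψ p.1 (Φ (p.1 - p.2) (u p.2)) ∂vol₂ := by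
  rw [integral_prod _ (hL.pressure_vloc hL.state.sizeLE_u.2)]
  refine integral_congr_ae (ae_of_all _ fun x => ?_)
  have h0 : ψ x * ∫ y, fderiv ℝ G (x - y) (u y) = 0 := by
    have h1 := hL.state.divFree _ (smoothIn_reflect (ψ := ψ) hL.ker.smoothG hL.supp x)
    simp only [fderiv_reflect hL.ker.smoothG, integral_neg, integral_const_mul] at h1
    exact neg_eq_zero.1 h1
  beta_reduce
  rw [divField_vloc hL.cut hL.ker hu, h0, add_zero, conv,
    ← (fderiv ℝ ψ x).integral_comp_comm (integrable_clm_apply hL.ker.smooth hu x), ← integral_const_mul]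

lemma integral_pressure_vstar (hL : IsLocalized D u z q ψ Φ G ρ) (hu : Integrable u) :
    ∫ x, q x * divField (vstar ψ Φ u) x =
      -∫ p : E3 × E3, q p.2 * (ψ p.1 * fderiv ℝ G (p.1 - p.2) (u p.1)) ∂vol₂ := by
  rw [integral_prod_symm _ (hL.pressure_deriv), ← integral_neg]
  refine integral_congr_ae (ae_of_all _ fun x => ?_)
  beta_reduce
  rw [divField_vstar hL.cut hL.ker hu, ← integral_neg, ← integral_const_mul]
  refine integral_congr_ae (ae_of_all _ fun y => ?_)
  beta_reduce
  rw [← neg_sub x y, fderiv_neg_arg hL.ker.evenG, map_smul]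
  simp

lemma integral_inner_vloc (hL : IsLocalized D u z q ψ Φ G ρ) (hu : Integrable u) :
    ∫ x, ⟪z x, vloc ψ Φ u x⟫ =
      ∫ p : E3 × E3, ψ p.1 * bil Φ (p.1 - p.2) (z p.1) (u p.2) ∂vol₂ := by
  rw [integral_prod _ (hL.psi_bil hL.state.sizeLE_z.1 hL.state.sizeLE_u.2)]
  refine integral_congr_ae (ae_of_all _ fun x => ?_)
  beta_reduce
  rw [vloc, inner_smul_right, conv, ← integral_inner (integrable_clm_apply hL.ker.smooth hu x),
    ← integral_const_mul]
  rfl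

lemma integral_inner_vstar (hL : IsLocalized D u z q ψ Φ G ρ) (hu : Integrable u) :
    ∫ x, ⟪z x, vstar ψ Φ u x⟫ =
      ∫ p : E3 × E3, ψ p.2 * bil Φ (p.1 - p.2) (z p.1) (u p.2) ∂vol₂ := by
  rw [integral_prod _ (hL.forcing_vstar)]
  refine integral_congr_ae (ae_of_all _ fun x => ?_)
  beta_reduce
  rw [vstar, conv, ← integral_inner (integrable_clm_apply hL.ker.smooth (hL.cut.integrable_smul hu) x)]
  refine integral_congr_ae (ae_of_all _ fun y => ?_)
  simp only [map_smul, inner_smul_right, bil]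

/-- The viscous contribution to the balance. -/
def visc (ψ : E3 → ℝ) (Φ : E3 → E3 →L[ℝ] E3) (w : L2Vec D) : ℝ :=
  (∫ x in D, ⟪w x, lapField (vloc ψ Φ (fld w)) x⟫) + ∫ x in D, ⟪w x, lapField (vstar ψ Φ (fld w)) x⟫

lemma balance_eq {w ζ : L2Vec D} {π : L32 D} (hL : IsLocalized D (fld w) (fld ζ) (fld π) ψ Φ G ρ)
    (ν : ℝ) : balance ν ψ Φ w ζ π =
      ∫ p, twoPoint ψ Φ G (fld w) (fld ζ) (fld π) p ∂vol₂ + ν * visc ψ Φ w := by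
  have hD := hL.meas
  have hu := integrable_fld hD w
  have ⟨m1, m2⟩ := hL.state.sizeLE_u
  have c : ∀ v : E3 → E3, ∫ x in D, ⟪w x, fderiv ℝ v x (w x)⟫ =
      ∫ x, ⟪fld w x, fderiv ℝ v x (fld w x)⟫ := fun v =>
    setIntegral_fld_eq hD w (f := fun x b => ⟪b, fderiv ℝ v x b⟫) fun x => by simp
  have d : ∀ v : E3 → E3, ∫ x in D, π x * divField v x = ∫ x, fld π x * divField v x := fun v =>
    setIntegral_fld_eq hD π (f := fun x b => b * divField v x) fun x => by simp
  have i2 := (hL.dpsi_bil m1 m2 m1).add (hL.psi_tri m1 m2 m1)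
  have i3 := i2.sub (hL.psi_tri m2 m1 m2)
  have i4 := i3.add (hL.pressure_vloc m2)
  have i5 := i4.sub hL.pressure_deriv
  have j6 := hL.psi_bil hL.state.sizeLE_z.1 m2
  have e := integral_add' (i5.add j6) hL.forcing_vstar
  rw [integral_add' i5 j6, integral_sub' i4 hL.pressure_deriv, integral_add' i3 (hL.pressure_vloc
    m2), integral_sub' i2 (hL.psi_tri m2 m1 m2)] at e
  rw [(integral_twoPoint hL).2, show ∫ p, rawTwoPoint _ _ _ _ _ _ p ∂vol₂ = _ from e, balance, forcing, forcing, visc, c, c, d, d, setIntegral_inner_eq hD ζ,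
    setIntegral_inner_eq hD ζ, integral_convective_vloc hL hu, integral_convective_vstar hL hu,
    integral_pressure_vloc hL hu, integral_pressure_vstar hL hu, integral_inner_vloc hL hu,
    integral_inner_vstar hL hu]
  simp only [Pi.add_apply]
  ring

end TwoPoint

/-! ### Error terms in the two-point balance -/

lemma rpow_three_halves {b : ℝ} (hb : 0 ≤ b) : b ^ (3 / 2 : ℝ) = √b ^ 3 := by
  rw [Real.sqrt_eq_rpow, ← Real.rpow_natCast, ← Real.rpow_mul hb]
  norm_num

lemma mul_sq_le_young {a c η : ℝ} (ha : 0 ≤ a) (hc : 0 ≤ c) (hη : 0 < η) :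
    a * c ^ 2 ≤ (η⁻¹) ^ 2 * a ^ 3 + η * c ^ 3 := by
  rcases le_total a (η * c) with h | h
  · have : a * c ^ 2 ≤ η * c * c ^ 2 := by gcongr
    have : 0 ≤ (η⁻¹) ^ 2 * a ^ 3 := by positivity
    linarith
  · have h1 : c ≤ η⁻¹ * a := by rwa [inv_mul_eq_div, le_div_iff₀ hη, mul_comm]
    have : a * c ^ 2 ≤ a * (η⁻¹ * a) ^ 2 := by gcongr
    have : 0 ≤ η * c ^ 3 := by positivity
    nlinarith

lemma mul_le_young_left {a b η : ℝ} (ha : 0 ≤ a) (hb : 0 ≤ b) (hη : 0 < η) :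
    a * b ≤ (η⁻¹) ^ 2 * a ^ 3 + η * b ^ (3 / 2 : ℝ) := by
  rw [rpow_three_halves hb]
  simpa [hb] using mul_sq_le_young ha (sqrt_nonneg b) hη

lemma mul_le_young_right {a b η : ℝ} (ha : 0 ≤ a) (hb : 0 ≤ b) (hη : 0 < η) (hη1 : η ≤ 1) :
    a * b ≤ η * a ^ 3 + (η⁻¹) ^ 2 * b ^ (3 / 2 : ℝ) := by
  have h := mul_le_young_left ha hb (inv_pos.2 (Real.sqrt_pos.2 hη))
  rw [inv_inv, sq_sqrt hη.le] at h
  refine h.trans ?_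
  gcongr
  rw [inv_pow]
  refine inv_anti₀ (by positivity) (Real.le_sqrt_of_sq_le ?_)
  rw [← pow_mul]
  exact pow_le_of_le_one hη.le hη1 (by norm_num)

lemma le_one_add_pow {t : ℝ≥0∞} {r s : ℝ} (hr : 0 ≤ r) (hrs : r ≤ s) : t ^ r ≤ 1 + t ^ s := by
  rcases le_total t 1 with h | h
  · exact (ENNReal.rpow_le_one h hr).trans le_self_add
  · exact (ENNReal.rpow_le_rpow_of_exponent_le h hrs).trans le_add_self

section Density

variable {D : Set E3} {u z : E3 → E3}
  {q : E3 → ℝ} {ψ : E3 → ℝ} {Φ : E3 → E3 →L[ℝ] E3} {G : E3 → ℝ} {ρ : ℝ}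

/-- The part of the two-point density without increments. -/
def mainDensity (ψ : E3 → ℝ) (Φ : E3 → E3 →L[ℝ] E3) (G : E3 → ℝ) (u z : E3 → E3) (q : E3 → ℝ)
    (p : E3 × E3) : ℝ :=
  fderiv ℝ ψ p.1 (u p.1) * bil Φ (p.1 - p.2) (u p.1) (u p.1)
    + q p.1 * fderiv ℝ ψ p.1 (Φ (p.1 - p.2) (u p.1))
    + q p.1 * (fderiv ℝ ψ p.1 (u p.1) * G (p.1 - p.2))
    + 2 * (ψ p.1 * bil Φ (p.1 - p.2) (z p.1) (u p.1))

/-- The part of the two-point density linear in the increments. -/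
def errDensity (ψ : E3 → ℝ) (Φ : E3 → E3 →L[ℝ] E3) (G : E3 → ℝ) (u z : E3 → E3) (q : E3 → ℝ)
    (p : E3 × E3) : ℝ :=
  1 / 2 * (fderiv ℝ ψ p.1 (u p.2 - u p.1) * bil Φ (p.1 - p.2) (u p.2) (u p.2))
    + fderiv ℝ ψ p.1 (u p.1) * bil Φ (p.1 - p.2) (u p.1) (u p.2 - u p.1)
    + q p.1 * fderiv ℝ ψ p.1 (Φ (p.1 - p.2) (u p.2 - u p.1))
    + (q p.2 - q p.1) * (fderiv ℝ ψ p.1 (u p.1) * G (p.1 - p.2))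
    + 2 * (ψ p.1 * bil Φ (p.1 - p.2) (z p.1) (u p.2 - u p.1))
    + (ψ p.2 - ψ p.1) * bil Φ (p.1 - p.2) (z p.1) (u p.2)

lemma twoPoint_eq (p : E3 × E3) : twoPoint ψ Φ G u z q p =
    1 / 2 * (ψ p.1 * tri Φ (p.1 - p.2) (u p.2 - u p.1) (u p.2 - u p.1) (u p.2 - u p.1))
      + mainDensity ψ Φ G u z q p + errDensity ψ Φ G u z q p := by
  simp only [twoPoint, mainDensity, errDensity, bil, map_sub, inner_sub_right]
  ring

lemma abs_errDensity_le {B Λ η : ℝ} (hψ0 : ∀ x, |ψ x| ≤ B) (hψ1 : ∀ x, ‖fderiv ℝ ψ x‖ ≤ B)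
    (hψ : Differentiable ℝ ψ) (hΦ : ∀ k, ‖Φ k‖ ≤ Λ) (hG : ∀ k, |G k| ≤ Λ) (hη : 0 < η) (hη1 : η ≤ 1)
    {x y : E3} (hxy : ‖x - y‖ ≤ ρ) :
    |errDensity ψ Φ G u z q (x, y)| ≤ B * Λ *
      (5 * (η⁻¹) ^ 2 * (‖u y - u x‖ ^ 3 + |q y - q x| ^ (3 / 2 : ℝ))
        + (3 * η + ρ) * (‖u x‖ ^ 3 + ‖u y‖ ^ 3 + |q x| ^ (3 / 2 : ℝ) + ‖z x‖ ^ (3 / 2 : ℝ))) := by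
  have hB : 0 ≤ B := (abs_nonneg _).trans (hψ0 0)
  have hΛ : 0 ≤ Λ := (abs_nonneg _).trans (hG 0)
  have hρ : 0 ≤ ρ := (norm_nonneg _).trans hxy
  have hlip : ‖ψ y - ψ x‖ ≤ B * ρ := by
    refine (Convex.norm_image_sub_le_of_norm_fderiv_le (𝕜 := ℝ) (fun w _ => hψ w)
      (fun w _ => hψ1 w) convex_univ (mem_univ x) (mem_univ y)).trans ?_
    gcongr
    rwa [norm_sub_rev]
  have l : ∀ a, ‖fderiv ℝ ψ x a‖ ≤ B * ‖a‖ := (fderiv ℝ ψ x).le_of_opNorm_le (hψ1 x)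
  have m := (Φ (x - y)).le_of_opNorm_le (hΦ _)
  have b : ∀ a c, ‖bil Φ (x - y) a c‖ ≤ ‖a‖ * (Λ * ‖c‖) := fun a c =>
    norm_inner_le_of_le le_rfl (m c)
  have hsum : ‖errDensity ψ Φ G u z q (x, y)‖ ≤ _ := norm_add_le_of_le (norm_add_le_of_le
    (norm_add_le_of_le (norm_add_le_of_le (norm_add_le_of_le
      (norm_mul_le_of_le (by norm_num : ‖(1 / 2 : ℝ)‖ ≤ 1 / 2) (norm_mul_le_of_le (l _) (b _ _)))
      (norm_mul_le_of_le (l _) (b _ _)))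
      (norm_mul_le_of_le le_rfl ((l _).trans (mul_le_mul_of_nonneg_left (m _) hB))))
      (norm_mul_le_of_le le_rfl (norm_mul_le_of_le (l _) (hG _))))
      (norm_mul_le_of_le (by norm_num : ‖(2 : ℝ)‖ ≤ 2) (norm_mul_le_of_le (hψ0 _) (b _ _))))
      (norm_mul_le_of_le hlip (b _ _))
  have d0 := norm_nonneg (u y - u x)
  have y1 := mul_sq_le_young d0 (norm_nonneg (u y)) hη
  have y2 := mul_sq_le_young d0 (norm_nonneg (u x)) hη
  have y3 := mul_le_young_left d0 (abs_nonneg (q x)) hη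
  have y4 := mul_le_young_right (norm_nonneg (u x)) (abs_nonneg (q y - q x)) hη hη1
  have y5 := mul_le_young_left d0 (norm_nonneg (z x)) hη
  have y6 := mul_le_mul_of_nonneg_left
    (mul_le_young_left (norm_nonneg (u y)) (norm_nonneg (z x)) one_pos) hρ
  refine (hsum.trans_eq ?_).trans (mul_le_mul_of_nonneg_left (a := B * Λ) (b := 1 / 2 *
    (‖u y - u x‖ * ‖u y‖ ^ 2) + ‖u y - u x‖ * ‖u x‖ ^ 2 + ‖u y - u x‖ * |q x| + ‖u x‖ * |q y - q x|
    + 2 * (‖u y - u x‖ * ‖z x‖) + ρ * (‖u y‖ * ‖z x‖)) ?_ (by positivity))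
  · simp only [norm_eq_abs]
    ring
  have p1 : 0 ≤ (η⁻¹) ^ 2 * ‖u y - u x‖ ^ 3 := by positivity
  have p2 : 0 ≤ (η⁻¹) ^ 2 * |q y - q x| ^ (3 / 2 : ℝ) := by positivity
  have p3 : 0 ≤ η * ‖u x‖ ^ 3 := by positivity
  have p4 : 0 ≤ η * ‖u y‖ ^ 3 := by positivity
  have p5 : 0 ≤ η * |q x| ^ (3 / 2 : ℝ) := by positivity
  have p6 : 0 ≤ η * ‖z x‖ ^ (3 / 2 : ℝ) := by positivity
  have p7 : 0 ≤ ρ * ‖u x‖ ^ 3 := by positivity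
  have p9 : 0 ≤ ρ * |q x| ^ (3 / 2 : ℝ) := by positivity
  nlinarith

lemma errDensity_ne_zero (hL : IsLocalized D u z q ψ Φ G ρ) {x y : E3}
    (h : errDensity ψ Φ G u z q (x, y) ≠ 0) : x ∈ D ∧ y ∈ D ∧ ‖x - y‖ ≤ ρ := by
  have hk : x - y ∈ closedBall (0 : E3) ρ := by
    by_contra hk
    refine h ?_
    have e1 := hL.ker.smooth.eq_zero_of_notMem hk
    have e2 := hL.ker.smoothG.eq_zero_of_notMem hk
    simp [errDensity, bil, e1, e2]
  have hk' : y - x ∈ closedBall (0 : E3) ρ := by simpa [norm_sub_rev] using hk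
  have hx : x ∈ tsupport ψ ∨ y ∈ tsupport ψ := by
    by_contra! hn
    refine h ?_
    have e1 := image_eq_zero_of_notMem_tsupport hn.1
    have e2 := image_eq_zero_of_notMem_tsupport hn.2
    have e3 : fderiv ℝ ψ x = 0 := image_eq_zero_of_notMem_tsupport fun hx =>
      hn.1 (tsupport_fderiv_subset ℝ hx)
    simp only [errDensity, e1, e2, e3]
    simp
  have hs := @hL.cut.support
  have hm := fun {x y} => mem_of_cthickening (x := x) (y := y) hL.supp
  exact ⟨hx.elim (@hs _) (hm · hk'), hx.elim (hm · hk) (@hs _), by simpa using hk⟩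

/-- The cubed size of the increments, pressure included. -/
def oscDensity (u : E3 → E3) (q : E3 → ℝ) (h x : E3) : ℝ≥0∞ :=
  ‖u (x + h) - u x‖ₑ ^ 3 + ‖q (x + h) - q x‖ₑ ^ (3 / 2 : ℝ)

/-- The cubed size of the fields at two points. -/
def sizeDensity (u z : E3 → E3) (q : E3 → ℝ) (h x : E3) : ℝ≥0∞ :=
  ‖u x‖ₑ ^ 3 + ‖u (x + h)‖ₑ ^ 3 + ‖q x‖ₑ ^ (3 / 2 : ℝ) + ‖z x‖ₑ ^ (3 / 2 : ℝ)

lemma ofReal_norm_pow {F : Type*} [NormedAddCommGroup F] (a : F) (n : ℕ) :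
    ofReal (‖a‖ ^ n) = ‖a‖ₑ ^ n := by
  rw [ofReal_pow (norm_nonneg _), ofReal_norm]

lemma ofReal_norm_rpow {F : Type*} [NormedAddCommGroup F] (a : F) {r : ℝ} (hr : 0 ≤ r) :
    ofReal (‖a‖ ^ r) = ‖a‖ₑ ^ r := by
  rw [← ENNReal.ofReal_rpow_of_nonneg (norm_nonneg _) hr, ofReal_norm]

lemma measurableSet_shiftDomain_prod (hD : MeasurableSet D) :
    MeasurableSet {r : E3 × E3 | r.2 ∈ shiftDomain D r.1} :=
  (measurable_snd hD).inter ((measurable_snd.add measurable_fst) hD)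

lemma measurableSet_shiftDomain (hD : MeasurableSet D) (h : E3) :
    MeasurableSet (shiftDomain D h) :=
  hD.inter ((measurable_id.add_const h) hD)

lemma lintegral_errDensity_le (hL : IsLocalized D u z q ψ Φ G ρ) {B Λ η : ℝ}
    (hψ0 : ∀ x, |ψ x| ≤ B) (hψ1 : ∀ x, ‖fderiv ℝ ψ x‖ ≤ B) (hΦ : ∀ k, ‖Φ k‖ ≤ Λ) (hG : ∀ k, |G k| ≤ Λ)
    (hη : 0 < η) (hη1 : η ≤ 1) :
    ∫⁻ p, ‖errDensity ψ Φ G u z q p‖ₑ ∂vol₂ ≤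
      ∫⁻ h in closedBall (0 : E3) ρ, ∫⁻ x in shiftDomain D h,
        ofReal (B * Λ) * (ofReal (5 * (η⁻¹) ^ 2) * oscDensity u q h x
          + ofReal (3 * η + ρ) * sizeDensity u z q h x) := by
  have hB : 0 ≤ B := (abs_nonneg _).trans (hψ0 0)
  have hΛ : 0 ≤ Λ := (abs_nonneg _).trans (hG 0)
  set f : E3 → E3 → ℝ≥0∞ := fun h x => ofReal (B * Λ) *
    (ofReal (5 * (η⁻¹) ^ 2) * oscDensity u q h x
          + ofReal (3 * η + ρ) * sizeDensity u z q h x) with hf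
  set T : Set (E3 × E3) := {r | r.1 ∈ closedBall (0 : E3) ρ ∧ r.2 ∈ shiftDomain D r.1}
  have hT : MeasurableSet T := (measurable_fst measurableSet_closedBall).inter
    (measurableSet_shiftDomain_prod hL.meas)
  have ⟨hD, ⟨hu, hz, hq, _, _⟩, hψ, _, _⟩ := hL
  have hfm : Measurable (uncurry f) := by
    simp only [hf, Function.uncurry_def, oscDensity, sizeDensity]
    fun_prop
  have hbound : ∀ x h, ‖errDensity ψ Φ G u z q (x, x + h)‖ₑ ≤
      T.indicator (uncurry f) (h, x) := by
    intro x h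
    by_cases h0 : errDensity ψ Φ G u z q (x, x + h) = 0
    · simp [h0]
    obtain ⟨h1, h2, h3⟩ := errDensity_ne_zero hL h0
    have hmem : (h, x) ∈ T := ⟨by simpa using h3, h1, h2⟩
    rw [indicator_of_mem hmem]
    have := abs_errDensity_le (u := u) (z := z) (q := q) hψ0 hψ1 hψ.differentiable hΦ hG hη hη1 h3
    rw [← ofReal_norm, norm_eq_abs]
    refine (ofReal_le_ofReal this).trans_eq ?_
    have hρ0 : 0 ≤ ρ := (norm_nonneg _).trans h3
    simp only [Function.uncurry_apply_pair, hf, oscDensity, sizeDensity]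
    have h32 : (0 : ℝ) ≤ 3 / 2 := by norm_num
    simp only [← ofReal_norm_pow, ← ofReal_norm_rpow _ h32, norm_eq_abs]
    iterate 4 rw [← ofReal_add (by positivity) (by positivity)]
    rw [← ofReal_mul (by positivity), ← ofReal_mul (by positivity),
      ← ofReal_add (by positivity) (by positivity), ← ofReal_mul (by positivity)]
  calc ∫⁻ p, ‖errDensity ψ Φ G u z q p‖ₑ ∂vol₂
      ≤ ∫⁻ x, ∫⁻ y, ‖errDensity ψ Φ G u z q (x, y)‖ₑ := lintegral_prod_le _
    _ = ∫⁻ x, ∫⁻ h, ‖errDensity ψ Φ G u z q (x, x + h)‖ₑ := by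
        refine lintegral_congr fun x => ?_
        exact (lintegral_add_left_eq_self (fun y => ‖errDensity ψ Φ G u z q (x, y)‖ₑ) x).symm
    _ ≤ ∫⁻ x, ∫⁻ h, T.indicator (uncurry f) (h, x) :=
        lintegral_mono fun x => lintegral_mono fun h => hbound x h
    _ = ∫⁻ h, ∫⁻ x, T.indicator (uncurry f) (h, x) :=
        lintegral_lintegral_swap ((hfm.indicator hT).comp measurable_swap).aemeasurable
    _ = _ := by
        rw [← lintegral_indicator measurableSet_closedBall]
        refine lintegral_congr fun h => ?_
        by_cases hh : h ∈ closedBall (0 : E3) ρ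
        · rw [indicator_of_mem hh, ← lintegral_indicator (measurableSet_shiftDomain hD h)]
          refine lintegral_congr fun x => ?_
          by_cases hx : x ∈ shiftDomain D h
          · rw [indicator_of_mem hx, indicator_of_mem (show (h, x) ∈ T from ⟨hh, hx⟩)]; rfl
          · rw [indicator_of_notMem hx, indicator_of_notMem (fun hc => hx hc.2)]
        · rw [indicator_of_notMem hh]
          have : ∀ x, T.indicator (uncurry f) (h, x) = 0 := fun x =>
            indicator_of_notMem (fun hc => hh hc.1) _
          simp [this]

end Density

/-! ### The balance in expectation -/

/-- The mean of a kernel is a multiple of the identity. -/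
lemma IsKernel.integral_apply {Φ : E3 → E3 →L[ℝ] E3} {G : E3 → ℝ} {ρ : ℝ} (hK : IsKernel ρ Φ G)
    (b : E3) : ∫ k, Φ k b = (∫ k, G k) • b := by
  have hc : ∀ i : Fin 3, SmoothIn (closedBall (0 : E3) ρ) fun k => Φ k b i := fun i =>
    (hK.smooth.clm_comp (ContinuousLinearMap.apply ℝ E3 b)).clm_comp (proj (𝕜 := ℝ) i : E3 →L[ℝ] ℝ)
  have hfd : ∀ (i : Fin 3) (k : E3), fderiv ℝ (fun k => Φ k b i) k (basisVec i) =
      (fderiv ℝ Φ k (basisVec i) b) i := by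
    intro i k
    rw [HasFDerivAt.fderiv (f := fun k => Φ k b i) (((proj (𝕜 := ℝ) i : E3 →L[ℝ] ℝ).comp
      (ContinuousLinearMap.apply ℝ E3 b)).hasFDerivAt.comp k
      (hK.smooth.differentiable k).hasFDerivAt)]
    rfl
  ext j
  have hj : ContDiff ℝ (⊤ : ℕ∞) fun k : E3 => k j := (proj (𝕜 := ℝ) j : E3 →L[ℝ] ℝ).contDiff
  have hprod : ∀ {g : E3 → ℝ}, SmoothIn (closedBall (0 : E3) ρ) g → ∀ a : E3,
      ∫ k : E3, k j * fderiv ℝ g k a = -∫ k, a j * g k := by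
    intro g hg a
    have h : ∀ k, fderiv ℝ (fun k : E3 => k j) k a = a j := fun k => by
      rw [HasFDerivAt.fderiv (f := fun k : E3 => k j) (proj (𝕜 := ℝ) j : E3 →L[ℝ] ℝ).hasFDerivAt]
      rfl
    rw [integral_mul_fderiv_eq_neg_fderiv_mul_of_integrable _
      ((hg.fderiv_apply a).smul_left hj).integrable (hg.smul_left hj).integrable
      (fun x _ => hj.differentiable (by simp) x) fun x _ => hg.differentiable x]
    · simp only [h]
    · simpa only [h] using hg.integrable.const_mul (a j)
  have e1 : (∫ k, Φ k b) j = ∫ k, Φ k b j := ((proj (𝕜 := ℝ) j : E3 →L[ℝ] ℝ).integral_comp_comm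
    (hK.smooth.clm_comp (ContinuousLinearMap.apply ℝ E3 b)).integrable).symm
  have h3 : ∑ i : Fin 3, ∫ k : E3, k j * (fderiv ℝ Φ k (basisVec i) b) i =
      ∫ k : E3, k j * fderiv ℝ G k b := by
    rw [← integral_finsetSum]
    · simp only [← mul_sum, hK.div]
    · intro i _
      have := ((hc i).fderiv_apply (basisVec i)).smul_left hj
      simp only [hfd] at this
      exact this.integrable
  simp only [← hfd, hprod (hc _), hprod hK.smoothG, integral_const_mul] at h3
  rw [Finset.sum_eq_single j (fun i _ hi => by simp [basisVec, hi.symm]) (by simp)] at h3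
  simp only [basisVec, PiLp.single_apply, if_true, one_mul, neg_inj] at h3
  rw [e1, h3, PiLp.smul_apply, smul_eq_mul, mul_comm]

section Main

variable {D : Set E3} {u z : E3 → E3}
  {q : E3 → ℝ} {ψ : E3 → ℝ} {Φ : E3 → E3 →L[ℝ] E3} {G : E3 → ℝ} {ρ : ℝ}

/-- The density of the energy flux and of twice the energy input. -/
def fluxDensity (ψ : E3 → ℝ) (u z : E3 → E3) (q : E3 → ℝ) (x : E3) : ℝ :=
  (‖u x‖ ^ 2 + 2 * q x) * fderiv ℝ ψ x (u x) + 2 * (ψ x * ⟪u x, z x⟫)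

lemma integral_mainDensity [IsFiniteMeasure (volume.restrict D)]
    (hL : IsLocalized D u z q ψ Φ G ρ) : Integrable (mainDensity ψ Φ G u z q) vol₂ ∧
    ∫ p, mainDensity ψ Φ G u z q p ∂vol₂ = (∫ k, G k) * ∫ x, fluxDensity ψ u z q x := by
  have hK := hL.ker
  have h1 := hL.state.sizeLE_u.1
  have hint : Integrable (mainDensity ψ Φ G u z q) vol₂ :=
    (((hL.dpsi_bil h1 h1 h1).add (hL.pressure_vloc h1)).add (hL.pressure_scalar
      hL.state.sizeLE_q.1)).add ((hL.psi_bil hL.state.sizeLE_z.1 h1).const_mul 2)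
  refine ⟨hint, ?_⟩
  rw [integral_prod _ hint, ← integral_const_mul]
  refine integral_congr_ae (ae_of_all _ fun x => ?_)
  have hΦi : ∀ b, Integrable fun k => Φ k b := fun b =>
    (hK.smooth.clm_comp (ContinuousLinearMap.apply ℝ E3 b)).integrable
  have hb : ∀ a b, ∫ y, bil Φ (x - y) a b = (∫ k, G k) * ⟪a, b⟫ := fun a b => by
    rw [integral_sub_left_eq_self (fun k => bil Φ k a b) volume x]
    simp only [bil]
    rw [integral_inner (hΦi b), hK.integral_apply, inner_smul_right]
  have hbi : ∀ a b, Integrable fun y => bil Φ (x - y) a b := fun a b =>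
    Integrable.comp_sub_left (f := fun k => bil Φ k a b) ((hΦi b).const_inner a) x
  have hl : ∀ (l : E3 →L[ℝ] ℝ) b, ∫ y, l (Φ (x - y) b) = (∫ k, G k) * l b := fun l b => by
    rw [integral_sub_left_eq_self (fun k => l (Φ k b)) volume x, l.integral_comp_comm (hΦi b),
      hK.integral_apply, map_smul, smul_eq_mul]
  have hli : ∀ (l : E3 →L[ℝ] ℝ) b, Integrable fun y => l (Φ (x - y) b) := fun l b =>
    Integrable.comp_sub_left (f := fun k => l (Φ k b)) (l.integrable_comp (hΦi b)) x
  have hg : ∫ y, G (x - y) = ∫ k, G k := integral_sub_left_eq_self G volume x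
  have hgi : Integrable fun y => G (x - y) := hK.smoothG.integrable.comp_sub_left x
  have j1 := (hbi (u x) (u x)).const_mul (fderiv ℝ ψ x (u x))
  have j2 := (hli (fderiv ℝ ψ x) (u x)).const_mul (q x)
  have j3 := (hgi.const_mul (fderiv ℝ ψ x (u x))).const_mul (q x)
  have j4 := ((hbi (z x) (u x)).const_mul (ψ x)).const_mul 2
  have e := integral_add' ((j1.add j2).add j3) j4
  rw [integral_add' (j1.add j2) j3, integral_add' j1 j2] at e
  refine (e :).trans ?_
  simp only [integral_const_mul, hb, hl, hg, fluxDensity, real_inner_self_eq_norm_sq,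
    real_inner_comm]
  ring

lemma abs_visc_le [IsFiniteMeasure (volume.restrict D)]
    (hD : MeasurableSet D) {S : Set E3} (hψ : SmoothIn D ψ) (hΦ : SmoothIn S Φ) {B M : ℝ}
    (hB : C2Bound ψ B) (hM : C2Bound Φ M) (w : L2Vec D) :
    |visc ψ Φ w| ≤ 24 * (B * M) * (∫ x in D, ‖w x‖) ^ 2 := by
  have hu := integrable_fld hD w
  have hI : ∫ y, ‖fld w y‖ = ∫ x in D, ‖w x‖ := by
    rw [setIntegral_fld_eq hD w (f := fun _ (b : E3) => ‖b‖) fun _ => norm_zero]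
  have key : ∀ v : E3 → E3, FieldBound v (12 * (B * M * ∫ y, ‖fld w y‖)) →
      |∫ x in D, ⟪w x, lapField v x⟫| ≤ 12 * (B * M) * (∫ x in D, ‖w x‖) ^ 2 := by
    intro v hv
    rw [← norm_eq_abs]
    refine (norm_integral_le_of_norm_le ((Lp.integrable_restrict w).norm.mul_const
      (12 * (B * M * ∫ y, ‖fld w y‖))) (ae_of_all _ fun x => ?_)).trans_eq ?_
    · refine (norm_inner_le_norm _ _).trans ?_
      gcongr
      exact hv.lap x
    · rw [integral_mul_const, hI]; ring
  refine (abs_add_le _ _).trans ((add_le_add (key _ (fieldBound_vloc hψ hΦ hB hM hu))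
    (key _ (fieldBound_vstar hψ hΦ hB hM hu))).trans_eq ?_)
  ring

end Main

/-! ### The averaged two-point balance -/

lemma enorm_sq_eq {D : Set E3} (w : L2Vec D) : ‖w‖ₑ ^ 2 = ∫⁻ x in D, ‖w x‖ₑ ^ 2 := by
  rw [← ofReal_norm_pow, ← setIntegral_norm_sq,
    ofReal_integral_eq_lintegral_ofReal (integrable_norm_sq w) (ae_of_all _ fun x => by positivity)]
  simp only [ofReal_norm_pow]

lemma enorm_sq_le {D : Set E3} (w : L2Vec D) : ‖w‖ₑ ^ 2 ≤ volume D + ∫⁻ x in D, ‖w x‖ₑ ^ 3 := by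
  have h : ∀ t : ℝ≥0∞, t ^ 2 ≤ 1 + t ^ 3 := fun t => by
    simpa using le_one_add_pow (t := t) (r := 2) (s := 3) (by norm_num) (by norm_num)
  rw [enorm_sq_eq]
  refine (lintegral_mono fun x => h _).trans_eq ?_
  rw [lintegral_add_left measurable_const]
  simp

lemma lintegral_const_mul_add_mul {α : Type*} {mα : MeasurableSpace α} {μ : Measure α}
    {f g : α → ℝ≥0∞} (hf : Measurable f) (hg : Measurable g) (c₀ c₁ c₂ : ℝ≥0∞) :
    ∫⁻ x, c₀ * (c₁ * f x + c₂ * g x) ∂μ = c₀ * (c₁ * (∫⁻ x, f x ∂μ) + c₂ * ∫⁻ x, g x ∂μ) := by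
  rw [lintegral_const_mul _ (by fun_prop), lintegral_add_left (by fun_prop),
    lintegral_const_mul _ hf, lintegral_const_mul _ hg]

section Moments

variable {D : Set E3} [IsFiniteMeasure (volume.restrict D)]

lemma setLIntegral_fld_eq {F : Type*} [NormedAddCommGroup F] [NormedSpace ℝ F] [CompleteSpace F]
    {r : ℝ≥0∞} [hr : Fact (1 ≤ r)] (hD : MeasurableSet D) (w : Lp F r (volume.restrict D : Measure E3))
    {f : F → ℝ≥0∞} (hf : f 0 = 0) : ∫⁻ x in D, f (w x) = ∫⁻ x, f (fld w x) := by
  rw [← lintegral_indicator hD]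
  refine lintegral_congr_ae ?_
  filter_upwards [fld_ae_eq hD w] with x hx
  rw [hx]
  by_cases h : x ∈ D
  · simp [h]
  · simp [h, hf]

lemma increment_ae_eq {F : Type*} [NormedAddCommGroup F] [NormedSpace ℝ F] [CompleteSpace F]
    {r : ℝ≥0∞} [hr : Fact (1 ≤ r)] (hD : MeasurableSet D) (w : Lp F r (volume.restrict D : Measure E3))
    (h : E3) : increment D w h =ᵐ[volume] fun x => fld w (x + h) - fld w x := by
  have h1 := (measurePreserving_add_right (volume : Measure E3) h).quasiMeasurePreserving.ae
    (fld_ae_eq hD w)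
  filter_upwards [fld_ae_eq hD w, h1] with x hx hx'
  rw [increment, hx, hx']

lemma isState_fld (hD : MeasurableSet D) {w ζ : L2Vec D} {π : L32 D} (hw : w ∈ solH D)
    (h1 : ∫⁻ x, ‖fld w x‖ₑ ^ 3 ≠ ⊤) (h2 : ∫⁻ x, ‖fld ζ x‖ₑ ^ (3 / 2 : ℝ) ≠ ⊤)
    (h3 : ∫⁻ x, ‖fld π x‖ₑ ^ (3 / 2 : ℝ) ≠ ⊤) : IsState D (fld w) (fld ζ) (fld π) := by
  have mw := measurable_fld_right hD w
  have mz := measurable_fld_right hD ζ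
  have mq := measurable_fld_L32_right hD π
  have i : ∀ {F : Type} [NormedAddCommGroup F] [MeasurableSpace F] [OpensMeasurableSpace F]
      {f : E3 → F} {r : ℝ}, 0 ≤ r → Measurable f → ∫⁻ x, ‖f x‖ₑ ^ r ≠ ⊤ →
      Integrable fun x => ‖f x‖ ^ r := fun {F} _ _ _ {f r} hr hf h => by
    refine ⟨(hf.norm.pow_const r).aestronglyMeasurable, ?_⟩
    rw [hasFiniteIntegral_iff_ofReal (ae_of_all _ fun x => by positivity)]
    simp only [ofReal_norm_rpow _ hr]
    exact h.lt_top
  have h0 : (0 : ℝ) ≤ 3 / 2 := by norm_num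
  refine ⟨mw, mz, mq, ?_, fun g hg => ?_⟩
  · have i1 := i (r := 3) (by norm_num) mw (by exact_mod_cast h1)
    have i2 := i h0 mz h2
    have i3 := i h0 mq h3
    have hm : Measurable fun x => size (fld w) (fld ζ) (fld π) x ^ 3 := by unfold size; fun_prop
    refine (((i1.add i2).add i3).const_mul 9).mono' hm.aestronglyMeasurable (ae_of_all _ fun x => ?_)
    rw [norm_of_nonneg (pow_nonneg (size_bounds _ _ _ _).1 3)]
    simp only [Pi.add_apply, rpow_three_halves (norm_nonneg _), Real.rpow_ofNat]
    have a0 := norm_nonneg (fld w x)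
    have b0 := sqrt_nonneg ‖fld ζ x‖
    have c0 := sqrt_nonneg ‖fld π x‖
    unfold size
    rw [← norm_eq_abs]
    generalize ‖fld w x‖ = a at *
    generalize √‖fld ζ x‖ = b at *
    generalize √‖fld π x‖ = c at *
    nlinarith [mul_nonneg (add_nonneg a0 b0) (sq_nonneg (a - b)),
      mul_nonneg (add_nonneg a0 c0) (sq_nonneg (a - c)),
      mul_nonneg (add_nonneg b0 c0) (sq_nonneg (b - c)),
      mul_nonneg a0 (sq_nonneg (b - c)), mul_nonneg b0 (sq_nonneg (a - c)),
      mul_nonneg c0 (sq_nonneg (a - b))]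
  · rw [← setIntegral_fld_eq hD w (f := fun x b => fderiv ℝ g x b) fun x => by simp]
    exact setIntegral_fderiv_solH hg hw

end Moments

section Expectation

variable {D : Set E3} [IsFiniteMeasure (volume.restrict D)] {Ω : Type*}
  {mΩ : MeasurableSpace Ω} {P : Measure Ω}
  {w ζ : Ω → L2Vec D} {π : Ω → L32 D}

lemma measurable_fld_comp (hD : MeasurableSet D) (hw : Measurable w) :
    Measurable fun r : Ω × E3 => fld (w r.1) r.2 :=
  (measurable_fld_L2Vec hD).comp ((hw.comp measurable_fst).prodMk measurable_snd)

lemma measurable_fld_comp_L32 (hD : MeasurableSet D) (hπ : Measurable π) :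
    Measurable fun r : Ω × E3 => fld (π r.1) r.2 :=
  (measurable_fld_L32 hD).comp ((hπ.comp measurable_fst).prodMk measurable_snd)

/-- A random state whose moments are bounded. -/
structure HasMoments (P : Measure Ω) (w ζ : Ω → L2Vec D) (π : Ω → L32 D) (K : ℝ≥0∞) : Prop where
  meas : MeasurableSet D
  ne_top : K ≠ ⊤
  mw : Measurable w
  mz : Measurable ζ
  mq : Measurable π
  le_w : ∫⁻ ω, (∫⁻ x, ‖fld (w ω) x‖ₑ ^ 3) ∂P ≤ K
  le_z : ∫⁻ ω, (∫⁻ x, ‖fld (ζ ω) x‖ₑ ^ (3 / 2 : ℝ)) ∂P ≤ K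
  le_q : ∫⁻ ω, (∫⁻ x, ‖fld (π ω) x‖ₑ ^ (3 / 2 : ℝ)) ∂P ≤ K

/-- The mean oscillation of a random state over a shift. -/
def meanOsc (P : Measure Ω) (w : Ω → L2Vec D) (π : Ω → L32 D) (h : E3) : ℝ≥0∞ :=
  ∫⁻ ω, (∫⁻ x in shiftDomain D h, oscDensity (fld (w ω)) (fld (π ω)) h x) ∂P

/-- A cutoff bounded by `B` together with its derivative. -/
structure CutoffLE (D : Set E3) (ψ : E3 → ℝ) (B : ℝ) : Prop where
  smooth : SmoothIn D ψ
  value : ∀ x, |ψ x| ≤ B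
  deriv : ∀ x, ‖fderiv ℝ ψ x‖ ≤ B

variable {K : ℝ≥0∞} {B : ℝ}

lemma HasMoments.measurable (hM : HasMoments P w ζ π K) :
    (Measurable fun ω => ∫⁻ x, ‖fld (w ω) x‖ₑ ^ 3) ∧
    (Measurable fun ω => ∫⁻ x, ‖fld (ζ ω) x‖ₑ ^ (3 / 2 : ℝ)) ∧
    Measurable fun ω => ∫⁻ x, ‖fld (π ω) x‖ₑ ^ (3 / 2 : ℝ) :=
  ⟨((measurable_fld_comp hM.meas hM.mw).enorm.pow_const 3).lintegral_prod_right',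
    ((measurable_fld_comp hM.meas hM.mz).enorm.pow_const _).lintegral_prod_right',
    ((measurable_fld_comp_L32 hM.meas hM.mq).enorm.pow_const _).lintegral_prod_right'⟩

lemma HasMoments.ae_isState (hM : HasMoments P w ζ π K) (hsol : ∀ ω, w ω ∈ solH D) :
    ∀ᵐ ω ∂P, IsState D (fld (w ω)) (fld (ζ ω)) (fld (π ω)) := by
  have ⟨n1, n2, n3⟩ := hM.measurable
  filter_upwards [ae_lt_top n1 (ne_top_of_le_ne_top hM.ne_top hM.le_w),
    ae_lt_top n2 (ne_top_of_le_ne_top hM.ne_top hM.le_z),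
    ae_lt_top n3 (ne_top_of_le_ne_top hM.ne_top hM.le_q)] with ω h1 h2 h3
  exact isState_fld hM.meas (hsol ω) h1.ne h2.ne h3.ne

lemma lintegral_sizeDensity_le (hM : HasMoments P w ζ π K) (h : E3) :
    ∫⁻ ω, (∫⁻ x, sizeDensity (fld (w ω)) (fld (ζ ω)) (fld (π ω)) h x) ∂P ≤ 4 * K := by
  have ⟨n1, n2, n3⟩ := hM.measurable
  have e1 : ∀ ω, ∫⁻ x, sizeDensity (fld (w ω)) (fld (ζ ω)) (fld (π ω)) h x =
      (∫⁻ x, ‖fld (w ω) x‖ₑ ^ 3) + (∫⁻ x, ‖fld (w ω) x‖ₑ ^ 3)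
      + (∫⁻ x, ‖fld (π ω) x‖ₑ ^ (3 / 2 : ℝ)) + ∫⁻ x, ‖fld (ζ ω) x‖ₑ ^ (3 / 2 : ℝ) := by
    intro ω
    have m1 := measurable_fld_right hM.meas (w ω)
    have m2 := measurable_fld_L32_right hM.meas (π ω)
    simp only [sizeDensity]
    rw [lintegral_add_left (by fun_prop), lintegral_add_left (by fun_prop),
      lintegral_add_left (by fun_prop),
      lintegral_add_right_eq_self (fun x => ‖fld (w ω) x‖ₑ ^ 3) h]
  simp only [e1]
  rw [lintegral_add_left (by fun_prop), lintegral_add_left (by fun_prop),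
    lintegral_add_left (by fun_prop)]
  calc _ ≤ K + K + K + K := by gcongr; exacts [hM.le_w, hM.le_w, hM.le_q, hM.le_z]
    _ = 4 * K := by ring

/-- Fubini's theorem for sums of densities with bounds that are uniform in the shift. -/
lemma lintegral_shift_le [SFinite P] {S : E3 → Set E3}
    (hS : MeasurableSet {r : E3 × E3 | r.2 ∈ S r.1})
    {o s : Ω → E3 → E3 → ℝ≥0∞} (mo : Measurable fun r : (Ω × E3) × E3 => o r.1.1 r.1.2 r.2)
    (ms : Measurable fun r : (Ω × E3) × E3 => s r.1.1 r.1.2 r.2) (c₀ c₁ c₂ : ℝ≥0∞)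
    {T U : ℝ≥0∞} {ρ : ℝ}
    (hT : ∀ h ∈ closedBall (0 : E3) ρ, ∫⁻ ω, (∫⁻ x in S h, o ω h x) ∂P ≤ T)
    (hU : ∀ h ∈ closedBall (0 : E3) ρ, ∫⁻ ω, (∫⁻ x in S h, s ω h x) ∂P ≤ U) :
    ∫⁻ ω, (∫⁻ h in closedBall (0 : E3) ρ, ∫⁻ x in S h,
        c₀ * (c₁ * o ω h x + c₂ * s ω h x)) ∂P ≤
      c₀ * (c₁ * T + c₂ * U) * volume (closedBall (0 : E3) ρ) := by
  have hset : MeasurableSet {r : (Ω × E3) × E3 | r.2 ∈ S r.1.2} :=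
    hS.preimage (f := fun r : (Ω × E3) × E3 => (r.1.2, r.2)) (by fun_prop)
  have hSh : ∀ h, MeasurableSet (S h) := fun h =>
    hS.preimage (f := fun x : E3 => (h, x)) (by fun_prop)
  have int : ∀ {f : (Ω × E3) × E3 → ℝ≥0∞}, Measurable f →
      Measurable fun r : Ω × E3 => ∫⁻ x in S r.2, f (r, x) := by
    intro f hf
    have h1 : Measurable fun r : Ω × E3 => ∫⁻ x,
        {r : (Ω × E3) × E3 | r.2 ∈ S r.1.2}.indicator f (r, x) :=
      (hf.indicator hset).lintegral_prod_right'
    convert h1 using 2 with r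
    rw [← lintegral_indicator (hSh r.2)]
    rfl
  have mtot : Measurable fun r : (Ω × E3) × E3 =>
      c₀ * (c₁ * o r.1.1 r.1.2 r.2 + c₂ * s r.1.1 r.1.2 r.2) :=
    ((mo.const_mul c₁).add (ms.const_mul c₂)).const_mul c₀
  rw [lintegral_lintegral_swap (int mtot).aemeasurable, ← setLIntegral_const]
  refine setLIntegral_mono' measurableSet_closedBall fun h hh => ?_
  have mo' : ∀ ω, Measurable fun x => o ω h x := fun ω =>
    mo.comp (f := fun x : E3 => ((ω, h), x)) (by fun_prop)
  have ms' : ∀ ω, Measurable fun x => s ω h x := fun ω =>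
    ms.comp (f := fun x : E3 => ((ω, h), x)) (by fun_prop)
  have e1 : ∀ ω, ∫⁻ x in S h, c₀ * (c₁ * o ω h x + c₂ * s ω h x) =
      c₀ * (c₁ * (∫⁻ x in S h, o ω h x) + c₂ * ∫⁻ x in S h, s ω h x) := fun ω =>
    lintegral_const_mul_add_mul (mo' ω) (ms' ω) _ _ _
  have mI : Measurable fun ω => ∫⁻ x in S h, o ω h x :=
    (int mo).comp (f := fun ω => (ω, h)) (by fun_prop)
  have mJ : Measurable fun ω => ∫⁻ x in S h, s ω h x :=
    (int ms).comp (f := fun ω => (ω, h)) (by fun_prop)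
  simp only [e1]
  rw [lintegral_const_mul_add_mul mI mJ]
  gcongr
  · exact hT h hh
  · exact hU h hh

variable [IsProbabilityMeasure P]

variable {ψ : E3 → ℝ} {Φ : E3 → E3 →L[ℝ] E3} {G : E3 → ℝ} {ρ : ℝ}

lemma lintegral_lintegral_errDensity_le (hM : HasMoments P w ζ π K) {τ : ℝ≥0∞}
    (hsol : ∀ ω, w ω ∈ solH D) (hτ : ∀ h ∈ closedBall (0 : E3) ρ, meanOsc P w π h ≤ τ)
    {Λ η : ℝ} (hψ : CutoffLE D ψ B) (hK : IsKernel ρ Φ G) (hρ : cthickening ρ (tsupport ψ) ⊆ D) (hΦ : ∀ k, ‖Φ k‖ ≤ Λ)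
    (hG : ∀ k, |G k| ≤ Λ) (hη : 0 < η) (hη1 : η ≤ 1) :
    ∫⁻ ω, (∫⁻ p, ‖errDensity ψ Φ G (fld (w ω)) (fld (ζ ω)) (fld (π ω)) p‖ₑ ∂vol₂) ∂P ≤
      ofReal (B * Λ) * (ofReal (5 * (η⁻¹) ^ 2) * τ + ofReal (3 * η + ρ) * (4 * K)) *
        volume (closedBall (0 : E3) ρ) := by
  have hD := hM.meas
  have mw := measurable_fld_comp hD hM.mw
  have mz := measurable_fld_comp hD hM.mz
  have mq := measurable_fld_comp_L32 hD hM.mq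
  refine (lintegral_mono_ae ((hM.ae_isState hsol).mono fun ω hω => lintegral_errDensity_le
    ⟨hD, hω, hψ.smooth, hK, hρ⟩ hψ.value hψ.deriv hΦ hG hη hη1)).trans
    (lintegral_shift_le (measurableSet_shiftDomain_prod hD) ?_ ?_ _ _ _ hτ fun h _ =>
      (lintegral_mono fun ω => setLIntegral_le_lintegral _ _).trans (lintegral_sizeDensity_le hM h))
  · have a1 := mw.comp (f := fun r : (Ω × E3) × E3 => (r.1.1, r.2 + r.1.2)) (by fun_prop)
    have a2 := mw.comp (f := fun r : (Ω × E3) × E3 => (r.1.1, r.2)) (by fun_prop)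
    have a3 := mq.comp (f := fun r : (Ω × E3) × E3 => (r.1.1, r.2 + r.1.2)) (by fun_prop)
    have a4 := mq.comp (f := fun r : (Ω × E3) × E3 => (r.1.1, r.2)) (by fun_prop)
    exact ((a1.sub a2).enorm.pow_const 3).add ((a3.sub a4).enorm.pow_const _)
  · have a1 := mw.comp (f := fun r : (Ω × E3) × E3 => (r.1.1, r.2 + r.1.2)) (by fun_prop)
    have a2 := mw.comp (f := fun r : (Ω × E3) × E3 => (r.1.1, r.2)) (by fun_prop)
    have a4 := mq.comp (f := fun r : (Ω × E3) × E3 => (r.1.1, r.2)) (by fun_prop)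
    have a5 := mz.comp (f := fun r : (Ω × E3) × E3 => (r.1.1, r.2)) (by fun_prop)
    exact (((a2.enorm.pow_const 3).add (a1.enorm.pow_const 3)).add (a4.enorm.pow_const _)).add
      (a5.enorm.pow_const _)

/-- The cubic form of the increments of a field, integrated against a kernel. -/
def cubicFlux (ψ : E3 → ℝ) (Φ : E3 → E3 →L[ℝ] E3) (u : E3 → E3) : ℝ :=
  ∫ p : E3 × E3, 1 / 2 * (ψ p.1 * tri Φ (p.1 - p.2) (u p.2 - u p.1) (u p.2 - u p.1)
    (u p.2 - u p.1)) ∂vol₂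

lemma balance_eq_flux {w ζ : L2Vec D} {π : L32 D}
    (hL : IsLocalized D (fld w) (fld ζ) (fld π) ψ Φ G ρ) (ν : ℝ) :
    balance ν ψ Φ w ζ π = cubicFlux ψ Φ (fld w)
      + (∫ k, G k) * (∫ x, fluxDensity ψ (fld w) (fld ζ) (fld π) x)
      + (∫ p, errDensity ψ Φ G (fld w) (fld ζ) (fld π) p ∂vol₂) + ν * visc ψ Φ w := by
  have m : SizeLE (fld w) (fld ζ) (fld π) 1 fun p => fld w p.2 - fld w p.1 := by
    have ⟨m1, m2⟩ := hL.state.sizeLE_u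
    have s := size_bounds (fld w) (fld ζ) (fld π)
    refine ⟨m2.1.sub m1.1, fun p => (norm_sub_le _ _).trans ?_⟩
    linarith [(s p.1).2.1, (s p.2).2.1]
  have i1 := (hL.psi_tri m m m).const_mul (1 / 2)
  have i2 := integral_mainDensity hL
  have i3 : Integrable (errDensity ψ Φ G (fld w) (fld ζ) (fld π)) vol₂ := by
    refine (((integral_twoPoint hL).1.sub i1).sub i2.1).congr (ae_of_all _ fun p => ?_)
    simp only [Pi.sub_apply, twoPoint_eq]
    ring
  have e := integral_add' (i1.add i2.1) i3
  rw [integral_add' i1 i2.1, i2.2] at e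
  rw [balance_eq hL, integral_congr_ae (ae_of_all _ fun p => twoPoint_eq p)]
  exact congrArg (· + _) e

lemma enorm_integral_flux_le (hM : HasMoments P w ζ π K) {τ : ℝ≥0∞}
    (hsol : ∀ ω, w ω ∈ solH D) (hτ : ∀ h ∈ closedBall (0 : E3) ρ, meanOsc P w π h ≤ τ)
    {Λ η ν : ℝ} (hν : 0 ≤ ν) (hψ : CutoffLE D ψ B) (hK : IsKernel ρ Φ G)
    (hρ : cthickening ρ (tsupport ψ) ⊆ D) (hΦ : ∀ k, ‖Φ k‖ ≤ Λ) (hG : ∀ k, |G k| ≤ Λ)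
    (hη : 0 < η) (hη1 : η ≤ 1) {B₂ M C : ℝ} (hB₂ : C2Bound ψ B₂) (hC2 : C2Bound Φ M)
    (hC : ∀ w : L2Vec D, ∫ x in D, ‖w x‖ ≤ C * ‖w‖)
    (hint : Integrable (fun ω => balance ν ψ Φ (w ω) (ζ ω) (π ω)) P)
    (hbal : ∫ ω, balance ν ψ Φ (w ω) (ζ ω) (π ω) ∂P = 0) :
    ‖∫ ω, (cubicFlux ψ Φ (fld (w ω))
      + (∫ k, G k) * ∫ x, fluxDensity ψ (fld (w ω)) (fld (ζ ω)) (fld (π ω)) x) ∂P‖ₑ ≤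
      ofReal (B * Λ) * (ofReal (5 * (η⁻¹) ^ 2) * τ + ofReal (3 * η + ρ) * (4 * K)) *
        volume (closedBall (0 : E3) ρ)
      + ofReal (ν * M) * (ofReal (24 * B₂ * C ^ 2) * (volume D + K)) := by
  by_cases hT : Integrable (fun ω => cubicFlux ψ Φ (fld (w ω))
      + (∫ k, G k) * ∫ x, fluxDensity ψ (fld (w ω)) (fld (ζ ω)) (fld (π ω)) x) P
  swap
  · rw [integral_undef hT]; simp
  have mI := hM.measurable.1
  have hB20 := hB₂.nonneg
  have hM0 := hC2.nonneg
  rw [← sub_zero (∫ ω, _ ∂P), ← hbal, ← integral_sub hT hint]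
  let b : Ω → ℝ≥0∞ := fun ω => ofReal (ν * M) * (ofReal (24 * B₂ * C ^ 2) *
    (volume D + ∫⁻ x, ‖fld (w ω) x‖ₑ ^ 3))
  have hb : Measurable b := by fun_prop
  have hvisc : ∀ ω, ‖ν * visc ψ Φ (w ω)‖ₑ ≤ b ω := by
    intro ω
    have h3 : |ν * visc ψ Φ (w ω)| ≤ (ν * M) * ((24 * B₂ * C ^ 2) * ‖w ω‖ ^ 2) := by
      have h0 : 0 ≤ ∫ x in D, ‖w ω x‖ := integral_nonneg fun _ => norm_nonneg _
      rw [abs_mul, abs_of_nonneg hν]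
      calc ν * |visc ψ Φ (w ω)| ≤ ν * (24 * (B₂ * M) * (C * ‖w ω‖) ^ 2) := by
            grw [abs_visc_le hM.meas hψ.smooth hK.smooth hB₂ hC2 (w ω), hC]
        _ = _ := by ring
    rw [← ofReal_norm, norm_eq_abs]
    refine (ofReal_le_ofReal h3).trans ?_
    rw [ofReal_mul (p := ν * M) (by positivity), ofReal_mul (p := 24 * B₂ * C ^ 2) (by positivity),
      ofReal_norm_pow]
    simp only [b]
    gcongr
    refine (enorm_sq_le (w ω)).trans_eq ?_
    rw [setLIntegral_fld_eq hM.meas (w ω) (f := fun b : E3 => ‖b‖ₑ ^ 3) (by simp)]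
  refine ((enorm_integral_le_lintegral_enorm _).trans
    (lintegral_mono_ae ((hM.ae_isState hsol).mono fun ω hω => ?_))).trans ((lintegral_add_right _
      hb).trans_le (add_le_add (lintegral_lintegral_errDensity_le hM hsol hτ hψ hK hρ hΦ hG hη hη1) ?_))
  · rw [balance_eq_flux ⟨hM.meas, hω, hψ.smooth, hK, hρ⟩ ν]
    have : ∀ a b c d : ℝ, a + b - (a + b + c + d) = -(c + d) := fun a b c d => by ring
    rw [this, enorm_neg]
    exact (enorm_add_le _ _).trans (add_le_add (enorm_integral_le_lintegral_enorm _) (hvisc ω))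
  · rw [lintegral_const_mul _ (by fun_prop), lintegral_const_mul _ (by fun_prop),
      lintegral_add_left (by fun_prop), lintegral_const, measure_univ, mul_one]
    gcongr
    exact hM.le_w

end Expectation

/-! ### Averages over short time intervals -/

section TimeAverages

lemma tendsto_eLpNorm_translate {V : Type*} [NormedAddCommGroup V] {f : ℝ → V}
    (hf : MemLp f 2 volume) :
    Tendsto (fun h : ℝ => eLpNorm (fun s => f (s + h) - f s) 2 volume) (𝓝 0) (𝓝 0) := by
  set F : Lp V 2 (volume : Measure ℝ) := hf.toLp f with hF
  have : Fact ((2 : ℝ≥0∞) ≠ ∞) := ⟨by norm_num⟩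
  have h1 : Continuous fun h : ℝ => DomAddAct.mk h +ᵥ F :=
    DomAddAct.continuous_mk.vadd continuous_const
  have h2 : Tendsto (fun h : ℝ => ‖(DomAddAct.mk h +ᵥ F) - F‖ₑ) (𝓝 0) (𝓝 0) := by
    have h3 : Continuous fun h : ℝ => ‖(DomAddAct.mk h +ᵥ F) - F‖ₑ := (h1.sub continuous_const).enorm
    have := h3.tendsto 0
    simpa using this
  refine h2.congr fun h => ?_
  rw [Lp.enorm_def]
  refine eLpNorm_congr_ae ?_
  have e1 : (DomAddAct.mk h +ᵥ F : Lp V 2 (volume : Measure ℝ)) =ᵐ[volume] fun s => f (s + h) := by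
    have := (measurePreserving_add_right (volume : Measure ℝ) h).quasiMeasurePreserving.ae_eq_comp
      hf.coeFn_toLp
    refine (Lp.coeFn_compMeasurePreserving F _).trans ?_
    refine EventuallyEq.trans ?_ this
    refine ae_of_all _ fun s => ?_
    simp [hF, add_comm]
  filter_upwards [Lp.coeFn_sub (DomAddAct.mk h +ᵥ F) F, e1, hf.coeFn_toLp] with s a1 a2 a3
  rw [a1, Pi.sub_apply, a2, a3]

lemma lintegral_enorm_mul_le {V : Type*} [NormedAddCommGroup V] {f g : ℝ → V} (hf : AEStronglyMeasurable f)
    (hg : AEStronglyMeasurable g) :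
    ∫⁻ s, ‖f s‖ₑ * ‖g s‖ₑ ≤ eLpNorm f 2 volume * eLpNorm g 2 volume := by
  have h := ENNReal.lintegral_mul_le_Lp_mul_Lq volume Real.HolderConjugate.two_two hf.enorm hg.enorm
  simpa [eLpNorm_eq_lintegral_rpow_enorm_toReal (p := 2) (by norm_num) (by norm_num)] using h

lemma intervalIntegrable_of_memLp_two {V : Type*} [NormedAddCommGroup V] {f : ℝ → V}
    (hf : MemLp f 2 volume) (a b : ℝ) : IntervalIntegrable f volume a b := by
  rw [intervalIntegrable_iff, IntegrableOn]
  have : IsFiniteMeasure ((volume : Measure ℝ).restrict (uIoc a b)) := by rw [uIoc]; infer_instance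
  exact (hf.restrict _).integrable (by norm_num)

lemma enorm_average_sub_le {V : Type*} [NormedAddCommGroup V] [NormedSpace ℝ V] {f : ℝ → V} (hf : MemLp f 2 volume) (B : V →L[ℝ] V →L[ℝ] ℝ)
    {g : ℝ} (hg1 : |g| ≤ 1) {δ : ℝ} (hδ : 0 < δ) (s : ℝ) :
    ‖g * (δ⁻¹ * ∫ r in s..s + δ, B (f r) (f (s + δ))) - g * B (f s) (f s)‖ₑ ≤
      ∫⁻ h in Ioc 0 δ, ofReal δ⁻¹ * (‖B‖ₑ * (‖f (s + h) - f s‖ₑ * ‖f (s + δ)‖ₑ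
        + ‖f s‖ₑ * ‖f (s + δ) - f s‖ₑ)) := by
  have e1 : ∫ r in s..s + δ, B (f r) (f (s + δ)) = ∫ h in (0 : ℝ)..δ, B (f (s + h)) (f (s + δ)) := by
    rw [intervalIntegral.integral_comp_add_left (fun r => B (f r) (f (s + δ)))]; simp
  have i1 : IntervalIntegrable (fun h => B (f (s + h)) (f (s + δ))) volume 0 δ := by
    have h1 : MemLp (fun h => f (s + h)) 2 volume :=
      hf.comp_measurePreserving (measurePreserving_add_left volume s)
    have := intervalIntegrable_of_memLp_two h1 0 δ
    exact ⟨(B.flip (f (s + δ))).integrable_comp this.1, (B.flip (f (s + δ))).integrable_comp this.2⟩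
  have e2 : g * (δ⁻¹ * ∫ r in s..s + δ, B (f r) (f (s + δ))) - g * B (f s) (f s) =
      ∫ h in Ioc 0 δ, g * (δ⁻¹ * (B (f (s + h)) (f (s + δ)) - B (f s) (f s))) := by
    rw [← intervalIntegral.integral_of_le hδ.le, intervalIntegral.integral_const_mul,
      intervalIntegral.integral_const_mul, intervalIntegral.integral_sub i1 (by simp), e1]
    simp only [intervalIntegral.integral_const, sub_zero, smul_eq_mul]
    field_simp
  rw [e2]
  refine (enorm_integral_le_lintegral_enorm _).trans (lintegral_mono fun h => ?_)
  have e3 : B (f (s + h)) (f (s + δ)) - B (f s) (f s) =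
      B (f (s + h) - f s) (f (s + δ)) + B (f s) (f (s + δ) - f s) := by
    simp only [map_sub, sub_apply]; ring
  have hg' : ‖g‖ₑ ≤ 1 := by
    rw [← ofReal_norm, norm_eq_abs]
    exact ENNReal.ofReal_le_one.2 hg1
  have hB : ∀ x y : V, ‖B x y‖ₑ ≤ ‖B‖ₑ * (‖x‖ₑ * ‖y‖ₑ) := fun x y => by
    simp only [← ofReal_norm]
    rw [← ofReal_mul (norm_nonneg _), ← ofReal_mul (norm_nonneg _), ← mul_assoc]
    exact ofReal_le_ofReal (B.le_opNorm₂ x y)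
  have hδ' : ‖δ⁻¹‖ₑ = ofReal δ⁻¹ := Real.enorm_of_nonneg (by positivity)
  simp only [enorm_mul, e3, hδ']
  calc _ ≤ 1 * (ofReal δ⁻¹ * (‖B‖ₑ * (‖f (s + h) - f s‖ₑ * ‖f (s + δ)‖ₑ)
        + ‖B‖ₑ * (‖f s‖ₑ * ‖f (s + δ) - f s‖ₑ))) := by
        gcongr
        exact (enorm_add_le _ _).trans (add_le_add (hB _ _) (hB _ _))
    _ = _ := by ring

lemma integrable_weight_bilin {V : Type*} [NormedAddCommGroup V] [NormedSpace ℝ V] {f : ℝ → V}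
    (hf : MemLp f 2 volume) (B : V →L[ℝ] V →L[ℝ] ℝ)
    {g : ℝ → ℝ} (hg : Measurable g) (hg1 : ∀ s, |g s| ≤ 1) (T : ℝ) :
    Integrable (fun s => g s * B (f s) (f s)) (volume.restrict (Ioc 0 T)) := by
  refine ((hf.norm.integrable_sq.const_mul ‖B‖).restrict).mono' ?_ (ae_of_all _ fun s => ?_)
  · exact hg.aestronglyMeasurable.mul (B.isBoundedBilinearMap.continuous.comp_aestronglyMeasurable
      (hf.1.restrict.prodMk hf.1.restrict))
  · rw [norm_mul]
    calc _ ≤ 1 * (‖B‖ * ‖f s‖ * ‖f s‖) := by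
          gcongr
          · exact hg1 s
          · exact B.le_opNorm₂ _ _
      _ = _ := by ring

variable {V : Type*} [NormedAddCommGroup V] [NormedSpace ℝ V] [CompleteSpace V]

lemma integral_bilin_comp {f : ℝ → V} (hf : MemLp f 2 volume) (B : V →L[ℝ] V →L[ℝ] ℝ) (a b : ℝ)
    (v : V) : ∫ r in a..b, B (f r) v = B (∫ r in a..b, f r) v :=
  (B.flip v).intervalIntegral_comp_comm (intervalIntegrable_of_memLp_two hf a b)

lemma integrable_average {f : ℝ → V} (hf : MemLp f 2 volume) (B : V →L[ℝ] V →L[ℝ] ℝ)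
    {g : ℝ → ℝ} (hg : Measurable g) (hg1 : ∀ s, |g s| ≤ 1) (δ T : ℝ) :
    Integrable (fun s => g s * (δ⁻¹ * ∫ r in s..s + δ, B (f r) (f (s + δ))))
      (volume.restrict (Ioc 0 T)) := by
  have hc : Continuous fun s => ∫ r in s..s + δ, f r := by
    have h0 : ∀ s : ℝ, ∫ r in s..s + δ, f r = (∫ r in (0 : ℝ)..s + δ, f r) - ∫ r in (0 : ℝ)..s, f r :=
      fun s => (intervalIntegral.integral_interval_sub_left (intervalIntegrable_of_memLp_two hf _ _)
        (intervalIntegrable_of_memLp_two hf _ _)).symm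
    have h1 : Continuous fun s : ℝ => ∫ r in (0 : ℝ)..s, f r :=
      intervalIntegral.continuous_primitive (fun a b => intervalIntegrable_of_memLp_two hf a b) 0
    simp only [h0]
    exact (h1.comp (continuous_add_const δ)).sub h1
  obtain ⟨C, hC⟩ := isCompact_Icc.exists_bound_of_continuousOn (s := Icc (0 : ℝ) T) hc.continuousOn
  have hm : AEStronglyMeasurable (fun s => f (s + δ)) (volume.restrict (Ioc 0 T)) :=
    (hf.1.comp_measurePreserving (measurePreserving_add_right volume δ)).restrict
  have hi : Integrable (fun s => f (s + δ)) (volume.restrict (Ioc 0 T)) :=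
    ((hf.comp_measurePreserving (measurePreserving_add_right volume δ)).restrict _).integrable
      (by norm_num)
  refine (hi.norm.const_mul (|δ⁻¹| * (‖B‖ * C))).mono' ?_ ?_
  · simp only [integral_bilin_comp hf]
    refine hg.aestronglyMeasurable.mul (AEStronglyMeasurable.const_mul ?_ _)
    have h2 : AEStronglyMeasurable (fun s => (∫ r in s..s + δ, f r, f (s + δ)))
      (volume.restrict (Ioc 0 T)) := hc.aestronglyMeasurable.prodMk hm
    exact B.isBoundedBilinearMap.continuous.comp_aestronglyMeasurable h2
  · filter_upwards [ae_restrict_mem measurableSet_Ioc] with s hs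
    rw [integral_bilin_comp hf, norm_mul, norm_mul, norm_eq_abs, norm_eq_abs]
    have h3 := B.le_opNorm₂ (∫ r in s..s + δ, f r) (f (s + δ))
    have h4 := hC s ⟨hs.1.le, hs.2⟩
    calc _ ≤ 1 * (|δ⁻¹| * (‖B‖ * C * ‖f (s + δ)‖)) := by
          gcongr
          · exact hg1 s
          · exact h3.trans (by gcongr)
      _ = _ := by ring

lemma tendsto_integral_average {f : ℝ → V} (hfm : StronglyMeasurable f)
    (hf : MemLp f 2 volume) (B : V →L[ℝ] V →L[ℝ] ℝ)
    {g : ℝ → ℝ} (hg : Measurable g) (hg1 : ∀ s, |g s| ≤ 1) (T : ℝ) :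
    Tendsto (fun δ => ∫ s in Ioc 0 T, g s * (δ⁻¹ * ∫ r in s..s + δ, B (f r) (f (s + δ))))
      (𝓝[>] 0) (𝓝 (∫ s in Ioc 0 T, g s * B (f s) (f s))) := by
  have hlim := integrable_weight_bilin hf B hg hg1 T
  set ω : ℝ → ℝ≥0∞ := fun h => eLpNorm (fun s => f (s + h) - f s) 2 volume with hω
  set N := eLpNorm f 2 volume with hN
  have hNt : N ≠ ⊤ := hf.2.ne
  have hω0 : Tendsto ω (𝓝 0) (𝓝 0) := tendsto_eLpNorm_translate hf
  have hsh : ∀ h : ℝ, StronglyMeasurable fun s => f (s + h) := fun h =>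
    hfm.comp_measurable (measurable_id.add_const h)
  have key : ∀ δ > 0, ∀ ε : ℝ≥0∞, (∀ h ∈ Ioc 0 δ, ω h ≤ ε) →
      ‖(∫ s in Ioc 0 T, g s * (δ⁻¹ * ∫ r in s..s + δ, B (f r) (f (s + δ))))
        - ∫ s in Ioc 0 T, g s * B (f s) (f s)‖ₑ ≤ ‖B‖ₑ * (2 * N) * ε := by
    intro δ hδ ε hε
    rw [← integral_sub (integrable_average hf B hg hg1 δ T) hlim]
    refine (enorm_integral_le_lintegral_enorm _).trans ?_
    refine (lintegral_mono fun s => enorm_average_sub_le hf B (hg1 s) hδ s).trans ?_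
    refine (setLIntegral_le_lintegral _ _).trans ?_
    have hm : Measurable fun p : ℝ × ℝ => ofReal δ⁻¹ * (‖B‖ₑ *
        (‖f (p.1 + p.2) - f p.1‖ₑ * ‖f (p.1 + δ)‖ₑ + ‖f p.1‖ₑ * ‖f (p.1 + δ) - f p.1‖ₑ)) := by
      have a1 : StronglyMeasurable fun p : ℝ × ℝ => f (p.1 + p.2) :=
        hfm.comp_measurable (measurable_fst.add measurable_snd)
      have a2 : StronglyMeasurable fun p : ℝ × ℝ => f p.1 := hfm.comp_measurable measurable_fst
      have a3 : StronglyMeasurable fun p : ℝ × ℝ => f (p.1 + δ) :=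
        (hsh δ).comp_measurable measurable_fst
      exact ((((a1.sub a2).enorm.mul a3.enorm).add (a2.enorm.mul (a3.sub a2).enorm)).const_mul
        _).const_mul _
    rw [lintegral_lintegral_swap hm.aemeasurable]
    calc _ ≤ ∫⁻ _ in Ioc (0 : ℝ) δ, ofReal δ⁻¹ * (‖B‖ₑ * (2 * N) * ε) := by
          refine setLIntegral_mono' measurableSet_Ioc fun h hh => ?_
          have b1 : Measurable fun s => ‖f (s + h) - f s‖ₑ * ‖f (s + δ)‖ₑ := (((hsh h).sub hfm).enorm.mul (hsh δ).enorm)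
          have b2 : Measurable fun s => ‖f s‖ₑ * ‖f (s + δ) - f s‖ₑ := (hfm.enorm.mul ((hsh δ).sub hfm).enorm)
          generalize ofReal δ⁻¹ = d, ‖B‖ₑ = b
          have e := lintegral_const_mul_add_mul (μ := volume) b1 b2 (d * b) 1 1
          simp only [one_mul, mul_assoc d b] at e
          rw [e]
          have c1 : ∫⁻ s, ‖f (s + h) - f s‖ₑ * ‖f (s + δ)‖ₑ ≤ ε * N := by
            refine (lintegral_enorm_mul_le ((hsh h).sub hfm).aestronglyMeasurable
              (hsh δ).aestronglyMeasurable).trans ?_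
            rw [hN, ← eLpNorm_comp_measurePreserving hf.1 (measurePreserving_add_right volume δ)]
            gcongr
            · exact hε h hh
            · rfl
          have c2 : ∫⁻ s, ‖f s‖ₑ * ‖f (s + δ) - f s‖ₑ ≤ N * ε := by
            refine (lintegral_enorm_mul_le hfm.aestronglyMeasurable
              ((hsh δ).sub hfm).aestronglyMeasurable).trans ?_
            gcongr
            exact hε δ ⟨hδ, le_rfl⟩
          calc _ ≤ d * (b * (ε * N + N * ε)) := by gcongr
            _ = _ := by ring
      _ = _ := by
          rw [setLIntegral_const, volume_Ioc, sub_zero, mul_right_comm,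
            ← ofReal_mul (by positivity), inv_mul_cancel₀ hδ.ne', ENNReal.ofReal_one, one_mul]
  rw [tendsto_iff_edist_tendsto_0]
  refine tendsto_nhds_zero.2 fun ε hε => ?_
  have hK : ‖B‖ₑ * (2 * N) ≠ ⊤ := mul_ne_top enorm_ne_top (mul_ne_top (by simp) hNt)
  obtain ⟨ε', hε', hε''⟩ : ∃ ε' : ℝ≥0∞, 0 < ε' ∧ ‖B‖ₑ * (2 * N) * ε' ≤ ε := by
    by_cases h0 : ‖B‖ₑ * (2 * N) = 0
    · exact ⟨1, one_pos, by simp [h0]⟩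
    · by_cases ht : ε = ⊤
      · exact ⟨1, one_pos, by simp [ht]⟩
      · exact ⟨ε / (‖B‖ₑ * (2 * N)), ENNReal.div_pos hε.ne' hK, ENNReal.mul_div_le⟩
  obtain ⟨δ₀, hδ₀, hsmall⟩ := Metric.eventually_nhds_iff.1 (tendsto_nhds_zero.1 hω0 ε' hε')
  filter_upwards [Ioo_mem_nhdsGT hδ₀] with δ hδ
  rw [edist_eq_enorm_sub]
  refine (key δ hδ.1 ε' fun h hh => hsmall ?_).trans hε''
  rw [dist_eq, sub_zero, abs_of_pos hh.1]
  exact hh.2.trans_lt hδ.2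

end TimeAverages

/-! ### The Wiener process -/

section Series

variable {H : Type*} [NormedAddCommGroup H] [InnerProductSpace ℝ H] (e : HilbertBasis ℕ ℝ H)

lemma inner_eq_of_hasSum {c : ℕ → ℝ} {w : H} (h : HasSum (fun k => c k • e k) w) (k : ℕ) :
    ⟪e k, w⟫ = c k := by
  have h1 : HasSum (fun j => ⟪e k, c j • e j⟫) ⟪e k, w⟫ := h.mapL (innerSL ℝ (e k))
  have h2 : HasSum (fun j => ⟪e k, c j • e j⟫) (c k) := by
    convert hasSum_ite_eq k (c k) using 2 with j
    rw [inner_smul_right, orthonormal_iff_ite.1 e.orthonormal k j]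
    by_cases hj : j = k
    · simp [hj]
    · simp [hj, Ne.symm hj]
  exact h1.unique h2

lemma summable_smul_basis_iff (c : ℕ → ℝ) :
    Summable (fun k => c k • e k) ↔ Summable fun k => c k ^ 2 := by
  constructor
  · rintro ⟨w, hw⟩
    have h := (e.hasSum_inner_mul_inner w w).summable
    refine h.congr fun k => ?_
    rw [real_inner_comm, inner_eq_of_hasSum e hw, sq]
  · intro h
    have h1 : Memℓp c 2 := by
      rw [memℓp_gen_iff (by norm_num)]
      refine h.congr fun k => ?_
      simp
    exact (e.hasSum_repr_symm ⟨c, h1⟩).summable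

lemma summable_sq_iff (c : ℕ → ℝ) :
    (Summable fun k => c k ^ 2) ↔ ∑' k, ofReal (c k ^ 2) ≠ ⊤ := by
  refine ⟨fun h => h.tsum_ofReal_ne_top, fun h => ?_⟩
  refine (ENNReal.summable_toReal h).congr fun k => ?_
  rw [toReal_ofReal (sq_nonneg _)]

lemma hasSum_basis {c : ℕ → ℝ} (hc : Summable fun k => c k ^ 2) :
    HasSum (fun k => c k • e k) (∑' k, c k • e k) :=
  ((summable_smul_basis_iff e c).2 hc).hasSum

open Classical in
lemma inner_tsum_basis (c : ℕ → ℝ) (k : ℕ) :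
    ⟪e k, ∑' j, c j • e j⟫ = if ∑' k, ofReal (c k ^ 2) = ⊤ then 0 else c k := by
  by_cases h : ∑' k, ofReal (c k ^ 2) = ⊤
  · have h1 : ¬ Summable fun k => c k • e k := by
      rw [summable_smul_basis_iff, summable_sq_iff]
      exact not_not.2 h
    rw [if_pos h, tsum_eq_zero_of_not_summable h1, inner_zero_right]
  · rw [if_neg h]
    exact inner_eq_of_hasSum e (hasSum_basis e ((summable_sq_iff c).2 h)) k

lemma enorm_sq_eq_tsum (w : H) : ‖w‖ₑ ^ 2 = ∑' k, ofReal (⟪e k, w⟫ ^ 2) := by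
  have h := e.hasSum_inner_mul_inner w w
  have h1 : ‖w‖ ^ 2 = ∑' k, ⟪e k, w⟫ ^ 2 := by
    rw [← real_inner_self_eq_norm_sq, ← h.tsum_eq]
    exact tsum_congr fun k => by rw [real_inner_comm, sq]
  rw [← ofReal_norm, ← ofReal_pow (norm_nonneg _), h1, ENNReal.ofReal_tsum_of_nonneg
    (fun k => sq_nonneg _)]
  exact h.summable.congr fun k => by rw [real_inner_comm, sq]

variable [MeasurableSpace H] [BorelSpace H] [SecondCountableTopology H]

lemma measurable_of_inner_basis {α : Type*} {mα : MeasurableSpace α} {f : α → H}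
    (hf : ∀ k, Measurable fun x => ⟪e k, f x⟫) : Measurable f := by
  have h1 : ∀ n : ℕ, Measurable fun x => ∑ k ∈ Finset.range n, ⟪e k, f x⟫ • e k := fun n =>
    Finset.measurable_fun_sum _ fun k _ => (hf k).smul_const (e k)
  refine measurable_of_tendsto_metrizable h1 (tendsto_pi_nhds.2 fun x => ?_)
  have := (e.hasSum_repr (f x)).tendsto_sum_nat
  simpa only [e.repr_apply_apply] using this

lemma measurable_tsum_basis {α : Type*} {mα : MeasurableSpace α} {b : ℕ → α → ℝ}
    (hb : ∀ k, Measurable (b k)) : Measurable fun x => ∑' k, b k x • e k := by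
  classical
  refine measurable_of_inner_basis e fun k => ?_
  simp only [inner_tsum_basis]
  refine Measurable.ite ?_ measurable_const (hb k)
  have : Measurable fun x => ∑' k, ofReal (b k x ^ 2) :=
    Measurable.tsum fun k => ((hb k).pow_const 2).ennreal_ofReal
  exact this (measurableSet_singleton ⊤)

end Series

section Wiener

variable {D : Set E3} {e : HilbertBasis ℕ ℝ (VelH D)} {σ : ℕ → ℝ} {Ω : Type*}
  {mΩ : MeasurableSpace Ω} {P : Measure Ω} {ℱ : Filtration ℝ≥0 mΩ} {β : ℕ → ℝ≥0 → Ω → ℝ}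

lemma measurable_wiener (hB : IsBrownianFamily P ℱ β) (t : ℝ≥0) :
    Measurable[ℱ t] (wiener e σ β t) :=
  measurable_tsum_basis e fun k => (hB.adapted k t).measurable.const_mul (σ k)

lemma lintegral_sq_increment (hB : IsBrownianFamily P ℱ β) (k : ℕ) {s t : ℝ≥0} (hst : s ≤ t) :
    ∫⁻ ω, ofReal ((β k t ω - β k s ω) ^ 2) ∂P = ofReal ((t : ℝ) - s) := by
  have h := (hB.brownian k).toIsPreBrownianReal.hasLaw_sub t s
  have e1 : ∫⁻ ω, ofReal ((β k t ω - β k s ω) ^ 2) ∂P =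
      ∫⁻ x, ofReal (x ^ 2) ∂(gaussianReal 0 (nndist t.1 s.1)) := by
    rw [← h.map_eq, lintegral_map' (by fun_prop) h.aemeasurable]
    rfl
  have hi : Integrable (fun x : ℝ => x ^ 2) (gaussianReal 0 (nndist t.1 s.1)) := by
    have := (memLp_id_gaussianReal (μ := 0) (v := nndist t.1 s.1) 2).integrable_sq
    exact this
  rw [e1, ← ofReal_integral_eq_lintegral_ofReal hi (ae_of_all _ fun x => sq_nonneg x)]
  congr 1
  have hv := variance_id_gaussianReal (μ := 0) (v := nndist t.1 s.1)
  rw [variance_of_integral_eq_zero aemeasurable_id (by simp)] at hv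
  simp only [id] at hv
  rw [hv, coe_nndist, dist_eq, abs_of_nonneg (sub_nonneg.2 (by exact_mod_cast hst))]
  rfl

lemma integral_increment (hB : IsBrownianFamily P ℱ β) (k : ℕ) (s t : ℝ≥0) :
    ∫ ω, (β k t ω - β k s ω) ∂P = 0 := by
  have h := ((hB.brownian k).toIsPreBrownianReal.hasLaw_sub t s).integral_eq
  rw [integral_id_gaussianReal] at h
  exact h

lemma summable_noise (hB : IsBrownianFamily P ℱ β) (hσ : Summable fun k => σ k ^ 2) (t : ℝ≥0) :
    ∀ᵐ ω ∂P, Summable fun k => (σ k * β k t ω) ^ 2 := by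
  have hm : ∀ k, Measurable (β k t) := fun k => (hB.adapted k t).measurable.mono (ℱ.le t) le_rfl
  have h1 : ∫⁻ ω, (∑' k, ofReal ((σ k * β k t ω) ^ 2)) ∂P ≠ ⊤ := by
    rw [lintegral_tsum fun k => (((hm k).const_mul _).pow_const 2).ennreal_ofReal.aemeasurable]
    have h2 : ∀ k, ∫⁻ ω, ofReal ((σ k * β k t ω) ^ 2) ∂P = ofReal (σ k ^ 2 * t) := by
      intro k
      have h3 := lintegral_sq_increment hB k (zero_le (a := t))
      have h4 : ∀ᵐ ω ∂P, ofReal ((σ k * β k t ω) ^ 2) =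
          ofReal (σ k ^ 2) * ofReal ((β k t ω - β k 0 ω) ^ 2) := by
        filter_upwards [(hB.brownian k).toIsPreBrownianReal.eval_zero_ae_eq_zero] with ω hω
        rw [hω, sub_zero, mul_pow, ofReal_mul (sq_nonneg _)]
      rw [lintegral_congr_ae h4, lintegral_const_mul _ (by have := hm k; have := (hB.adapted k 0).measurable.mono (ℱ.le 0) le_rfl; fun_prop), h3,
        ← ofReal_mul (sq_nonneg _)]
      simp
    simp only [h2]
    exact (hσ.mul_right (t : ℝ)).tsum_ofReal_ne_top
  filter_upwards [ae_lt_top' (Measurable.tsum fun k =>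
    (((hm k).const_mul _).pow_const 2).ennreal_ofReal).aemeasurable h1] with ω hω
  exact (summable_sq_iff _).2 hω.ne

lemma inner_wiener_sub (hB : IsBrownianFamily P ℱ β) (hσ : Summable fun k => σ k ^ 2)
    (s t : ℝ≥0) : ∀ᵐ ω ∂P, ∀ k, ⟪e k, wiener e σ β t ω - wiener e σ β s ω⟫ =
      σ k * (β k t ω - β k s ω) := by
  filter_upwards [summable_noise hB hσ t, summable_noise hB hσ s] with ω h1 h2 k
  rw [inner_sub_right, wiener, wiener, inner_eq_of_hasSum e (hasSum_basis e h1),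
    inner_eq_of_hasSum e (hasSum_basis e h2), mul_sub]

lemma lintegral_wiener_sub_sq (hB : IsBrownianFamily P ℱ β) (hσ : Summable fun k => σ k ^ 2)
    {s t : ℝ≥0} (hst : s ≤ t) :
    ∫⁻ ω, ‖wiener e σ β t ω - wiener e σ β s ω‖ₑ ^ 2 ∂P
      = ofReal ((∑' k, σ k ^ 2) * ((t : ℝ) - s)) := by
  have hm : ∀ k t, Measurable (β k t) := fun k t => (hB.adapted k t).measurable.mono (ℱ.le t) le_rfl
  have h1 : ∀ᵐ ω ∂P, ‖wiener e σ β t ω - wiener e σ β s ω‖ₑ ^ 2 =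
      ∑' k, ofReal (σ k ^ 2) * ofReal ((β k t ω - β k s ω) ^ 2) := by
    filter_upwards [inner_wiener_sub (e := e) hB hσ s t] with ω hω
    rw [enorm_sq_eq_tsum e]
    refine tsum_congr fun k => ?_
    rw [hω, mul_pow, ofReal_mul (sq_nonneg _)]
  have hm' : ∀ k, Measurable fun ω => ofReal ((β k t ω - β k s ω) ^ 2) := fun k =>
    (((hm k t).sub (hm k s)).pow_const 2).ennreal_ofReal
  rw [lintegral_congr_ae h1, lintegral_tsum fun k => ((hm' k).const_mul _).aemeasurable]
  have hts : 0 ≤ (t : ℝ) - s := sub_nonneg.2 (by exact_mod_cast hst)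
  rw [← tsum_mul_right, ENNReal.ofReal_tsum_of_nonneg (fun k => by positivity) (hσ.mul_right _)]
  refine tsum_congr fun k => ?_
  rw [lintegral_const_mul _ (hm' k), lintegral_sq_increment hB k hst,
    ofReal_mul (sq_nonneg _)]

/-- Increments of the noise are orthogonal to the past. -/
lemma integral_inner_wiener_sub [IsProbabilityMeasure P] (hB : IsBrownianFamily P ℱ β)
    (hσ : Summable fun k => σ k ^ 2)
    {s t : ℝ≥0} (hst : s ≤ t) {X : Ω → VelH D} (hX : Measurable[ℱ s] X)
    (hX2 : ∫⁻ ω, ‖X ω‖ₑ ^ 2 ∂P ≠ ⊤) :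
    Integrable (fun ω => ⟪wiener e σ β t ω - wiener e σ β s ω, X ω⟫) P ∧
    ∫ ω, ⟪wiener e σ β t ω - wiener e σ β s ω, X ω⟫ ∂P = 0 := by
  have hXm : Measurable X := hX.mono (ℱ.le s) le_rfl
  set ξ : Ω → VelH D := fun ω => wiener e σ β t ω - wiener e σ β s ω with hξ
  have hξm : Measurable ξ := ((measurable_wiener hB t).mono (ℱ.le t) le_rfl).sub
    ((measurable_wiener hB s).mono (ℱ.le s) le_rfl)
  have hint : ∀ {f : Ω → VelH D}, Measurable f → ∫⁻ ω, ‖f ω‖ₑ ^ 2 ∂P ≠ ⊤ →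
      Integrable (fun ω => ‖f ω‖ ^ 2) P := by
    intro f hf hf2
    refine ⟨(hf.norm.pow_const 2).aestronglyMeasurable, ?_⟩
    rw [hasFiniteIntegral_iff_ofReal (ae_of_all _ fun x => by positivity)]
    simp only [ofReal_norm_pow]
    exact hf2.lt_top
  have i1 := hint hXm hX2
  have i2 := hint hξm (by rw [hξ, lintegral_wiener_sub_sq hB hσ hst]; exact ofReal_ne_top)
  have hdom : Integrable (fun ω => ‖ξ ω‖ ^ 2 + ‖X ω‖ ^ 2) P := i2.add i1
  have hyoung : ∀ a b : ℝ, 0 ≤ a → 0 ≤ b → a * b ≤ a ^ 2 + b ^ 2 := fun a b ha hb => by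
    nlinarith [sq_nonneg (a - b), mul_nonneg ha hb]
  refine ⟨hdom.mono' (hξm.inner hXm).aestronglyMeasurable (ae_of_all _ fun ω =>
    (norm_inner_le_norm _ _).trans (hyoung _ _ (norm_nonneg _) (norm_nonneg _))), ?_⟩
  have hterm : ∀ k, ∫ ω, ⟪ξ ω, e k⟫ * ⟪e k, X ω⟫ ∂P = 0 := by
    intro k
    have h1 : ∀ᵐ ω ∂P, ⟪ξ ω, e k⟫ * ⟪e k, X ω⟫ = σ k * ((β k t ω - β k s ω) * ⟪e k, X ω⟫) := by
      filter_upwards [inner_wiener_sub (e := e) hB hσ s t] with ω hω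
      rw [real_inner_comm, hω, mul_assoc]
    have hmX : Measurable[ℱ s] fun ω => ⟪e k, X ω⟫ :=
      Measurable.inner (f := fun _ => e k) (@measurable_const _ _ _ (ℱ s) _) hX
    have hind : IndepFun (fun ω => β k t ω - β k s ω) (fun ω => ⟪e k, X ω⟫) P := by
      rw [IndepFun_iff_Indep]
      refine indep_of_indep_of_le_right (indep_of_indep_of_le_left (hB.indepPast s t hst) ?_)
        hmX.comap_le
      rintro _ ⟨S, hS, rfl⟩
      exact ⟨(fun x : ℕ → ℝ => x k) ⁻¹' S, measurable_pi_apply k hS, rfl⟩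
    rw [integral_congr_ae h1, integral_const_mul, hind.integral_fun_mul_eq_mul_integral
      (((hB.adapted k t).measurable.mono (ℱ.le t) le_rfl).sub
        ((hB.adapted k s).measurable.mono (ℱ.le s) le_rfl)).aestronglyMeasurable
      (hmX.mono (ℱ.le s) le_rfl).aestronglyMeasurable, integral_increment hB]
    simp
  have hcs : ∀ (x y : VelH D) (n : ℕ), |∑ k ∈ Finset.range n, ⟪x, e k⟫ * ⟪e k, y⟫| ≤
      ‖x‖ ^ 2 + ‖y‖ ^ 2 := by
    intro x y n
    have h1 := e.orthonormal.sum_inner_products_le x (s := Finset.range n)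
    have h2 := e.orthonormal.sum_inner_products_le y (s := Finset.range n)
    refine (Finset.abs_sum_le_sum_abs _ _).trans ?_
    refine le_trans ?_ (add_le_add h1 h2)
    rw [← sum_add_distrib]
    refine sum_le_sum fun k _ => ?_
    rw [abs_mul, real_inner_comm]
    exact hyoung _ _ (abs_nonneg _) (abs_nonneg _)
  have hmk : ∀ k, Measurable fun ω => ⟪ξ ω, e k⟫ * ⟪e k, X ω⟫ := fun k =>
    (hξm.inner measurable_const).mul (measurable_const.inner hXm)
  have hik : ∀ k, Integrable (fun ω => ⟪ξ ω, e k⟫ * ⟪e k, X ω⟫) P := fun k => by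
    refine hdom.mono' (hmk k).aestronglyMeasurable (ae_of_all _ fun ω => ?_)
    rw [norm_mul]
    have h1 : ‖⟪ξ ω, e k⟫‖ ≤ ‖ξ ω‖ := by
      simpa [e.orthonormal.1 k] using norm_inner_le_norm (𝕜 := ℝ) (ξ ω) (e k)
    have h2 : ‖⟪e k, X ω⟫‖ ≤ ‖X ω‖ := by
      simpa [e.orthonormal.1 k] using norm_inner_le_norm (𝕜 := ℝ) (e k) (X ω)
    exact (mul_le_mul h1 h2 (norm_nonneg _) (norm_nonneg _)).trans
      (hyoung _ _ (norm_nonneg _) (norm_nonneg _))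
  have hlim := tendsto_integral_of_dominated_convergence
    (F := fun n ω => ∑ k ∈ Finset.range n, ⟪ξ ω, e k⟫ * ⟪e k, X ω⟫) (f := fun ω => ⟪ξ ω, X ω⟫)
    (μ := P) (fun ω => ‖ξ ω‖ ^ 2 + ‖X ω‖ ^ 2)
    (fun n => (Finset.measurable_fun_sum _ fun k _ => hmk k).aestronglyMeasurable) hdom
    (fun n => ae_of_all _ fun ω => hcs _ _ n)
    (ae_of_all _ fun ω => (e.hasSum_inner_mul_inner (ξ ω) (X ω)).tendsto_sum_nat)
  have hz : ∀ n, ∫ ω, ∑ k ∈ Finset.range n, ⟪ξ ω, e k⟫ * ⟪e k, X ω⟫ ∂P = 0 := fun n => by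
    rw [integral_finsetSum _ fun k _ => hik k]
    exact Finset.sum_eq_zero fun k _ => hterm k
  simp only [hz] at hlim
  exact (tendsto_nhds_unique tendsto_const_nhds hlim).symm

/-- Brownian paths are jointly measurable off a null set. -/
lemma exists_measurable_brownian (hB : IsBrownianFamily P ℱ β) (k : ℕ) :
    ∃ b : ℝ → Ω → ℝ, Measurable (uncurry b) ∧ ∀ᵐ ω ∂P, ∀ s, b s ω = β k s.toNNReal ω := by
  obtain ⟨N, hN, hNm, hN0⟩ := exists_measurable_superset_of_null (ae_iff.1 (hB.brownian k).cont)
  have hcont : ∀ ω, Continuous fun s : ℝ => Nᶜ.indicator (fun ω => β k s.toNNReal ω) ω := by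
    intro ω
    by_cases h : ω ∈ N
    · simpa [h] using continuous_const
    · simp only [mem_compl_iff, h, not_false_eq_true, indicator_of_mem]
      have h1 : Continuous (β k · ω) := by
        by_contra hc
        exact h (hN hc)
      exact h1.comp continuous_real_toNNReal
  refine ⟨_, measurable_uncurry_of_continuous_of_measurable hcont fun s =>
    ((hB.adapted k s.toNNReal).measurable.mono (ℱ.le _) le_rfl).indicator hNm.compl, ?_⟩
  filter_upwards [measure_eq_zero_iff_ae_notMem.1 hN0] with ω hω s
  simp [hω]

lemma exists_measurable_wiener (hB : IsBrownianFamily P ℱ β) (e : HilbertBasis ℕ ℝ (VelH D))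
    (σ : ℕ → ℝ) : ∃ W : ℝ → Ω → VelH D, Measurable (uncurry W) ∧
      ∀ᵐ ω ∂P, ∀ s, W s ω = wiener e σ β s.toNNReal ω := by
  choose b hb hbe using exists_measurable_brownian hB
  refine ⟨fun s ω => ∑' k, (σ k * b k s ω) • e k,
    measurable_tsum_basis e fun k => (hb k).const_mul _, ?_⟩
  filter_upwards [ae_all_iff.2 hbe] with ω hω s
  exact tsum_congr fun k => by rw [hω k s]

end Wiener

/-! ### Second moments of the stationary forcing -/

section Probability

variable {Ω : Type*} {mΩ : MeasurableSpace Ω} {P : Measure Ω} [IsProbabilityMeasure P]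

/-- A form of Fatou's lemma for sequences bounded by centered terms that are bounded in `L²`. -/
lemma lintegral_le_of_tendsto_of_le {Y : Ω → ℝ} {Yn N Q : ℕ → Ω → ℝ} {C q : ℝ} (hC : 0 ≤ C)
    (hq : 0 ≤ q) (hY0 : ∀ᵐ ω ∂P, 0 ≤ Y ω) (hY : ∀ᵐ ω ∂P, Tendsto (fun n => Yn n ω) atTop (𝓝 (Y ω)))
    (hle : ∀ n, ∀ᵐ ω ∂P, Yn n ω ≤ N n ω + Q n ω) (hN : ∀ n, Integrable (N n) P)
    (hN0 : ∀ n, ∫ ω, N n ω ∂P = 0) (hN2 : ∀ n, Integrable (fun ω => N n ω ^ 2) P)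
    (hNC : ∀ n, ∫ ω, N n ω ^ 2 ∂P ≤ C) (hQ : ∀ n, Integrable (Q n) P) (hQ0 : ∀ n ω, 0 ≤ Q n ω)
    (hQq : ∀ n, ∫ ω, Q n ω ∂P ≤ q) : ∫⁻ ω, ofReal (Y ω) ∂P ≤ ofReal q := by
  have key : ∀ r : ℝ, 0 < r → ∫⁻ ω, ofReal (Y ω) ∂P ≤ ofReal (q + r * C) := by
    intro r hr
    have hr' : 0 < r⁻¹ := inv_pos.2 hr
    refine (ENNReal.add_le_add_iff_right (a := ofReal r⁻¹) ofReal_ne_top).1 ?_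
    rw [← ofReal_add (by positivity) hr'.le]
    have e0 : ∫⁻ ω, ofReal (Y ω) ∂P + ofReal r⁻¹ =
        ∫⁻ ω, (ofReal (Y ω) + ofReal r⁻¹) ∂P := by
      rw [lintegral_add_right _ measurable_const]; simp
    rw [e0]
    set B : ℕ → Ω → ℝ := fun n ω => N n ω + r * N n ω ^ 2 + r⁻¹ + Q n ω with hBdef
    have hBi : ∀ n, Integrable (B n) P := fun n =>
      (((hN n).add ((hN2 n).const_mul r)).add (integrable_const _)).add (hQ n)
    have hB0 : ∀ n ω, 0 ≤ B n ω := fun n ω => by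
      have h1 : 0 ≤ N n ω + r * N n ω ^ 2 + r⁻¹ := by
        have h2 : N n ω + r * N n ω ^ 2 + r⁻¹ = r * (N n ω + r⁻¹ / 2) ^ 2 + 3 / 4 * r⁻¹ := by
          field_simp; ring
        rw [h2]; positivity
      exact add_nonneg h1 (hQ0 n ω)
    have hBint : ∀ n, ∫ ω, B n ω ∂P ≤ q + r * C + r⁻¹ := fun n => by
      have e : ∫ ω, B n ω ∂P = ∫ ω, N n ω ∂P + r * ∫ ω, N n ω ^ 2 ∂P + r⁻¹ + ∫ ω, Q n ω ∂P := by
        have e1 := integral_add (((hN n).add ((hN2 n).const_mul r)).add (integrable_const r⁻¹)) (hQ n)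
        have e2 := integral_add ((hN n).add ((hN2 n).const_mul r)) (integrable_const (μ := P) r⁻¹)
        have e3 := integral_add (hN n) ((hN2 n).const_mul r)
        have e4 : ∫ ω, r * N n ω ^ 2 ∂P = r * ∫ ω, N n ω ^ 2 ∂P := integral_const_mul _ _
        have e5 : ∫ _, r⁻¹ ∂P = r⁻¹ := by simp
        rw [← e4, ← e3.trans rfl, ← e5]
        exact e1.trans (congrArg (· + _) (e2.trans rfl))
      rw [e, hN0]
      have := hNC n
      have := hQq n
      nlinarith
    calc ∫⁻ ω, (ofReal (Y ω) + ofReal r⁻¹) ∂P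
        ≤ ∫⁻ ω, liminf (fun n => ofReal (B n ω)) atTop ∂P := by
          refine lintegral_mono_ae ?_
          filter_upwards [hY0, hY, ae_all_iff.2 hle] with ω hω h1 h2
          have h3 : Tendsto (fun n => ofReal (Yn n ω + r⁻¹)) atTop
              (𝓝 (ofReal (Y ω + r⁻¹))) :=
            (continuous_ofReal.tendsto _).comp (h1.add_const _)
          rw [← ofReal_add hω hr'.le, ← h3.liminf_eq]
          refine liminf_le_liminf (Eventually.of_forall fun n => ofReal_le_ofReal ?_)
          have : 0 ≤ r * N n ω ^ 2 := by positivity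
          simp only [hBdef]
          linarith [h2 n]
      _ ≤ liminf (fun n => ∫⁻ ω, ofReal (B n ω) ∂P) atTop :=
          lintegral_liminf_le' fun n => (hBi n).1.aemeasurable.ennreal_ofReal
      _ ≤ ofReal (q + r * C + r⁻¹) := by
          refine (liminf_le_liminf (v := fun _ => ofReal (q + r * C + r⁻¹))
            (Eventually.of_forall fun n => ?_)).trans_eq (liminf_const _)
          rw [← ofReal_integral_eq_lintegral_ofReal (hBi n) (ae_of_all _ (hB0 n))]
          exact ofReal_le_ofReal (hBint n)
  have hlim : Tendsto (fun r : ℝ => ofReal (q + r * C)) (𝓝[>] 0) (𝓝 (ofReal q)) := by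
    have h1 : Continuous fun r : ℝ => ofReal (q + r * C) :=
      continuous_ofReal.comp (by fun_prop)
    simpa using (h1.tendsto 0).mono_left nhdsWithin_le_nhds
  refine ge_of_tendsto hlim ?_
  filter_upwards [self_mem_nhdsWithin] with r hr using key r hr

/-- The second moment of a time integral of a process with short-range correlations. -/
lemma integral_sq_integral_le {T δ c : ℝ} (hT : 0 ≤ T) (hδ : 0 ≤ δ) (hc : 0 ≤ c) {m : ℝ → Ω → ℝ}
    (hm : Measurable (uncurry m))
    (h2 : ∀ s ∈ Ioc 0 T, ∫⁻ ω, ofReal (m s ω ^ 2) ∂P ≤ ofReal c)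
    (h0 : ∀ s ∈ Ioc 0 T, ∀ t ∈ Ioc 0 T, s + δ ≤ t → ∫ ω, m s ω * m t ω ∂P = 0) :
    Integrable (fun ω => (∫ s in Ioc 0 T, m s ω) ^ 2) P ∧
    ∫ ω, (∫ s in Ioc 0 T, m s ω) ^ 2 ∂P ≤ 2 * δ * T * c := by
  set μ : Measure ℝ := volume.restrict (Ioc 0 T) with hμ
  have hms : ∀ s, Measurable (m s) := fun s => hm.comp measurable_prodMk_left
  have hsq : ∀ s ∈ Ioc 0 T, Integrable (fun ω => m s ω ^ 2) P := fun s hs => by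
    refine ⟨((hms s).pow_const 2).aestronglyMeasurable, ?_⟩
    rw [hasFiniteIntegral_iff_ofReal (ae_of_all _ fun x => by positivity)]
    exact (h2 s hs).trans_lt ENNReal.ofReal_lt_top
  have hsqc : ∀ s ∈ Ioc 0 T, ∫ ω, m s ω ^ 2 ∂P ≤ c := fun s hs => by
    have h := h2 s hs
    rw [← ofReal_integral_eq_lintegral_ofReal (hsq s hs) (ae_of_all _ fun x => by positivity)] at h
    exact (ENNReal.ofReal_le_ofReal_iff hc).1 h
  have hK : Measurable fun q : Ω × ℝ × ℝ => m q.2.1 q.1 * m q.2.2 q.1 :=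
    (hm.comp (f := fun q : Ω × ℝ × ℝ => (q.2.1, q.1)) (by fun_prop)).mul
      (hm.comp (f := fun q : Ω × ℝ × ℝ => (q.2.2, q.1)) (by fun_prop))
  have hp : ∀ᵐ p ∂(μ.prod μ), p.1 ∈ Ioc 0 T ∧ p.2 ∈ Ioc 0 T := by
    have a1 : ∀ᵐ s ∂μ, s ∈ Ioc 0 T := ae_restrict_mem measurableSet_Ioc
    filter_upwards [Measure.quasiMeasurePreserving_fst.ae a1,
      Measure.quasiMeasurePreserving_snd.ae a1] with p q1 q2 using ⟨q1, q2⟩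
  have hyoung : ∀ a b : ℝ, |a * b| ≤ a ^ 2 + b ^ 2 := fun a b => by
    rw [abs_mul]
    nlinarith [sq_nonneg (|a| - |b|), mul_nonneg (abs_nonneg a) (abs_nonneg b), sq_abs a, sq_abs b]
  have hdom : ∀ s ∈ Ioc 0 T, ∀ t ∈ Ioc 0 T, Integrable (fun ω => m s ω * m t ω) P :=
    fun s hs t ht => ((hsq s hs).add (hsq t ht)).mono' ((hms s).mul (hms t)).aestronglyMeasurable
      (ae_of_all _ fun ω => hyoung _ _)
  have habs : ∀ s ∈ Ioc 0 T, ∀ t ∈ Ioc 0 T, ∫ ω, |m s ω * m t ω| ∂P ≤ c := fun s hs t ht => by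
    have h1 : ∫ ω, |m s ω * m t ω| ∂P ≤ ∫ ω, (1 / 2 * m s ω ^ 2 + 1 / 2 * m t ω ^ 2) ∂P := by
      refine integral_mono (hdom s hs t ht).abs
        (((hsq s hs).const_mul _).add ((hsq t ht).const_mul _)) fun ω => ?_
      simp only [abs_mul]
      nlinarith [sq_nonneg (|m s ω| - |m t ω|), sq_abs (m s ω), sq_abs (m t ω)]
    rw [integral_add ((hsq s hs).const_mul _) ((hsq t ht).const_mul _), integral_const_mul,
      integral_const_mul] at h1
    linarith [hsqc s hs, hsqc t ht]
  have hKi : Integrable (fun q : Ω × ℝ × ℝ => m q.2.1 q.1 * m q.2.2 q.1) (P.prod (μ.prod μ)) := by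
    refine (integrable_prod_iff' hK.aestronglyMeasurable).2 ⟨?_, ?_⟩
    · filter_upwards [hp] with p hp using hdom _ hp.1 _ hp.2
    · refine (integrable_const c).mono' (hK.norm.stronglyMeasurable.integral_prod_left' (μ := P)).aestronglyMeasurable ?_
      filter_upwards [hp] with p hp
      rw [norm_of_nonneg (integral_nonneg fun _ => norm_nonneg _)]
      exact habs _ hp.1 _ hp.2
  have e1 : ∀ ω, (∫ s, m s ω ∂μ) ^ 2 = ∫ p, m p.1 ω * m p.2 ω ∂(μ.prod μ) := fun ω => by
    rw [sq, integral_prod_mul (fun s => m s ω) (fun s => m s ω)]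
  simp only [e1]
  refine ⟨hKi.integral_prod_left, ?_⟩
  rw [integral_integral_swap (f := fun ω (p : ℝ × ℝ) => m p.1 ω * m p.2 ω) hKi]
  set R : Set (ℝ × ℝ) := {p | |p.1 - p.2| < δ} with hR
  have hRm : MeasurableSet R := measurableSet_lt (by fun_prop) measurable_const
  have hRle : (μ.prod μ).real R ≤ 2 * δ * T := by
    have h3 : (μ.prod μ) R ≤ ofReal (2 * δ * T) := by
      rw [Measure.prod_apply hRm]
      calc _ ≤ ∫⁻ _, ofReal (2 * δ) ∂μ := by
            refine lintegral_mono fun s => (Measure.restrict_apply_le _ _).trans ?_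
            refine (measure_mono (t := Ioo (s - δ) (s + δ)) fun t ht => ?_).trans_eq ?_
            · have := abs_lt.1 (show |s - t| < δ from ht)
              exact ⟨by linarith [this.2], by linarith [this.1]⟩
            · rw [Real.volume_Ioo]; congr 1; ring
        _ = _ := by
            rw [lintegral_const, hμ, Measure.restrict_apply_univ, volume_Ioc, sub_zero,
              ← ofReal_mul (by positivity)]
    exact ENNReal.toReal_le_of_le_ofReal (by positivity) h3
  calc _ ≤ ∫ p, R.indicator (fun _ => c) p ∂(μ.prod μ) := by
        refine integral_mono_ae hKi.integral_prod_right ((integrable_const c).indicator hRm) ?_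
        filter_upwards [hp] with p hp
        by_cases hpR : p ∈ R
        · simp only [hpR, indicator_of_mem]
          exact ((le_abs_self _).trans (abs_integral_le_integral_abs)).trans (habs _ hp.1 _ hp.2)
        · simp only [hpR, not_false_eq_true, indicator_of_notMem]
          have h4 : δ ≤ |p.1 - p.2| := not_lt.1 hpR
          rcases le_total p.1 p.2 with h5 | h5
          · rw [abs_of_nonpos (by linarith)] at h4
            exact (h0 _ hp.1 _ hp.2 (by linarith)).le
          · rw [abs_of_nonneg (by linarith)] at h4
            simp only [mul_comm (m p.1 _)]
            exact (h0 _ hp.2 _ hp.1 (by linarith)).le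
    _ = (μ.prod μ).real R * c := by rw [integral_indicator hRm, setIntegral_const, smul_eq_mul]
    _ ≤ _ := by gcongr

end Probability

/-- The one-step energy inequality for a bounded concave function of the energy. -/
lemma concave_energy_step {H : Type*} [NormedAddCommGroup H] [InnerProductSpace ℝ H] {κ : ℝ}
    (hκ : 0 ≤ κ) {z₀ z₁ ξ : H} {I : ℝ} (h : ⟪z₁ - z₀, z₁⟫ = -I + ⟪ξ, z₁⟫) :
    ((1 + κ * ‖z₀‖ ^ 2) ^ 2)⁻¹ * (2 * I) ≤ ‖z₀‖ ^ 2 / (1 + κ * ‖z₀‖ ^ 2)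
      - ‖z₁‖ ^ 2 / (1 + κ * ‖z₁‖ ^ 2) + 2 * ⟪ξ, ((1 + κ * ‖z₀‖ ^ 2) ^ 2)⁻¹ • z₀⟫ + ‖ξ‖ ^ 2 := by
  have h1 : ‖z₁‖ ^ 2 - ‖z₀‖ ^ 2 ≤ -(2 * I) + 2 * ⟪ξ, z₀⟫ + ‖ξ‖ ^ 2 := by
    have a1 : ‖z₁ - z₀ - ξ‖ ^ 2 = ‖z₁ - z₀‖ ^ 2 - 2 * ⟪z₁ - z₀, ξ⟫ + ‖ξ‖ ^ 2 := norm_sub_sq_real _ _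
    have a2 : ‖z₁ - z₀‖ ^ 2 = ‖z₁‖ ^ 2 - 2 * ⟪z₁, z₀⟫ + ‖z₀‖ ^ 2 := norm_sub_sq_real _ _
    have a3 : ⟪z₁ - z₀, z₁⟫ = ‖z₁‖ ^ 2 - ⟪z₁, z₀⟫ := by
      rw [inner_sub_left, real_inner_self_eq_norm_sq, real_inner_comm z₀]
    have a4 : ⟪z₁ - z₀, ξ⟫ = ⟪ξ, z₁⟫ - ⟪ξ, z₀⟫ := by
      rw [inner_sub_left, real_inner_comm z₁, real_inner_comm z₀]
    nlinarith [sq_nonneg ‖z₁ - z₀ - ξ‖]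
  rw [inner_smul_right]
  have hx := sq_nonneg ‖z₀‖
  have hy := sq_nonneg ‖z₁‖
  have hn := sq_nonneg ‖ξ‖
  generalize ‖z₀‖ ^ 2 = x at *
  generalize ‖z₁‖ ^ 2 = y at *
  generalize ‖ξ‖ ^ 2 = n at *
  generalize ⟪ξ, z₀⟫ = m at *
  have hκx : 0 ≤ κ * x := mul_nonneg hκ hx
  have hκy : 0 ≤ κ * y := mul_nonneg hκ hy
  have ha : 0 < 1 + κ * x := by linarith
  have hb : 0 < 1 + κ * y := by linarith
  have h2 : ((1 + κ * x) ^ 2)⁻¹ * (x - y) ≤ x / (1 + κ * x) - y / (1 + κ * y) := by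
    have : x / (1 + κ * x) - y / (1 + κ * y) - ((1 + κ * x) ^ 2)⁻¹ * (x - y) =
        κ * (x - y) ^ 2 / ((1 + κ * x) ^ 2 * (1 + κ * y)) := by
      field_simp; ring
    have h3 : 0 ≤ κ * (x - y) ^ 2 / ((1 + κ * x) ^ 2 * (1 + κ * y)) := by positivity
    linarith
  have hw : ((1 + κ * x) ^ 2)⁻¹ ≤ 1 := inv_le_one_of_one_le₀ (one_le_pow₀ (by linarith))
  have hw0 : 0 ≤ ((1 + κ * x) ^ 2)⁻¹ := by positivity
  generalize ((1 + κ * x) ^ 2)⁻¹ = w at *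
  nlinarith [mul_le_mul_of_nonneg_left h1 hw0, mul_le_mul_of_nonneg_right hw hn]

instance instCompleteSpaceVelV (D : Set E3) : CompleteSpace (VelV D) :=
  (Submodule.isClosed_topologicalClosure _).completeSpace_coe

section Saturation

variable {H : Type*} [NormedAddCommGroup H]

/-- A bounded concave function of the energy. -/
def satEnergy (κ : ℝ) (z : H) : ℝ := ‖z‖ ^ 2 / (1 + κ * ‖z‖ ^ 2)

/-- The derivative of `satEnergy` with respect to the energy. -/
def satWeight (κ : ℝ) (z : H) : ℝ := ((1 + κ * ‖z‖ ^ 2) ^ 2)⁻¹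

variable {κ : ℝ}

lemma satWeight_nonneg (κ : ℝ) (z : H) : 0 ≤ satWeight κ z := by unfold satWeight; positivity

lemma satWeight_le_one (hκ : 0 < κ) (z : H) : satWeight κ z ≤ 1 :=
  inv_le_one_of_one_le₀ (one_le_pow₀ (by have := mul_nonneg hκ.le (sq_nonneg ‖z‖); linarith))

lemma satEnergy_nonneg (hκ : 0 < κ) (z : H) : 0 ≤ satEnergy κ z := by unfold satEnergy; positivity

lemma satEnergy_le (hκ : 0 < κ) (z : H) : satEnergy κ z ≤ κ⁻¹ := by
  unfold satEnergy
  rw [div_le_iff₀ (by positivity), mul_add, inv_mul_cancel_left₀ hκ.ne']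
  have := inv_pos.2 hκ
  linarith

lemma norm_satWeight_smul_sq_le [NormedSpace ℝ H] (hκ : 0 < κ) (z : H) : ‖satWeight κ z • z‖ ^ 2 ≤ κ⁻¹ := by
  have h0 := satWeight_nonneg κ z
  have h1 := satWeight_le_one hκ z
  have h2 : satWeight κ z * ‖z‖ ^ 2 ≤ satEnergy κ z := by
    unfold satWeight satEnergy
    rw [inv_mul_eq_div]
    refine div_le_div_of_nonneg_left (by positivity) (by positivity) ?_
    have := mul_nonneg hκ.le (sq_nonneg ‖z‖)
    nlinarith
  rw [norm_smul, mul_pow, norm_of_nonneg h0]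
  have := satEnergy_le hκ z
  nlinarith [mul_le_mul_of_nonneg_left h2 h0, satEnergy_nonneg hκ z]

lemma norm_mul_norm_satWeight_le [NormedSpace ℝ H] (hκ : 0 < κ) (ξ z : H) :
    ‖ξ‖ * ‖satWeight κ z • z‖ ≤ ‖ξ‖ ^ 2 + κ⁻¹ := by
  have := norm_satWeight_smul_sq_le hκ z
  nlinarith [sq_nonneg (‖ξ‖ - ‖satWeight κ z • z‖), sq_nonneg ‖ξ‖]

variable [MeasurableSpace H] [BorelSpace H]

lemma measurable_satWeight (κ : ℝ) : Measurable (satWeight κ : H → ℝ) := by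
  unfold satWeight; fun_prop

lemma measurable_satEnergy (κ : ℝ) : Measurable (satEnergy κ : H → ℝ) := by
  unfold satEnergy; fun_prop

end Saturation

section Paths

variable {D : Set E3} {e : HilbertBasis ℕ ℝ (VelH D)} {lam : ℕ → ℝ} {α : ℝ}
  {z : ℝ≥0 → VelH D}

lemma IsRegularPath.exists_lift (hz : IsRegularPath e lam α z) :
    ∃ f : ℝ → VelV D, StronglyMeasurable f ∧ MemLp f 2 volume ∧
      ∀ᵐ s, s ∈ Icc (0 : ℝ) 1 → f s = toV (z s.toNNReal) ∧ (f s).field = (z s.toNNReal : L2Vec D) := by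
  obtain ⟨f₀, hf₀, hfe⟩ := (hz.energy 1).1
  refine ⟨(Icc 0 1).indicator f₀, hf₀.indicator measurableSet_Icc,
    (memLp_indicator_iff_restrict measurableSet_Icc).2 ((hz.energy 1).ae_eq hfe), ?_⟩
  rw [EventuallyEq, ae_restrict_iff' measurableSet_Icc] at hfe
  filter_upwards [hfe, hz.inV] with s h1 h2 hs
  rw [indicator_of_mem hs, ← h1 hs]
  exact ⟨rfl, toV_field (h2 hs.1)⟩

lemma average_dissipation_le {κ : ℝ} (hκ : 0 < κ) {s δ : ℝ} (hδ : 0 < δ) {f : ℝ → VelV D}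
    (hf : MemLp f 2 volume) {L : VelV D →L[ℝ] VelV D →L[ℝ] ℝ} {v : VelV D} {z₀ z₁ W₀ W₁ : VelH D}
    (hv : v.field = (z₁ : L2Vec D)) {c : ℝ}
    (h0 : ⟪(z₀ : L2Vec D), v.field⟫ = c - (∫ r in (0 : ℝ)..s, L (f r) v) + ⟪(W₀ : L2Vec D), v.field⟫)
    (h1 : ⟪(z₁ : L2Vec D), v.field⟫ = c - (∫ r in (0 : ℝ)..s + δ, L (f r) v)
      + ⟪(W₁ : L2Vec D), v.field⟫) :
    satWeight κ z₀ * (δ⁻¹ * ∫ r in s..s + δ, ((2 : ℝ) • L) (f r) v) ≤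
      δ⁻¹ * (satEnergy κ z₀ - satEnergy κ z₁) + 2 * δ⁻¹ * ⟪W₁ - W₀, satWeight κ z₀ • z₀⟫
        + δ⁻¹ * ‖W₁ - W₀‖ ^ 2 := by
  have hii : ∀ p q : ℝ, IntervalIntegrable (fun r => L (f r) v) volume p q := fun p q =>
    have := intervalIntegrable_of_memLp_two hf p q
    ⟨(L.flip v).integrable_comp this.1, (L.flip v).integrable_comp this.2⟩
  have hint : ∫ r in s..s + δ, L (f r) v = (∫ r in (0 : ℝ)..s + δ, L (f r) v)
      - ∫ r in (0 : ℝ)..s, L (f r) v :=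
    (intervalIntegral.integral_interval_sub_left (hii _ _) (hii _ _)).symm
  have hmain : ⟪z₁ - z₀, z₁⟫ = -(∫ r in s..s + δ, L (f r) v) + ⟪W₁ - W₀, z₁⟫ := by
    rw [inner_sub_left, inner_sub_left]
    rw [hv] at h0 h1
    simp only [Submodule.coe_inner]
    linarith
  have hc := concave_energy_step hκ.le hmain
  have hBI : ∫ r in s..s + δ, ((2 : ℝ) • L) (f r) v = 2 * ∫ r in s..s + δ, L (f r) v :=
    intervalIntegral.integral_const_mul _ _
  rw [hBI]
  have := mul_le_mul_of_nonneg_left hc (inv_pos.2 hδ).le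
  simp only [satWeight, satEnergy]
  linarith

lemma integral_le_of_le_add {Ω : Type*} {mΩ : MeasurableSpace Ω} {μ : Measure Ω}
    {G A M Q : Ω → ℝ} {a b c : ℝ} (hA : Integrable A μ) (hM : Integrable M μ) (hQ : Integrable Q μ)
    (hG : Integrable G μ) (h : ∀ᵐ x ∂μ, G x ≤ a * A x + b * M x + c * Q x) :
    ∫ x, G x ∂μ ≤ a * (∫ x, A x ∂μ) + b * (∫ x, M x ∂μ) + c * ∫ x, Q x ∂μ := by
  have h1 : Integrable (fun x => a * A x + b * M x) μ := (hA.const_mul a).add (hM.const_mul b)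
  refine (integral_mono_ae hG (h1.add (hQ.const_mul c)) h).trans_eq ?_
  simp only [Pi.add_apply]
  rw [integral_add h1 (hQ.const_mul c), integral_add (hA.const_mul a) (hM.const_mul b),
    integral_const_mul, integral_const_mul, integral_const_mul]

/-- The energy balance of a path, for a concave function of the energy and in integrated form. -/
lemma IsRegularPath.exists_dissipation (hz : IsRegularPath e lam α z)
    (hzm : Measurable fun s : ℝ => z (min s.toNNReal 1)) {W : ℝ → VelH D} (hW : Measurable W)
    {L : VelV D →L[ℝ] VelV D →L[ℝ] ℝ} {a : ℝ} (ha : 0 < a)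
    (hL : ∀ v : VelV D, a * stokesForm v v ≤ L v v) {C : ℝ} (hC : 0 < C)
    (hP : ∀ v : VelV D, ‖v.field‖ ≤ C * ‖v.grad‖)
    (heq : ∀ (t : ℝ≥0) (v : VelV D), ⟪(z t : L2Vec D), v.field⟫ = ⟪(z 0 : L2Vec D), v.field⟫
      - (∫ s in (0 : ℝ)..t, L (toV (z s.toNNReal)) v) + ⟪(W t : L2Vec D), v.field⟫)
    {κ : ℝ} (hκ : 0 < κ) :
    ∃ Y : ℝ × (ℝ → ℝ), Tendsto Y.2 (𝓝[>] 0) (𝓝 Y.1) ∧ 0 ≤ Y.1 ∧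
      ∫⁻ s in Ioc (0 : ℝ) (1 / 2), ofReal (2 * a / C ^ 2 *
        (satWeight κ (z (min s.toNNReal 1)) * ‖z (min s.toNNReal 1)‖ ^ 2)) ≤ ofReal Y.1 ∧
      ∀ δ ∈ Ioc (0 : ℝ) (1 / 2),
        Integrable (fun s => ‖W (s + δ) - W s‖ ^ 2) (volume.restrict (Ioc (0 : ℝ) (1 / 2))) →
        Y.2 δ ≤ δ⁻¹ * (∫ s in Ioc (0 : ℝ) (1 / 2), (satEnergy κ (z (min s.toNNReal 1))
            - satEnergy κ (z (min (s + δ).toNNReal 1))))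
          + 2 * δ⁻¹ * (∫ s in Ioc (0 : ℝ) (1 / 2), ⟪W (s + δ) - W s,
            satWeight κ (z (min s.toNNReal 1)) • z (min s.toNNReal 1)⟫)
          + δ⁻¹ * ∫ s in Ioc (0 : ℝ) (1 / 2), ‖W (s + δ) - W s‖ ^ 2 := by
  obtain ⟨f, hfm, hf, hfe⟩ := hz.exists_lift
  set ζ : ℝ → VelH D := fun s => z (min s.toNNReal 1) with hζ
  have hζe : ∀ s ∈ Icc (0 : ℝ) 1, ζ s = z s.toNNReal := fun s hs => by
    simp only [hζ]
    rw [min_eq_left (Real.toNNReal_le_one.2 hs.2)]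
  set g : ℝ → ℝ := fun s => satWeight κ (ζ s) with hg
  have hgm : Measurable g := (measurable_satWeight κ).comp hzm
  have hg0 : ∀ s, 0 ≤ g s := fun s => satWeight_nonneg _ _
  have hg1 : ∀ s, |g s| ≤ 1 := fun s => by rw [abs_of_nonneg (hg0 s)]; exact satWeight_le_one hκ _
  set B : VelV D →L[ℝ] VelV D →L[ℝ] ℝ := (2 : ℝ) • L with hB
  have hBv : ∀ v w, B v w = 2 * L v w := fun v w => rfl
  have hcoer : ∀ v : VelV D, 2 * a / C ^ 2 * ‖v.field‖ ^ 2 ≤ B v v := fun v => by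
    have h1 := hL v
    rw [stokesForm, real_inner_self_eq_norm_sq] at h1
    have h2 : ‖v.field‖ ^ 2 ≤ C ^ 2 * ‖v.grad‖ ^ 2 := by
      rw [← mul_pow]; exact pow_le_pow_left₀ (norm_nonneg _) (hP v) 2
    rw [hBv, div_mul_eq_mul_div, div_le_iff₀ (by positivity)]
    nlinarith [sq_pos_of_pos hC, mul_le_mul_of_nonneg_left h1 (sq_nonneg C)]
  have hpos : ∀ s, 0 ≤ g s * B (f s) (f s) := fun s =>
    mul_nonneg (hg0 s) (le_trans (by positivity) (hcoer (f s)))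
  refine ⟨(∫ s in Ioc 0 (1 / 2), g s * B (f s) (f s), fun δ =>
    ∫ s in Ioc 0 (1 / 2), g s * (δ⁻¹ * ∫ r in s..s + δ, B (f r) (f (s + δ)))),
    tendsto_integral_average hfm hf B hgm hg1 _, integral_nonneg hpos, ?_, ?_⟩
  · rw [ofReal_integral_eq_lintegral_ofReal (integrable_weight_bilin hf B hgm hg1 _)
      (ae_of_all _ hpos)]
    refine lintegral_mono_ae ?_
    filter_upwards [ae_restrict_of_ae hfe, ae_restrict_mem measurableSet_Ioc] with s h1 hs
    have hs' : s ∈ Icc (0 : ℝ) 1 := ⟨hs.1.le, by linarith [hs.2]⟩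
    refine ofReal_le_ofReal ?_
    have h2 := hcoer (f s)
    rw [(h1 hs').2, ← hζe s hs', Submodule.norm_coe] at h2
    calc _ = g s * (2 * a / C ^ 2 * ‖ζ s‖ ^ 2) := by simp only [hg]; ring
      _ ≤ _ := mul_le_mul_of_nonneg_left h2 (hg0 s)
  · intro δ hδ hξ
    have hδ' : 0 < δ⁻¹ := inv_pos.2 hδ.1
    have hWm : Measurable fun s => W (s + δ) - W s := (hW.comp (measurable_id.add_const δ)).sub hW
    have hFm : Measurable fun s => satEnergy κ (ζ s) := (measurable_satEnergy κ).comp hzm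
    have hFb : ∀ s, ‖satEnergy κ (ζ s)‖ ≤ κ⁻¹ := fun s => by
      rw [norm_of_nonneg (satEnergy_nonneg hκ _)]; exact satEnergy_le hκ _
    have i1 : Integrable (fun s => satEnergy κ (ζ s)) (volume.restrict (Ioc (0 : ℝ) (1 / 2))) :=
      Integrable.of_bound hFm.aestronglyMeasurable κ⁻¹ (ae_of_all _ hFb)
    have i2 : Integrable (fun s => satEnergy κ (ζ (s + δ)))
        (volume.restrict (Ioc (0 : ℝ) (1 / 2))) :=
      Integrable.of_bound (hFm.comp (measurable_id.add_const δ)).aestronglyMeasurable κ⁻¹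
        (ae_of_all _ fun s => hFb _)
    have hXm : Measurable fun s => satWeight κ (ζ s) • ζ s := hgm.smul hzm
    have i3 : Integrable (fun s => ⟪W (s + δ) - W s, satWeight κ (ζ s) • ζ s⟫)
        (volume.restrict (Ioc (0 : ℝ) (1 / 2))) := by
      refine (hξ.add (integrable_const κ⁻¹)).mono' (hWm.inner hXm).aestronglyMeasurable
        (ae_of_all _ fun s => (norm_inner_le_norm _ _).trans ?_)
      exact norm_mul_norm_satWeight_le hκ _ _
    have hstep : ∀ᵐ s ∂(volume.restrict (Ioc (0 : ℝ) (1 / 2))),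
        g s * (δ⁻¹ * ∫ r in s..s + δ, B (f r) (f (s + δ))) ≤
          δ⁻¹ * (satEnergy κ (ζ s) - satEnergy κ (ζ (s + δ)))
          + 2 * δ⁻¹ * ⟪W (s + δ) - W s, satWeight κ (ζ s) • ζ s⟫
          + δ⁻¹ * ‖W (s + δ) - W s‖ ^ 2 := by
      have hshift := (measurePreserving_add_right (volume : Measure ℝ) δ).quasiMeasurePreserving.ae hfe
      filter_upwards [ae_restrict_of_ae hshift, ae_restrict_mem measurableSet_Ioc] with s h2 hs
      have hs0 : s ∈ Icc (0 : ℝ) 1 := ⟨hs.1.le, by linarith [hs.2]⟩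
      have hs1 : s + δ ∈ Icc (0 : ℝ) 1 := ⟨by linarith [hs.1, hδ.1], by linarith [hs.2, hδ.2]⟩
      obtain ⟨h3, h4⟩ := h2 hs1
      set v := f (s + δ) with hv
      have hLf : ∀ᵐ r, r ∈ Icc (0 : ℝ) 1 → L (f r) v = L (toV (z r.toNNReal)) v := by
        filter_upwards [hfe] with r hr hr'
        rw [(hr hr').1]
      have hcongr : ∀ p q : ℝ, p ∈ Icc (0 : ℝ) 1 → q ∈ Icc (0 : ℝ) 1 →
          ∫ r in p..q, L (f r) v = ∫ r in p..q, L (toV (z r.toNNReal)) v := by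
        intro p q hp hq
        refine intervalIntegral.integral_congr_ae ?_
        filter_upwards [hLf] with r hr hr'
        exact hr (uIcc_subset_Icc hp hq (uIoc_subset_uIcc hr'))
      have hz0 : (0 : ℝ) ∈ Icc (0 : ℝ) 1 := ⟨le_rfl, zero_le_one⟩
      have e0 := heq s.toNNReal v
      have e1 := heq (s + δ).toNNReal v
      rw [coe_toNNReal _ hs0.1, ← hcongr 0 s hz0 hs0, ← hζe s hs0] at e0
      rw [coe_toNNReal _ hs1.1, ← hcongr 0 _ hz0 hs1, ← hζe _ hs1] at e1
      rw [← hζe _ hs1] at h4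
      exact average_dissipation_le hκ hδ.1 hf h4 e0 e1
    exact integral_le_of_le_add (i1.sub i2) i3 hξ (integrable_average hf B hgm hg1 δ _) hstep

end Paths

lemma integrable_sq_of_lintegral {α H : Type*} [NormedAddCommGroup H] [MeasurableSpace H]
    [BorelSpace H] {mα : MeasurableSpace α} {μ : Measure α} {f : α → H} (hf : Measurable f)
    (h : ∫⁻ x, ‖f x‖ₑ ^ 2 ∂μ ≠ ⊤) : Integrable (fun x => ‖f x‖ ^ 2) μ := by
  refine ⟨(hf.norm.pow_const 2).aestronglyMeasurable, ?_⟩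
  rw [hasFiniteIntegral_iff_ofReal (ae_of_all _ fun x => by positivity)]
  simp only [ofReal_norm_pow]
  exact h.lt_top

section Noise

variable {D : Set E3} {e : HilbertBasis ℕ ℝ (VelH D)} {σ : ℕ → ℝ} {Ω : Type*}
  {mΩ : MeasurableSpace Ω} {P : Measure Ω} {ℱ : Filtration ℝ≥0 mΩ} {β : ℕ → ℝ≥0 → Ω → ℝ}
  {W : ℝ → Ω → VelH D} {X : ℝ → Ω → VelH D}

lemma lintegral_measurable_wiener_sub_sq (hB : IsBrownianFamily P ℱ β)
    (hσ : Summable fun k => σ k ^ 2) (hWe : ∀ᵐ ω ∂P, ∀ s, W s ω = wiener e σ β s.toNNReal ω)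
    {s δ : ℝ} (hs : 0 ≤ s) (hδ : 0 ≤ δ) :
    ∫⁻ ω, ‖W (s + δ) ω - W s ω‖ₑ ^ 2 ∂P = ofReal ((∑' k, σ k ^ 2) * δ) := by
  have h := lintegral_wiener_sub_sq (e := e) hB hσ
    (toNNReal_le_toNNReal (show s ≤ s + δ by linarith))
  rw [coe_toNNReal _ hs, coe_toNNReal _ (by positivity), add_sub_cancel_left] at h
  rw [← h]
  refine lintegral_congr_ae ?_
  filter_upwards [hWe] with ω hω
  rw [hω, hω]

variable [IsProbabilityMeasure P]

/-- The time integral of the increments of the noise against an adapted bounded process is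
centered, with a variance of the order of the square of the length of the increments. -/
lemma integral_noise_term (hB : IsBrownianFamily P ℱ β)
    (hσ : Summable fun k => σ k ^ 2) (hW : Measurable (uncurry W))
    (hWe : ∀ᵐ ω ∂P, ∀ s, W s ω = wiener e σ β s.toNNReal ω)
    (hX : Measurable (uncurry X)) (hXa : ∀ s, Measurable[ℱ s.toNNReal] (X s)) {R : ℝ}
    (hR : 0 < R) (hXR : ∀ s ω, ‖X s ω‖ ^ 2 ≤ R) {T δ : ℝ} (hT : 0 ≤ T) (hδ : 0 < δ) :
    Integrable (fun ω => ∫ s in Ioc 0 T, ⟪W (s + δ) ω - W s ω, X s ω⟫) P ∧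
    ∫ ω, (∫ s in Ioc 0 T, ⟪W (s + δ) ω - W s ω, X s ω⟫) ∂P = 0 ∧
    Integrable (fun ω => (∫ s in Ioc 0 T, ⟪W (s + δ) ω - W s ω, X s ω⟫) ^ 2) P ∧
    ∫ ω, (∫ s in Ioc 0 T, ⟪W (s + δ) ω - W s ω, X s ω⟫) ^ 2 ∂P ≤
      2 * δ * T * (R * ((∑' k, σ k ^ 2) * δ)) ∧
    Integrable (fun q : Ω × ℝ => ‖W (q.2 + δ) q.1 - W q.2 q.1‖ ^ 2)
      (P.prod (volume.restrict (Ioc 0 T))) := by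
  have hσ0 : 0 ≤ ∑' k, σ k ^ 2 := tsum_nonneg fun k => sq_nonneg _
  have hξm : Measurable fun q : Ω × ℝ => W (q.2 + δ) q.1 - W q.2 q.1 :=
    (hW.comp (f := fun q : Ω × ℝ => (q.2 + δ, q.1)) (by fun_prop)).sub
      (hW.comp (f := fun q : Ω × ℝ => (q.2, q.1)) (by fun_prop))
  have hξs : ∀ s, Measurable fun ω => W (s + δ) ω - W s ω := fun s =>
    hξm.comp (measurable_prodMk_right (y := s))
  have hXm : Measurable fun q : Ω × ℝ => X q.2 q.1 :=
    hX.comp (f := fun q : Ω × ℝ => (q.2, q.1)) (by fun_prop)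
  have hXs : ∀ s, Measurable (X s) := fun s => (hXa s).mono (ℱ.le _) le_rfl
  have hm : Measurable fun q : Ω × ℝ => ⟪W (q.2 + δ) q.1 - W q.2 q.1, X q.2 q.1⟫ := hξm.inner hXm
  have hmu : Measurable (uncurry fun s ω => ⟪W (s + δ) ω - W s ω, X s ω⟫) :=
    hm.comp (f := fun q : ℝ × Ω => (q.2, q.1)) (by fun_prop)
  have hi2 : Integrable (fun q : Ω × ℝ => ‖W (q.2 + δ) q.1 - W q.2 q.1‖ ^ 2)
      (P.prod (volume.restrict (Ioc 0 T))) := by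
    refine integrable_sq_of_lintegral hξm ?_
    rw [lintegral_prod_symm _ (hξm.enorm.pow_const 2).aemeasurable]
    have : ∫⁻ s in Ioc 0 T, (∫⁻ ω, ‖W (s + δ) ω - W s ω‖ₑ ^ 2 ∂P) =
        ∫⁻ s in Ioc 0 T, ofReal ((∑' k, σ k ^ 2) * δ) :=
      setLIntegral_congr_fun measurableSet_Ioc fun s hs =>
        lintegral_measurable_wiener_sub_sq hB hσ hWe hs.1.le hδ.le
    rw [this, setLIntegral_const, volume_Ioc]
    exact mul_ne_top ofReal_ne_top ofReal_ne_top
  have hyoung : ∀ x y : VelH D, ‖y‖ ^ 2 ≤ R → ‖⟪x, y⟫‖ ≤ ‖x‖ ^ 2 + R := fun x y hy =>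
    (norm_inner_le_norm _ _).trans (by nlinarith [sq_nonneg (‖x‖ - ‖y‖), sq_nonneg ‖x‖])
  have hi : Integrable (fun q : Ω × ℝ => ⟪W (q.2 + δ) q.1 - W q.2 q.1, X q.2 q.1⟫)
      (P.prod (volume.restrict (Ioc 0 T))) :=
    (hi2.add (integrable_const R)).mono' hm.aestronglyMeasurable
      (ae_of_all _ fun q => hyoung _ _ (hXR _ _))
  have hX2 : ∀ s, ∫⁻ ω, ‖X s ω‖ₑ ^ 2 ∂P ≠ ⊤ := fun s => by
    refine ne_top_of_le_ne_top (b := ofReal R) ofReal_ne_top ?_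
    calc _ ≤ ∫⁻ _, ofReal R ∂P := lintegral_mono fun ω => by
          rw [← ofReal_norm_pow]; exact ofReal_le_ofReal (hXR s ω)
      _ = _ := by simp
  have hzero : ∀ s ∈ Ioc 0 T, ∫ ω, ⟪W (s + δ) ω - W s ω, X s ω⟫ ∂P = 0 := fun s hs => by
    rw [← (integral_inner_wiener_sub (e := e) hB hσ (toNNReal_le_toNNReal
      (show s ≤ s + δ by linarith)) (hXa s) (hX2 s)).2]
    refine integral_congr_ae ?_
    filter_upwards [hWe] with ω hω
    rw [hω, hω]
  have hm2 : ∀ s ∈ Ioc 0 T, ∫⁻ ω, ofReal (⟪W (s + δ) ω - W s ω, X s ω⟫ ^ 2) ∂P ≤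
      ofReal (R * ((∑' k, σ k ^ 2) * δ)) := fun s hs => by
    rw [ofReal_mul hR.le, ← lintegral_measurable_wiener_sub_sq hB hσ hWe hs.1.le hδ.le,
      ← lintegral_const_mul _ ((hξs s).enorm.pow_const 2)]
    refine lintegral_mono fun ω => ?_
    rw [← ofReal_norm_pow, ← ofReal_mul hR.le]
    refine ofReal_le_ofReal ?_
    have h1 := abs_real_inner_le_norm (W (s + δ) ω - W s ω) (X s ω)
    rw [← sq_abs]
    calc _ ≤ (‖W (s + δ) ω - W s ω‖ * ‖X s ω‖) ^ 2 := by gcongr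
      _ = ‖X s ω‖ ^ 2 * ‖W (s + δ) ω - W s ω‖ ^ 2 := by ring
      _ ≤ _ := by gcongr; exact hXR s ω
  have horth : ∀ s ∈ Ioc 0 T, ∀ t ∈ Ioc 0 T, s + δ ≤ t →
      ∫ ω, ⟪W (s + δ) ω - W s ω, X s ω⟫ * ⟪W (t + δ) ω - W t ω, X t ω⟫ ∂P = 0 := by
    intro s hs t ht hst
    set Y : Ω → VelH D := fun ω =>
      ⟪wiener e σ β (s + δ).toNNReal ω - wiener e σ β s.toNNReal ω, X s ω⟫ • X t ω with hY
    have hle1 : ℱ s.toNNReal ≤ ℱ t.toNNReal := ℱ.mono (toNNReal_le_toNNReal (by linarith))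
    have hle2 : ℱ (s + δ).toNNReal ≤ ℱ t.toNNReal := ℱ.mono (toNNReal_le_toNNReal hst)
    have hYm : Measurable[ℱ t.toNNReal] Y := by
      have q1 : Measurable[ℱ t.toNNReal] (wiener e σ β (s + δ).toNNReal) :=
        (measurable_wiener hB _).mono hle2 le_rfl
      have q2 : Measurable[ℱ t.toNNReal] (wiener e σ β s.toNNReal) :=
        (measurable_wiener hB _).mono hle1 le_rfl
      have q3 : Measurable[ℱ t.toNNReal] (X s) := (hXa s).mono hle1 le_rfl
      have q4 : Measurable[ℱ t.toNNReal] fun ω =>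
          ⟪wiener e σ β (s + δ).toNNReal ω - wiener e σ β s.toNNReal ω, X s ω⟫ :=
        Measurable.inner (𝕜 := ℝ) (q1.sub q2) q3
      exact q4.smul (hXa t)
    have hYe : ∀ᵐ ω ∂P, Y ω = ⟪W (s + δ) ω - W s ω, X s ω⟫ • X t ω := by
      filter_upwards [hWe] with ω hω
      simp only [hY, hω]
    have hY2 : ∫⁻ ω, ‖Y ω‖ₑ ^ 2 ∂P ≠ ⊤ := by
      have hmm : Measurable fun ω => ofReal (⟪W (s + δ) ω - W s ω, X s ω⟫ ^ 2) :=
        (((hξs s).inner (hXs s)).pow_const 2).ennreal_ofReal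
      have h1 : ∫⁻ ω, ‖Y ω‖ₑ ^ 2 ∂P ≤ ofReal R * ofReal (R * ((∑' k, σ k ^ 2) * δ)) := by
        refine le_trans ?_ (mul_le_mul_right (hm2 s hs) _)
        rw [← lintegral_const_mul _ hmm]
        refine lintegral_mono_ae ?_
        filter_upwards [hYe] with ω hω
        rw [hω, ← ofReal_norm_pow, ← ofReal_mul hR.le, norm_smul, mul_pow,
          norm_eq_abs, sq_abs, mul_comm]
        refine ofReal_le_ofReal ?_
        gcongr
        exact hXR t ω
      exact ne_top_of_le_ne_top (mul_ne_top ofReal_ne_top ofReal_ne_top) h1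
    rw [← (integral_inner_wiener_sub (e := e) hB hσ (toNNReal_le_toNNReal
      (show t ≤ t + δ by linarith)) hYm hY2).2]
    refine integral_congr_ae ?_
    filter_upwards [hWe, hYe] with ω hω hω'
    rw [hω', ← hω, ← hω]
    exact (real_inner_smul_right _ _ _).symm
  have hsq := integral_sq_integral_le hT hδ.le (c := R * ((∑' k, σ k ^ 2) * δ)) (by positivity) hmu
    hm2 horth
  refine ⟨hi.integral_prod_left, ?_, hsq.1, hsq.2, hi2⟩
  rw [integral_integral_swap (f := fun ω s => ⟪W (s + δ) ω - W s ω, X s ω⟫) hi]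
  exact (setIntegral_congr_fun measurableSet_Ioc hzero).trans (by simp)

end Noise

lemma abs_integral_sub_translate_le {F : ℝ → ℝ} (hF : Measurable F) {C : ℝ} (h0 : ∀ s, 0 ≤ F s)
    (hC : ∀ s, F s ≤ C) {T δ : ℝ} (hT : 0 ≤ T) (hδ : 0 ≤ δ) :
    |∫ s in Ioc 0 T, (F s - F (s + δ))| ≤ 2 * C * δ := by
  have hb : ∀ s, ‖F s‖ ≤ C := fun s => by rw [norm_of_nonneg (h0 s)]; exact hC s
  have hi : ∀ a b : ℝ, IntervalIntegrable F volume a b := fun a b =>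
    ⟨Integrable.of_bound hF.aestronglyMeasurable C (ae_of_all _ hb),
      Integrable.of_bound hF.aestronglyMeasurable C (ae_of_all _ hb)⟩
  have hFd : Measurable fun s => F (s + δ) := hF.comp (measurable_id.add_const δ)
  have hi' : IntervalIntegrable (fun s => F (s + δ)) volume 0 T :=
    ⟨Integrable.of_bound hFd.aestronglyMeasurable C (ae_of_all _ fun s => hb _),
      Integrable.of_bound hFd.aestronglyMeasurable C (ae_of_all _ fun s => hb _)⟩
  rw [← intervalIntegral.integral_of_le hT, intervalIntegral.integral_sub (hi _ _) hi',
    intervalIntegral.integral_comp_add_right, zero_add,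
    intervalIntegral.integral_interval_sub_interval_comm (hi _ _) (hi _ _) (hi _ _)]
  have h1 : ∀ a b : ℝ, |∫ s in a..b, F s| ≤ C * |b - a| := fun a b =>
    intervalIntegral.norm_integral_le_of_norm_le_const fun s _ => hb s
  have h2 := h1 0 δ
  have h3 := h1 T (T + δ)
  rw [sub_zero, abs_of_nonneg hδ] at h2
  rw [add_sub_cancel_left, abs_of_nonneg hδ] at h3
  refine (abs_sub _ _).trans ?_
  linarith

lemma centered_add {Ω : Type*} {mΩ : MeasurableSpace Ω} {P : Measure Ω} [IsProbabilityMeasure P]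
    {A M : Ω → ℝ} (hA : Measurable A) {C : ℝ} (hC : ∀ ω, |A ω| ≤ C) (hA0 : ∫ ω, A ω ∂P = 0)
    (hM : Integrable M P) (hM0 : ∫ ω, M ω ∂P = 0) (hM2 : Integrable (fun ω => M ω ^ 2) P) (c : ℝ) :
    Integrable (fun ω => A ω + c * M ω) P ∧ ∫ ω, (A ω + c * M ω) ∂P = 0 ∧
    Integrable (fun ω => (A ω + c * M ω) ^ 2) P ∧
    ∫ ω, (A ω + c * M ω) ^ 2 ∂P ≤ 2 * C ^ 2 + 2 * c ^ 2 * ∫ ω, M ω ^ 2 ∂P := by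
  have hAi : Integrable A P := Integrable.of_bound hA.aestronglyMeasurable C (ae_of_all _ hC)
  have hN2 : ∀ ω, (A ω + c * M ω) ^ 2 ≤ 2 * C ^ 2 + 2 * c ^ 2 * M ω ^ 2 := fun ω => by
    have h1 : A ω ^ 2 ≤ C ^ 2 := sq_le_sq' (abs_le.1 (hC ω)).1 (abs_le.1 (hC ω)).2
    nlinarith [sq_nonneg (A ω - c * M ω)]
  have hNi : Integrable (fun ω => A ω + c * M ω) P := hAi.add (hM.const_mul _)
  have hdom : Integrable (fun ω => 2 * C ^ 2 + 2 * c ^ 2 * M ω ^ 2) P :=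
    (integrable_const _).add (hM2.const_mul _)
  have hN2i : Integrable (fun ω => (A ω + c * M ω) ^ 2) P :=
    hdom.mono' (hNi.1.pow 2) (ae_of_all _ fun ω => by
      rw [norm_of_nonneg (sq_nonneg _)]; exact hN2 ω)
  refine ⟨hNi, ?_, hN2i, (integral_mono hN2i hdom hN2).trans_eq ?_⟩
  · rw [integral_add hAi (hM.const_mul _), hA0, integral_const_mul, hM0]
    simp
  · rw [integral_add (integrable_const _) (hM2.const_mul _), integral_const, probReal_univ, one_smul,
      integral_const_mul]

lemma centered_term {H : Type*} [NormedAddCommGroup H] [MeasurableSpace H] [BorelSpace H]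
    {Ω : Type*} {mΩ : MeasurableSpace Ω} {P : Measure Ω} [IsProbabilityMeasure P] {ζ : ℝ → Ω → H}
    {Z₀ : Ω → H} {κ : ℝ} (hκ : 0 < κ) (hζ : Measurable fun q : ℝ × Ω => ζ q.1 q.2)
    (hst : ∀ s, IdentDistrib (ζ s) Z₀ P P) {T δ : ℝ} (hT : 0 ≤ T) (hδ : 0 < δ) {M : Ω → ℝ}
    (hM : Integrable M P) (hM0 : ∫ ω, M ω ∂P = 0) (hM2 : Integrable (fun ω => M ω ^ 2) P) :
    Integrable (fun ω => δ⁻¹ * (∫ s in Ioc (0 : ℝ) T, (satEnergy κ (ζ s ω)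
      - satEnergy κ (ζ (s + δ) ω))) + 2 * δ⁻¹ * M ω) P ∧
    ∫ ω, (δ⁻¹ * (∫ s in Ioc (0 : ℝ) T, (satEnergy κ (ζ s ω)
      - satEnergy κ (ζ (s + δ) ω))) + 2 * δ⁻¹ * M ω) ∂P = 0 ∧
    Integrable (fun ω => (δ⁻¹ * (∫ s in Ioc (0 : ℝ) T, (satEnergy κ (ζ s ω)
      - satEnergy κ (ζ (s + δ) ω))) + 2 * δ⁻¹ * M ω) ^ 2) P ∧
    ∫ ω, (δ⁻¹ * (∫ s in Ioc (0 : ℝ) T, (satEnergy κ (ζ s ω)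
      - satEnergy κ (ζ (s + δ) ω))) + 2 * δ⁻¹ * M ω) ^ 2 ∂P ≤
      2 * (2 * κ⁻¹) ^ 2 + 8 * (δ⁻¹) ^ 2 * ∫ ω, M ω ^ 2 ∂P := by
  have hEm : Measurable fun q : ℝ × Ω => satEnergy κ (ζ q.1 q.2) := (measurable_satEnergy κ).comp hζ
  have hEd : Measurable fun q : Ω × ℝ => satEnergy κ (ζ q.2 q.1) - satEnergy κ (ζ (q.2 + δ) q.1) :=
    (hEm.comp (f := fun q : Ω × ℝ => (q.2, q.1)) (by fun_prop)).sub
      (hEm.comp (f := fun q : Ω × ℝ => (q.2 + δ, q.1)) (by fun_prop))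
  have hAb : ∀ ω, |δ⁻¹ * (∫ s in Ioc (0 : ℝ) T, (satEnergy κ (ζ s ω)
      - satEnergy κ (ζ (s + δ) ω)))| ≤ 2 * κ⁻¹ := fun ω => by
    have h := abs_integral_sub_translate_le (F := fun s => satEnergy κ (ζ s ω))
      (hEm.comp (measurable_prodMk_right (y := ω))) (fun s => satEnergy_nonneg hκ _)
      (fun s => satEnergy_le hκ _) hT hδ.le
    rw [abs_mul, abs_of_pos (inv_pos.2 hδ), inv_mul_le_iff₀ hδ]
    linarith
  have hA0 : ∫ ω, (δ⁻¹ * (∫ s in Ioc (0 : ℝ) T, (satEnergy κ (ζ s ω)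
      - satEnergy κ (ζ (s + δ) ω)))) ∂P = 0 := by
    rw [integral_const_mul]
    have hint : Integrable (fun q : Ω × ℝ => satEnergy κ (ζ q.2 q.1)
        - satEnergy κ (ζ (q.2 + δ) q.1)) (P.prod (volume.restrict (Ioc (0 : ℝ) T))) := by
      refine Integrable.of_bound hEd.aestronglyMeasurable κ⁻¹ (ae_of_all _ fun q => ?_)
      rw [norm_eq_abs, abs_le]
      constructor <;> linarith [satEnergy_le hκ (ζ q.2 q.1), satEnergy_nonneg hκ (ζ q.2 q.1),
        satEnergy_le hκ (ζ (q.2 + δ) q.1), satEnergy_nonneg hκ (ζ (q.2 + δ) q.1)]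
    have hstat : ∀ s, ∫ ω, satEnergy κ (ζ s ω) ∂P = ∫ ω, satEnergy κ (Z₀ ω) ∂P := fun s =>
      ((hst s).comp (measurable_satEnergy κ)).integral_eq
    have hsi : ∀ s, Integrable (fun ω => satEnergy κ (ζ s ω)) P := fun s =>
      Integrable.of_bound (hEm.comp measurable_prodMk_left).aestronglyMeasurable κ⁻¹
        (ae_of_all _ fun ω => by
          rw [norm_of_nonneg (satEnergy_nonneg hκ _)]; exact satEnergy_le hκ _)
    rw [integral_integral_swap (f := fun ω s => satEnergy κ (ζ s ω) - satEnergy κ (ζ (s + δ) ω))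
      hint]
    simp [integral_sub (hsi _) (hsi _), hstat]
  have hAm : Measurable fun ω => δ⁻¹ * (∫ s in Ioc (0 : ℝ) T, (satEnergy κ (ζ s ω)
      - satEnergy κ (ζ (s + δ) ω))) :=
    (hEd.stronglyMeasurable.integral_prod_right'
      (ν := volume.restrict (Ioc (0 : ℝ) T))).measurable.const_mul _
  have h := centered_add hAm hAb hA0 hM hM0 hM2 (2 * δ⁻¹)
  have e : 2 * (2 * δ⁻¹) ^ 2 = 8 * (δ⁻¹) ^ 2 := by ring
  rwa [e] at h

section Forcing

variable {D : Set E3} {e : HilbertBasis ℕ ℝ (VelH D)} {lam σ : ℕ → ℝ}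
  {L : VelV D →L[ℝ] VelV D →L[ℝ] ℝ} {ν : ℝ} {Ω : Type*} {mΩ : MeasurableSpace Ω} {P : Measure Ω}
  {ℱ : Filtration ℝ≥0 mΩ} {β : ℕ → ℝ≥0 → Ω → ℝ} {u Z : ℝ≥0 → Ω → VelH D}

lemma IsStationaryMartingaleSolution.identDistrib_forcing
    (hsol : IsStationaryMartingaleSolution e lam σ L ν P ℱ β u Z) (t : ℝ≥0) :
    IdentDistrib (Z t) (Z 0) P P := by
  have h := (hsol.stationary t).comp (u := fun f : ℝ≥0 → VelH D × VelH D => (f 0).2)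
    (measurable_pi_apply (0 : ℝ≥0)).snd
  simpa [comp_def] using h

variable [IsProbabilityMeasure P]

lemma lintegral_satWeight_mul_le
    (hsol : IsStationaryMartingaleSolution e lam σ L ν P ℱ β u Z) (hσ : Summable fun k => σ k ^ 2)
    {a : ℝ} (ha : 0 < a) (hL : ∀ v : VelV D, a * stokesForm v v ≤ L v v) {C : ℝ} (hC : 0 < C)
    (hP : ∀ v : VelV D, ‖v.field‖ ≤ C * ‖v.grad‖) {κ : ℝ} (hκ : 0 < κ) :
    ∫⁻ ω, ofReal (2 * a / C ^ 2 * (satWeight κ (Z 0 ω) * ‖Z 0 ω‖ ^ 2)) ∂P ≤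
      ofReal (∑' k, σ k ^ 2) := by
  have hB := hsol.noise
  have hσ0 : 0 ≤ ∑' k, σ k ^ 2 := tsum_nonneg fun k => sq_nonneg _
  set S := ∑' k, σ k ^ 2 with hS
  obtain ⟨W, hW, hWe⟩ := exists_measurable_wiener hB e σ
  have hζ : Measurable fun q : ℝ × Ω => Z (min q.1.toNNReal 1) q.2 :=
    measurable_progressive hsol.progressive_Z
  set ζ : ℝ → Ω → VelH D := fun s ω => Z (min s.toNNReal 1) ω with hζd
  set X : ℝ → Ω → VelH D := fun s ω => satWeight κ (ζ s ω) • ζ s ω with hXd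
  have hXm : Measurable (uncurry X) := ((measurable_satWeight κ).comp hζ).smul hζ
  have hXa : ∀ s, Measurable[ℱ s.toNNReal] (X s) := fun s => by
    have h1 : Measurable[ℱ s.toNNReal] (ζ s) :=
      (hsol.progressive_Z.stronglyAdapted (min s.toNNReal 1)).measurable.mono
        (ℱ.mono (min_le_left _ _)) le_rfl
    exact ((measurable_satWeight κ).comp h1).smul h1
  have hXR : ∀ s ω, ‖X s ω‖ ^ 2 ≤ κ⁻¹ := fun s ω => norm_satWeight_smul_sq_le hκ _
  obtain ⟨α, -, hreg⟩ := hsol.regular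
  have hdiss : ∀ᵐ ω ∂P, ∃ Y : ℝ × (ℝ → ℝ), Tendsto Y.2 (𝓝[>] 0) (𝓝 Y.1) ∧ 0 ≤ Y.1 ∧
      ∫⁻ s in Ioc (0 : ℝ) (1 / 2), ofReal (2 * a / C ^ 2 *
        (satWeight κ (ζ s ω) * ‖ζ s ω‖ ^ 2)) ≤ ofReal Y.1 ∧
      ∀ δ ∈ Ioc (0 : ℝ) (1 / 2),
        Integrable (fun s => ‖W (s + δ) ω - W s ω‖ ^ 2) (volume.restrict (Ioc (0 : ℝ) (1 / 2))) →
        Y.2 δ ≤ δ⁻¹ * (∫ s in Ioc (0 : ℝ) (1 / 2), (satEnergy κ (ζ s ω)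
            - satEnergy κ (ζ (s + δ) ω)))
          + 2 * δ⁻¹ * (∫ s in Ioc (0 : ℝ) (1 / 2), ⟪W (s + δ) ω - W s ω, X s ω⟫)
          + δ⁻¹ * ∫ s in Ioc (0 : ℝ) (1 / 2), ‖W (s + δ) ω - W s ω‖ ^ 2 := by
    filter_upwards [hreg, hsol.ornsteinUhlenbeck, hWe] with ω h1 h2 h3
    refine h1.2.exists_dissipation (hζ.comp (measurable_prodMk_right (y := ω)))
      (hW.comp (measurable_prodMk_right (y := ω))) ha hL hC hP (fun t v => ?_) hκ
    have h4 := h3 t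
    rw [Real.toNNReal_coe] at h4
    change _ = _ - _ + ⟪(W t ω : L2Vec D), v.field⟫
    rw [h4]
    exact h2 t v
  obtain ⟨Y, hY⟩ := hdiss.choice
  set δ : ℕ → ℝ := fun n => 1 / 2 / ((n : ℝ) + 1) with hδ
  have hδ0 : ∀ n, 0 < δ n := fun n => by positivity
  have hδ1 : ∀ n, δ n ∈ Ioc (0 : ℝ) (1 / 2) := fun n => ⟨hδ0 n, div_le_self (by norm_num) (by
    have : (0 : ℝ) ≤ n := n.cast_nonneg
    linarith)⟩
  have hδt : Tendsto δ atTop (𝓝[>] 0) := by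
    refine tendsto_nhdsWithin_iff.2 ⟨?_, Eventually.of_forall hδ0⟩
    have h := (tendsto_one_div_add_atTop_nhds_zero_nat (𝕜 := ℝ)).const_mul (1 / 2)
    rw [mul_zero] at h
    refine h.congr fun n => ?_
    rw [hδ, mul_one_div]
  have hnoise := fun n => integral_noise_term (T := 1 / 2) (δ := δ n) hB hσ hW hWe hXm hXa
    (inv_pos.2 hκ) hXR (by norm_num) (hδ0 n)
  have hterm := fun n => centered_term (T := 1 / 2) hκ hζ
    (fun s => hsol.identDistrib_forcing (min s.toNNReal 1)) (by norm_num) (hδ0 n)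
    (hnoise n).1 (hnoise n).2.1 (hnoise n).2.2.1
  have hfin := lintegral_le_of_tendsto_of_le (P := P) (Y := fun ω => (Y ω).1)
    (Yn := fun n ω => (Y ω).2 (δ n)) (N := fun n ω => (δ n)⁻¹ * (∫ s in Ioc (0 : ℝ) (1 / 2),
      (satEnergy κ (ζ s ω) - satEnergy κ (ζ (s + δ n) ω)))
      + 2 * (δ n)⁻¹ * (∫ s in Ioc (0 : ℝ) (1 / 2), ⟪W (s + δ n) ω - W s ω, X s ω⟫))
    (Q := fun n ω => (δ n)⁻¹ * ∫ s in Ioc (0 : ℝ) (1 / 2), ‖W (s + δ n) ω - W s ω‖ ^ 2)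
    (C := 2 * (2 * κ⁻¹) ^ 2 + 8 * (κ⁻¹ * S)) (q := 1 / 2 * S) (by positivity) (by positivity)
    (hY.mono fun ω h => h.2.1) (hY.mono fun ω h => h.1.comp hδt) (fun n => ?_)
    (fun n => (hterm n).1) (fun n => (hterm n).2.1) (fun n => (hterm n).2.2.1) (fun n => ?_)
    (fun n => (hnoise n).2.2.2.2.integral_prod_left.const_mul _)
    (fun n ω => mul_nonneg (inv_pos.2 (hδ0 n)).le (integral_nonneg fun s => sq_nonneg _))
    (fun n => ?_)
  · have hstat : ∀ s, ∫⁻ ω, ofReal (2 * a / C ^ 2 * (satWeight κ (ζ s ω) * ‖ζ s ω‖ ^ 2)) ∂P =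
        ∫⁻ ω, ofReal (2 * a / C ^ 2 * (satWeight κ (Z 0 ω) * ‖Z 0 ω‖ ^ 2)) ∂P := fun s => by
      have hm : Measurable fun z : VelH D =>
          ofReal (2 * a / C ^ 2 * (satWeight κ z * ‖z‖ ^ 2)) :=
        (((measurable_satWeight κ).mul (measurable_norm.pow_const 2)).const_mul _).ennreal_ofReal
      exact ((hsol.identDistrib_forcing (min s.toNNReal 1)).comp hm).lintegral_eq
    have hmm : Measurable fun q : Ω × ℝ =>
        ofReal (2 * a / C ^ 2 * (satWeight κ (ζ q.2 q.1) * ‖ζ q.2 q.1‖ ^ 2)) := by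
      have h1 : Measurable fun q : Ω × ℝ => ζ q.2 q.1 :=
        hζ.comp (f := fun q : Ω × ℝ => (q.2, q.1)) (by fun_prop)
      exact ((((measurable_satWeight κ).comp h1).mul (h1.norm.pow_const 2)).const_mul _).ennreal_ofReal
    have h2 := (lintegral_mono_ae (hY.mono fun ω h => h.2.2.1)).trans hfin
    rw [lintegral_lintegral_swap hmm.aemeasurable] at h2
    simp only [hstat] at h2
    rw [setLIntegral_const, volume_Ioc, sub_zero, mul_comm, ofReal_mul (by norm_num)] at h2
    exact (ENNReal.mul_le_mul_iff_right (by simp) ofReal_ne_top).1 h2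
  · filter_upwards [hY, (hnoise n).2.2.2.2.prod_right_ae] with ω h h'
    exact h.2.2.2 (δ n) (hδ1 n) h'
  · refine (hterm n).2.2.2.trans ?_
    have h1 := (hnoise n).2.2.2.1
    have h2 : 8 * ((δ n)⁻¹) ^ 2 * (2 * δ n * (1 / 2) * (κ⁻¹ * (S * δ n))) = 8 * (κ⁻¹ * S) := by
      have := (hδ0 n).ne'
      field_simp
    rw [← h2]
    gcongr
  · rw [integral_const_mul, integral_integral_swap (f := fun ω s => ‖W (s + δ n) ω - W s ω‖ ^ 2)
      (hnoise n).2.2.2.2]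
    have h1 : ∀ s ∈ Ioc (0 : ℝ) (1 / 2), ∫ ω, ‖W (s + δ n) ω - W s ω‖ ^ 2 ∂P = S * δ n := by
      intro s hs
      have hm : Measurable fun ω => W (s + δ n) ω - W s ω :=
        (hW.comp (f := fun ω => (s + δ n, ω)) (by fun_prop)).sub
          (hW.comp (f := fun ω => (s, ω)) (by fun_prop))
      have h2 := lintegral_measurable_wiener_sub_sq hB hσ hWe hs.1.le (hδ0 n).le
      have h3 := integrable_sq_of_lintegral (μ := P) hm (by rw [h2]; exact ofReal_ne_top)
      simp only [← ofReal_norm_pow] at h2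
      rw [← ofReal_integral_eq_lintegral_ofReal h3 (ae_of_all _ fun ω => sq_nonneg _)] at h2
      have hpos : 0 ≤ S * δ n := mul_nonneg hσ0 (hδ0 n).le
      exact (ENNReal.ofReal_eq_ofReal_iff (integral_nonneg fun ω => sq_nonneg _) hpos).1 h2
    rw [setIntegral_congr_fun measurableSet_Ioc h1, setIntegral_const, Real.volume_real_Ioc_of_le
      (by norm_num), smul_eq_mul]
    have := (hδ0 n).ne'
    field_simp
    simp

/-- The second moment of the forcing is bounded by the intensity of the noise. -/
lemma lintegral_norm_sq_forcing_le
    (hsol : IsStationaryMartingaleSolution e lam σ L ν P ℱ β u Z) (hσ : Summable fun k => σ k ^ 2)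
    {a : ℝ} (ha : 0 < a) (hL : ∀ v : VelV D, a * stokesForm v v ≤ L v v) {C : ℝ} (hC : 0 < C)
    (hP : ∀ v : VelV D, ‖v.field‖ ≤ C * ‖v.grad‖) :
    ofReal (2 * a / C ^ 2) * ∫⁻ ω, ‖Z 0 ω‖ₑ ^ 2 ∂P ≤ ofReal (∑' k, σ k ^ 2) := by
  have hZm : Measurable (Z 0) :=
    (hsol.progressive_Z.stronglyAdapted 0).measurable.mono (ℱ.le 0) le_rfl
  set κ : ℕ → ℝ := fun n => 1 / ((n : ℝ) + 1) with hκ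
  have hκ0 : ∀ n, 0 < κ n := fun n => by positivity
  have hκt : Tendsto κ atTop (𝓝 0) := tendsto_one_div_add_atTop_nhds_zero_nat
  have hlim : ∀ z : VelH D, Tendsto (fun n => ofReal (2 * a / C ^ 2 *
      (satWeight (κ n) z * ‖z‖ ^ 2))) atTop (𝓝 (ofReal (2 * a / C ^ 2) * ‖z‖ₑ ^ 2)) := by
    intro z
    have h1 : Tendsto (fun n => satWeight (κ n) z) atTop (𝓝 1) := by
      have h2 : Tendsto (fun n => ((1 + κ n * ‖z‖ ^ 2) ^ 2)⁻¹) atTop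
          (𝓝 (((1 + 0 * ‖z‖ ^ 2) ^ 2)⁻¹)) :=
        (((hκt.mul_const _).const_add 1).pow 2).inv₀ (by simp)
      simpa [satWeight] using h2
    have h3 := ((h1.mul_const (‖z‖ ^ 2)).const_mul (2 * a / C ^ 2))
    rw [one_mul] at h3
    rw [← ofReal_norm_pow, ← ofReal_mul (by positivity)]
    exact (continuous_ofReal.tendsto _).comp h3
  calc _ = ∫⁻ ω, ofReal (2 * a / C ^ 2) * ‖Z 0 ω‖ₑ ^ 2 ∂P :=
        (lintegral_const_mul _ (hZm.enorm.pow_const 2)).symm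
    _ = ∫⁻ ω, liminf (fun n => ofReal (2 * a / C ^ 2 *
        (satWeight (κ n) (Z 0 ω) * ‖Z 0 ω‖ ^ 2))) atTop ∂P :=
        lintegral_congr fun ω => (hlim (Z 0 ω)).liminf_eq.symm
    _ ≤ liminf (fun n => ∫⁻ ω, ofReal (2 * a / C ^ 2 *
        (satWeight (κ n) (Z 0 ω) * ‖Z 0 ω‖ ^ 2)) ∂P) atTop :=
        lintegral_liminf_le fun n => ((((measurable_satWeight (κ n)).comp hZm).mul
          (hZm.norm.pow_const 2)).const_mul _).ennreal_ofReal
    _ ≤ _ := (liminf_le_liminf (v := fun _ => ofReal (∑' k, σ k ^ 2))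
          (Eventually.of_forall fun n =>
            lintegral_satWeight_mul_le hsol hσ ha hL hC hP (hκ0 n))).trans_eq (liminf_const _)

end Forcing

/-! ### Radial kernels -/

/-- The kernel `A(|h|²) id + X(|h|²) h ⊗ h`. -/
def radialKernel (A X : ℝ → ℝ) (h : E3) : E3 →L[ℝ] E3 :=
  A (‖h‖ ^ 2) • ContinuousLinearMap.id ℝ E3 + X (‖h‖ ^ 2) • (innerSL ℝ h).smulRight h

section Radial

variable {A X g A' X' g' : ℝ → ℝ} {ρ : ℝ}

lemma radialKernel_apply (h b : E3) :
    radialKernel A X h b = A (‖h‖ ^ 2) • b + (X (‖h‖ ^ 2) * ⟪h, b⟫) • h := by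
  simp [radialKernel, smul_smul]

lemma contDiff_radialKernel (hA : ContDiff ℝ (⊤ : ℕ∞) A) (hX : ContDiff ℝ (⊤ : ℕ∞) X) :
    ContDiff ℝ (⊤ : ℕ∞) (radialKernel A X) := by
  have hs : ContDiff ℝ (⊤ : ℕ∞) fun h : E3 => ‖h‖ ^ 2 := contDiff_norm_sq ℝ
  exact ((hA.comp hs).smul contDiff_const).add
    ((hX.comp hs).smul ((innerSL ℝ).contDiff.smulRight contDiff_id))

lemma fderiv_radialKernel_apply (hA : ContDiff ℝ (⊤ : ℕ∞) A) (hX : ContDiff ℝ (⊤ : ℕ∞) X)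
    (dA : ∀ s, HasDerivAt A (A' s) s) (dX : ∀ s, HasDerivAt X (X' s) s) (h a b : E3) :
    fderiv ℝ (radialKernel A X) h a b = (2 * ⟪h, a⟫ * A' (‖h‖ ^ 2)) • b
      + (2 * ⟪h, a⟫ * X' (‖h‖ ^ 2) * ⟪h, b⟫ + X (‖h‖ ^ 2) * ⟪a, b⟫) • h
      + (X (‖h‖ ^ 2) * ⟪h, b⟫) • a := by
  have hl : HasDerivAt (fun t : ℝ => h + t • a) a 0 := by
    simpa using ((hasDerivAt_id (0 : ℝ)).smul_const a).const_add h
  have e0 : h + (0 : ℝ) • a = h := by simp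
  have h1 : HasDerivAt (fun t : ℝ => radialKernel A X (h + t • a))
      (fderiv ℝ (radialKernel A X) h a) 0 := by
    have := ((contDiff_radialKernel hA hX).differentiable (by simp)
      (h + (0 : ℝ) • a)).hasFDerivAt.comp_hasDerivAt (0 : ℝ) hl
    rwa [e0] at this
  have h1b : HasDerivAt (fun t : ℝ => radialKernel A X (h + t • a) b)
      (fderiv ℝ (radialKernel A X) h a b) 0 := by
    simpa using h1.clm_apply (hasDerivAt_const (0 : ℝ) b)
  have hs : HasDerivAt (fun t : ℝ => ‖h + t • a‖ ^ 2) (2 * ⟪h, a⟫) 0 := by simpa using hl.norm_sq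
  have hi : HasDerivAt (fun t : ℝ => ⟪h + t • a, b⟫) ⟪a, b⟫ 0 := by
    simpa using hl.inner ℝ (hasDerivAt_const (0 : ℝ) b)
  have hA0 : HasDerivAt (fun t : ℝ => A (‖h + t • a‖ ^ 2)) (A' (‖h‖ ^ 2) * (2 * ⟪h, a⟫)) 0 := by
    have := (dA (‖h + (0 : ℝ) • a‖ ^ 2)).comp (0 : ℝ) hs
    rwa [e0] at this
  have hX0 : HasDerivAt (fun t : ℝ => X (‖h + t • a‖ ^ 2)) (X' (‖h‖ ^ 2) * (2 * ⟪h, a⟫)) 0 := by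
    have := (dX (‖h + (0 : ℝ) • a‖ ^ 2)).comp (0 : ℝ) hs
    rwa [e0] at this
  have h2 := (hA0.smul_const b).add ((hX0.mul hi).smul hl)
  have h3 : (fun t : ℝ => radialKernel A X (h + t • a) b) = (fun t : ℝ => A (‖h + t • a‖ ^ 2) • b) +
        ((fun t : ℝ => X (‖h + t • a‖ ^ 2)) * fun t : ℝ => ⟪h + t • a, b⟫) •
          fun t : ℝ => h + t • a := by
    ext1 t; simp [radialKernel_apply]
  rw [h3] at h1b
  rw [h1b.unique h2]
  simp only [Pi.mul_apply, e0]
  module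

lemma tri_radialKernel (hA : ContDiff ℝ (⊤ : ℕ∞) A) (hX : ContDiff ℝ (⊤ : ℕ∞) X)
    (dA : ∀ s, HasDerivAt A (A' s) s) (dX : ∀ s, HasDerivAt X (X' s) s) (h v : E3) :
    tri (radialKernel A X) h v v v = 2 * ⟪h, v⟫ * ((A' (‖h‖ ^ 2) + X (‖h‖ ^ 2)) * ‖v‖ ^ 2
      + X' (‖h‖ ^ 2) * ⟪h, v⟫ ^ 2) := by
  rw [tri, fderiv_radialKernel_apply hA hX dA dX]
  simp only [inner_add_right, real_inner_smul_right, real_inner_self_eq_norm_sq,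
    real_inner_comm h v]
  ring

lemma smoothIn_of_eq_zero {F : Type*} [NormedAddCommGroup F] [NormedSpace ℝ F] {f : E3 → F}
    (hf : ContDiff ℝ (⊤ : ℕ∞) f) (h0 : ∀ h, ρ < ‖h‖ → f h = 0) :
    SmoothIn (closedBall 0 ρ) f := by
  have hs : tsupport f ⊆ closedBall 0 ρ := by
    refine closure_minimal (fun h hh => ?_) isClosed_closedBall
    rw [mem_closedBall_zero_iff]
    by_contra! hlt
    exact hh (h0 h hlt)
  exact ⟨hf, (isCompact_closedBall 0 ρ).of_isClosed_subset (isClosed_tsupport f) hs, hs⟩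

lemma isKernel_radialKernel (hρ : 0 ≤ ρ) (hA : ContDiff ℝ (⊤ : ℕ∞) A)
    (hX : ContDiff ℝ (⊤ : ℕ∞) X) (hg : ContDiff ℝ (⊤ : ℕ∞) g)
    (dA : ∀ s, HasDerivAt A (A' s) s) (dX : ∀ s, HasDerivAt X (X' s) s)
    (dg : ∀ s, HasDerivAt g (A' s + s * X' s + 2 * X s) s)
    (zA : ∀ s, ρ ^ 2 ≤ s → A s = 0) (zX : ∀ s, ρ ^ 2 ≤ s → X s = 0)
    (zg : ∀ s, ρ ^ 2 ≤ s → g s = 0) :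
    IsKernel ρ (radialKernel A X) (fun h => g (‖h‖ ^ 2)) := by
  have hs : ContDiff ℝ (⊤ : ℕ∞) fun h : E3 => ‖h‖ ^ 2 := contDiff_norm_sq ℝ
  have far : ∀ h : E3, ρ < ‖h‖ → ρ ^ 2 ≤ ‖h‖ ^ 2 := fun h hh => by gcongr
  refine ⟨smoothIn_of_eq_zero (contDiff_radialKernel hA hX) fun h hh => ?_,
    smoothIn_of_eq_zero (hg.comp hs) fun h hh => zg _ (far h hh), fun h => ?_, fun h => by simp,
    fun h a b => ?_, fun h b => ?_⟩
  · ext1 b; simp [radialKernel_apply, zA _ (far h hh), zX _ (far h hh)]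
  · ext1 b; simp [radialKernel_apply]
  · simp only [radialKernel_apply, inner_add_left, inner_add_right, real_inner_smul_left,
      real_inner_smul_right, real_inner_comm h a]
    ring
  · have hd : HasFDerivAt (fun h : E3 => g (‖h‖ ^ 2))
        ((A' (‖h‖ ^ 2) + ‖h‖ ^ 2 * X' (‖h‖ ^ 2) + 2 * X (‖h‖ ^ 2)) • (2 • innerSL ℝ h)) h :=
      (dg (‖h‖ ^ 2)).comp_hasFDerivAt h (hasStrictFDerivAt_norm_sq h).hasFDerivAt
    rw [hd.fderiv]
    simp only [fderiv_radialKernel_apply hA hX dA dX]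
    have e1 : ⟪h, b⟫ = ∑ i, h i * b i := by simp [PiLp.inner_apply, mul_comm]
    have e2 : ‖h‖ ^ 2 = ∑ i, h i * h i := by rw [EuclideanSpace.real_norm_sq_eq]; simp [sq]
    have e3 : ∀ i, ⟪h, basisVec i⟫ = h i := fun i => by
      simp [basisVec, EuclideanSpace.inner_single_right]
    have e4 : ∀ i, ⟪basisVec i, b⟫ = b i := fun i => by
      simp [basisVec, inner_single_left]
    have e5 : ∀ i, (basisVec i : E3) i = 1 := fun i => by simp [basisVec]
    simp only [PiLp.add_apply, PiLp.smul_apply, smul_eq_mul, e3, e4, e5]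
    generalize hc : A' (‖h‖ ^ 2) = p
    generalize X' (‖h‖ ^ 2) = q
    generalize X (‖h‖ ^ 2) = r
    simp only [add_apply, smul_apply, smul_eq_mul, innerSL_apply_apply,
      two_smul, e1, e2, Fin.sum_univ_three]
    ring

lemma norm_radialKernel_le {a x : ℝ} {h : E3} (hA : |A (‖h‖ ^ 2)| ≤ a)
    (hX : |X (‖h‖ ^ 2)| * ‖h‖ ^ 2 ≤ x) : ‖radialKernel A X h‖ ≤ a + x := by
  refine (norm_add_le _ _).trans (add_le_add ?_ ?_)
  · rw [norm_smul, norm_eq_abs]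
    calc _ ≤ |A (‖h‖ ^ 2)| * 1 := by gcongr; exact norm_id_le
      _ ≤ a := by rwa [mul_one]
  · rw [norm_smul, norm_eq_abs, ContinuousLinearMap.norm_smulRight_apply, innerSL_apply_norm,
      ← sq]
    exact hX

end Radial

/-- A smooth family of compactly supported functions has uniform second order bounds on compact
sets of parameters. -/
lemma exists_uniform_C2Bound {F : Type*} [NormedAddCommGroup F] [NormedSpace ℝ F]
    {f : ℝ × E3 → F} (hf : ContDiff ℝ (⊤ : ℕ∞) f) {R : ℝ}
    (h0 : ∀ l ∈ Icc (0 : ℝ) 1, ∀ h, R < ‖h‖ → f (l, h) = 0) :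
    ∃ M, ∀ l ∈ Icc (0 : ℝ) 1, C2Bound (fun h => f (l, h)) M := by
  have slice : ∀ {g : ℝ × E3 → F}, ContDiff ℝ (⊤ : ℕ∞) g → ∀ l (a h : E3),
      dirDeriv a (fun h => g (l, h)) h = fderiv ℝ g (l, h) (0, a) := by
    intro g hg l a h
    have h1 : HasFDerivAt (fun h : E3 => (l, h)) (inr ℝ ℝ E3) h :=
      hasFDerivAt_prodMk_right l h
    have h2 := (hg.differentiable (by simp) (l, h)).hasFDerivAt.comp h h1
    change fderiv ℝ (g ∘ fun h => (l, h)) h a = _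
    rw [h2.fderiv]; simp
  have smooth : ∀ {g : ℝ × E3 → F}, ContDiff ℝ (⊤ : ℕ∞) g → ∀ a : E3,
      ContDiff ℝ (⊤ : ℕ∞) fun p => fderiv ℝ g p (0, a) := fun hg a =>
    (hg.fderiv_right (m := (⊤ : ℕ∞)) (by simp)).clm_apply contDiff_const
  have bound : ∀ {g : ℝ × E3 → F}, ContDiff ℝ (⊤ : ℕ∞) g →
      (∀ l ∈ Icc (0 : ℝ) 1, ∀ h, R < ‖h‖ → g (l, h) = 0) →
      ∃ M, 0 ≤ M ∧ ∀ l ∈ Icc (0 : ℝ) 1, ∀ h, ‖g (l, h)‖ ≤ M := by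
    intro g hg hz
    obtain ⟨M, hM⟩ := ((isCompact_Icc (a := (0 : ℝ)) (b := 1)).prod
      (isCompact_closedBall (0 : E3) R)).exists_bound_of_continuousOn hg.continuous.continuousOn
    refine ⟨|M|, abs_nonneg _, fun l hl h => ?_⟩
    by_cases hh : ‖h‖ ≤ R
    · exact (hM (l, h) ⟨hl, by simpa using hh⟩).trans (le_abs_self M)
    · rw [hz l hl h (not_le.1 hh), norm_zero]; exact abs_nonneg _
  have zero : ∀ {g : ℝ × E3 → F}, ContDiff ℝ (⊤ : ℕ∞) g →
      (∀ l ∈ Icc (0 : ℝ) 1, ∀ h, R < ‖h‖ → g (l, h) = 0) → ∀ a : E3,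
      ∀ l ∈ Icc (0 : ℝ) 1, ∀ h, R < ‖h‖ → fderiv ℝ g (l, h) (0, a) = 0 := by
    intro g hg hz a l hl h hh
    rw [← slice hg]
    have : (fun h => g (l, h)) =ᶠ[𝓝 h] fun _ => 0 := by
      filter_upwards [(isOpen_lt continuous_const continuous_norm).mem_nhds hh] with k hk
      exact hz l hl k hk
    rw [dirDeriv, this.fderiv_eq]; simp
  obtain ⟨M₀, p₀, b₀⟩ := bound hf h0
  choose M₁ p₁ b₁ using fun i : Fin 3 => bound (smooth hf (basisVec i)) (zero hf h0 (basisVec i))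
  choose M₂ p₂ b₂ using fun i : Fin 3 =>
    bound (smooth (smooth hf (basisVec i)) (basisVec i))
      (zero (smooth hf (basisVec i)) (zero hf h0 (basisVec i)) (basisVec i))
  have hs1 : ∀ i, M₁ i ≤ ∑ j, M₁ j := fun i =>
    single_le_sum (fun j _ => p₁ j) (Finset.mem_univ i)
  have hs2 : ∀ i, M₂ i ≤ ∑ j, M₂ j := fun i =>
    single_le_sum (fun j _ => p₂ j) (Finset.mem_univ i)
  have q1 : 0 ≤ ∑ j, M₁ j := sum_nonneg fun j _ => p₁ j
  have q2 : 0 ≤ ∑ j, M₂ j := sum_nonneg fun j _ => p₂ j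
  refine ⟨M₀ + ∑ j, M₁ j + ∑ j, M₂ j, fun l hl => ⟨fun x => by linarith [b₀ l hl x], fun i x => ?_,
    fun i x => ?_⟩⟩
  · rw [slice hf]; linarith [b₁ i l hl x, hs1 i]
  · have e : dirDeriv (basisVec i) (fun h => f (l, h)) =
        fun h => fderiv ℝ f (l, h) (0, basisVec i) := funext fun h => slice hf l _ h
    rw [e, slice (smooth hf (basisVec i))]
    linarith [b₂ i l hl x, hs2 i]

/-! ### Smooth cutoffs of balls -/

/-- A smooth function that is `1` for `t ≤ 0` and `0` for `t ≥ 1`. -/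
def smoothStep (t : ℝ) : ℝ := smoothTransition (1 - t)

lemma contDiff_smoothStep : ContDiff ℝ (⊤ : ℕ∞) smoothStep :=
  smoothTransition.contDiff.comp (contDiff_const.sub contDiff_id)

lemma smoothStep_of_nonpos {t : ℝ} (h : t ≤ 0) : smoothStep t = 1 :=
  smoothTransition.one_of_one_le (by linarith)

lemma smoothStep_of_one_le {t : ℝ} (h : 1 ≤ t) : smoothStep t = 0 :=
  smoothTransition.zero_of_nonpos (by linarith)

lemma smoothStep_nonneg (t : ℝ) : 0 ≤ smoothStep t := smoothTransition.nonneg _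

lemma smoothStep_le_one (t : ℝ) : smoothStep t ≤ 1 := smoothTransition.le_one _

lemma antitone_smoothStep : Antitone smoothStep := fun _ _ h =>
  smoothTransition.monotone (by linarith)

/-- The antiderivative of `-smoothStep` that vanishes for `t ≥ 1`. -/
def smoothRamp (t : ℝ) : ℝ := ∫ x in t..1, smoothStep x

lemma hasDerivAt_smoothRamp (t : ℝ) : HasDerivAt smoothRamp (-smoothStep t) t :=
  intervalIntegral.integral_hasDerivAt_left (contDiff_smoothStep.continuous.intervalIntegrable _ _)
    (contDiff_smoothStep.continuous.stronglyMeasurableAtFilter _ _)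
    contDiff_smoothStep.continuous.continuousAt

lemma contDiff_smoothRamp : ContDiff ℝ (⊤ : ℕ∞) smoothRamp := by
  rw [contDiff_infty_iff_deriv]
  refine ⟨fun t => (hasDerivAt_smoothRamp t).differentiableAt, ?_⟩
  rw [show deriv smoothRamp = fun t => -smoothStep t from
    funext fun t => (hasDerivAt_smoothRamp t).deriv]
  exact contDiff_smoothStep.neg

lemma smoothRamp_of_one_le {t : ℝ} (h : 1 ≤ t) : smoothRamp t = 0 := by
  rw [smoothRamp, intervalIntegral.integral_symm, neg_eq_zero]
  refine (intervalIntegral.integral_congr (g := fun _ => (0 : ℝ)) fun x hx => ?_).trans (by simp)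
  rw [uIcc_of_le h] at hx
  exact smoothStep_of_one_le hx.1

lemma smoothRamp_nonneg (t : ℝ) : 0 ≤ smoothRamp t := by
  rcases le_total 1 t with h | h
  · rw [smoothRamp_of_one_le h]
  · exact intervalIntegral.integral_nonneg h fun x _ => smoothStep_nonneg x

lemma smoothRamp_le {t : ℝ} (h : t ≤ 1) : smoothRamp t ≤ 1 - t := by
  have := intervalIntegral.integral_mono_on h
    (contDiff_smoothStep.continuous.intervalIntegrable (μ := volume) t 1)
    (intervalIntegrable_const (c := (1 : ℝ))) fun x _ => smoothStep_le_one x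
  simpa [smoothRamp] using this

/-- The smooth cutoff of `s ≤ l²` at distance `ε²`. -/
def stepAt (ε l s : ℝ) : ℝ := smoothStep ((s - l ^ 2) / ε ^ 2)

/-- The antiderivative of `-stepAt ε l` with bounded support on the right. -/
def rampAt (ε l s : ℝ) : ℝ := ε ^ 2 * smoothRamp ((s - l ^ 2) / ε ^ 2)

section Step

variable {ε l s : ℝ}

lemma contDiff_stepAt_prod (ε : ℝ) : ContDiff ℝ (⊤ : ℕ∞) fun p : ℝ × ℝ => stepAt ε p.1 p.2 :=
  contDiff_smoothStep.comp (by fun_prop)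

lemma contDiff_rampAt_prod (ε : ℝ) : ContDiff ℝ (⊤ : ℕ∞) fun p : ℝ × ℝ => rampAt ε p.1 p.2 :=
  contDiff_const.mul (contDiff_smoothRamp.comp (by fun_prop))

lemma contDiff_stepAt (ε l : ℝ) : ContDiff ℝ (⊤ : ℕ∞) (stepAt ε l) :=
  (contDiff_stepAt_prod ε).comp (contDiff_const.prodMk contDiff_id)

lemma contDiff_rampAt (ε l : ℝ) : ContDiff ℝ (⊤ : ℕ∞) (rampAt ε l) :=
  (contDiff_rampAt_prod ε).comp (contDiff_const.prodMk contDiff_id)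

lemma hasDerivAt_stepAt (ε l s : ℝ) : HasDerivAt (stepAt ε l) (deriv (stepAt ε l) s) s :=
  ((contDiff_stepAt ε l).differentiable (by simp) s).hasDerivAt

lemma hasDerivAt_rampAt (hε : 0 < ε) (s : ℝ) : HasDerivAt (rampAt ε l) (-stepAt ε l s) s := by
  have h1 : HasDerivAt (fun s : ℝ => (s - l ^ 2) / ε ^ 2) (1 / ε ^ 2) s :=
    ((hasDerivAt_id s).sub_const _).div_const _
  have h2 := ((hasDerivAt_smoothRamp _).comp s h1).const_mul (ε ^ 2)
  have e : ε ^ 2 * (-smoothStep ((s - l ^ 2) / ε ^ 2) * (1 / ε ^ 2)) = -stepAt ε l s := by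
    rw [stepAt]; field_simp
  rw [e] at h2
  exact h2

lemma stepAt_of_le (hs : s ≤ l ^ 2) : stepAt ε l s = 1 :=
  smoothStep_of_nonpos (div_nonpos_of_nonpos_of_nonneg (by linarith) (sq_nonneg ε))

lemma stepAt_of_ge (hε : 0 < ε) (hs : l ^ 2 + ε ^ 2 ≤ s) : stepAt ε l s = 0 :=
  smoothStep_of_one_le (by rw [le_div_iff₀ (by positivity)]; linarith)

lemma rampAt_of_ge (hε : 0 < ε) (hs : l ^ 2 + ε ^ 2 ≤ s) : rampAt ε l s = 0 := by
  rw [rampAt, smoothRamp_of_one_le (by rw [le_div_iff₀ (by positivity)]; linarith), mul_zero]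

lemma abs_stepAt_le : |stepAt ε l s| ≤ 1 := by
  rw [stepAt, abs_of_nonneg (smoothStep_nonneg _)]; exact smoothStep_le_one _

lemma abs_stepAt_mul_le (hε : 0 < ε) (h0 : 0 ≤ s) : |stepAt ε l s| * s ≤ l ^ 2 + ε ^ 2 := by
  rcases le_total (l ^ 2 + ε ^ 2) s with h | h
  · rw [stepAt_of_ge hε h]; simp; positivity
  · calc _ ≤ 1 * s := by gcongr; exact abs_stepAt_le
      _ ≤ _ := by linarith

lemma abs_rampAt_le (hε : 0 < ε) (h0 : 0 ≤ s) : |rampAt ε l s| ≤ l ^ 2 + ε ^ 2 := by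
  rcases le_total (l ^ 2 + ε ^ 2) s with h | h
  · rw [rampAt_of_ge hε h]; simp; positivity
  · rw [rampAt, abs_of_nonneg (mul_nonneg (sq_nonneg ε) (smoothRamp_nonneg _))]
    have h1 : (s - l ^ 2) / ε ^ 2 ≤ 1 := by rw [div_le_one (by positivity)]; linarith
    calc _ ≤ ε ^ 2 * (1 - (s - l ^ 2) / ε ^ 2) := by gcongr; exact smoothRamp_le h1
      _ = ε ^ 2 - s + l ^ 2 := by field_simp; ring
      _ ≤ _ := by linarith

lemma antitone_stepAt (ε l : ℝ) : Antitone (stepAt ε l) := fun _ _ h =>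
  antitone_smoothStep (by gcongr)

end Step

/-! ### The two families of kernels -/

/-- The cubic forms `s(h, v)` that occur in the structure functions. -/
structure IsCubicForm (m : ℕ) (s : E3 → E3 → ℝ) : Prop where
  measurable : Measurable fun p : E3 × E3 => s p.1 p.2
  odd : ∀ h v, s (-h) v = -s h v
  homogeneous : ∀ (r : ℝ) h v, s (r • h) v = r ^ (m + 1) * s h v
  lipschitz : ∀ n v w, ‖n‖ = 1 → |s n v - s n w| ≤ 3 * ‖v - w‖ * (‖v‖ ^ 2 + ‖w‖ ^ 2)
  zero : ∀ h, s h 0 = 0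

lemma isCubicForm_inner_mul_sq : IsCubicForm 0 fun h v => ‖v‖ ^ 2 * ⟪v, h⟫ := by
  refine ⟨by fun_prop, fun h v => by simp, fun r h v => ?_, fun n v w hn => ?_, by simp⟩
  · rw [real_inner_smul_right]; ring
  · have h1 : |⟪v - w, n⟫| ≤ ‖v - w‖ := by simpa [hn] using abs_real_inner_le_norm (v - w) n
    have h2 : |⟪w, n⟫| ≤ ‖w‖ := by simpa [hn] using abs_real_inner_le_norm w n
    have h3 : |‖v‖ - ‖w‖| ≤ ‖v - w‖ := abs_norm_sub_norm_le v w
    have e : ‖v‖ ^ 2 * ⟪v, n⟫ - ‖w‖ ^ 2 * ⟪w, n⟫ =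
        ‖v‖ ^ 2 * ⟪v - w, n⟫ + (‖v‖ - ‖w‖) * (‖v‖ + ‖w‖) * ⟪w, n⟫ := by
      rw [inner_sub_left]; ring
    have p1 := norm_nonneg v
    have p2 := norm_nonneg w
    have p3 := norm_nonneg (v - w)
    rw [e]
    calc _ ≤ |‖v‖ ^ 2 * ⟪v - w, n⟫| + |(‖v‖ - ‖w‖) * (‖v‖ + ‖w‖) * ⟪w, n⟫| := abs_add_le _ _
      _ = ‖v‖ ^ 2 * |⟪v - w, n⟫| + |‖v‖ - ‖w‖| * (‖v‖ + ‖w‖) * |⟪w, n⟫| := by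
          rw [abs_mul, abs_mul, abs_mul, abs_of_nonneg (sq_nonneg ‖v‖),
            abs_of_nonneg (add_nonneg p1 p2)]
      _ ≤ ‖v‖ ^ 2 * ‖v - w‖ + ‖v - w‖ * (‖v‖ + ‖w‖) * ‖w‖ := by gcongr
      _ ≤ _ := by nlinarith [mul_nonneg p3 (sq_nonneg (‖v‖ - ‖w‖)), mul_nonneg p3 (sq_nonneg ‖v‖),
          mul_nonneg p3 (sq_nonneg ‖w‖)]

lemma isCubicForm_inner_cube : IsCubicForm 2 fun h v => ⟪v, h⟫ ^ 3 := by
  refine ⟨by fun_prop, fun h v => ?_, fun r h v => ?_, fun n v w hn => ?_, by simp⟩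
  · rw [inner_neg_right]; ring
  · rw [real_inner_smul_right]; ring
  · have h1 : |⟪v - w, n⟫| ≤ ‖v - w‖ := by simpa [hn] using abs_real_inner_le_norm (v - w) n
    have h2 : |⟪w, n⟫| ≤ ‖w‖ := by simpa [hn] using abs_real_inner_le_norm w n
    have h3 : |⟪v, n⟫| ≤ ‖v‖ := by simpa [hn] using abs_real_inner_le_norm v n
    have q2 : ⟪w, n⟫ ^ 2 ≤ ‖w‖ ^ 2 := sq_le_sq' (by linarith [abs_le.1 h2]) (abs_le.1 h2).2
    have q3 : ⟪v, n⟫ ^ 2 ≤ ‖v‖ ^ 2 := sq_le_sq' (by linarith [abs_le.1 h3]) (abs_le.1 h3).2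
    have e : ⟪v, n⟫ ^ 3 - ⟪w, n⟫ ^ 3 =
        ⟪v - w, n⟫ * (⟪v, n⟫ ^ 2 + ⟪v, n⟫ * ⟪w, n⟫ + ⟪w, n⟫ ^ 2) := by
      rw [inner_sub_left]; ring
    have q4 : |⟪v, n⟫ ^ 2 + ⟪v, n⟫ * ⟪w, n⟫ + ⟪w, n⟫ ^ 2| ≤ 3 * (‖v‖ ^ 2 + ‖w‖ ^ 2) := by
      rw [abs_le]
      constructor <;> nlinarith [sq_nonneg (⟪v, n⟫ - ⟪w, n⟫), sq_nonneg (⟪v, n⟫ + ⟪w, n⟫),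
        sq_nonneg ‖v‖, sq_nonneg ‖w‖]
    rw [e, abs_mul]
    calc _ ≤ ‖v - w‖ * (3 * (‖v‖ ^ 2 + ‖w‖ ^ 2)) := by gcongr
      _ = _ := by ring

/-- The kernels at scales `l ≥ ε` whose cubic form is concentrated on `l ≤ |h| ≤ l + ε`, with
bounds for two derivatives that depend on `ε` only. -/
def HasKernels (m : ℕ) (s : E3 → E3 → ℝ) : Prop :=
  ∀ ε ∈ Ioc (0 : ℝ) 1, ∃ M : ℝ, ∀ l ∈ Icc ε 1, ∃ Φ : E3 → E3 →L[ℝ] E3,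
    IsKernel (2 * l) Φ (fun h => ‖h‖ ^ m * stepAt ε l (‖h‖ ^ 2)) ∧ C2Bound Φ M ∧
    (∀ h, ‖Φ h‖ ≤ 4 * l ^ m) ∧ ∀ h v, tri Φ h v v v = 2 * deriv (stepAt ε l) (‖h‖ ^ 2) * s h v

lemma hasKernels_inner_mul_sq : HasKernels 0 fun h v => ‖v‖ ^ 2 * ⟪v, h⟫ := by
  rintro ε ⟨hε, hε1⟩
  have hs : ContDiff ℝ (⊤ : ℕ∞) fun p : ℝ × E3 => (p.1, ‖p.2‖ ^ 2) :=
    contDiff_fst.prodMk ((contDiff_norm_sq ℝ).comp contDiff_snd)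
  obtain ⟨M, hM⟩ := exists_uniform_C2Bound (R := 2)
    (f := fun p : ℝ × E3 => stepAt ε p.1 (‖p.2‖ ^ 2) • ContinuousLinearMap.id ℝ E3)
    (((contDiff_stepAt_prod ε).comp hs).smul contDiff_const) (by
      intro l hl h hh
      change stepAt ε l (‖h‖ ^ 2) • _ = _
      rw [stepAt_of_ge hε (by nlinarith [hl.1, hl.2])]
      ext1 b; simp)
  refine ⟨M, fun l hl => ⟨radialKernel (stepAt ε l) fun _ => 0, ?_, ?_, fun h => ?_, fun h v => ?_⟩⟩
  · have hl0 := hε.trans_le hl.1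
    have z : ∀ s, (2 * l) ^ 2 ≤ s → stepAt ε l s = 0 := fun s hs =>
      stepAt_of_ge hε (by nlinarith [hl.1])
    simpa using isKernel_radialKernel (A' := deriv (stepAt ε l)) (X := fun _ => 0) (X' := fun _ => 0)
      (g := stepAt ε l) (by linarith) (contDiff_stepAt ε l) contDiff_const (contDiff_stepAt ε l)
      (hasDerivAt_stepAt ε l) (fun s => hasDerivAt_const s (0 : ℝ))
      (fun s => by simpa using hasDerivAt_stepAt ε l s) z (fun _ _ => rfl) z
  · convert hM l ⟨hε.le.trans hl.1, hl.2⟩ using 2 with h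
    ext1 b; simp [radialKernel_apply]
  · refine (norm_radialKernel_le (a := 1) (x := 0) abs_stepAt_le (by simp)).trans (by norm_num)
  · rw [tri_radialKernel (contDiff_stepAt ε l) contDiff_const (hasDerivAt_stepAt ε l)
      (fun s => hasDerivAt_const s (0 : ℝ)), real_inner_comm v h]
    simp; ring

lemma hasKernels_inner_cube : HasKernels 2 fun h v => ⟪v, h⟫ ^ 3 := by
  rintro ε ⟨hε, hε1⟩
  have hs : ContDiff ℝ (⊤ : ℕ∞) fun p : ℝ × E3 => (p.1, ‖p.2‖ ^ 2) :=
    contDiff_fst.prodMk ((contDiff_norm_sq ℝ).comp contDiff_snd)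
  obtain ⟨M, hM⟩ := exists_uniform_C2Bound (R := 2)
    (f := fun p : ℝ × E3 => radialKernel (rampAt ε p.1) (stepAt ε p.1) p.2)
    ((((contDiff_rampAt_prod ε).comp hs).smul contDiff_const).add
      (((contDiff_stepAt_prod ε).comp hs).smul
        (((innerSL ℝ).contDiff.smulRight contDiff_id).comp contDiff_snd))) (by
      intro l hl h hh
      have h1 : l ^ 2 + ε ^ 2 ≤ ‖h‖ ^ 2 := by nlinarith [hl.1, hl.2]
      ext1 b
      simp [radialKernel_apply, stepAt_of_ge hε h1, rampAt_of_ge hε h1])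
  refine ⟨M, fun l hl => ⟨radialKernel (rampAt ε l) (stepAt ε l), ?_,
    hM l ⟨hε.le.trans hl.1, hl.2⟩, fun h => ?_, fun h v => ?_⟩⟩
  · have hl0 := hε.trans_le hl.1
    have far : ∀ s, (2 * l) ^ 2 ≤ s → l ^ 2 + ε ^ 2 ≤ s := fun s hs => by nlinarith [hl.1]
    refine isKernel_radialKernel (A' := fun s => -stepAt ε l s) (X' := deriv (stepAt ε l))
      (g := fun s => s * stepAt ε l s) (by linarith) (contDiff_rampAt ε l) (contDiff_stepAt ε l)
      (contDiff_id.mul (contDiff_stepAt ε l)) (hasDerivAt_rampAt hε) (hasDerivAt_stepAt ε l)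
      (fun s => ?_) (fun s hs => rampAt_of_ge hε (far s hs)) (fun s hs => stepAt_of_ge hε (far s hs))
      (fun s hs => by rw [stepAt_of_ge hε (far s hs), mul_zero])
    exact ((hasDerivAt_id s).mul (hasDerivAt_stepAt ε l s)).congr_deriv (by simp only [id]; ring)
  · refine (norm_radialKernel_le (abs_rampAt_le hε (sq_nonneg _))
      (abs_stepAt_mul_le hε (sq_nonneg _))).trans ?_
    have : ε ^ 2 ≤ l ^ 2 := by have := hl.1; gcongr
    linarith
  · rw [tri_radialKernel (contDiff_rampAt ε l) (contDiff_stepAt ε l) (hasDerivAt_rampAt hε)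
      (hasDerivAt_stepAt ε l), real_inner_comm v h]
    ring

/-! ### Polar coordinates and radial profiles -/

lemma integrable_prod_assoc {Ω β α F : Type*} [NormedAddCommGroup F] [NormedSpace ℝ F]
    {mΩ : MeasurableSpace Ω} {mβ : MeasurableSpace β} {mα : MeasurableSpace α} {P : Measure Ω}
    {κ : Measure β} {μ : Measure α} [SFinite P] [SFinite κ] [SFinite μ] {H : (Ω × β) × α → F}
    (hH : Integrable H ((P.prod κ).prod μ)) :
    (∀ᵐ ω ∂P, Integrable (fun r : β × α => H ((ω, r.1), r.2)) (κ.prod μ)) ∧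
      Integrable (fun ω => ∫ r : β × α, H ((ω, r.1), r.2) ∂(κ.prod μ)) P ∧
      ∫ ω, (∫ r : β × α, H ((ω, r.1), r.2) ∂(κ.prod μ)) ∂P = ∫ a, ∫ z, H (z, a) ∂(P.prod κ) ∂μ := by
  have hm := (measurePreserving_prodAssoc P κ μ).symm
  have hi : Integrable (H ∘ MeasurableEquiv.prodAssoc.symm) (P.prod (κ.prod μ)) :=
    (hm.integrable_comp_emb (MeasurableEquiv.measurableEmbedding _)).2 hH
  refine ⟨hi.prod_right_ae, hi.integral_prod_left, ?_⟩
  rw [← integral_prod_symm H hH, ← hm.integral_comp (MeasurableEquiv.measurableEmbedding _) H]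
  exact (integral_prod _ hi).symm

lemma integral_polar {f : E3 → ℝ} (hf : Integrable f) :
    ∫ h, f h = ∫ n : sphere (0 : E3) 1, (∫ r in Ioi (0 : ℝ), r ^ 2 * f (r • (n : E3)))
      ∂sphereMeasure := by
  have hm := (volume : Measure E3).measurePreserving_homeomorphUnitSphereProd
  have hemb := (homeomorphUnitSphereProd E3).measurableEmbedding
  have hd : Module.finrank ℝ E3 - 1 = 2 := by simp
  rw [hd] at hm
  have e : ∀ x : ({(0)}ᶜ : Set E3), f ((homeomorphUnitSphereProd E3 x).2.1 •
      ((homeomorphUnitSphereProd E3 x).1 : E3)) = f x := fun x => by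
    congr 1
    have hx : ‖(x : E3)‖ ≠ 0 := norm_ne_zero_iff.2 x.2
    simp [smul_smul, hx]
  have i1 : Integrable (fun x : ({(0)}ᶜ : Set E3) => f x) ((volume : Measure E3).comap (↑)) :=
    (integrableOn_iff_comap_subtypeVal (measurableSet_singleton (0 : E3)).compl).1 hf.integrableOn
  have i2 : Integrable (fun p : sphere (0 : E3) 1 × Ioi (0 : ℝ) => f (p.2.1 • (p.1 : E3)))
      ((volume : Measure E3).toSphere.prod (Measure.volumeIoiPow 2)) := by
    rw [← hm.integrable_comp_emb hemb]
    exact i1.congr (ae_of_all _ fun x => (e x).symm)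
  calc ∫ h, f h = ∫ x : ({(0)}ᶜ : Set E3), f x ∂((volume : Measure E3).comap (↑)) := by
        rw [integral_subtype_comap (measurableSet_singleton (0 : E3)).compl f,
          restrict_compl_singleton]
    _ = ∫ p : sphere (0 : E3) 1 × Ioi (0 : ℝ), f (p.2.1 • (p.1 : E3))
          ∂((volume : Measure E3).toSphere.prod (Measure.volumeIoiPow 2)) := by
        rw [← hm.integral_comp hemb]
        exact integral_congr_ae (ae_of_all _ fun x => (e x).symm)
    _ = _ := by
        rw [integral_prod _ i2]
        refine integral_congr_ae (ae_of_all _ fun n => ?_)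
        simp only [Measure.volumeIoiPow, ofReal]
        rw [integral_withDensity_eq_integral_smul
            ((measurable_subtype_coe.pow_const _).real_toNNReal),
          integral_subtype_comap measurableSet_Ioi
            fun r : ℝ => Real.toNNReal (r ^ 2) • f (r • (n : E3))]
        refine setIntegral_congr_fun measurableSet_Ioi fun r hr => ?_
        simp only [NNReal.smul_def, coe_toNNReal _ (sq_nonneg r), smul_eq_mul]

lemma sphereMeasure_real_univ : sphereMeasure.real univ = 4 * Real.pi := by
  rw [sphereMeasure, Measure.toSphere_real_apply_univ, Measure.real, volume_ball_fin_three]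
  simp
  rw [toReal_ofReal (by positivity)]
  ring

instance isFiniteMeasure_sphereMeasure : IsFiniteMeasure sphereMeasure :=
  inferInstanceAs (IsFiniteMeasure (volume : Measure E3).toSphere)

lemma integral_radial (f : ℝ → ℝ) :
    ∫ h : E3, f ‖h‖ = 4 * Real.pi * ∫ r in Ioi (0 : ℝ), r ^ 2 * f r := by
  have h := integral_fun_norm_addHaar (volume : Measure E3) f
  rw [← smul_assoc, nsmul_eq_mul, ← Measure.toSphere_real_apply_univ] at h
  have hd : Module.finrank ℝ E3 - 1 = 2 := by simp
  rw [h, hd]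
  change sphereMeasure.real univ • _ = _
  rw [sphereMeasure_real_univ]
  simp

/-- The radial weight of the kernels. -/
def weight (m : ℕ) (ε l r : ℝ) : ℝ := -deriv (stepAt ε l) (r ^ 2) * r ^ (m + 3)

section Weight

variable {m : ℕ} {ε l : ℝ}

lemma continuous_deriv_stepAt (ε l : ℝ) : Continuous (deriv (stepAt ε l)) :=
  (contDiff_stepAt ε l).continuous_deriv (by simp)

lemma continuous_weight (m : ℕ) (ε l : ℝ) : Continuous (weight m ε l) := by
  have := continuous_deriv_stepAt ε l
  unfold weight
  fun_prop

lemma deriv_stepAt_eq_zero_of_lt {s : ℝ} (hs : s < l ^ 2) : deriv (stepAt ε l) s = 0 := by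
  have : stepAt ε l =ᶠ[𝓝 s] fun _ => 1 := by
    filter_upwards [Iio_mem_nhds hs] with t ht using stepAt_of_le (le_of_lt ht)
  rw [this.deriv_eq]; simp

lemma deriv_stepAt_eq_zero_of_gt (hε : 0 < ε) {s : ℝ} (hs : l ^ 2 + ε ^ 2 < s) :
    deriv (stepAt ε l) s = 0 := by
  have : stepAt ε l =ᶠ[𝓝 s] fun _ => 0 := by
    filter_upwards [Ioi_mem_nhds hs] with t ht using stepAt_of_ge hε (le_of_lt ht)
  rw [this.deriv_eq]; simp

lemma deriv_stepAt_nonpos (ε l s : ℝ) : deriv (stepAt ε l) s ≤ 0 :=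
  (antitone_stepAt ε l).deriv_nonpos

lemma weight_nonneg {r : ℝ} (hr : 0 ≤ r) : 0 ≤ weight m ε l r :=
  mul_nonneg (by linarith [deriv_stepAt_nonpos ε l (r ^ 2)]) (by positivity)

lemma weight_eq_zero (hε : 0 < ε) (hl : 0 ≤ l) {r : ℝ} (hr : 0 ≤ r)
    (hn : r ∉ Icc l (l + ε)) : weight m ε l r = 0 := by
  rw [weight, neg_mul, neg_eq_zero, mul_eq_zero]
  left
  by_cases h : l ≤ r
  · have h2 : l + ε < r := by by_contra! h3; exact hn ⟨h, h3⟩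
    exact deriv_stepAt_eq_zero_of_gt hε (by nlinarith)
  · push Not at h
    exact deriv_stepAt_eq_zero_of_lt (by nlinarith)

lemma integral_Ioi_weight_mul (hε : 0 < ε) (hl : 0 ≤ l) (g : ℝ → ℝ) :
    ∫ r in Ioi (0 : ℝ), weight m ε l r * g r = ∫ r in (0 : ℝ)..(l + ε), weight m ε l r * g r := by
  rw [intervalIntegral.integral_of_le (by linarith)]
  refine setIntegral_eq_of_subset_of_forall_sdiff_eq_zero measurableSet_Ioi Ioc_subset_Ioi_self
    fun r hr => ?_
  rw [weight_eq_zero hε hl (le_of_lt hr.1), zero_mul]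
  exact fun h => hr.2 ⟨hr.1, h.2⟩

lemma hasDerivAt_stepAt_sq (ε l r : ℝ) :
    HasDerivAt (fun r => stepAt ε l (r ^ 2)) (deriv (stepAt ε l) (r ^ 2) * (2 * r)) r := by
  simpa [comp_def] using (hasDerivAt_stepAt ε l (r ^ 2)).comp r (hasDerivAt_pow 2 r)

/-- The total weight. -/
def totalWeight (m : ℕ) (ε l : ℝ) : ℝ := ∫ r in (0 : ℝ)..(l + ε), weight m ε l r

lemma totalWeight_ge (hε : 0 < ε) (hl : 0 ≤ l) : l ^ (m + 2) / 2 ≤ totalWeight m ε l := by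
  have c1 := continuous_deriv_stepAt ε l
  have h1 := intervalIntegral.integral_eq_sub_of_hasDerivAt (a := 0) (b := l + ε)
    (fun r _ => hasDerivAt_stepAt_sq ε l r)
    (Continuous.intervalIntegrable (by fun_prop) _ _)
  rw [stepAt_of_ge hε (by nlinarith), stepAt_of_le (by simpa using sq_nonneg l)] at h1
  have h2 : l ^ (m + 2) / 2 = ∫ r in (0 : ℝ)..(l + ε),
      -(l ^ (m + 2) / 2) * (deriv (stepAt ε l) (r ^ 2) * (2 * r)) := by
    rw [intervalIntegral.integral_const_mul, h1]; ring
  rw [h2]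
  refine intervalIntegral.integral_mono_on (by linarith)
    (Continuous.intervalIntegrable (by fun_prop) _ _)
    ((continuous_weight m ε l).intervalIntegrable _ _) fun r hr => ?_
  by_cases hlr : l ≤ r
  · have h3 : l ^ (m + 2) ≤ r ^ (m + 2) := by gcongr
    have h4 := mul_nonneg (neg_nonneg.2 (deriv_stepAt_nonpos ε l (r ^ 2))) hr.1
    calc _ = (-deriv (stepAt ε l) (r ^ 2) * r) * l ^ (m + 2) := by ring
      _ ≤ (-deriv (stepAt ε l) (r ^ 2) * r) * r ^ (m + 2) := by gcongr
      _ = _ := by rw [weight]; ring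
  · have : deriv (stepAt ε l) (r ^ 2) = 0 :=
      deriv_stepAt_eq_zero_of_lt (by nlinarith [hr.1, not_le.1 hlr])
    simp [weight, this]

/-- The mean of the scalar kernel, up to a relative error of size `ε / l`. -/
lemma integral_scalar_kernel (hε : 0 < ε) (hl : 0 ≤ l) : ∃ δ : ℝ, |δ| ≤ ε * totalWeight m ε l ∧
      ∫ h : E3, ‖h‖ ^ m * stepAt ε l (‖h‖ ^ 2) =
        8 * Real.pi / (m + 3) * (l * totalWeight m ε l + δ) := by
  have c0 := (contDiff_stepAt ε l).continuous
  have c1 := continuous_deriv_stepAt ε l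
  have cw := continuous_weight m ε l
  refine ⟨∫ r in (0 : ℝ)..(l + ε), weight m ε l r * (r - l), ?_, ?_⟩
  · rw [totalWeight, ← intervalIntegral.integral_const_mul, ← norm_eq_abs]
    refine intervalIntegral.norm_integral_le_of_norm_le (by linarith) (ae_of_all _ fun r hr => ?_)
      (Continuous.intervalIntegrable (by fun_prop) _ _)
    have hw := weight_nonneg (m := m) (ε := ε) (l := l) hr.1.le
    rw [norm_eq_abs, abs_mul, abs_of_nonneg hw, mul_comm]
    by_cases h : r ∈ Icc l (l + ε)
    · gcongr
      rw [abs_le]; constructor <;> linarith [h.1, h.2]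
    · rw [weight_eq_zero hε hl hr.1.le h]; simp
  · have e1 : ∫ r in Ioi (0 : ℝ), r ^ 2 * (r ^ m * stepAt ε l (r ^ 2)) =
        ∫ r in (0 : ℝ)..(l + ε), r ^ (m + 2) * stepAt ε l (r ^ 2) := by
      rw [intervalIntegral.integral_of_le (by linarith)]
      have h3 : ∀ r : ℝ, r ^ 2 * (r ^ m * stepAt ε l (r ^ 2)) = r ^ (m + 2) * stepAt ε l (r ^ 2) :=
        fun r => by ring
      simp only [h3]
      refine setIntegral_eq_of_subset_of_forall_sdiff_eq_zero measurableSet_Ioi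
        Ioc_subset_Ioi_self fun r hr => ?_
      have : l + ε < r := by by_contra! h; exact hr.2 ⟨hr.1, h⟩
      rw [stepAt_of_ge hε (by nlinarith), mul_zero]
    have d1 : ∀ r : ℝ, HasDerivAt (fun r => r ^ (m + 3) * stepAt ε l (r ^ 2))
        ((m + 3 : ℕ) * r ^ (m + 2) * stepAt ε l (r ^ 2)
          + r ^ (m + 3) * (deriv (stepAt ε l) (r ^ 2) * (2 * r))) r := fun r =>
      (hasDerivAt_pow (m + 3) r).mul (hasDerivAt_stepAt_sq ε l r)
    have h1 := intervalIntegral.integral_eq_sub_of_hasDerivAt (a := 0) (b := l + ε)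
      (fun r _ => d1 r) (Continuous.intervalIntegrable (by fun_prop) _ _)
    rw [stepAt_of_ge hε (by nlinarith)] at h1
    have h2 : ∫ r in (0 : ℝ)..(l + ε), ((m + 3 : ℕ) * r ^ (m + 2) * stepAt ε l (r ^ 2)
          + r ^ (m + 3) * (deriv (stepAt ε l) (r ^ 2) * (2 * r))) =
        (m + 3) * (∫ r in (0 : ℝ)..(l + ε), r ^ (m + 2) * stepAt ε l (r ^ 2))
          - 2 * (l * totalWeight m ε l + ∫ r in (0 : ℝ)..(l + ε), weight m ε l r * (r - l)) := by
      rw [totalWeight, ← intervalIntegral.integral_const_mul l,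
        ← intervalIntegral.integral_add (Continuous.intervalIntegrable (by fun_prop) _ _)
          (Continuous.intervalIntegrable (by fun_prop) _ _),
        ← intervalIntegral.integral_const_mul, ← intervalIntegral.integral_const_mul,
        ← intervalIntegral.integral_sub (Continuous.intervalIntegrable (by fun_prop) _ _)
          (Continuous.intervalIntegrable (by fun_prop) _ _)]
      congr 1
      ext1 r
      rw [weight]
      push_cast
      ring
    rw [h2] at h1
    rw [integral_radial fun r => r ^ m * stepAt ε l (r ^ 2), e1]
    have hm : (m : ℝ) + 3 ≠ 0 := by positivity
    have h4 : (∫ r in (0 : ℝ)..(l + ε), r ^ (m + 2) * stepAt ε l (r ^ 2)) =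
        2 / (m + 3) * (l * totalWeight m ε l
          + ∫ r in (0 : ℝ)..(l + ε), weight m ε l r * (r - l)) := by
      field_simp
      simp at h1
      linarith
    rw [h4]
    ring

end Weight

/-! ### Means of cubic forms of increments -/

lemma IsCubicForm.abs_le {m : ℕ} {s : E3 → E3 → ℝ} (hs : IsCubicForm m s) (h v : E3) :
    |s h v| ≤ 3 * ‖h‖ ^ (m + 1) * ‖v‖ ^ 3 := by
  rcases eq_or_ne h 0 with rfl | h0
  · have := hs.homogeneous 0 0 v
    simp_all
  · have hn : ‖h‖ ≠ 0 := norm_ne_zero_iff.2 h0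
    have h1 := hs.lipschitz (‖h‖⁻¹ • h) v 0 (by simp [norm_smul, hn])
    have h2 := hs.homogeneous ‖h‖ (‖h‖⁻¹ • h) v
    rw [smul_smul, mul_inv_cancel₀ hn, one_smul] at h2
    rw [hs.zero, sub_zero, sub_zero, norm_zero] at h1
    rw [h2, abs_mul, abs_of_nonneg (by positivity)]
    calc _ ≤ ‖h‖ ^ (m + 1) * (3 * ‖v‖ * (‖v‖ ^ 2 + 0 ^ 2)) := by gcongr
      _ = _ := by ring

lemma add_pow_three_le (a b : ℝ≥0∞) : (a + b) ^ 3 ≤ 8 * (a ^ 3 + b ^ 3) := by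
  have key : ∀ {a b : ℝ≥0∞}, a ≤ b → (a + b) ^ 3 ≤ 8 * (a ^ 3 + b ^ 3) := fun {a b} h => by
    calc (a + b) ^ 3 ≤ (b + b) ^ 3 := by gcongr
      _ = 8 * b ^ 3 := by ring
      _ ≤ _ := by gcongr; exact le_add_self
  rcases le_total a b with h | h
  · exact key h
  · rw [add_comm a b, add_comm (a ^ 3)]; exact key h

section Means

variable {Ω : Type*} {mΩ : MeasurableSpace Ω} {P : Measure Ω} {U : Ω → E3 → E3} {ψ : E3 → ℝ}
  {m : ℕ} {s : E3 → E3 → ℝ} {K : ℝ≥0∞} {B : ℝ}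

/-- The mean of the cubic form `s(n, ·)` of the increments with shift `h`. -/
def incMean (P : Measure Ω) (ψ : E3 → ℝ) (s : E3 → E3 → ℝ) (U : Ω → E3 → E3) (h n : E3) : ℝ :=
  ∫ z : Ω × E3, ψ z.2 * s n (U z.1 (z.2 + h) - U z.1 z.2) ∂(P.prod volume)

/-- A bounded cutoff, a cubic form and a random field with bounded third moment. -/
structure IsCubicMean (P : Measure Ω) (U : Ω → E3 → E3) (ψ : E3 → ℝ) (m : ℕ) (s : E3 → E3 → ℝ)
    (K : ℝ≥0∞) (B : ℝ) : Prop where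
  hU : Measurable fun r : Ω × E3 => U r.1 r.2
  k1 : ∫⁻ ω, (∫⁻ x, ‖U ω x‖ₑ ^ 3) ∂P ≤ K
  hK : K ≠ ⊤
  hs : IsCubicForm m s
  hψm : Measurable ψ
  hψ : ∀ x, |ψ x| ≤ B

lemma lintegral_increment_le (hc : IsCubicMean P U ψ m s K B) (h : E3) :
    ∫⁻ z : Ω × E3, ‖U z.1 (z.2 + h) - U z.1 z.2‖ₑ ^ 3 ∂(P.prod volume) ≤ 16 * K := by
  have hU := hc.hU
  have m1 : Measurable fun z : Ω × E3 => U z.1 (z.2 + h) :=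
    hU.comp (f := fun z : Ω × E3 => (z.1, z.2 + h)) (by fun_prop)
  have e1 : ∫⁻ z : Ω × E3, ‖U z.1 z.2‖ₑ ^ 3 ∂(P.prod volume) ≤ K := by
    rw [lintegral_prod _ (by fun_prop)]; exact hc.k1
  have e2 : ∫⁻ z : Ω × E3, ‖U z.1 (z.2 + h)‖ₑ ^ 3 ∂(P.prod volume) ≤ K := by
    rw [lintegral_prod _ (by fun_prop)]
    exact (lintegral_congr fun ω =>
      lintegral_add_right_eq_self (fun x => ‖U ω x‖ₑ ^ 3) h).trans_le hc.k1
  calc _ ≤ ∫⁻ z : Ω × E3, 8 * (‖U z.1 (z.2 + h)‖ₑ ^ 3 + ‖U z.1 z.2‖ₑ ^ 3) ∂(P.prod volume) :=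
        lintegral_mono fun z => (pow_le_pow_left' (enorm_sub_le) 3).trans (add_pow_three_le _ _)
    _ ≤ 8 * (K + K) := by
        rw [lintegral_const_mul _ (by fun_prop), lintegral_add_left (by fun_prop)]
        gcongr
    _ = 16 * K := by ring

lemma enorm_psi_mul_le (hc : IsCubicMean P U ψ m s K B) (x n v : E3) :
    ‖ψ x * s n v‖ₑ ≤ ofReal (3 * B) * ‖n‖ₑ ^ (m + 1) * ‖v‖ₑ ^ 3 := by
  have hB : 0 ≤ B := (abs_nonneg _).trans (hc.hψ 0)
  rw [← ofReal_norm_pow, ← ofReal_norm_pow, ← ofReal_mul (by positivity),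
    ← ofReal_mul (by positivity), ← ofReal_norm, norm_eq_abs, abs_mul]
  refine ofReal_le_ofReal ?_
  calc _ ≤ B * (3 * ‖n‖ ^ (m + 1) * ‖v‖ ^ 3) := mul_le_mul (hc.hψ x) (hc.hs.abs_le n v) (abs_nonneg _) hB
    _ = _ := by ring

lemma enorm_incMean_le (hc : IsCubicMean P U ψ m s K B)
    (h n : E3) (hn : ‖n‖ = 1) :
    ‖incMean P ψ s U h n‖ₑ ≤ ofReal (3 * B) * (16 * K) := by
  refine (enorm_integral_le_lintegral_enorm _).trans ?_
  have e : ‖n‖ₑ = 1 := by rw [← ofReal_norm, hn]; simp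
  calc _ ≤ ∫⁻ z : Ω × E3, ofReal (3 * B) * ‖U z.1 (z.2 + h) - U z.1 z.2‖ₑ ^ 3
          ∂(P.prod volume) := lintegral_mono fun z => by
        simpa [e] using enorm_psi_mul_le hc z.2 n (U z.1 (z.2 + h) - U z.1 z.2)
    _ ≤ _ := by
        rw [lintegral_const_mul' _ _ ofReal_ne_top]
        gcongr
        exact lintegral_increment_le hc h

lemma IsCubicMean.measurable (hc : IsCubicMean P U ψ m s K B) :
    Measurable fun r : (Ω × E3) × E3 × E3 =>
      ψ r.1.2 * s r.2.2 (U r.1.1 (r.1.2 + r.2.1) - U r.1.1 r.1.2) :=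
  (hc.hψm.comp measurable_fst.snd).mul (hc.hs.measurable.comp (measurable_snd.snd.prodMk
    ((hc.hU.comp (f := fun r : (Ω × E3) × E3 × E3 => (r.1.1, r.1.2 + r.2.1)) (by fun_prop)).sub
      (hc.hU.comp (f := fun r : (Ω × E3) × E3 × E3 => (r.1.1, r.1.2)) (by fun_prop)))))

variable [IsProbabilityMeasure P]

lemma integrable_cubic (hc : IsCubicMean P U ψ m s K B) {α : Type*} {mα : MeasurableSpace α}
    {μ : Measure α} [SFinite μ] {c : α → ℝ} {h n : α → E3} (mc : Measurable c) (hh : Measurable h)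
    (hn : Measurable n) (hfin : ∫⁻ a, ‖c a‖ₑ * ‖n a‖ₑ ^ (m + 1) ∂μ ≠ ⊤) :
    Integrable (fun r : (Ω × E3) × α => c r.2 *
      (ψ r.1.2 * s (n r.2) (U r.1.1 (r.1.2 + h r.2) - U r.1.1 r.1.2))) ((P.prod volume).prod μ) := by
  have hK := hc.hK
  have m4 : Measurable fun r : (Ω × E3) × α => c r.2 *
      (ψ r.1.2 * s (n r.2) (U r.1.1 (r.1.2 + h r.2) - U r.1.1 r.1.2)) :=
    (mc.comp measurable_snd).mul (hc.measurable.comp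
      (f := fun r : (Ω × E3) × α => (r.1, h r.2, n r.2)) (by fun_prop))
  refine ⟨m4.aestronglyMeasurable, ?_⟩
  rw [hasFiniteIntegral_iff_enorm, lintegral_prod_symm' _ m4.enorm]
  refine lt_of_le_of_lt (b := ofReal (3 * B) * (16 * K) *
    ∫⁻ a, ‖c a‖ₑ * ‖n a‖ₑ ^ (m + 1) ∂μ) ?_ (by finiteness)
  rw [← lintegral_const_mul _ (by fun_prop)]
  refine lintegral_mono fun a => ?_
  calc _ ≤ ∫⁻ z : Ω × E3, (‖c a‖ₑ * (ofReal (3 * B) * ‖n a‖ₑ ^ (m + 1))) *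
          ‖U z.1 (z.2 + h a) - U z.1 z.2‖ₑ ^ 3 ∂(P.prod volume) := by
        refine lintegral_mono fun z => ?_
        rw [enorm_mul, mul_assoc]
        gcongr
        exact enorm_psi_mul_le hc _ _ _
    _ ≤ (‖c a‖ₑ * (ofReal (3 * B) * ‖n a‖ₑ ^ (m + 1))) * (16 * K) := by
        rw [lintegral_const_mul']
        · gcongr
          exact lintegral_increment_le hc _
        · finiteness
    _ = _ := by ring

lemma integrable_cubic_slice (hc : IsCubicMean P U ψ m s K B) (h n : E3) :
    Integrable (fun z : Ω × E3 => ψ z.2 * s n (U z.1 (z.2 + h) - U z.1 z.2)) (P.prod volume) := by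
  have := integrable_cubic (μ := Measure.dirac ()) (c := fun _ => 1) (h := fun _ => h)
    (n := fun _ => n) hc measurable_const measurable_const measurable_const
    (by simp)
  simpa using this.prod_left_ae

lemma stronglyMeasurable_incMean (hc : IsCubicMean P U ψ m s K B) {α : Type*} {mα : MeasurableSpace α}
    {h n : α → E3} (hh : Measurable h) (hn : Measurable n) :
    StronglyMeasurable fun a => incMean P ψ s U (h a) (n a) := by
  exact (hc.measurable.comp (f := fun r : α × (Ω × E3) => (r.2, h r.1, n r.1))
    (by fun_prop)).stronglyMeasurable.integral_prod_right'

/-- The means of cubic forms depend continuously on the shift. -/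
lemma enorm_incMean_sub_le {D : Set E3} (hc : IsCubicMean P U ψ m s K B) {h h' n : E3} (hn : ‖n‖ = 1)
    (hD : ∀ x, ψ x ≠ 0 → x + h ∈ D ∧ x + h' ∈ D) (hDm : MeasurableSet D) {τ : ℝ≥0∞}
    (hτ : ∫⁻ ω, (∫⁻ x in shiftDomain D (h - h'), ‖U ω (x + (h - h')) - U ω x‖ₑ ^ 3) ∂P ≤ τ)
    {η : ℝ} (hη : 0 < η) :
    ‖incMean P ψ s U h n - incMean P ψ s U h' n‖ₑ ≤ ofReal (3 * B) *
      (ofReal (2 * (η⁻¹) ^ 2) * τ + ofReal η * (32 * K)) := by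
  have hB : 0 ≤ B := (abs_nonneg _).trans (hc.hψ 0)
  have hU := hc.hU
  have ms : ∀ k : E3, Measurable fun z : Ω × E3 => U z.1 (z.2 + k) := fun k =>
    hc.hU.comp (f := fun z : Ω × E3 => (z.1, z.2 + k)) (by fun_prop)
  have mh := ms h
  have mh' := ms h'
  set S : Set E3 := {x | ψ x ≠ 0}
  have hS : MeasurableSet S := hc.hψm (measurableSet_singleton 0).compl
  have hS2 : MeasurableSet {z : Ω × E3 | z.2 ∈ S} := measurable_snd hS
  have mI : Measurable fun z : Ω × E3 => {z : Ω × E3 | z.2 ∈ S}.indicator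
      (fun z => ‖U z.1 (z.2 + h) - U z.1 (z.2 + h')‖ₑ ^ 3) z :=
    Measurable.indicator (by fun_prop) hS2
  have hI : ∫⁻ z : Ω × E3, {z : Ω × E3 | z.2 ∈ S}.indicator
      (fun z => ‖U z.1 (z.2 + h) - U z.1 (z.2 + h')‖ₑ ^ 3) z ∂(P.prod volume) ≤ τ := by
    rw [lintegral_prod _ mI.aemeasurable]
    refine (lintegral_mono fun ω => ?_).trans hτ
    rw [← lintegral_indicator (measurableSet_shiftDomain hDm _),
      ← lintegral_add_right_eq_self ((shiftDomain D (h - h')).indicator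
        fun x => ‖U ω (x + (h - h')) - U ω x‖ₑ ^ 3) h']
    refine lintegral_mono fun x => ?_
    by_cases hx : ψ x ≠ 0
    · have h1 : x + h' + (h - h') = x + h := by abel
      have h2 : x + h' ∈ shiftDomain D (h - h') := ⟨(hD x hx).2, by rw [h1]; exact (hD x hx).1⟩
      simp only [indicator_of_mem h2, h1]
      exact indicator_le_self _ _ _
    · have : (ω, x) ∉ {z : Ω × E3 | z.2 ∈ S} := hx
      simp only [indicator_of_notMem this]
      exact zero_le
  rw [incMean, incMean, ← integral_sub (integrable_cubic_slice hc h n)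
    (integrable_cubic_slice hc h' n)]
  refine (enorm_integral_le_lintegral_enorm _).trans ?_
  have hpt : ∀ z : Ω × E3, ‖ψ z.2 * s n (U z.1 (z.2 + h) - U z.1 z.2)
      - ψ z.2 * s n (U z.1 (z.2 + h') - U z.1 z.2)‖ₑ ≤ ofReal (3 * B) *
      (ofReal (2 * (η⁻¹) ^ 2) * {z : Ω × E3 | z.2 ∈ S}.indicator
        (fun z => ‖U z.1 (z.2 + h) - U z.1 (z.2 + h')‖ₑ ^ 3) z
      + ofReal η * (‖U z.1 (z.2 + h) - U z.1 z.2‖ₑ ^ 3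
        + ‖U z.1 (z.2 + h') - U z.1 z.2‖ₑ ^ 3)) := by
    intro z
    by_cases hz : ψ z.2 = 0
    · simp [hz]
    have : z ∈ {z : Ω × E3 | z.2 ∈ S} := hz
    rw [indicator_of_mem this]
    have hv : U z.1 (z.2 + h) - U z.1 (z.2 + h') =
      (U z.1 (z.2 + h) - U z.1 z.2) - (U z.1 (z.2 + h') - U z.1 z.2) := by abel
    rw [hv]
    generalize U z.1 (z.2 + h) - U z.1 z.2 = v
    generalize U z.1 (z.2 + h') - U z.1 z.2 = w
    rw [← ofReal_norm_pow, ← ofReal_norm_pow, ← ofReal_norm_pow,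
      ← ofReal_add (by positivity) (by positivity), ← ofReal_mul (by positivity),
      ← ofReal_mul (by positivity), ← ofReal_add (by positivity) (by positivity),
      ← ofReal_mul (by positivity), ← ofReal_norm, norm_eq_abs, ← mul_sub, abs_mul]
    refine ofReal_le_ofReal ?_
    have y1 := mul_sq_le_young (norm_nonneg (v - w)) (norm_nonneg v) hη
    have y2 := mul_sq_le_young (norm_nonneg (v - w)) (norm_nonneg w) hη
    calc _ ≤ B * (3 * ‖v - w‖ * (‖v‖ ^ 2 + ‖w‖ ^ 2)) :=
          mul_le_mul (hc.hψ _) (hc.hs.lipschitz n v w hn) (abs_nonneg _) hB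
      _ = 3 * B * (‖v - w‖ * ‖v‖ ^ 2 + ‖v - w‖ * ‖w‖ ^ 2) := by ring
      _ ≤ _ := mul_le_mul_of_nonneg_left (by linarith) (by positivity)
  refine (lintegral_mono hpt).trans ?_
  have mz : Measurable fun z : Ω × E3 => ‖U z.1 (z.2 + h) - U z.1 z.2‖ₑ ^ 3
        + ‖U z.1 (z.2 + h') - U z.1 z.2‖ₑ ^ 3 := by fun_prop
  rw [lintegral_const_mul_add_mul mI mz]
  gcongr
  rw [lintegral_add_left (by fun_prop)]
  calc _ ≤ 16 * K + 16 * K :=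
        add_le_add (lintegral_increment_le hc h) (lintegral_increment_le hc h')
    _ = 32 * K := by ring

/-- The mean cubic flux in polar coordinates. -/
lemma integral_cubicFlux_eq (hc : IsCubicMean P U ψ m s K B) {ε l : ℝ} (hε : 0 < ε) (hl : 0 ≤ l)
    {Φ : E3 → E3 →L[ℝ] E3}
    (hΦ : ∀ h v, tri Φ h v v v = 2 * deriv (stepAt ε l) (‖h‖ ^ 2) * s h v) :
    Integrable (fun ω => cubicFlux ψ Φ (U ω)) P ∧
      ∫ ω, cubicFlux ψ Φ (U ω) ∂P = ∫ n : sphere (0 : E3) 1, (∫ r in (0 : ℝ)..(l + ε),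
        weight m ε l r * incMean P ψ s U (r • (n : E3)) n) ∂sphereMeasure := by
  have cd := continuous_deriv_stepAt ε l
  have cm : Continuous fun h : E3 => -deriv (stepAt ε l) (‖h‖ ^ 2) := by fun_prop
  have h1 : ∀ u : E3 → E3, cubicFlux ψ Φ u = ∫ p : E3 × E3, -deriv (stepAt ε l) (‖p.2‖ ^ 2) *
      (ψ p.1 * s p.2 (u (p.1 + p.2) - u p.1)) ∂vol₂ := by
    intro u
    rw [cubicFlux, ← (measurePreserving_prod_add (volume : Measure E3) volume).integral_comp
      (MeasurableEquiv.shearAddRight E3).measurableEmbedding]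
    refine integral_congr_ae (ae_of_all _ fun p => ?_)
    have : p.1 - (p.1 + p.2) = -p.2 := by abel
    simp only [this, hΦ, norm_neg, hc.hs.odd]
    ring
  have hfin : ∫⁻ h : E3, ‖-deriv (stepAt ε l) (‖h‖ ^ 2)‖ₑ * ‖h‖ₑ ^ (m + 1) ≠ ⊤ := by
    have ci : Integrable fun h : E3 => -deriv (stepAt ε l) (‖h‖ ^ 2) * ‖h‖ ^ (m + 1) := by
      refine Continuous.integrable_of_hasCompactSupport (by fun_prop)
        (HasCompactSupport.intro (isCompact_closedBall (0 : E3) (l + ε)) fun h hh => ?_)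
      rw [mem_closedBall_zero_iff, not_le] at hh
      rw [deriv_stepAt_eq_zero_of_gt hε (by nlinarith)]; simp
    have := ci.2
    rw [hasFiniteIntegral_iff_enorm] at this
    simpa [enorm_mul] using this.ne
  have hint := integrable_cubic (μ := volume) (n := fun h => h) (h := fun h => h) hc cm.measurable measurable_id measurable_id hfin
  obtain ⟨-, h4, h5⟩ := integrable_prod_assoc hint
  simp only [h1]
  refine ⟨h4, ?_⟩
  rw [h5]
  have h2 : ∀ h : E3, ∫ z : Ω × E3, -deriv (stepAt ε l) (‖h‖ ^ 2) *
      (ψ z.2 * s h (U z.1 (z.2 + h) - U z.1 z.2)) ∂(P.prod volume) =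
      -deriv (stepAt ε l) (‖h‖ ^ 2) * incMean P ψ s U h h := fun h => by
    rw [integral_const_mul, incMean]
  have h3 := hint.integral_prod_right
  simp only [h2] at h3 ⊢
  rw [integral_polar h3]
  refine integral_congr_ae (ae_of_all _ fun n => ?_)
  simp only
  rw [← integral_Ioi_weight_mul hε hl]
  refine setIntegral_congr_fun measurableSet_Ioi fun r hr => ?_
  have hr0 : (0 : ℝ) < r := hr
  have hn : ‖(n : E3)‖ = 1 := by simp
  have e1 : ‖r • (n : E3)‖ = r := by rw [norm_smul, hn, mul_one, norm_of_nonneg hr0.le]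
  have e2 : incMean P ψ s U (r • (n : E3)) (r • (n : E3)) =
      r ^ (m + 1) * incMean P ψ s U (r • (n : E3)) n := by
    rw [incMean, incMean, ← integral_const_mul]
    refine integral_congr_ae (ae_of_all _ fun z => ?_)
    simp only [hc.hs.homogeneous]; ring
  simp only [e1, e2, weight]
  ring

lemma abs_integral_cubicFlux_sub_le (hc : IsCubicMean P U ψ m s K B) {ε l : ℝ} (hε : 0 < ε) (hl : 0 ≤ l)
    {Φ : E3 → E3 →L[ℝ] E3}
    (hΦ : ∀ h v, tri Φ h v v v = 2 * deriv (stepAt ε l) (‖h‖ ^ 2) * s h v) {t : ℝ}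
    (ht : ∀ n : E3, ‖n‖ = 1 → ∀ r ∈ Icc l (l + ε),
      |incMean P ψ s U (r • n) n - incMean P ψ s U (l • n) n| ≤ t) :
    |(∫ ω, cubicFlux ψ Φ (U ω) ∂P) - totalWeight m ε l *
      ∫ n : sphere (0 : E3) 1, incMean P ψ s U (l • (n : E3)) n ∂sphereMeasure| ≤
      totalWeight m ε l * t * (4 * Real.pi) := by
  have hK := hc.hK
  set C : ℝ := (ofReal (3 * B) * (16 * K)).toReal
  have hC : ∀ h n : E3, ‖n‖ = 1 → ‖incMean P ψ s U h n‖ ≤ C := fun h n hn => by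
    have h1 := enorm_incMean_le hc h n hn
    rw [← toReal_enorm]
    exact toReal_mono (by finiteness) h1
  have cw := continuous_weight m ε l
  have hle : (0 : ℝ) ≤ l + ε := by linarith
  have hn1 : ∀ n : sphere (0 : E3) 1, ‖(n : E3)‖ = 1 := fun n => by simp
  have mN : Measurable fun n : sphere (0 : E3) 1 => (n : E3) := measurable_subtype_coe
  have sm1 : StronglyMeasurable fun a : sphere (0 : E3) 1 × ℝ =>
      incMean P ψ s U (a.2 • (a.1 : E3)) a.1 :=
    stronglyMeasurable_incMean hc (by fun_prop) (by fun_prop)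
  have sm2 : StronglyMeasurable fun a : sphere (0 : E3) 1 × ℝ =>
      weight m ε l a.2 * incMean P ψ s U (a.2 • (a.1 : E3)) a.1 :=
    (cw.comp continuous_snd).stronglyMeasurable.mul sm1
  have smr : ∀ n : sphere (0 : E3) 1,
      StronglyMeasurable fun r : ℝ => incMean P ψ s U (r • (n : E3)) n := fun n =>
    sm1.comp_measurable (g := fun r : ℝ => (n, r)) (by fun_prop)
  have smn : ∀ r : ℝ, StronglyMeasurable fun n : sphere (0 : E3) 1 =>
      incMean P ψ s U (r • (n : E3)) n := fun r =>
    sm1.comp_measurable (g := fun n : sphere (0 : E3) 1 => (n, r)) (by fun_prop)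
  have iw : IntervalIntegrable (weight m ε l) volume 0 (l + ε) := cw.intervalIntegrable _ _
  have ir : ∀ n : sphere (0 : E3) 1, IntervalIntegrable
      (fun r => weight m ε l r * incMean P ψ s U (r • (n : E3)) n) volume 0 (l + ε) := fun n => by
    rw [intervalIntegrable_iff] at iw ⊢
    exact iw.mul_bdd (smr n).aestronglyMeasurable (ae_of_all _ fun r => hC _ _ (hn1 n))
  have key : ∀ n : sphere (0 : E3) 1,
      ‖(∫ r in (0 : ℝ)..(l + ε), weight m ε l r * incMean P ψ s U (r • (n : E3)) n)
        - totalWeight m ε l * incMean P ψ s U (l • (n : E3)) n‖ ≤ totalWeight m ε l * t := by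
    intro n
    rw [totalWeight, ← intervalIntegral.integral_mul_const, ← intervalIntegral.integral_mul_const,
      ← intervalIntegral.integral_sub (ir n) (iw.mul_const _)]
    refine intervalIntegral.norm_integral_le_of_norm_le hle (ae_of_all _ fun r hr => ?_)
      (iw.mul_const _)
    have hw := weight_nonneg (m := m) (ε := ε) (l := l) hr.1.le
    rw [← mul_sub, norm_mul, norm_of_nonneg hw]
    by_cases h : r ∈ Icc l (l + ε)
    · gcongr
      exact ht n (hn1 n) r h
    · rw [weight_eq_zero hε hl hr.1.le h]; simp
  have i2 : Integrable (fun n : sphere (0 : E3) 1 => totalWeight m ε l *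
      incMean P ψ s U (l • (n : E3)) n) sphereMeasure :=
    (Integrable.of_bound (smn l).aestronglyMeasurable C
      (ae_of_all _ fun n => hC _ _ (hn1 n))).const_mul _
  have i1 : Integrable (fun n : sphere (0 : E3) 1 =>
      ∫ r in (0 : ℝ)..(l + ε), weight m ε l r * incMean P ψ s U (r • (n : E3)) n)
      sphereMeasure := by
    have sm3 : StronglyMeasurable fun n : sphere (0 : E3) 1 =>
        ∫ r in (0 : ℝ)..(l + ε), weight m ε l r * incMean P ψ s U (r • (n : E3)) n := by
      simp only [intervalIntegral.integral_of_le hle]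
      exact sm2.integral_prod_right'
    have h0 : Integrable (fun n : sphere (0 : E3) 1 =>
        (∫ r in (0 : ℝ)..(l + ε), weight m ε l r * incMean P ψ s U (r • (n : E3)) n)
        - totalWeight m ε l * incMean P ψ s U (l • (n : E3)) n) sphereMeasure :=
      Integrable.of_bound (sm3.sub i2.1.stronglyMeasurable_mk |>.aestronglyMeasurable.congr
        (by filter_upwards [i2.1.ae_eq_mk] with n hn; simp [hn])) _ (ae_of_all _ key)
    exact (h0.add i2).congr (ae_of_all _ fun n => by simp)
  rw [(integral_cubicFlux_eq hc hε hl hΦ).2, ← integral_const_mul,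
    ← integral_sub i1 i2, ← norm_eq_abs, ← sphereMeasure_real_univ]
  exact norm_integral_le_of_norm_le_const (ae_of_all _ key)

/-- The structure function of a cubic form. -/
def structureFn (s : E3 → E3 → ℝ) {D : Set E3} (P : Measure Ω) (u : Ω → L2Vec D) (ψ : E3 → ℝ)
    (l : ℝ) : ℝ :=
  (1 / (4 * Real.pi)) * ∫ ω, (∫ n : sphere (0 : E3) 1, (∫ x in D,
    ψ x * s n (increment D (u ω) (l • (n : E3)) x)) ∂sphereMeasure) ∂P

lemma structureFn_eq {D : Set E3} [IsFiniteMeasure (volume.restrict D)]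
    (hD : MeasurableSet D) {w : Ω → L2Vec D} (hc : IsCubicMean P (fun ω => fld (w ω)) ψ m s K B)
    (hψD : ∀ x ∉ D, ψ x = 0) (l : ℝ) :
    structureFn s P w ψ l = 1 / (4 * Real.pi) * ∫ n : sphere (0 : E3) 1,
      incMean P ψ s (fun ω => fld (w ω)) (l • (n : E3)) n ∂sphereMeasure := by
  have mN : Measurable fun n : sphere (0 : E3) 1 => (n : E3) := measurable_subtype_coe
  have hint := integrable_cubic (μ := sphereMeasure) (c := fun _ => 1)
    (n := fun n => (n : E3)) (h := fun n => l • (n : E3)) hc measurable_const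
    (by fun_prop) mN (by
      have : ∀ n : sphere (0 : E3) 1, ‖(n : E3)‖ₑ = 1 := fun n => by rw [← ofReal_norm]; simp
      simp only [this]
      simp)
  simp only [one_mul] at hint
  obtain ⟨h1, -, h2⟩ := integrable_prod_assoc hint
  rw [structureFn]
  simp only [incMean]
  rw [← h2]
  congr 1
  refine integral_congr_ae ?_
  filter_upwards [h1] with ω hω
  rw [integral_prod_symm _ hω]
  refine integral_congr_ae (ae_of_all _ fun n => ?_)
  simp only
  rw [setIntegral_eq_integral_of_forall_compl_eq_zero fun x hx => by rw [hψD x hx, zero_mul]]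
  refine integral_congr_ae ?_
  filter_upwards [increment_ae_eq hD (w ω) (l • (n : E3))] with x hx
  rw [hx]

end Means

/-! ### The error in the local law at a fixed scale -/

lemma abs_residual_le {m : ℕ} {ε l A N F t W δ c T : ℝ} (hl : 0 < l)
    (hW : l ^ (m + 2) / 2 ≤ W) (h1 : |A - W * N| ≤ W * t * (4 * Real.pi)) (hδ : |δ| ≤ ε * W)
    (hc : c = 8 * Real.pi / (m + 3) * (l * W + δ)) (hT : T = A + c * F) :
    |1 / l * (1 / (4 * Real.pi) * N) + 2 / (m + 3) * F| ≤
      (l⁻¹) ^ (m + 3) * |T| + l⁻¹ * t + l⁻¹ * (ε * |F|) := by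
  have hpi := Real.pi_gt_three
  have hW0 : 0 < W := lt_of_lt_of_le (by positivity) hW
  have hm : (0 : ℝ) < m + 3 := by positivity
  have e : 1 / l * (1 / (4 * Real.pi) * N) + 2 / (m + 3) * F =
      (4 * Real.pi * l * W)⁻¹ * (T - (A - W * N) - 8 * Real.pi / (m + 3) * (δ * F)) := by
    rw [hT, hc]; field_simp; ring
  have b0 : |T - (A - W * N) - 8 * Real.pi / (m + 3) * (δ * F)| ≤
      |T| + W * t * (4 * Real.pi) + 4 * Real.pi * (ε * W * |F|) := by
    have h8 : 8 * Real.pi / (m + 3) ≤ 4 * Real.pi := by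
      rw [div_le_iff₀ hm]; nlinarith [Nat.cast_nonneg (α := ℝ) m, Real.pi_pos]
    calc _ ≤ |T| + |A - W * N| + |8 * Real.pi / (m + 3) * (δ * F)| :=
          (abs_sub _ _).trans (by gcongr; exact abs_sub _ _)
      _ ≤ _ := by
        rw [abs_mul (8 * Real.pi / (m + 3)), abs_mul δ, abs_of_nonneg (by positivity :
          0 ≤ 8 * Real.pi / ((m : ℝ) + 3))]
        gcongr
  have b1 : (4 * Real.pi * l * W)⁻¹ ≤ (l⁻¹) ^ (m + 3) := by
    rw [inv_pow]
    refine inv_anti₀ (by positivity) ?_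
    calc l ^ (m + 3) = 1 * l * l ^ (m + 2) := by ring
      _ ≤ (2 * Real.pi) * l * l ^ (m + 2) := by gcongr; linarith
      _ = 4 * Real.pi * l * (l ^ (m + 2) / 2) := by ring
      _ ≤ _ := by gcongr
  rw [e, abs_mul, abs_of_nonneg (by positivity : 0 ≤ (4 * Real.pi * l * W)⁻¹)]
  calc _ ≤ (4 * Real.pi * l * W)⁻¹ *
        (|T| + W * t * (4 * Real.pi) + 4 * Real.pi * (ε * W * |F|)) := by gcongr
    _ = (4 * Real.pi * l * W)⁻¹ * |T| + l⁻¹ * t + l⁻¹ * (ε * |F|) := by field_simp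
    _ ≤ _ := by gcongr

section Density

variable {D : Set E3} [IsFiniteMeasure (volume.restrict D)] {Ω : Type*}
  {mΩ : MeasurableSpace Ω} {P : Measure Ω}
  {w ζ : Ω → L2Vec D} {π : Ω → L32 D} {ψ : E3 → ℝ} {B : ℝ} {K : ℝ≥0∞}

lemma mul_le_rpow_add_pow (a b : ℝ≥0∞) : a * b ≤ a ^ (3 / 2 : ℝ) + b ^ 3 := by
  rcases le_total a (b ^ 2) with h | h
  · calc a * b ≤ b ^ 2 * b := by gcongr
      _ = b ^ 3 := by ring
      _ ≤ _ := le_add_self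
  · have h1 : b ≤ a ^ (1 / 2 : ℝ) := by
      have := ENNReal.rpow_le_rpow h (show (0 : ℝ) ≤ 1 / 2 by norm_num)
      rw [← rpow_natCast, ← rpow_mul] at this
      norm_num at this
      simpa using this
    have h2 := ENNReal.rpow_add_of_nonneg (x := a) 1 (1 / 2 : ℝ) (by norm_num) (by norm_num)
    calc a * b ≤ a * a ^ (1 / 2 : ℝ) := by gcongr
      _ = a ^ (3 / 2 : ℝ) := by
        rw [ENNReal.rpow_one] at h2
        rw [← h2]
        norm_num
      _ ≤ _ := le_self_add

/-- The density of the energy flux of the fields, without forcing. -/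
def nonlinearDensity (ψ : E3 → ℝ) (u : E3 → E3) (q : E3 → ℝ) (x : E3) : ℝ :=
  (‖u x‖ ^ 2 + 2 * q x) * fderiv ℝ ψ x (u x)

lemma HasMoments.integral_bounds (hM : HasMoments P w ζ π K) {f : Ω × E3 → ℝ} (hf : Measurable f)
    {g : Ω × E3 → ℝ≥0∞} (hg : Measurable g) (hgK : ∫⁻ ω, (∫⁻ x, g (ω, x)) ∂P ≤ K)
    (hfg : ∀ z, ‖f z‖ₑ ≤ ofReal B * (3 * ‖fld (w z.1) z.2‖ₑ ^ 3 + 2 * g z)) :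
    Integrable f (P.prod volume) ∧ ‖∫ z, f z ∂(P.prod volume)‖ₑ ≤ ofReal B * (5 * K) := by
  have mw := (measurable_fld_comp hM.meas hM.mw).enorm.pow_const 3
  have hK := hM.ne_top
  have h : ∫⁻ z, ‖f z‖ₑ ∂(P.prod volume) ≤ ofReal B * (5 * K) := by
    refine (lintegral_mono hfg).trans ?_
    rw [lintegral_const_mul_add_mul mw hg, lintegral_prod _ mw.aemeasurable,
      lintegral_prod _ hg.aemeasurable]
    calc _ ≤ ofReal B * (3 * K + 2 * K) := by gcongr; exact hM.le_w
      _ = _ := by ring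
  exact ⟨⟨hf.aestronglyMeasurable, h.trans_lt (by finiteness)⟩,
    (enorm_integral_le_lintegral_enorm _).trans h⟩

lemma nonlinearDensity_bounds (hM : HasMoments P w ζ π K) (hψ : CutoffLE D ψ B) :
    let f := fun z : Ω × E3 => nonlinearDensity ψ (fld (w z.1)) (fld (π z.1)) z.2
    Integrable f (P.prod volume) ∧ ‖∫ z, f z ∂(P.prod volume)‖ₑ ≤ ofReal B * (5 * K) := by
  have mw := measurable_fld_comp hM.meas hM.mw
  have mq := measurable_fld_comp_L32 hM.meas hM.mq
  have mg : Measurable (gradient ψ) := hψ.smooth.gradient.continuous.measurable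
  refine hM.integral_bounds ?_ (mq.enorm.pow_const _) hM.le_q fun z => ?_
  · simp only [nonlinearDensity, fderiv_apply_eq_inner]
    exact ((mw.norm.pow_const 2).add (mq.const_mul 2)).mul
      ((mg.comp measurable_snd).inner (𝕜 := ℝ) mw)
  have h1 : ‖fderiv ℝ ψ z.2 (fld (w z.1) z.2)‖ₑ ≤ ofReal B * ‖fld (w z.1) z.2‖ₑ := by
    refine (le_opENorm _ _).trans ?_
    gcongr
    rw [← ofReal_norm]
    exact ofReal_le_ofReal (hψ.deriv _)
  have h2 : ‖‖fld (w z.1) z.2‖ ^ 2 + 2 * fld (π z.1) z.2‖ₑ ≤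
      ‖fld (w z.1) z.2‖ₑ ^ 2 + 2 * ‖fld (π z.1) z.2‖ₑ := by
    refine (enorm_add_le _ _).trans_eq ?_
    rw [enorm_pow, enorm_norm, enorm_mul, ← ofReal_norm (2 : ℝ)]
    norm_num
  rw [nonlinearDensity, enorm_mul]
  generalize ‖fld (w z.1) z.2‖ₑ = a at *
  generalize ‖fld (π z.1) z.2‖ₑ = b at *
  calc _ ≤ (a ^ 2 + 2 * b) * (ofReal B * a) := by gcongr
    _ = ofReal B * (a ^ 3 + 2 * (b * a)) := by ring
    _ ≤ ofReal B * (a ^ 3 + 2 * (b ^ (3 / 2 : ℝ) + a ^ 3)) := by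
        gcongr; exact mul_le_rpow_add_pow b a
    _ = _ := by ring

lemma inputDensity_bounds (hM : HasMoments P w ζ π K) (hψ : CutoffLE D ψ B) :
    let f := fun z : Ω × E3 => ψ z.2 * ⟪fld (w z.1) z.2, fld (ζ z.1) z.2⟫
    Integrable f (P.prod volume) ∧ ‖∫ z, f z ∂(P.prod volume)‖ₑ ≤ ofReal B * (5 * K) := by
  have mw := measurable_fld_comp hM.meas hM.mw
  have mz := measurable_fld_comp hM.meas hM.mz
  refine hM.integral_bounds ((hψ.smooth.continuous.measurable.comp measurable_snd).mul
    (mw.inner (𝕜 := ℝ) mz)) (mz.enorm.pow_const _) hM.le_z fun z => ?_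
  rw [enorm_mul]
  gcongr
  · rw [← ofReal_norm]
    exact ofReal_le_ofReal (hψ.value _)
  · calc _ ≤ ‖fld (ζ z.1) z.2‖ₑ * ‖fld (w z.1) z.2‖ₑ := by
          rw [← ofReal_norm, ← ofReal_norm, ← ofReal_norm, ← ofReal_mul (norm_nonneg _), mul_comm]
          exact ofReal_le_ofReal (norm_inner_le_norm _ _)
      _ ≤ _ := (mul_le_rpow_add_pow _ _).trans_eq (add_comm _ _)
      _ ≤ _ := add_le_add (le_mul_of_one_le_left' (by norm_num))
        (le_mul_of_one_le_left' (by norm_num))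

variable [IsProbabilityMeasure P]

lemma integral_fluxDensity (hM : HasMoments P w ζ π K) (hψ : CutoffLE D ψ B) :
    Integrable (fun ω => ∫ x, fluxDensity ψ (fld (w ω)) (fld (ζ ω)) (fld (π ω)) x) P ∧
    ‖∫ ω, (∫ x, fluxDensity ψ (fld (w ω)) (fld (ζ ω)) (fld (π ω)) x) ∂P‖ₑ ≤
      ofReal B * (15 * K) ∧
    ∫ ω, (∫ x, fluxDensity ψ (fld (w ω)) (fld (ζ ω)) (fld (π ω)) x) ∂P =
      (∫ ω, (∫ x in D, (‖w ω x‖ ^ 2 + 2 * π ω x) * ⟪w ω x, gradient ψ x⟫) ∂P)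
        + 2 * ∫ ω, (∫ x in D, ψ x * ⟪w ω x, ζ ω x⟫) ∂P := by
  have hD := hM.meas
  obtain ⟨i1, b1⟩ := nonlinearDensity_bounds hM hψ
  obtain ⟨i2, b2⟩ := inputDensity_bounds hM hψ
  have i3 : Integrable (fun z : Ω × E3 => fluxDensity ψ (fld (w z.1)) (fld (ζ z.1))
      (fld (π z.1)) z.2) (P.prod volume) := i1.add (i2.const_mul 2)
  have e' := integral_add i1 (i2.const_mul 2)
  rw [integral_const_mul] at e'
  have e := (integral_prod _ i3).symm.trans e'
  refine ⟨i3.integral_prod_left, ?_, ?_⟩ <;> rw [e]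
  · refine (enorm_add_le _ _).trans ?_
    rw [enorm_mul, ← ofReal_norm (2 : ℝ)]
    calc _ ≤ ofReal B * (5 * K) + ofReal ‖(2 : ℝ)‖ * (ofReal B * (5 * K)) := by gcongr
      _ = _ := by norm_num; ring
  · rw [integral_prod _ i1, integral_prod _ i2]
    congr 2
    · ext1 ω
      rw [← setIntegral_eq_integral_of_forall_compl_eq_zero (s := D) fun x hx => by
        simp [nonlinearDensity, fld_of_notMem _ hx]]
      refine integral_congr_ae ?_
      filter_upwards [fld_ae_eq_restrict hD (w ω), fld_ae_eq_restrict hD (π ω)] with x h1 h2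
      rw [nonlinearDensity, h1, h2, fderiv_apply_eq_inner, real_inner_comm]
    · congr 1
      ext1 ω
      rw [← setIntegral_eq_integral_of_forall_compl_eq_zero (s := D) fun x hx => by
        simp [fld_of_notMem _ hx]]
      refine integral_congr_ae ?_
      filter_upwards [fld_ae_eq_restrict hD (w ω), fld_ae_eq_restrict hD (ζ ω)] with x h1 h2
      rw [h1, h2]

end Density

lemma ofReal_scale_mul_volume_le {B l : ℝ} (hB : 0 ≤ B) (hl : 0 < l) (m : ℕ) :
    ofReal ((l⁻¹) ^ (m + 3)) * ofReal (B * (4 * l ^ m)) *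
      volume (closedBall (0 : E3) (2 * l)) ≤ ofReal (136 * B) := by
  rw [Measure.addHaar_closedBall_eq_addHaar_ball, volume_ball_fin_three,
    ← ofReal_pow (by positivity), ← ofReal_mul (by positivity),
    ← ofReal_mul (by positivity), ← ofReal_mul (by positivity)]
  refine ofReal_le_ofReal ?_
  have e : (l⁻¹) ^ (m + 3) * (B * (4 * l ^ m)) * ((2 * l) ^ 3 * (Real.pi * 4 / 3)) =
      B * (128 / 3 * Real.pi) := by
    rw [inv_pow]; field_simp; ring
  rw [e, mul_comm]
  gcongr
  nlinarith [Real.pi_lt_d2]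

/-- The constant in the error bound of the local laws. -/
def errConst (B B₂ C : ℝ) (K : ℝ≥0∞) (D : Set E3) : ℝ≥0∞ :=
  ofReal (2000 * (B + B₂ * C ^ 2)) * (1 + volume D + K)

lemma mul_le_errConst {B B₂ C a : ℝ} {K V : ℝ≥0∞} {D : Set E3} (ha : a ≤ 2000 * (B + B₂ * C ^ 2))
    (hV : V ≤ 1 + volume D + K) : ofReal a * V ≤ errConst B B₂ C K D :=
  mul_le_mul' (ofReal_le_ofReal ha) hV

section Residual

variable {D : Set E3} [IsFiniteMeasure (volume.restrict D)] {Ω : Type*}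
  {mΩ : MeasurableSpace Ω} {P : Measure Ω} [IsProbabilityMeasure P]
  {w ζ : Ω → L2Vec D} {π : Ω → L32 D} {K : ℝ≥0∞}

lemma enorm_residual_le (hM : HasMoments P w ζ π K) (hsol : ∀ ω, w ω ∈ solH D) {τ τ' : ℝ≥0∞}
    {ε l : ℝ} (hε : 0 < ε) (hεl : ε ≤ l) (hl1 : l ≤ 1)
    (hτ : ∀ h ∈ closedBall (0 : E3) (2 * l), meanOsc P w π h ≤ τ)
    (hτ' : ∀ h ∈ closedBall (0 : E3) ε, meanOsc P w π h ≤ τ')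
    (hτ't : τ' ≠ ⊤) {m : ℕ} (hm : m ≤ 2) {s : E3 → E3 → ℝ} (hs : IsCubicForm m s)
    {B η η' ν : ℝ} (hν : 0 ≤ ν) {ψ : E3 → ℝ} (hψ : CutoffLE D ψ B) {Φ : E3 → E3 →L[ℝ] E3}
    (hK : IsKernel (2 * l) Φ fun h => ‖h‖ ^ m * stepAt ε l (‖h‖ ^ 2))
    (htri : ∀ h v, tri Φ h v v v = 2 * deriv (stepAt ε l) (‖h‖ ^ 2) * s h v)
    (hΦ : ∀ h, ‖Φ h‖ ≤ 4 * l ^ m) (hρ : cthickening (2 * l) (tsupport ψ) ⊆ D)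
    (hη : 0 < η) (hη1 : η ≤ 1) (hη' : 0 < η') {B₂ M C : ℝ} (hB₂ : C2Bound ψ B₂)
    (hC2 : C2Bound Φ M) (hC : ∀ w : L2Vec D, ∫ x in D, ‖w x‖ ≤ C * ‖w‖)
    (hint : Integrable (fun ω => balance ν ψ Φ (w ω) (ζ ω) (π ω)) P)
    (hbal : ∫ ω, balance ν ψ Φ (w ω) (ζ ω) (π ω) ∂P = 0) :
    ‖1 / l * structureFn s P w ψ l
      + 2 / (m + 3) * ∫ ω, (∫ x, fluxDensity ψ (fld (w ω)) (fld (ζ ω)) (fld (π ω)) x) ∂P‖ₑ ≤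
      errConst B B₂ C K D * (ofReal ((η⁻¹) ^ 2) * τ + ofReal (η + l))
      + ofReal ((l⁻¹) ^ 5) * (errConst B B₂ C K D *
        (ofReal ((η'⁻¹) ^ 2) * τ' + ofReal (η' + ε + ν * M))) := by
  have hl : 0 < l := hε.trans_le hεl
  have hB : 0 ≤ B := (abs_nonneg _).trans (hψ.value 0)
  have hB20 := hB₂.nonneg
  have hM0 := hC2.nonneg
  have hKt := hM.ne_top
  have hc : IsCubicMean P (fun ω => fld (w ω)) ψ m s K B := ⟨measurable_fld_comp hM.meas hM.mw,
    hM.le_w, hKt, hs, hψ.smooth.continuous.measurable, hψ.value⟩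
  have hG : ∀ h : E3, |‖h‖ ^ m * stepAt ε l (‖h‖ ^ 2)| ≤ 4 * l ^ m := fun h => by
    rw [abs_mul, abs_of_nonneg (by positivity : 0 ≤ ‖h‖ ^ m)]
    by_cases hh : ‖h‖ ≤ 2 * l
    · calc ‖h‖ ^ m * |stepAt ε l (‖h‖ ^ 2)| ≤ (2 * l) ^ m * 1 := by gcongr; exact abs_stepAt_le
        _ = 2 ^ m * l ^ m := by ring
        _ ≤ 2 ^ 2 * l ^ m := by gcongr; norm_num
        _ = _ := by ring
    · rw [stepAt_of_ge hε (by nlinarith [not_le.1 hh])]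
      simp; positivity
  set T' : ℝ≥0∞ := ofReal (3 * B) *
    (ofReal (2 * (η'⁻¹) ^ 2) * τ' + ofReal η' * (32 * K)) with hT'
  have hT't : T' ≠ ⊤ := by rw [hT']; finiteness
  have hmem : ∀ x, ψ x ≠ 0 → ∀ h : E3, ‖h‖ ≤ 2 * l → x + h ∈ D := fun x hx h hh =>
    mem_of_cthickening hρ (subset_tsupport ψ hx) (by simpa using hh)
  have ht : ∀ n : E3, ‖n‖ = 1 → ∀ r ∈ Icc l (l + ε),
      |incMean P ψ s (fun ω => fld (w ω)) (r • n) n - incMean P ψ s (fun ω => fld (w ω)) (l • n) n|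
        ≤ T'.toReal := by
    intro n hn r hr
    have nrm : ∀ t : ℝ, ‖t • n‖ = |t| := fun t => by rw [norm_smul, hn, mul_one, norm_eq_abs]
    have h1 : ‖r • n‖ ≤ 2 * l := by rw [nrm, abs_of_nonneg (hl.le.trans hr.1)]; linarith [hr.2]
    have h2 : ‖l • n‖ ≤ 2 * l := by rw [nrm, abs_of_nonneg hl.le]; linarith
    have h3 : r • n - l • n ∈ closedBall (0 : E3) ε := by
      rw [mem_closedBall_zero_iff, ← sub_smul, nrm, abs_of_nonneg (by linarith [hr.1])]
      linarith [hr.2]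
    have h4 := enorm_incMean_sub_le hc hn (fun x hx => ⟨hmem x hx _ h1, hmem x hx _ h2⟩) hM.meas
      ((lintegral_mono fun ω => lintegral_mono fun x => le_self_add).trans (hτ' _ h3)) hη'
    rw [← norm_eq_abs, ← toReal_enorm]
    exact toReal_mono hT't h4
  obtain ⟨iA, -⟩ := integral_cubicFlux_eq hc hε hl.le htri
  have hA := abs_integral_cubicFlux_sub_le hc hε hl.le htri ht
  obtain ⟨iF, hF, -⟩ := integral_fluxDensity hM hψ
  have hflux := enorm_integral_flux_le hM hsol hτ hν hψ hK hρ hΦ hG hη hη1 hB₂ hC2 hC hint hbal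
  rw [integral_add iA (iF.const_mul _), integral_const_mul] at hflux
  obtain ⟨δ, hδ, hcδ⟩ := integral_scalar_kernel (m := m) hε hl.le
  have hres := abs_residual_le hl (totalWeight_ge hε hl.le) hA hδ hcδ rfl
    (F := ∫ ω, (∫ x, fluxDensity ψ (fld (w ω)) (fld (ζ ω)) (fld (π ω)) x) ∂P)
  rw [← structureFn_eq hM.meas hc
    (fun x hx => image_eq_zero_of_notMem_tsupport fun h => hx (hψ.smooth.support h)) l] at hres
  generalize (∫ ω, (∫ x, fluxDensity ψ (fld (w ω)) (fld (ζ ω)) (fld (π ω)) x) ∂P) = F at *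
  generalize (∫ ω, cubicFlux ψ Φ (fld (w ω)) ∂P) = A at *
  generalize (∫ h : E3, ‖h‖ ^ m * stepAt ε l (‖h‖ ^ 2)) = c at *
  rw [← ofReal_norm, norm_eq_abs]
  refine (ofReal_le_ofReal hres).trans ?_
  have hl' : 1 ≤ l⁻¹ := (one_le_inv₀ hl).2 hl1
  rw [ofReal_add (by positivity) (by positivity),
    ofReal_add (by positivity) (by positivity), ofReal_mul (by positivity),
    ofReal_mul (by positivity), ofReal_mul (by positivity),
    ENNReal.ofReal_toReal hT't, ofReal_mul hε.le, ← norm_eq_abs, ← norm_eq_abs,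
    ofReal_norm, ofReal_norm, ofReal_add (p := η' + ε) (by positivity) (by positivity),
    ofReal_add (p := η') (by positivity) (by positivity)]
  set L := ofReal ((l⁻¹) ^ 5)
  set Q := errConst B B₂ C K D
  have q0 : 0 ≤ B₂ * C ^ 2 := by positivity
  have V1 : (1 : ℝ≥0∞) ≤ 1 + volume D + K := by rw [add_assoc]; exact le_self_add
  have VK : K ≤ 1 + volume D + K := le_add_self
  have VD : volume D + K ≤ 1 + volume D + K := by rw [add_assoc]; exact le_add_self
  have L1 : ofReal ((l⁻¹) ^ (m + 3)) ≤ L :=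
    ofReal_le_ofReal (pow_le_pow_right₀ hl' (by omega))
  have L2 : ofReal l⁻¹ ≤ L := ofReal_le_ofReal (le_self_pow₀ hl' (by norm_num))
  have b1 : ofReal ((l⁻¹) ^ (m + 3)) * ‖A + c * F‖ₑ ≤
      Q * (ofReal ((η⁻¹) ^ 2) * τ + ofReal (η + l))
        + L * (Q * ofReal (ν * M)) := by
    refine (mul_le_mul_right hflux _).trans ?_
    rw [mul_add]
    refine add_le_add ?_ ?_
    · have h3 : ofReal (3 * η + 2 * l) ≤ ofReal (3 * (η + l)) :=
        ofReal_le_ofReal (by linarith)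
      rw [ofReal_mul (by norm_num)] at h3
      rw [ofReal_mul (p := 5) (by norm_num)]
      generalize ofReal (3 * η + 2 * l) = y at *
      generalize ofReal (η + l) = y' at *
      generalize ofReal ((η⁻¹) ^ 2) = x
      calc _ = (ofReal ((l⁻¹) ^ (m + 3)) * ofReal (B * (4 * l ^ m)) *
            volume (closedBall (0 : E3) (2 * l))) *
            (ofReal 5 * x * τ + y * (4 * K)) := by ring
        _ ≤ ofReal (136 * B) *
            (ofReal 5 * x * τ + ofReal 3 * y' * (4 * K)) := by
            gcongr
            exact ofReal_scale_mul_volume_le hB hl m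
        _ = ofReal (5 * (136 * B)) * 1 * (x * τ)
            + ofReal (12 * (136 * B)) * K * y' := by
            rw [ofReal_mul (p := 5) (by norm_num),
              ofReal_mul (p := 12) (by norm_num),
              show (12 : ℝ) = 3 * 4 by norm_num, ofReal_mul (p := 3) (by norm_num),
              show ofReal 4 = 4 by norm_num]
            ring
        _ ≤ Q * (x * τ) + Q * y' := by
            gcongr
            · exact mul_le_errConst (by linarith) V1
            · exact mul_le_errConst (by linarith) VK
        _ = _ := by ring
    · calc _ ≤ L * (ofReal (ν * M) * Q) := by
            gcongr
            exact mul_le_errConst (by linarith) VD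
        _ = _ := by ring
  have b2 : ofReal l⁻¹ * T' ≤ L *
      (Q * (ofReal ((η'⁻¹) ^ 2) * τ') + Q * ofReal η') := by
    rw [hT', ofReal_mul (p := 2) (by norm_num)]
    generalize ofReal ((η'⁻¹) ^ 2) = x
    refine mul_le_mul' L2 ?_
    calc _ = ofReal (2 * (3 * B)) * 1 * (x * τ')
          + ofReal (32 * (3 * B)) * K * ofReal η' := by
          rw [ofReal_mul (p := 2) (by norm_num),
            ofReal_mul (p := 32) (by norm_num), show ofReal 32 = 32 by norm_num]
          ring
      _ ≤ _ := by
          gcongr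
          · exact mul_le_errConst (by linarith) V1
          · exact mul_le_errConst (by linarith) VK
  have b3 : ofReal l⁻¹ * (ofReal ε * ‖F‖ₑ) ≤ L * (Q * ofReal ε) := by
    refine mul_le_mul' L2 ?_
    calc _ ≤ ofReal ε * (ofReal B * (15 * K)) := by gcongr
      _ = ofReal (15 * B) * K * ofReal ε := by
          rw [ofReal_mul (p := 15) (by norm_num), show ofReal 15 = 15 by norm_num]
          ring
      _ ≤ _ := by gcongr; exact mul_le_errConst (by linarith) VK
  refine (add_le_add (add_le_add b1 b2) b3).trans_eq ?_
  ring

end Residual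

/-! ### Selection of the scales -/

/-- The bound of the error in a local law in terms of a modulus of continuity `κ` and of the
size `M ε` of the kernels with resolution `ε`. -/
def HasResidualBound (κ : E3 → ℝ≥0∞) (M : ℝ → ℝ) (R : ℝ → ℝ → ℝ) : Prop :=
  ∃ Q : ℝ≥0∞, Q ≠ ⊤ ∧ ∃ l₀ > 0, ∀ ν ∈ Ioo (0 : ℝ) 1, ∀ ε l τ τ' η η', 0 < ε → ε ≤ l → l ≤ l₀ →
    (∀ h ∈ closedBall (0 : E3) (2 * l), κ h ≤ τ) →
    (∀ h ∈ closedBall (0 : E3) ε, κ h ≤ τ') → τ' ≠ ⊤ → 0 < η → η ≤ 1 → 0 < η' →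
    ‖R ν l‖ₑ ≤ Q * (ofReal ((η⁻¹) ^ 2) * τ + ofReal (η + l))
      + ofReal ((l⁻¹) ^ 5) *
        (Q * (ofReal ((η'⁻¹) ^ 2) * τ' + ofReal (η' + ε + ν * M ε)))

lemma exists_closedBall_le {κ : E3 → ℝ≥0∞} (hκ : Tendsto κ (𝓝 0) (𝓝 0)) {δ : ℝ≥0∞} (hδ : 0 < δ) :
    ∃ d > 0, ∀ h ∈ closedBall (0 : E3) d, κ h ≤ δ := by
  obtain ⟨d, hd, h⟩ := Metric.nhds_basis_closedBall.eventually_iff.1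
    (tendsto_nhds_zero.1 hκ δ hδ)
  exact ⟨d, hd, fun x hx => h hx⟩

lemma exists_slow_rate {M : ℕ → ℝ} (hM : ∀ n, 0 ≤ M n) :
    ∃ c : ℝ → ℝ, (∀ ν, 0 < ν → 0 < c ν) ∧ Tendsto c (𝓝[>] 0) (𝓝 0) ∧
      ∀ ν, 0 < ν → ∃ n : ℕ, 3 * (1 / ((n : ℝ) + 1)) + ν * M n ≤ c ν := by
  have hb0 : ∀ (ν : ℝ) (n : ℕ), 0 ≤ ν → 0 ≤ 3 * (1 / ((n : ℝ) + 1)) + ν * M n := fun ν n hν => by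
    have := hM n
    positivity
  have hbb : ∀ ν : ℝ, 0 ≤ ν → BddBelow (range fun n : ℕ => 3 * (1 / ((n : ℝ) + 1)) + ν * M n) :=
    fun ν hν => ⟨0, by rintro _ ⟨n, rfl⟩; exact hb0 ν n hν⟩
  have hc0 : ∀ ν : ℝ, 0 < ν → 0 < (⨅ n : ℕ, (3 * (1 / ((n : ℝ) + 1)) + ν * M n)) + ν := fun ν hν =>
    add_pos_of_nonneg_of_pos (le_ciInf fun n => hb0 ν n hν.le) hν
  refine ⟨fun ν => (⨅ n : ℕ, (3 * (1 / ((n : ℝ) + 1)) + ν * M n)) + ν, hc0,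
    tendsto_order.2 ⟨fun x hx => ?_, fun x hx => ?_⟩, fun ν hν => ?_⟩
  · filter_upwards [self_mem_nhdsWithin] with ν hν using hx.trans (hc0 ν hν)
  · obtain ⟨n, hn⟩ := exists_nat_one_div_lt (show 0 < x / 6 by linarith)
    have ht : Tendsto (fun ν : ℝ => ν * M n + ν) (𝓝[>] 0) (𝓝 0) := by
      have : Continuous fun ν : ℝ => ν * M n + ν := by fun_prop
      simpa using (this.tendsto 0).mono_left nhdsWithin_le_nhds
    filter_upwards [self_mem_nhdsWithin, ht.eventually_lt_const (show 0 < x / 2 by linarith)]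
      with ν hν h2
    have h3 := ciInf_le (hbb ν (le_of_lt hν)) n
    linarith
  · obtain ⟨n, hn⟩ := exists_lt_of_ciInf_lt (lt_add_of_pos_right
      (⨅ n : ℕ, (3 * (1 / ((n : ℝ) + 1)) + ν * M n)) hν)
    exact ⟨n, hn.le⟩

lemma scale_pow_mul_le {c l p x y : ℝ} (hc : 0 < c) (hp : 0 < p) (hx : 0 ≤ x) (hy : 0 ≤ y)
    (hl : c ^ (1 / 10 : ℝ) ≤ l) (hxp : x ≤ p) (h : 3 * p + y ≤ c) :
    (l⁻¹) ^ 5 * ((p⁻¹) ^ 2 * p ^ 3 + (p + x + y)) ≤ c ^ (1 / 2 : ℝ) := by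
  have hr := rpow_pos_of_pos hc (1 / 10)
  have hl0 : 0 < l := hr.trans_le hl
  have e1 : (p⁻¹) ^ 2 * p ^ 3 = p := by field_simp
  have e4 := rpow_pos_of_pos hc (1 / 2)
  have e2 : (l⁻¹) ^ 5 ≤ (c ^ (1 / 2 : ℝ))⁻¹ := by
    rw [inv_pow]
    refine inv_anti₀ e4 ?_
    calc c ^ (1 / 2 : ℝ) = (c ^ (1 / 10 : ℝ)) ^ 5 := by
          rw [← Real.rpow_natCast, ← Real.rpow_mul hc.le]; norm_num
      _ ≤ l ^ 5 := by gcongr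
  have e3 : c = c ^ (1 / 2 : ℝ) * c ^ (1 / 2 : ℝ) := by rw [← Real.rpow_add hc]; norm_num
  rw [e1]
  calc _ ≤ (c ^ (1 / 2 : ℝ))⁻¹ * c := by
        gcongr
        linarith
    _ = (c ^ (1 / 2 : ℝ))⁻¹ * (c ^ (1 / 2 : ℝ) * c ^ (1 / 2 : ℝ)) := by rw [← e3]
    _ = _ := by field_simp

/-- The viscous range can be chosen so slowly that it serves all error bounds at once. -/
lemma exists_scale {κ : E3 → ℝ≥0∞} (hκ : Tendsto κ (𝓝 0) (𝓝 0)) {M : ℝ → ℝ} (hM : ∀ ε, 0 ≤ M ε) :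
    ∃ scale : ℝ → ℝ, (∀ ν ∈ Ioo (0 : ℝ) 1, 0 < scale ν) ∧ Tendsto scale (𝓝[>] 0) (𝓝 0) ∧
      ∀ R, HasResidualBound κ M R → VanishesInInertialRange scale R := by
  have hsel : ∀ n : ℕ, ∃ ε : ℝ, 0 < ε ∧ ε ≤ 1 / ((n : ℝ) + 1) ∧
      ∀ h ∈ closedBall (0 : E3) ε, κ h ≤ ofReal ((1 / ((n : ℝ) + 1)) ^ 3) := by
    intro n
    have hn : (0 : ℝ) < 1 / ((n : ℝ) + 1) := by positivity
    obtain ⟨d, hd, h⟩ := exists_closedBall_le hκ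
      (δ := ofReal ((1 / ((n : ℝ) + 1)) ^ 3)) (by positivity)
    exact ⟨min d (1 / ((n : ℝ) + 1)), lt_min hd hn, min_le_right _ _, fun x hx =>
      h x (Metric.closedBall_subset_closedBall (min_le_left _ _) hx)⟩
  choose ε hε hε1 hεκ using hsel
  obtain ⟨c, hc0, hct, hcn⟩ := exists_slow_rate fun n => hM (ε n)
  refine ⟨fun ν => c ν ^ (1 / 10 : ℝ), fun ν hν => rpow_pos_of_pos (hc0 ν hν.1) _, ?_, ?_⟩
  · simpa using hct.rpow_const (p := 1 / 10) (Or.inr (by norm_num))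
  rintro R ⟨Q, hQ, l₀, hl₀, hR⟩
  have hQt : Tendsto (fun x : ℝ => Q * ofReal x) (𝓝 0) (𝓝 0) := by
    have := ENNReal.Tendsto.const_mul (a := Q) (continuous_ofReal.tendsto 0) (Or.inr hQ)
    simpa using this
  refine tendsto_nhds_zero.2 fun δ hδ => ?_
  have hδ3 : 0 < δ / 3 := ENNReal.div_pos hδ.ne' (by simp)
  obtain ⟨r, hr, hrQ⟩ := Metric.nhds_basis_closedBall.eventually_iff.1
    (tendsto_nhds_zero.1 hQt _ hδ3)
  obtain ⟨η, hη, hηr, hη1⟩ : ∃ η : ℝ, 0 < η ∧ η ≤ r / 2 ∧ η ≤ 1 :=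
    ⟨min (r / 2) 1, lt_min (by linarith) one_pos, min_le_left _ _, min_le_right _ _⟩
  have hκ2 : Tendsto (fun h => Q * ofReal ((η⁻¹) ^ 2) * κ h) (𝓝 0) (𝓝 0) := by
    have h1 := ENNReal.Tendsto.const_mul (a := Q * ofReal ((η⁻¹) ^ 2)) hκ
      (Or.inr (mul_ne_top hQ ofReal_ne_top))
    rwa [mul_zero] at h1
  obtain ⟨d, hd, hdκ⟩ := exists_closedBall_le hκ2 hδ3
  have hl1 : 0 < min (min l₀ (r / 2)) (d / 2) := by positivity
  filter_upwards [Ioo_mem_nhdsGT hl1] with lI hlI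
  have hlt := hlI.2
  rw [lt_min_iff, lt_min_iff] at hlt
  have hs2 : Tendsto (fun ν => c ν ^ (1 / 2 : ℝ)) (𝓝[>] 0) (𝓝 0) := by
    simpa using hct.rpow_const (p := 1 / 2) (Or.inr (by norm_num))
  refine limsup_le_of_le (by isBoundedDefault) ?_
  filter_upwards [Ioo_mem_nhdsGT one_pos, hct.eventually_lt_const one_pos,
    tendsto_nhds_zero.1 (hQt.comp hs2) _ hδ3] with ν hν hc1 hνQ
  refine iSup₂_le fun l hl => ?_
  have hcν := hc0 ν hν.1
  obtain ⟨n, hn⟩ := hcn ν hν.1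
  have hMn := mul_nonneg hν.1.le (hM (ε n))
  have hp : (0 : ℝ) < 1 / ((n : ℝ) + 1) := by positivity
  have hlpos : 0 < l := (rpow_pos_of_pos hcν _).trans_le hl.1
  have hεl : ε n ≤ l := by
    have h1 : c ν ≤ c ν ^ (1 / 10 : ℝ) := by
      conv_lhs => rw [← Real.rpow_one (c ν)]
      exact Real.rpow_le_rpow_of_exponent_ge hcν hc1.le (by norm_num)
    linarith [hε1 n, hl.1]
  have hmain := hR ν hν (ε n) l (⨆ h ∈ closedBall (0 : E3) (2 * l), κ h) _ η
    (1 / ((n : ℝ) + 1)) (hε n) hεl (hl.2.trans hlt.1.1.le)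
    (fun h hh => le_iSup₂ (f := fun h (_ : h ∈ closedBall (0 : E3) (2 * l)) => κ h) h hh)
    (hεκ n) ofReal_ne_top hη hη1 hp
  refine hmain.trans ?_
  have t1 : Q * (ofReal ((η⁻¹) ^ 2) * ⨆ h ∈ closedBall (0 : E3) (2 * l), κ h) ≤
      δ / 3 := by
    rw [← mul_assoc, mul_iSup]
    refine iSup_le fun h => ?_
    rw [mul_iSup]
    refine iSup_le fun hh => hdκ h ?_
    exact Metric.closedBall_subset_closedBall (by linarith [hl.2]) hh
  have t2 : Q * ofReal (η + l) ≤ δ / 3 := by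
    refine hrQ ?_
    rw [mem_closedBall_zero_iff, norm_of_nonneg (by positivity)]
    linarith [hl.2]
  have t3 : ofReal ((l⁻¹) ^ 5) * (Q * (ofReal (((1 / ((n : ℝ) + 1))⁻¹) ^ 2) *
      ofReal ((1 / ((n : ℝ) + 1)) ^ 3) +
      ofReal (1 / ((n : ℝ) + 1) + ε n + ν * M (ε n)))) ≤ δ / 3 := by
    refine le_trans ?_ hνQ
    have hεn := (hε n).le
    rw [← ofReal_mul (by positivity), ← ofReal_add (by positivity) (by positivity),
      ← mul_assoc, mul_comm (ofReal _) Q, mul_assoc, ← ofReal_mul (by positivity)]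
    exact mul_le_mul_right (ofReal_le_ofReal
      (scale_pow_mul_le hcν hp hεn hMn hl.1 (hε1 n) hn)) Q
  rw [mul_add]
  calc _ ≤ δ / 3 + δ / 3 + δ / 3 := by gcongr
    _ = δ := ENNReal.add_thirds δ

/-! ### Moments of the fields at a fixed time -/

lemma enorm_pow_three_le {D : Set E3} (w : L2Vec D) :
    ‖w‖ₑ ^ 3 ≤ volume D ^ (1 / 2 : ℝ) * ∫⁻ x in D, ‖w x‖ₑ ^ 3 := by
  have h1 := eLpNorm_le_eLpNorm_mul_rpow_measure_univ (p := 2) (q := 3) (by norm_num)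
    (Lp.aestronglyMeasurable w)
  rw [← Lp.enorm_def, eLpNorm_eq_lintegral_rpow_enorm_toReal (p := 3) (by norm_num) (by norm_num)]
    at h1
  refine (pow_le_pow_left' h1 3).trans_eq ?_
  rw [mul_pow, ← rpow_natCast, ← rpow_natCast, ← rpow_mul,
    ← rpow_mul, mul_comm, Measure.restrict_apply_univ]
  norm_num

lemma enorm_rpow_eq {D : Set E3} (q : L32 D) :
    ‖q‖ₑ ^ (3 / 2 : ℝ) = ∫⁻ x in D, ‖q x‖ₑ ^ (3 / 2 : ℝ) := by
  have h : ((3 / 2 : ℝ≥0∞)).toReal = 3 / 2 := by simp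
  have h0 : (3 / 2 : ℝ≥0∞) ≠ ⊤ := by finiteness
  rw [Lp.enorm_def, eLpNorm_eq_lintegral_rpow_enorm_toReal (by norm_num) h0, h, ← rpow_mul]
  norm_num

lemma lintegral_rpow_le_enorm_sq {D : Set E3} (z : L2Vec D) :
    ∫⁻ x in D, ‖z x‖ₑ ^ (3 / 2 : ℝ) ≤ volume D + ‖z‖ₑ ^ 2 := by
  have h : ∀ t : ℝ≥0∞, t ^ (3 / 2 : ℝ) ≤ 1 + t ^ 2 := fun t => by
    simpa using le_one_add_pow (t := t) (r := 3 / 2) (s := 2) (by norm_num) (by norm_num)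
  rw [enorm_sq_eq]
  refine (lintegral_mono fun x => h _).trans_eq ?_
  rw [lintegral_add_left measurable_const]
  simp

section Moments

variable {D : Set E3} [IsFiniteMeasure (volume.restrict D)] {Ω : Type*}
  {mΩ : MeasurableSpace Ω} {P : Measure Ω} [IsProbabilityMeasure P]
  {w ζ : Ω → L2Vec D} {π : Ω → L32 D} {K : ℝ≥0∞}

lemma HasMoments.integrable (hM : HasMoments P w ζ π K) (k4 : ∫⁻ ω, ‖ζ ω‖ₑ ^ 2 ∂P ≤ K) :
    Integrable (fun ω => ‖w ω‖ ^ 2) P ∧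
      Integrable (fun ω => (1 + ‖w ω‖ ^ 2 + ‖ζ ω‖ + ‖π ω‖) * ‖w ω‖) P := by
  have ⟨hD, hK, hw, hζ, hπ, k1, _, k3⟩ := hM
  have hVt : volume D ≠ ⊤ := by simpa using measure_ne_top (volume.restrict D : Measure E3) univ
  have b3 : ∫⁻ ω, ‖w ω‖ₑ ^ 3 ∂P ≤ volume D ^ (1 / 2 : ℝ) * K := by
    refine (lintegral_mono fun ω => enorm_pow_three_le (w ω)).trans ?_
    rw [lintegral_const_mul' _ _ (by finiteness)]
    gcongr
    refine le_of_eq_of_le (lintegral_congr fun ω => ?_) k1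
    exact setLIntegral_fld_eq hD (w ω) (f := fun b : E3 => ‖b‖ₑ ^ 3) (by simp)
  have b3t := ne_top_of_le_ne_top (by finiteness : volume D ^ (1 / 2 : ℝ) * K ≠ ⊤) b3
  have b4 : ∫⁻ ω, ‖π ω‖ₑ ^ (3 / 2 : ℝ) ∂P ≤ K := by
    refine le_of_eq_of_le (lintegral_congr fun ω => ?_) k3
    rw [enorm_rpow_eq]
    exact setLIntegral_fld_eq hD (π ω) (f := fun b : ℝ => ‖b‖ₑ ^ (3 / 2 : ℝ)) (by simp)
  have pw : ∀ t : ℝ≥0∞, ∀ n : ℕ, n ≤ 3 → t ^ n ≤ 1 + t ^ 3 := fun t n hn => by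
    simpa using le_one_add_pow (t := t) (r := n) (s := 3) (by positivity) (by exact_mod_cast hn)
  refine ⟨integrable_sq_of_lintegral hw (ne_top_of_le_ne_top ?_
    (lintegral_mono fun ω => pw ‖w ω‖ₑ 2 (by norm_num))), ?_, ?_⟩
  · rw [lintegral_add_left measurable_const]
    simp only [lintegral_const, measure_univ, mul_one]
    finiteness
  · have := hw.norm
    have := hζ.norm
    have := hπ.norm
    exact Measurable.aestronglyMeasurable (by fun_prop)
  · rw [hasFiniteIntegral_iff_enorm]
    have pt : ∀ ω, ‖(1 + ‖w ω‖ ^ 2 + ‖ζ ω‖ + ‖π ω‖) * ‖w ω‖‖ₑ ≤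
        (2 + 4 * ‖w ω‖ₑ ^ 3) + (‖ζ ω‖ₑ ^ 2 + ‖π ω‖ₑ ^ (3 / 2 : ℝ)) := by
      intro ω
      grw [enorm_mul, enorm_add_le, enorm_add_le, enorm_add_le]
      simp only [enorm_pow, enorm_norm, enorm_one]
      generalize ‖w ω‖ₑ = a
      generalize ‖ζ ω‖ₑ = z
      generalize ‖π ω‖ₑ = q
      have h1 : z * a ≤ z ^ 2 + a ^ 2 := by
        rcases le_total z a with h | h
        · exact (mul_le_mul_left h a).trans ((sq a).symm.trans_le le_add_self)
        · exact (mul_le_mul_right h z).trans ((sq z).symm.trans_le le_self_add)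
      have h2 := mul_le_rpow_add_pow q a
      have h3 := pw a 1 (by norm_num)
      have h4 := pw a 2 (by norm_num)
      rw [pow_one] at h3
      calc _ = a + a ^ 3 + z * a + q * a := by ring
        _ ≤ (1 + a ^ 3) + a ^ 3 + (z ^ 2 + (1 + a ^ 3)) + (q ^ (3 / 2 : ℝ) + a ^ 3) := by
            gcongr
            exact h1.trans (by gcongr)
        _ = _ := by ring
    refine (lintegral_mono pt).trans_lt ?_
    have mw := hw.enorm
    have mz := hζ.enorm
    rw [lintegral_add_left (by fun_prop), lintegral_add_left measurable_const,
      lintegral_const_mul _ (by fun_prop), lintegral_add_left (by fun_prop), lintegral_const,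
      measure_univ, mul_one]
    refine lt_of_le_of_lt (b := (2 + 4 * (volume D ^ (1 / 2 : ℝ) * K)) + (K + K)) (by gcongr) ?_
    finiteness

end Moments

/-! ### The error bound for the solutions -/

/-- Kernels as in `HasKernels`, with a prescribed bound `M`. -/
def HasKernelsWith (m : ℕ) (s : E3 → E3 → ℝ) (M : ℝ → ℝ) : Prop :=
  ∀ ε ∈ Ioc (0 : ℝ) 1, ∀ l ∈ Icc ε 1, ∃ Φ : E3 → E3 →L[ℝ] E3,
    IsKernel (2 * l) Φ (fun h => ‖h‖ ^ m * stepAt ε l (‖h‖ ^ 2)) ∧ C2Bound Φ (M ε) ∧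
    (∀ h, ‖Φ h‖ ≤ 4 * l ^ m) ∧ ∀ h v, tri Φ h v v v = 2 * deriv (stepAt ε l) (‖h‖ ^ 2) * s h v

lemma HasKernels.exists_with {m : ℕ} {s : E3 → E3 → ℝ} (h : HasKernels m s) :
    ∃ M, HasKernelsWith m s M := by
  choose! M hM using h
  exact ⟨M, hM⟩

lemma HasKernelsWith.mono {m : ℕ} {s : E3 → E3 → ℝ} {M M' : ℝ → ℝ} (h : HasKernelsWith m s M)
    (hM : ∀ ε, M ε ≤ M' ε) : HasKernelsWith m s M' := fun ε hε l hl => by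
  obtain ⟨Φ, h1, h2, h3⟩ := h ε hε l hl
  exact ⟨Φ, h1, ⟨fun x => (h2.value x).trans (hM ε), fun i x => (h2.deriv i x).trans (hM ε),
    fun i x => (h2.deriv2 i x).trans (hM ε)⟩, h3⟩

lemma IsMartingaleSolution.measurable_zero {D : Set E3} {e : HilbertBasis ℕ ℝ (VelH D)}
    {lam σ : ℕ → ℝ} {L : VelV D →L[ℝ] VelV D →L[ℝ] ℝ} {ν : ℝ} {Ω : Type*} {mΩ : MeasurableSpace Ω}
    {P : Measure Ω} {ℱ : Filtration ℝ≥0 mΩ} {β : ℕ → ℝ≥0 → Ω → ℝ} {u Z : ℝ≥0 → Ω → VelH D}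
    (h : IsMartingaleSolution e lam σ L ν P ℱ β u Z) :
    Measurable (fun ω => (u 0 ω : L2Vec D)) ∧ Measurable fun ω => (Z 0 ω : L2Vec D) := by
  have key : ∀ {v : ℝ≥0 → Ω → VelH D}, IsStronglyProgressive ℱ v →
      Measurable fun ω => (v 0 ω : L2Vec D) := fun hv => by
    simpa [comp_def] using measurable_subtype_coe.comp
      ((measurable_progressive hv).comp (measurable_prodMk_left (x := (0 : ℝ))))
  exact ⟨key h.progressive_u, key h.progressive_Z⟩

lemma hasResidualBound {D : Set E3} [IsFiniteMeasure (volume.restrict D)]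
    (hDo : IsOpen D) {e : HilbertBasis ℕ ℝ (VelH D)} {lam σ : ℕ → ℝ} (hlam : ∀ k, 0 < lam k)
    {L : VelV D →L[ℝ] VelV D →L[ℝ] ℝ} {Ω : ℝ → Type*} [∀ ν, MeasurableSpace (Ω ν)]
    {P : ∀ ν, Measure (Ω ν)} [∀ ν, IsProbabilityMeasure (P ν)]
    {ℱ : ∀ ν, Filtration ℝ≥0 (inferInstance : MeasurableSpace (Ω ν))}
    {β : ∀ ν, ℕ → ℝ≥0 → Ω ν → ℝ} {u Z : ∀ ν, ℝ≥0 → Ω ν → VelH D} {p : ∀ ν, ℝ≥0 → Ω ν → L32 D}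
    (hsol : ∀ ν ∈ Ioo (0 : ℝ) 1, IsMartingaleSolution e lam σ L ν (P ν) (ℱ ν) (β ν) (u ν) (Z ν))
    (hp : ∀ ν ∈ Ioo (0 : ℝ) 1, IsStationaryPressure ν (P ν) (u ν) (Z ν) (p ν))
    {K : ℝ≥0∞} (hM : ∀ ν ∈ Ioo (0 : ℝ) 1, HasMoments (P ν) (fun ω => (u ν 0 ω : L2Vec D))
      (fun ω => (Z ν 0 ω : L2Vec D)) (fun ω => p ν 0 ω) K)
    (k4 : ∀ ν ∈ Ioo (0 : ℝ) 1, ∫⁻ ω, ‖(Z ν 0 ω : L2Vec D)‖ₑ ^ 2 ∂(P ν) ≤ K) {κ : E3 → ℝ≥0∞}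
    (hκ : ∀ ν ∈ Ioo (0 : ℝ) 1, ∀ h, meanOsc (P ν) (fun ω => (u ν 0 ω : L2Vec D)) (p ν 0) h ≤ κ h)
    {m : ℕ} (hm : m ≤ 2) {s : E3 → E3 → ℝ} (hs : IsCubicForm m s) {M : ℝ → ℝ}
    (hker : HasKernelsWith m s M) {ψ : E3 → ℝ} (hψ : IsCutoff D ψ) :
    HasResidualBound κ M fun ν l =>
      1 / l * structureFn s (P ν) (fun ω => (u ν 0 ω : L2Vec D)) ψ l + 2 / (m + 3) *
        (nonlinearFlux (P ν) (u ν 0) (p ν 0) ψ + 2 * energyInput (P ν) (u ν 0) (Z ν 0) ψ) := by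
  have hD := hDo.measurableSet
  have hψs := hψ.smoothIn
  have hVt : volume D ≠ ⊤ := by simpa using measure_ne_top (volume.restrict D : Measure E3) univ
  have hK : K ≠ ⊤ := (hM (1 / 2) (by norm_num)).ne_top
  obtain ⟨B₀, -, hB₀⟩ := hψs.exists_bound
  obtain ⟨B₁, -, hB₁⟩ := hψs.fderiv.exists_bound
  obtain ⟨B₂, hB₂⟩ := hψs.exists_C2Bound
  obtain ⟨C, -, hC⟩ := exists_integral_norm_le (F := E3) D 2 (by norm_num)
  obtain ⟨r, hr, hrD⟩ := hψ.compact.isCompact.exists_cthickening_subset_open hDo hψ.support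
  refine ⟨errConst (max B₀ B₁) B₂ C K D, by unfold errConst; finiteness, min 1 (r / 2),
    by positivity, fun ν hν ε l τ τ' η η' hε hεl hl hτ hτ' hτt hη hη1 hη' => ?_⟩
  rw [le_min_iff] at hl
  obtain ⟨Φ, hΦ, hΦM, hΦb, htri⟩ := hker ε ⟨hε, hεl.trans hl.1⟩ l ⟨hεl, hl.1⟩
  have hρ : cthickening (2 * l) (tsupport ψ) ⊆ D :=
    (Metric.cthickening_mono (by linarith [hl.2]) _).trans hrD
  have hMν := hM ν hν
  obtain ⟨hu2, hX⟩ := hMν.integrable (k4 ν hν)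
  obtain ⟨A, -, hA⟩ := exists_abs_balance_le hD hψs hΦ.smooth hρ ν
  have hint : Integrable (fun ω => balance ν ψ Φ (u ν 0 ω : L2Vec D) (Z ν 0 ω : L2Vec D)
      (p ν 0 ω)) (P ν) :=
    (hX.const_mul A).mono' ((measurable_balance hD hψs hΦ.smooth ν).comp
      ((hMν.mw.prodMk hMν.mz).prodMk hMν.mq)).aestronglyMeasurable (ae_of_all _ fun ω => hA _ _ _)
  have hbal := integral_balance_eq_zero hD hlam (hsol ν hν) (hp ν hν) hu2 hX hψs hΦ hρ
  have hc : CutoffLE D ψ (max B₀ B₁) :=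
    ⟨hψs, fun x => (hB₀ x).trans (le_max_left _ _), fun x => (hB₁ x).trans (le_max_right _ _)⟩
  have h := enorm_residual_le hMν (fun ω => (u ν 0 ω).2) hε hεl hl.1
    (fun h hh => (hκ ν hν h).trans (hτ h hh)) (fun h hh => (hκ ν hν h).trans (hτ' h hh)) hτt
    hm hs hν.1.le hc hΦ htri hΦb hρ hη hη1 hη' hB₂ hΦM hC hint hbal
  rw [(integral_fluxDensity hMν hc).2.2] at h
  exact h

lemma meanOsc_eq {D : Set E3} [IsFiniteMeasure (volume.restrict D)]
    (hD : MeasurableSet D) {Ω : Type*} {mΩ : MeasurableSpace Ω} {P : Measure Ω}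
    {w : Ω → L2Vec D} {π : Ω → L32 D} (hw : Measurable w) (h : E3) :
    meanOsc P w π h =
      ∫⁻ ω, (∫⁻ x in shiftDomain D h, ‖increment D (w ω) h x‖ₑ ^ 3) ∂P +
        ∫⁻ ω, (∫⁻ x in shiftDomain D h, ‖increment D (π ω) h x‖ₑ ^ (3 / 2 : ℝ)) ∂P := by
  have m : Measurable fun r : Ω × E3 => ‖fld (w r.1) (r.2 + h) - fld (w r.1) r.2‖ₑ ^ 3 :=
    ((((measurable_fld_comp hD hw).comp (measurable_fst.prodMk (measurable_snd.add_const h))).sub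
      (measurable_fld_comp hD hw)).enorm.pow_const 3)
  have e1 : ∀ ω, ∫⁻ x in shiftDomain D h, ‖increment D (w ω) h x‖ₑ ^ 3 =
      ∫⁻ x in shiftDomain D h, ‖fld (w ω) (x + h) - fld (w ω) x‖ₑ ^ 3 := fun ω =>
    lintegral_congr_ae (by
      filter_upwards [ae_restrict_of_ae (increment_ae_eq hD (w ω) h)] with x hx using by rw [hx])
  have e2 : ∀ ω, ∫⁻ x in shiftDomain D h, ‖increment D (π ω) h x‖ₑ ^ (3 / 2 : ℝ) =
      ∫⁻ x in shiftDomain D h, ‖fld (π ω) (x + h) - fld (π ω) x‖ₑ ^ (3 / 2 : ℝ) := fun ω =>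
    lintegral_congr_ae (by
      filter_upwards [ae_restrict_of_ae (increment_ae_eq hD (π ω) h)] with x hx using by rw [hx])
  simp only [meanOsc, e1, e2, oscDensity]
  rw [← lintegral_add_left m.lintegral_prod_right']
  refine lintegral_congr fun ω => lintegral_add_left (m.comp (measurable_prodMk_left (x := ω))) _

lemma hasMoments_of_le {D : Set E3} [IsFiniteMeasure (volume.restrict D)] (hD : MeasurableSet D)
    {Ω : Type*} {mΩ : MeasurableSpace Ω} {P : Measure Ω} [IsProbabilityMeasure P]
    {w ζ : Ω → L2Vec D} {π : Ω → L32 D} {K : ℝ≥0∞} (hK : K ≠ ⊤) (mw : Measurable w)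
    (mz : Measurable ζ) (mq : Measurable π) (hw : ∫⁻ ω, (∫⁻ x in D, ‖w ω x‖ₑ ^ 3) ∂P ≤ K)
    (hz : volume D + ∫⁻ ω, ‖ζ ω‖ₑ ^ 2 ∂P ≤ K)
    (hq : ∫⁻ ω, (∫⁻ x in D, ‖π ω x‖ₑ ^ (3 / 2 : ℝ)) ∂P ≤ K) : HasMoments P w ζ π K := by
  simp only [fun v : L2Vec D => setLIntegral_fld_eq hD v (f := fun b : E3 => ‖b‖ₑ ^ 3) (by simp)]
    at hw
  simp only [fun v : L32 D => setLIntegral_fld_eq hD v (f := fun b : ℝ => ‖b‖ₑ ^ (3 / 2 : ℝ))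
    (by simp)] at hq
  refine ⟨hD, hK, mw, mz, mq, hw, le_trans (lintegral_mono fun ω => ?_) (le_of_eq_of_le
    (a := ∫⁻ ω, (volume D + ‖ζ ω‖ₑ ^ 2) ∂P) ?_ hz), hq⟩
  · rw [← setLIntegral_fld_eq hD (ζ ω) (f := fun b : E3 => ‖b‖ₑ ^ (3 / 2 : ℝ)) (by simp)]
    exact lintegral_rpow_le_enorm_sq _
  · simp [lintegral_add_left measurable_const]

end LocalLaws

end

open LocalLaws in
theorem theorem1p1
    (D : Set E3) (hDopen : IsOpen D) (hDconn : IsConnected D) (hDbdd : Bornology.IsBounded D)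
    (e : HilbertBasis ℕ ℝ (VelH D)) (lam : ℕ → ℝ) (he : IsStokesEigenbasis e lam)
    (σ : ℕ → ℝ) (hσ : Summable (fun k => σ k ^ 2))
    (L : VelV D →L[ℝ] VelV D →L[ℝ] ℝ) (a b : ℝ) (ha : 0 < a) (hb : 0 < b)
    (hL : ∀ v : VelV D, a * stokesForm v v ≤ L v v ∧ L v v ≤ b * stokesForm v v)
    (Ω : ℝ → Type*) [∀ ν, MeasurableSpace (Ω ν)]
    (P : ∀ ν, Measure (Ω ν)) [∀ ν, IsProbabilityMeasure (P ν)]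
    (ℱ : ∀ ν, Filtration ℝ≥0 (inferInstance : MeasurableSpace (Ω ν)))
    (β : ∀ ν, ℕ → ℝ≥0 → Ω ν → ℝ)
    (u Z : ∀ ν, ℝ≥0 → Ω ν → VelH D) (p : ∀ ν, ℝ≥0 → Ω ν → L32 D)
    (hsol : ∀ ν ∈ Ioo (0 : ℝ) 1,
      IsStationaryMartingaleSolution e lam σ L ν (P ν) (ℱ ν) (β ν) (u ν) (Z ν))
    (hp : ∀ ν ∈ Ioo (0 : ℝ) 1, IsStationaryPressure ν (P ν) (u ν) (Z ν) (p ν))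
    (henergy : EnergyEstimate P u)
    (hA1 : VelocityPrecompact P u)
    (hA2 : PressurePrecompact P p) :
    ∃ scale : ℝ → ℝ, (∀ ν ∈ Ioo (0 : ℝ) 1, 0 < scale ν) ∧ Tendsto scale (𝓝[>] 0) (𝓝 0) ∧
      ∀ ψ : E3 → ℝ, IsCutoff D ψ → VanishesInInertialRange scale (fun ν l =>
          1 / l * structureZero (P ν) (u ν 0) ψ l + 2 / 3 * nonlinearFlux (P ν) (u ν 0) (p ν 0) ψ
            + 4 / 3 * energyInput (P ν) (u ν 0) (Z ν 0) ψ) ∧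
        VanishesInInertialRange scale (fun ν l =>
          1 / l * structureLong (P ν) (u ν 0) ψ l + 2 / 5 * nonlinearFlux (P ν) (u ν 0) (p ν 0) ψ
            + 4 / 5 * energyInput (P ν) (u ν 0) (Z ν 0) ψ) := by
  have hD := hDopen.measurableSet
  have hVt : volume D < ⊤ := hDbdd.measure_lt_top
  have : IsFiniteMeasure (volume.restrict D : Measure E3) := ⟨by simpa using hVt⟩
  obtain ⟨C₀, hC₀⟩ := exists_poincare hDbdd
  obtain ⟨⟨C₁, hC₁⟩, hlim₁⟩ := hA1
  obtain ⟨⟨C₂, hC₂⟩, hlim₂⟩ := hA2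
  have hq : (0 : ℝ) < 2 * a / ((C₀ : ℝ) + 1) ^ 2 := by positivity
  set S : ℝ≥0∞ := ENNReal.ofReal (∑' k, σ k ^ 2) / ENNReal.ofReal (2 * a / ((C₀ : ℝ) + 1) ^ 2)
    with hS
  have hSt : S ≠ ⊤ := ENNReal.div_ne_top ENNReal.ofReal_ne_top (by simpa using hq)
  have hZ : ∀ ν ∈ Ioo (0 : ℝ) 1, ∫⁻ ω, ‖Z ν 0 ω‖ₑ ^ 2 ∂(P ν) ≤ S := fun ν hν => by
    rw [hS, ENNReal.le_div_iff_mul_le (Or.inl (by simpa using hq)) (Or.inl ENNReal.ofReal_ne_top),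
      mul_comm]
    refine lintegral_norm_sq_forcing_le (hsol ν hν) hσ ha (fun v => (hL v).1) (by positivity)
      fun v => (hC₀ v).trans ?_
    gcongr
    linarith
  set K : ℝ≥0∞ := C₁ + C₂ + (volume D + S) with hKdef
  have hK : K ≠ ⊤ := by have := hVt.ne; finiteness
  set κ : E3 → ℝ≥0∞ := fun h =>
    (⨆ ν ∈ Ioo (0 : ℝ) 1, ∫⁻ ω, (∫⁻ x in shiftDomain D h,
      ‖increment D (u ν 0 ω : L2Vec D) h x‖ₑ ^ 3) ∂(P ν)) +
    ⨆ ν ∈ Ioo (0 : ℝ) 1, ∫⁻ ω, (∫⁻ x in shiftDomain D h,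
      ‖increment D (p ν 0 ω) h x‖ₑ ^ (3 / 2 : ℝ)) ∂(P ν) with hκdef
  have hκ0 : Tendsto κ (𝓝 0) (𝓝 0) := (hlim₁.add hlim₂).trans_eq (by rw [add_zero])
  have hm := fun ν hν => (hsol ν hν).toIsMartingaleSolution.measurable_zero
  have hκ : ∀ ν ∈ Ioo (0 : ℝ) 1, ∀ h,
      meanOsc (P ν) (fun ω => (u ν 0 ω : L2Vec D)) (p ν 0) h ≤ κ h := fun ν hν h => by
    rw [meanOsc_eq hD (hm ν hν).1]
    exact add_le_add
      (le_iSup₂ (f := fun ν (_ : ν ∈ Ioo (0 : ℝ) 1) => ∫⁻ ω, (∫⁻ x in shiftDomain D h,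
        ‖increment D (u ν 0 ω : L2Vec D) h x‖ₑ ^ 3) ∂(P ν)) ν hν)
      (le_iSup₂ (f := fun ν (_ : ν ∈ Ioo (0 : ℝ) 1) => ∫⁻ ω, (∫⁻ x in shiftDomain D h,
        ‖increment D (p ν 0 ω) h x‖ₑ ^ (3 / 2 : ℝ)) ∂(P ν)) ν hν)
  have k4 : ∀ ν ∈ Ioo (0 : ℝ) 1, volume D + ∫⁻ ω, ‖(Z ν 0 ω : L2Vec D)‖ₑ ^ 2 ∂(P ν) ≤ K :=
    fun ν hν => (add_le_add_right (hZ ν hν) _).trans le_add_self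
  have hM : ∀ ν ∈ Ioo (0 : ℝ) 1, HasMoments (P ν) (fun ω => (u ν 0 ω : L2Vec D))
      (fun ω => (Z ν 0 ω : L2Vec D)) (fun ω => p ν 0 ω) K := fun ν hν =>
    hasMoments_of_le hD hK (hm ν hν).1 (hm ν hν).2
      ((hp ν hν).measurable.comp measurable_prodMk_left)
      ((hC₁ ν hν).trans (le_self_add.trans le_self_add)) (k4 ν hν)
      ((hC₂ ν hν).trans (le_add_self.trans le_self_add))
  have hb {m : ℕ} (hm : m ≤ 2) {s : E3 → E3 → ℝ} (hs : IsCubicForm m s) {M : ℝ → ℝ}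
      (hker : HasKernelsWith m s M) {ψ : E3 → ℝ} (hψ : IsCutoff D ψ) := hasResidualBound hDopen
    (he.lam_pos hDbdd) (fun ν hν => (hsol ν hν).toIsMartingaleSolution) hp hM
    (fun ν hν => le_add_self.trans (k4 ν hν)) hκ hm hs hker hψ
  obtain ⟨M₁, hM₁⟩ := hasKernels_inner_mul_sq.exists_with
  obtain ⟨M₂, hM₂⟩ := hasKernels_inner_cube.exists_with
  obtain ⟨scale, h1, h2, h3⟩ := exists_scale hκ0 (M := fun ε => |M₁ ε| + |M₂ ε|)
    fun ε => by positivity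
  refine ⟨scale, h1, h2, fun ψ hψ => ⟨?_, ?_⟩⟩
  · have h := h3 _ (hb (by norm_num) isCubicForm_inner_mul_sq (hM₁.mono fun ε => (le_abs_self _).trans
        (le_add_of_nonneg_right (abs_nonneg _))) hψ)
    convert h using 3 with ν l
    rw [structureZero, structureFn]
    simp only [mul_assoc]
    push_cast
    ring
  · have h := h3 _ (hb (by norm_num) isCubicForm_inner_cube (hM₂.mono fun ε => (le_abs_self _).trans
        (le_add_of_nonneg_left (abs_nonneg _))) hψ)
    convert h using 3 with ν l
    rw [structureLong, structureFn]
    push_cast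
    ring
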